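/- Let $P_1,P_2,P_3$ be smooth closed compact manifolds of dimensions $p_1,p_2,p_3$ and let $N$ be a smooth manifold (without boundary) of dimension $n$, with diagonal $\Delta_N\subset N\times N$. Let $I=[0,1]$ and write points of $P_1\times P_2\times P_3$ as $x=(x_1,x_2,x_3)$. Suppose given smooth maps $f_i:P_i\to N$ and, for $(i,j)\in\{(1,2),(2,3),(3,1)\}$, smooth homotopies $H_{ij}=(H_{ij}^1,H_{ij}^2):P_i\times P_j\times I\to N\times N$ with $H_{ij}(x_i,x_j,0)=(f_i(x_i),f_j(x_j))$ and $H_{ij}(x_i,x_j,1)\notin\Delta_N$. For $(h,i,j)\in\{(1,2,3),(2,3,1),(3,1,2)\}$ let $T_1=\{0\le s\le t\le 1\}$, $T_2=\{0\le t\le s\le 1\}$ and define maps to $N^4$ $$\Phi_{hij}(x,s,t)=\big(H_{hi}(x_h,x_i,s),\,H_{ij}(x_i,x_j,t)\big)\quad\text{on }P_1\times P_2\times P_3\times I\times I,$$ $$\Phi_{1,(hi)j}(x,s,t)=\big(f_j(x_j),\,H^1_{hi}(x_h,x_i,s),\,H_{hi}(x_h,x_i,t)\big)\quad\text{on }P_1\times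 P_2\times P_3\times T_1,$$ $$\Phi_{2,(hi)j}(x,s,t)=\big(H_{hi}(x_h,x_i,s),\,H^2_{hi}(x_h,x_i,t),\,f_j(x_j)\big)\quad\text{on }P_1\times P_2\times P_3\times T_2.$$ Assume that each of these nine maps, together with its restrictions to the boundary strata of its domain (the products of $P_1\times P_2\times P_3$ with the open edges and with the vertices of the square or triangle), is transverse to $\Delta_N\times\Delta_N\subset N^4$. Let $W_{hij}$ and $X_{a,(hi)j}$ ($a=1,2$) be the preimages of $\Delta_N\times\Delta_N$ under $\Phi_{hij}$ and $\Phi_{a,(hi)j}$. Let $Z$ be the quotient of the disjoint union of these nine compact spaces, with the quotient topology, under the identifications, by equality of the point $(x,s,t)$, of $\{t=0\}\subset W_{hij}$ with $\{t=0\}\subset X_{2,(hi)j}$, of $\{s=0\}\subset W_{hij}$ with $\{s=0\}\subset X_{1,(ij)h}$, and of $\{s=t\}\subset X_{1,(hi)j}$ with $\{s=t\}\subset X_{2,(hi)j}$. Let $\pi_i:Z\to P_i$ be the projections, and let $e:Z\to N$ be the (well-defined, continuous) map given by $f_i(x_i)$ on $W_{hij}$ and by $f_j(x_j)$ on $X_{1,(hi)j}$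 and $X_{2,(hi)j}$. Theorem. $Z$ can be given the structure of a smooth closed compact (Hausdorff) manifold of dimension $p_1+p_2+p_3+2-2n$ (so $Z=\emptyset$ if this number is negative), in such a way that each of the nine pieces, regarded as a subset of $P_1\times P_2\times P_3\times\mathbb R^2$, is mapped diffeomorphically onto its image in $Z$ (a map between subsets of manifolds being smooth if it extends locally to a smooth map of the ambient manifolds). For this structure there is an isomorphism of real vector bundles over $Z$ $$TZ\oplus e^*TN\oplus e^*TN\;\cong\;\pi_1^*TP_1\oplus \pi_2^*TP_2\oplus \pi_3^*TP_3\oplus\epsilon^2,$$ where $\epsilon^2$ is the trivial bundle of rank $2$. -/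

import Mathlib

open scoped Manifold ContDiff Bundle

universe u v

namespace CubicObstruction

noncomputable section

/-! ### The product of the three manifolds with the parameter plane

The three link components are `P 0, P 1, P 2`; indices are read cyclically (addition in `Fin 3`),
so `(h, i, j) = (h, h + 1, h + 1 + 1)` runs over the three cyclic orderings. -/

/-- `P₁ × P₂ × P₃`. -/
abbrev Base (P : Fin 3 → Type u) : Type u := P 0 × P 1 × P 2

/-- `P₁ × P₂ × P₃ × ℝ²`; a point is written `(x, (s, t))`. -/
abbrev Ambient (P : Fin 3 → Type u) : Type u := Base P × (ℝ × ℝ)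

/-- The `i`-th component `x_i` of `x ∈ P₁ × P₂ × P₃`. -/
def coord {P : Fin 3 → Type u} : (i : Fin 3) → Base P → P i
  | 0, x => x.1
  | 1, x => x.2.1
  | 2, x => x.2.2

/-- The smooth model of `P₁ × P₂ × P₃`. -/
abbrev baseModel (p : Fin 3 → ℕ) := (𝓡 (p 0)).prod ((𝓡 (p 1)).prod (𝓡 (p 2)))

/-- The smooth model of `P₁ × P₂ × P₃ × ℝ²`. -/
abbrev ambientModel (p : Fin 3 → ℕ) := (baseModel p).prod 𝓘(ℝ, ℝ × ℝ)

/-- The smooth model of `N⁴ = (N × N) × (N × N)`. -/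
abbrev fourModel (n : ℕ) := ((𝓡 n).prod (𝓡 n)).prod ((𝓡 n).prod (𝓡 n))

section Link

variable (P : Fin 3 → Type u) (p : Fin 3 → ℕ) (N : Type v) (n : ℕ)
  [∀ i, TopologicalSpace (P i)] [∀ i, ChartedSpace (EuclideanSpace ℝ (Fin (p i))) (P i)]
  [TopologicalSpace N] [ChartedSpace (EuclideanSpace ℝ (Fin n)) N]

/-- A point `(f, F, H)` of (the mapping space model of) `𝒯₂Link(P₁, P₂, P₃; N)`: smooth maps
`f i : P i → N` and, for each of the pairs `(1,2), (2,3), (3,1)`, a smooth homotopy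
`H i : P i × P (i+1) × [0,1] → N × N` from `f i × f (i+1)` to a map `F i = H i (·, ·, 1)` which
misses the diagonal of `N × N`.  (Only the values of `H i` at times in `[0,1]` matter.) -/
structure QuadraticLink where
  f : ∀ i : Fin 3, P i → N
  H : ∀ i : Fin 3, P i × P (i + 1) × ℝ → N × N
  f_smooth : ∀ i, ContMDiff (𝓡 (p i)) (𝓡 n) ∞ (f i)
  H_smooth : ∀ i, ContMDiffOn ((𝓡 (p i)).prod ((𝓡 (p (i + 1))).prod 𝓘(ℝ, ℝ)))
    ((𝓡 n).prod (𝓡 n)) ∞ (H i) {q | q.2.2 ∈ Set.Icc (0 : ℝ) 1}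
  H_zero : ∀ i x y, H i (x, y, 0) = (f i x, f (i + 1) y)
  H_one : ∀ i x y, (H i (x, y, 1)).1 ≠ (H i (x, y, 1)).2

end Link

/-! ### The nine pieces -/

/-- Labels of the nine pieces, where `(h, i, j) = (h, h + 1, h + 1 + 1)`:
`W h` stands for `W_{hij}`, and `X₁ h`, `X₂ h` stand for `X_{1,(hi)j}`, `X_{2,(hi)j}`. -/
inductive Piece where
  | W (h : Fin 3)
  | X₁ (h : Fin 3)
  | X₂ (h : Fin 3)

/-- The parameter region of a piece: `I × I`, `T₁ = {0 ≤ s ≤ t ≤ 1}` or `T₂ = {0 ≤ t ≤ s ≤ 1}`. -/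
def Piece.region : Piece → Set (ℝ × ℝ)
  | .W _ => {σ | (0 ≤ σ.1 ∧ σ.1 ≤ 1) ∧ (0 ≤ σ.2 ∧ σ.2 ≤ 1)}
  | .X₁ _ => {σ | 0 ≤ σ.1 ∧ σ.1 ≤ σ.2 ∧ σ.2 ≤ 1}
  | .X₂ _ => {σ | 0 ≤ σ.2 ∧ σ.2 ≤ σ.1 ∧ σ.1 ≤ 1}

/-- `((a, b), (c, d)) ∈ Δ_N × Δ_N`. -/
def diagSq (N : Type v) : Set ((N × N) × (N × N)) := {y | y.1.1 = y.1.2 ∧ y.2.1 = y.2.2}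

/-- The parametrization `N × N → N⁴`, `(a, b) ↦ ((a, a), (b, b))` of `Δ_N × Δ_N`. -/
def diagSqMap {N : Type v} (y : N × N) : (N × N) × (N × N) := ((y.1, y.1), (y.2, y.2))

/-- The directions `τ` in which one can move from `σ` both forwards and backwards within `A`.
For a convex polygon `A` this is the tangent space at `σ` of the smallest face of `A` containing
`σ`: the whole plane in the interior, the direction of the edge on an open edge, and `0` at a
vertex. -/
def faceDirections (A : Set (ℝ × ℝ)) (σ : ℝ × ℝ) : Set (ℝ × ℝ) :=
  {τ | ∃ ε : ℝ, 0 < ε ∧ σ + ε • τ ∈ A ∧ σ - ε • τ ∈ A}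

section Construction

variable {P : Fin 3 → Type u} {p : Fin 3 → ℕ} {N : Type v} {n : ℕ}
  [∀ i, TopologicalSpace (P i)] [∀ i, ChartedSpace (EuclideanSpace ℝ (Fin (p i))) (P i)]
  [TopologicalSpace N] [ChartedSpace (EuclideanSpace ℝ (Fin n)) N]

/-- For a convex polygon `A`: the map `Φ : P₁ × P₂ × P₃ × A → N⁴` and its restrictions to the
boundary strata `P₁ × P₂ × P₃ × (open edges)`, `P₁ × P₂ × P₃ × (vertices)` are all transverse to
`Δ_N × Δ_N`. (Transversality on the smallest stratum through a point implies it on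
the larger ones.) -/
def TransverseToDiagSq (p : Fin 3 → ℕ) (n : ℕ)
    [∀ i, ChartedSpace (EuclideanSpace ℝ (Fin (p i))) (P i)]
    [ChartedSpace (EuclideanSpace ℝ (Fin n)) N]
    (A : Set (ℝ × ℝ)) (Φ : Ambient P → (N × N) × (N × N)) : Prop :=
  ∀ q : Ambient P, q.2 ∈ A → ∀ y : N × N, Φ q = diagSqMap y →
    ∀ w : TangentSpace (fourModel n) (Φ q),
      ∃ (ξ : TangentSpace (baseModel p) q.1) (τ : ℝ × ℝ)
        (η : TangentSpace ((𝓡 n).prod (𝓡 n)) y), τ ∈ faceDirections A q.2 ∧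
          w = mfderivWithin (ambientModel p) (fourModel n) Φ (Set.univ ×ˢ A) q (ξ, τ)
            + (show TangentSpace (fourModel n) (Φ q) from
                mfderiv ((𝓡 n).prod (𝓡 n)) (fourModel n) diagSqMap y η)

namespace QuadraticLink

variable (α : QuadraticLink P p N n)

/-- `H_{h,h+1}(x_h, x_{h+1}, s)`. -/
def htpy (h : Fin 3) (x : Base P) (s : ℝ) : N × N := α.H h (coord h x, coord (h + 1) x, s)

/-- The maps to `N⁴` defining the pieces: `Φ_{hij}`, `Φ_{1,(hi)j}` and `Φ_{2,(hi)j}`. -/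
def Φ : Piece → Ambient P → (N × N) × (N × N)
  | .W h, (x, (s, t)) => (α.htpy h x s, α.htpy (h + 1) x t)
  | .X₁ h, (x, (s, t)) =>
      ((α.f (h + 1 + 1) (coord (h + 1 + 1) x), (α.htpy h x s).1), α.htpy h x t)
  | .X₂ h, (x, (s, t)) =>
      (α.htpy h x s, ((α.htpy h x t).2, α.f (h + 1 + 1) (coord (h + 1 + 1) x)))

/-- The pieces `W_{hij}`, `X_{1,(hi)j}`, `X_{2,(hi)j}`: the preimages of `Δ_N × Δ_N`. -/
def piece (c : Piece) : Set (Ambient P) := {q | q.2 ∈ c.region ∧ α.Φ c q ∈ diagSq N}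

/-- The transversality assumption on the nine maps. -/
def IsTransverse : Prop := ∀ c : Piece, TransverseToDiagSq p n c.region (α.Φ c)

/-! ### The glued space `Z` -/

/-- The identifications of boundary parts, each given by equality of the points `(x, s, t)`:
`∂_t W_{hij} = ∂_t X_{2,(hi)j}` (where `t = 0`), `∂_s W_{hij} = ∂_s X_{1,(ij)h}` (where `s = 0`)
and `∂_{s=t} X_{1,(hi)j} = ∂_{s=t} X_{2,(hi)j}`. -/
inductive Glue : (Σ c : Piece, α.piece c) → (Σ c : Piece, α.piece c) → Prop
  | edge_t (h : Fin 3) (q : Ambient P) (hW : q ∈ α.piece (.W h)) (hX : q ∈ α.piece (.X₂ h))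
      (h0 : q.2.2 = 0) : Glue ⟨.W h, q, hW⟩ ⟨.X₂ h, q, hX⟩
  | edge_s (h : Fin 3) (q : Ambient P) (hW : q ∈ α.piece (.W h))
      (hX : q ∈ α.piece (.X₁ (h + 1))) (h0 : q.2.1 = 0) :
      Glue ⟨.W h, q, hW⟩ ⟨.X₁ (h + 1), q, hX⟩
  | edge_st (h : Fin 3) (q : Ambient P) (h₁ : q ∈ α.piece (.X₁ h)) (h₂ : q ∈ α.piece (.X₂ h))
      (h0 : q.2.1 = q.2.2) : Glue ⟨.X₁ h, q, h₁⟩ ⟨.X₂ h, q, h₂⟩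

/-- The space `Z`: the disjoint union of the nine pieces, glued along the identifications
(the quotient topology is the one Mathlib puts on `Quot`). -/
abbrev Z : Type u := Quot α.Glue

/-- The canonical map of a piece to `Z`. -/
def toZ (c : Piece) (q : α.piece c) : α.Z := Quot.mk _ ⟨c, q⟩

/-- The projection `Z → P₁ × P₂ × P₃`. -/
def base : α.Z → Base P :=
  Quot.lift (fun q => q.2.1.1) (by rintro _ _ (_ | _ | _) <;> rfl)

/-- The map `P₁ × P₂ × P₃ → N` which induces `e : Z → N` on a piece. -/
def endpt : Piece → Base P → N
  | .W h, x => α.f (h + 1) (coord (h + 1) x)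
  | .X₁ h, x => α.f (h + 1 + 1) (coord (h + 1 + 1) x)
  | .X₂ h, x => α.f (h + 1 + 1) (coord (h + 1 + 1) x)

theorem f_coord_succ (h : Fin 3) (x : Base P) :
    α.f (h + 1 + 1 + 1) (coord (h + 1 + 1 + 1) x) = α.f h (coord h x) := by
  fin_cases h <;> rfl

/-- The edge `t = 0` of `W_{hij}` is the edge `t = 0` of `X_{2,(hi)j}`. -/
theorem mem_piece_edge_t (h : Fin 3) (q : Ambient P) (h0 : q.2.2 = 0) :
    q ∈ α.piece (.W h) ↔ q ∈ α.piece (.X₂ h) := by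
  obtain ⟨x, s, t⟩ := q
  obtain rfl : t = 0 := h0
  simp [piece, Piece.region, Φ, diagSq, htpy, α.H_zero]

/-- The edge `s = 0` of `W_{hij}` is the edge `s = 0` of `X_{1,(ij)h}`. -/
theorem mem_piece_edge_s (h : Fin 3) (q : Ambient P) (h0 : q.2.1 = 0) :
    q ∈ α.piece (.W h) ↔ q ∈ α.piece (.X₁ (h + 1)) := by
  obtain ⟨x, s, t⟩ := q
  obtain rfl : s = 0 := h0
  simp only [piece, Piece.region, Φ, diagSq, htpy, α.H_zero, Set.mem_ofPred_eq,
    α.f_coord_succ h x, le_refl, zero_le_one, true_and]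

/-- The diagonal edge of `X_{1,(hi)j}` is the diagonal edge of `X_{2,(hi)j}`. -/
theorem mem_piece_edge_st (h : Fin 3) (q : Ambient P) (h0 : q.2.1 = q.2.2) :
    q ∈ α.piece (.X₁ h) ↔ q ∈ α.piece (.X₂ h) := by
  obtain ⟨x, s, t⟩ := q
  obtain rfl : s = t := h0
  simp only [piece, Piece.region, Φ, diagSq, Set.mem_ofPred_eq]
  constructor
  · rintro ⟨h1, h2, h3⟩
    exact ⟨h1, h3, h3.symm.trans h2.symm⟩
  · rintro ⟨h1, h2, h3⟩
    exact ⟨h1, h3.symm.trans h2.symm, h2⟩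

theorem endpt_eq_of_glue (a b : Σ c : Piece, α.piece c) (hab : α.Glue a b) :
    α.endpt a.1 a.2.1.1 = α.endpt b.1 b.2.1.1 := by
  obtain ⟨h, ⟨x, s, t⟩, hW, hX, h0⟩ | ⟨h, ⟨x, s, t⟩, hW, hX, h0⟩ | ⟨h, q, h₁, h₂, h0⟩ := hab
  · obtain rfl : t = 0 := h0
    have := hW.2.2
    simpa [Φ, htpy, α.H_zero, endpt] using this
  · obtain rfl : s = 0 := h0
    have := hW.2.1
    simp only [Φ, htpy, α.H_zero] at this
    simp only [endpt, α.f_coord_succ h x]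
    exact this.symm
  · rfl

/-- The map `e : Z → N` along which `TN` is pulled back to `Z`: it sends a point with `P`-components
`x` to `f_i(x_i)` on `W_{hij}`, and to `f_j(x_j)` on `X_{1,(hi)j}` and `X_{2,(hi)j}`. This is the
common endpoint `ω₁(1) = ω₂(1) = ω₃(1)` of the three paths in `N` associated with a point of
`Z`. -/
def e : α.Z → N := Quot.lift (fun q => α.endpt q.1 q.2.1.1) α.endpt_eq_of_glue

end QuadraticLink

/-! ### Diffeomorphisms from subsets, isomorphisms of bundles -/

/-- The map `ι : S → Z`, defined on a subset `S` of `P₁ × P₂ × P₃ × ℝ²`, is a diffeomorphism onto its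
image, where (as usual for subsets of manifolds) a map defined on a subset is called smooth if near
each point of the subset it extends to a smooth map on a neighbourhood in the manifold. -/
def IsDiffeoOntoImage (p : Fin 3 → ℕ) (d : ℕ)
    [∀ i, ChartedSpace (EuclideanSpace ℝ (Fin (p i))) (P i)]
    {Z : Type u} [TopologicalSpace Z] [ChartedSpace (EuclideanSpace ℝ (Fin d)) Z]
    (S : Set (Ambient P)) (ι : S → Z) : Prop :=
  (∀ q : S, ∃ (U : Set (Ambient P)) (g : Ambient P → Z), IsOpen U ∧ q.1 ∈ U ∧
      ContMDiffOn (ambientModel p) (𝓡 d) ∞ g U ∧ ∀ q' : S, q'.1 ∈ U → g q' = ι q') ∧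
    ∀ q : S, ∃ (U : Set Z) (g : Z → Ambient P), IsOpen U ∧ ι q ∈ U ∧
      ContMDiffOn (𝓡 d) (ambientModel p) ∞ g U ∧ ∀ q' : S, ι q' ∈ U → g (ι q') = q'

end Construction

/-- Isomorphism of real vector bundles over `B` (covering the identity): a family of linear
isomorphisms of the fibres which is continuous in both directions on the total spaces. -/
def BundleIso {B : Type*} (F₁ : Type*) (E₁ : B → Type*) (F₂ : Type*) (E₂ : B → Type*)
    [∀ b, AddCommMonoid (E₁ b)] [∀ b, Module ℝ (E₁ b)]
    [∀ b, AddCommMonoid (E₂ b)] [∀ b, Module ℝ (E₂ b)]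
    [TopologicalSpace (Bundle.TotalSpace F₁ E₁)] [TopologicalSpace (Bundle.TotalSpace F₂ E₂)] :
    Prop :=
  ∃ φ : ∀ b, E₁ b ≃ₗ[ℝ] E₂ b,
    Continuous (fun w : Bundle.TotalSpace F₁ E₁ =>
      (⟨w.proj, φ w.proj w.snd⟩ : Bundle.TotalSpace F₂ E₂)) ∧
    Continuous (fun w : Bundle.TotalSpace F₂ E₂ =>
      (⟨w.proj, (φ w.proj).symm w.snd⟩ : Bundle.TotalSpace F₁ E₁))

namespace QuadraticLink

variable {P : Fin 3 → Type u} {p : Fin 3 → ℕ} {N : Type v} {n : ℕ}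
  [∀ i, TopologicalSpace (P i)] [∀ i, ChartedSpace (EuclideanSpace ℝ (Fin (p i))) (P i)]
  [∀ i, IsManifold (𝓡 (p i)) ∞ (P i)]
  [TopologicalSpace N] [ChartedSpace (EuclideanSpace ℝ (Fin n)) N] [IsManifold (𝓡 n) ∞ N]
  (α : QuadraticLink P p N n)

/-- The pullback of `TN` to `Z` along `e`. -/
abbrev pullTN : α.Z → Type := α.e *ᵖ (TangentSpace (𝓡 n) : N → Type)

/-- The pullback of `T(P i)` to `Z` along the projection `Z → P i`. -/
abbrev pullTP (i : Fin 3) : α.Z → Type :=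
  (fun z => coord i (α.base z)) *ᵖ (TangentSpace (𝓡 (p i)) : P i → Type)

/-- The model fibre of `TP₁ ⊕ TP₂ ⊕ TP₃ ⊕ ε²`. -/
abbrev TargetFibre (p : Fin 3 → ℕ) : Type :=
  EuclideanSpace ℝ (Fin (p 0)) × EuclideanSpace ℝ (Fin (p 1)) × EuclideanSpace ℝ (Fin (p 2)) ×
    EuclideanSpace ℝ (Fin 2)

/-- The bundle `TP₁ ⊕ TP₂ ⊕ TP₃ ⊕ ε²` over `Z`. -/
abbrev targetBundle : α.Z → Type :=
  α.pullTP 0 ×ᵇ (α.pullTP 1 ×ᵇ (α.pullTP 2 ×ᵇ Bundle.Trivial α.Z (EuclideanSpace ℝ (Fin 2))))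

/-- The topology of the total space is Mathlib's topology on direct sums of bundles. -/
instance : TopologicalSpace (Bundle.TotalSpace (TargetFibre p) α.targetBundle) :=
  letI : TopologicalSpace (Bundle.TotalSpace
      (EuclideanSpace ℝ (Fin (p 2)) × EuclideanSpace ℝ (Fin 2))
      (α.pullTP 2 ×ᵇ Bundle.Trivial α.Z (EuclideanSpace ℝ (Fin 2)))) :=
    FiberBundle.Prod.topologicalSpace _ _ _ _
  letI : TopologicalSpace (Bundle.TotalSpace
      (EuclideanSpace ℝ (Fin (p 1)) × EuclideanSpace ℝ (Fin (p 2)) × EuclideanSpace ℝ (Fin 2))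
      (α.pullTP 1 ×ᵇ (α.pullTP 2 ×ᵇ Bundle.Trivial α.Z (EuclideanSpace ℝ (Fin 2))))) :=
    FiberBundle.Prod.topologicalSpace _ _ _ _
  FiberBundle.Prod.topologicalSpace _ _ _ _

/-- `TZ ⊕ TN ⊕ TN ≅ TP₁ ⊕ TP₂ ⊕ TP₃ ⊕ ε²` as vector bundles over `Z`. -/
def TangentBundleIso (d : ℕ) [ChartedSpace (EuclideanSpace ℝ (Fin d)) α.Z]
    [IsManifold (𝓡 d) ∞ α.Z] : Prop :=
  BundleIso
    (EuclideanSpace ℝ (Fin d) × EuclideanSpace ℝ (Fin n) × EuclideanSpace ℝ (Fin n))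
    ((TangentSpace (𝓡 d) : α.Z → Type) ×ᵇ (α.pullTN ×ᵇ α.pullTN))
    (TargetFibre p) α.targetBundle

end QuadraticLink

end

end CubicObstruction

set_option linter.unusedSectionVars false

/-! The homotopies end off the diagonal, so no point of a piece has a parameter equal to `1`, and
near its points each parameter region looks like a cone. In three linear coordinates of the plane
with sum zero (`yc`) these nine cones become sectors that tile the plane around the origin, and
neighbouring sectors meet along the edges prescribed by the gluing (`sector_cover`,
`edgeAt_of_mem_sector`). Hence `Z` embeds by `emb` as a compact subset `fan` of `P₁ × P₂ × P₃ × ℝ²`.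
Over each sector `fan` is the zero set of `2n` independent smooth equations
(`exists_localEquation`); Borel's lemma is used to extend the homotopies past time `0`, so that
these equations live on open sets. The equations of different sectors are unrelated away from the
common edge, so `fan` is bent along nine rays and at the origin.

Transversality on the boundary strata says that the equations are independent even together with the
function describing the stratum: the whole plane coordinate at the origin, a linear equation of the
ray on a ray, nothing elsewhere (`isFan`). A smooth retraction onto the stratum together with that
function is then a submersion whose restriction to `fan` is injective and which is complementary to
the equations of every adjacent sector at once (`StratumPoint.exists_projChart`). These submersions
serve as charts. To make them compatible, retractions are constructed at the vertex, then along the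
rays, then elsewhere, each one extending its predecessors (`exists_ray_lift`,
`IsFan.exists_retraction`). The outcome (`exists_smooth_structure`, `exists_isResolution`) is a
smooth structure for which every piece is embedded diffeomorphically, and a smooth map `r` from a
neighbourhood of `fan` to `Z` that is inverse to `emb`. The kernel of `dr` meets the tangent space
of each piece only in `0`; it has no component in the plane near the vertex, and is parallel to the
ray near a ray.

The bundle isomorphism sends an ambient tangent vector to its image under `dr` and to its normal
differential. The latter takes the differences of the two pairs of components of `dΦ` and transports
them along the homotopies to the common endpoint. Pieces glued along `s = 0` or `t = 0` have the
same normal differential in directions along the edge. Across `s = t` the differences `(a, b)`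
become `(b, -a - b)`. This rotation has order three and there are three diagonal edges, so a fixed
power of it on each piece removes the discrepancy (`twist_add_two`, `IsTransportData.normal_eq`).
Agreement along the edges is all that the kernel of `dr` can detect, so a partition of unity yields
a continuous family with the right values on that kernel (`IsResolution.exists_continuous_normal`).
Together with `dr` it is injective on fibres, and the dimensions agree. -/

namespace CubicObstruction

open Set Filter Topology

/-! ### Extension of smooth functions across the boundary of a half-space -/

section Borel

variable {E G : Type u} [NormedAddCommGroup E] [NormedSpace ℝ E]
  [NormedAddCommGroup G] [NormedSpace ℝ G]

/-- The closed half-space of points with nonnegative last coordinate. -/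
def upperHalf (E : Type u) : Set (E × ℝ) := {p | 0 ≤ p.2}

theorem upperHalf_eq (E : Type u) : upperHalf E = univ ×ˢ Ici (0 : ℝ) := by
  ext p; simp [upperHalf]

theorem uniqueDiffOn_upperHalf (E : Type u) [NormedAddCommGroup E] [NormedSpace ℝ E] :
    UniqueDiffOn ℝ (upperHalf E) := by
  rw [upperHalf_eq]
  exact uniqueDiffOn_univ.prod (uniqueDiffOn_Ici 0)

theorem subset_closure_interior_upperHalf (E : Type u) [NormedAddCommGroup E] [NormedSpace ℝ E] :
    upperHalf E ⊆ closure (interior (upperHalf E)) := by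
  rw [upperHalf_eq, interior_prod_eq, closure_prod_eq]
  simp

theorem upperHalf_mem_nhds {p : E × ℝ} (hp : 0 < p.2) : upperHalf E ∈ 𝓝 p := by
  filter_upwards [continuous_snd.continuousAt.eventually (lt_mem_nhds hp)] with q hq
  exact hq.le

/-- The one-sided derivative in the normal direction. -/
noncomputable def normalDeriv (h : E × ℝ → G) : E × ℝ → G :=
  fun p => fderivWithin ℝ h (upperHalf E) p (0, 1)

theorem contDiffOn_normalDeriv {h : E × ℝ → G} (hh : ContDiffOn ℝ ∞ h (upperHalf E)) :
    ContDiffOn ℝ ∞ (normalDeriv h) (upperHalf E) :=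
  (hh.fderivWithin (uniqueDiffOn_upperHalf E) (by simp)).clm_apply contDiffOn_const

theorem contDiffOn_iterate_normalDeriv {h : E × ℝ → G} (hh : ContDiffOn ℝ ∞ h (upperHalf E))
    (k : ℕ) : ContDiffOn ℝ ∞ (normalDeriv^[k] h) (upperHalf E) := by
  induction k with
  | zero => exact hh
  | succ k ih =>
    rw [Function.iterate_succ_apply']
    exact contDiffOn_normalDeriv ih

theorem normalDeriv_congr {h g : E × ℝ → G} (hg : EqOn h g (upperHalf E)) :
    EqOn (normalDeriv h) (normalDeriv g) (upperHalf E) := fun p hp => by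
  simp only [normalDeriv, fderivWithin_congr hg (hg hp)]

theorem iterate_normalDeriv_congr {h g : E × ℝ → G} (hg : EqOn h g (upperHalf E)) (k : ℕ) :
    EqOn (normalDeriv^[k] h) (normalDeriv^[k] g) (upperHalf E) := by
  induction k with
  | zero => exact hg
  | succ k ih =>
    rw [Function.iterate_succ_apply', Function.iterate_succ_apply']
    exact normalDeriv_congr ih

/-- Symmetry of the second derivative, which persists on the boundary because the half-space lies in
the closure of its interior. -/
theorem normalDeriv_fderivWithin {h : E × ℝ → G} (hh : ContDiffOn ℝ ∞ h (upperHalf E)) :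
    EqOn (normalDeriv (fderivWithin ℝ h (upperHalf E)))
      (fderivWithin ℝ (normalDeriv h) (upperHalf E)) (upperHalf E) := fun p hp => by
  have hd : DifferentiableWithinAt ℝ (fderivWithin ℝ h (upperHalf E)) (upperHalf E) p :=
    (hh.fderivWithin (uniqueDiffOn_upperHalf E) (m := ∞) (by simp)).differentiableOn
      (by simp) p hp
  have hsym := (hh p hp).isSymmSndFDerivWithinAt (n := ∞)
    (by rw [minSmoothness_of_isRCLikeNormedField]; exact WithTop.coe_le_coe.2 le_top) (uniqueDiffOn_upperHalf E)
    (subset_closure_interior_upperHalf E hp) hp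
  refine ContinuousLinearMap.ext fun v => ?_
  unfold normalDeriv
  rw [fderivWithin_clm_apply (uniqueDiffOn_upperHalf E p hp) hd (differentiableWithinAt_const _)]
  simp [hsym v (0, 1)]

theorem iterate_normalDeriv_fderivWithin (k : ℕ) : ∀ {h : E × ℝ → G},
    ContDiffOn ℝ ∞ h (upperHalf E) →
    EqOn (normalDeriv^[k] (fderivWithin ℝ h (upperHalf E)))
      (fderivWithin ℝ (normalDeriv^[k] h) (upperHalf E)) (upperHalf E) := by
  induction k with
  | zero => intro h _; exact eqOn_refl _ _
  | succ k ih =>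
    intro h hh
    rw [Function.iterate_succ_apply, Function.iterate_succ_apply]
    exact (iterate_normalDeriv_congr (normalDeriv_fderivWithin hh) k).trans
      (ih (contDiffOn_normalDeriv hh))

/-- A vector splits into a tangential and a normal part. The tangential derivative vanishes because
`g` is zero along the boundary, the normal one by assumption. -/
theorem fderivWithin_eq_zero_of_boundary {g : E × ℝ → G} (hg : ContDiffOn ℝ ∞ g (upperHalf E))
    (h0 : ∀ x, g (x, 0) = 0) (h1 : ∀ x, normalDeriv g (x, 0) = 0) (x : E) :
    fderivWithin ℝ g (upperHalf E) (x, 0) = 0 := by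
  have hx : (x, (0 : ℝ)) ∈ upperHalf E := le_refl (0 : ℝ)
  have hd := (hg.differentiableOn (by simp) _ hx).hasFDerivWithinAt
  have hι : HasFDerivWithinAt (fun y : E => (y, (0 : ℝ))) (ContinuousLinearMap.inl ℝ E ℝ) univ x :=
    (hasFDerivAt_prodMk_left x (0 : ℝ)).hasFDerivWithinAt
  have hc := hd.comp x hι (fun y _ => le_refl (0 : ℝ))
  have hz : HasFDerivWithinAt (fun _ : E => (0 : G)) (0 : E →L[ℝ] G) univ x :=
    hasFDerivWithinAt_const _ _ _
  have he : (g ∘ fun y : E => (y, (0 : ℝ))) = fun _ => 0 := funext h0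
  rw [he] at hc
  have h2 := uniqueDiffWithinAt_univ.eq hc hz
  refine ContinuousLinearMap.ext fun v => ?_
  have h3 : v = ContinuousLinearMap.inl ℝ E ℝ v.1 + v.2 • ((0 : E), (1 : ℝ)) := by ext <;> simp
  have h4 := DFunLike.congr_fun h2 v.1
  rw [h3, map_add, map_smul]
  have h5 := h1 x
  unfold normalDeriv at h5
  rw [h5]
  simpa using h4

/-- A function on the half-space extended by zero. -/
noncomputable def zeroExt (h : E × ℝ → G) : E × ℝ → G := fun p => if 0 ≤ p.2 then h p else 0

/-- The case that matters is a boundary point: the space is the union of two closed half-spaces, and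
the derivative within each of them is zero. -/
theorem hasFDerivAt_zeroExt {h : E × ℝ → G} (hh : ContDiffOn ℝ ∞ h (upperHalf E))
    (h0 : ∀ k x, normalDeriv^[k] h (x, 0) = 0) (p : E × ℝ) :
    HasFDerivAt (zeroExt h) (zeroExt (fderivWithin ℝ h (upperHalf E)) p) p := by
  rcases lt_trichotomy p.2 0 with hp | hp | hp
  · have : zeroExt h =ᶠ[𝓝 p] fun _ => 0 := by
      filter_upwards [continuous_snd.continuousAt.eventually (gt_mem_nhds hp)] with q hq
      simp [zeroExt, not_le.2 hq]
    rw [zeroExt, if_neg (not_le.2 hp)]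
    exact (hasFDerivAt_const _ _).congr_of_eventuallyEq this
  · obtain ⟨x, t⟩ := p
    obtain rfl : t = 0 := hp
    have hx : (x, (0 : ℝ)) ∈ upperHalf E := le_refl (0 : ℝ)
    have hz := fderivWithin_eq_zero_of_boundary hh (h0 0) (h0 1) x
    have hd := (hh.differentiableOn (by simp) _ hx).hasFDerivWithinAt
    rw [hz] at hd
    rw [zeroExt, if_pos (le_refl _), hz, ← hasFDerivWithinAt_univ]
    have hu : (univ : Set (E × ℝ)) = upperHalf E ∪ {p | p.2 ≤ 0} := by
      ext q
      simpa [upperHalf] using le_total 0 q.2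
    rw [hu]
    refine HasFDerivWithinAt.union (hd.congr (fun q hq => if_pos hq) (if_pos hx)) ?_
    refine (hasFDerivWithinAt_const (0 : G) _ _).congr (fun q hq => ?_) ?_
    · unfold zeroExt
      split_ifs with h
      · have : q = (q.1, 0) := Prod.ext rfl (le_antisymm hq h)
        rw [this]; exact h0 0 _
      · rfl
    · rw [zeroExt, if_pos (le_refl _)]; exact h0 0 x
  · have hm := upperHalf_mem_nhds hp
    have : zeroExt h =ᶠ[𝓝 p] h := by
      filter_upwards [hm] with q hq
      exact if_pos hq
    rw [zeroExt, if_pos hp.le]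
    exact ((hh.differentiableOn (by simp) _ hp.le).hasFDerivWithinAt.hasFDerivAt hm).congr_of_eventuallyEq
      this

/-- Induction with varying target: the derivative of the extension by zero is the extension by zero
of the derivative, and flatness at the boundary is inherited because normal derivatives commute with
the full derivative. -/
theorem contDiff_zeroExt_nat (m : ℕ) : ∀ {G : Type u} [NormedAddCommGroup G] [NormedSpace ℝ G]
    {h : E × ℝ → G}, ContDiffOn ℝ ∞ h (upperHalf E) →
    (∀ k x, normalDeriv^[k] h (x, 0) = 0) → ContDiff ℝ m (zeroExt h) := by
  induction m with
  | zero =>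
    intro G _ _ h hh h0
    exact contDiff_zero.2 (continuous_iff_continuousAt.2
      fun p => (hasFDerivAt_zeroExt hh h0 p).continuousAt)
  | succ m ih =>
    intro G _ _ h hh h0
    rw [Nat.cast_succ, contDiff_succ_iff_hasFDerivAt]
    refine ⟨zeroExt (fderivWithin ℝ h (upperHalf E)), ih (hh.fderivWithin
      (uniqueDiffOn_upperHalf E) (by simp)) fun k x => ?_, hasFDerivAt_zeroExt hh h0⟩
    have hx : (x, (0 : ℝ)) ∈ upperHalf E := le_refl (0 : ℝ)
    rw [iterate_normalDeriv_fderivWithin k hh hx]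
    refine fderivWithin_eq_zero_of_boundary (contDiffOn_iterate_normalDeriv hh k) (h0 k)
      (fun x => ?_) x
    rw [← Function.iterate_succ_apply' normalDeriv]
    exact h0 (k + 1) x

theorem contDiff_zeroExt {h : E × ℝ → G} (hh : ContDiffOn ℝ ∞ h (upperHalf E))
    (h0 : ∀ k x, normalDeriv^[k] h (x, 0) = 0) : ContDiff ℝ ∞ (zeroExt h) :=
  contDiff_infty.2 fun m => contDiff_zeroExt_nat m hh h0

end Borel

end CubicObstruction

/-! ### Borel's lemma with parameters, and extension of smooth functions from a half-space -/

namespace CubicObstruction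

open Set Filter Topology

section BorelSum

variable {E G : Type u} [NormedAddCommGroup E] [NormedSpace ℝ E]
  [NormedAddCommGroup G] [NormedSpace ℝ G]

/-- The full derivative in the normal direction. -/
noncomputable def vertDeriv (h : E × ℝ → G) : E × ℝ → G := fun p => fderiv ℝ h p (0, 1)

theorem contDiff_vertDeriv {h : E × ℝ → G} (hh : ContDiff ℝ ∞ h) : ContDiff ℝ ∞ (vertDeriv h) :=
  (hh.fderiv_right (m := ∞) (by simp)).clm_apply contDiff_const

theorem contDiff_iterate_vertDeriv {h : E × ℝ → G} (hh : ContDiff ℝ ∞ h) (k : ℕ) :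
    ContDiff ℝ ∞ (vertDeriv^[k] h) := by
  induction k with
  | zero => exact hh
  | succ k ih => rw [Function.iterate_succ_apply']; exact contDiff_vertDeriv ih

theorem normalDeriv_eq_vertDeriv {h : E × ℝ → G} (hh : ContDiff ℝ ∞ h) :
    EqOn (normalDeriv h) (vertDeriv h) (upperHalf E) := fun p hp => by
  unfold normalDeriv vertDeriv
  rw [((hh.differentiable (by simp)) p).fderivWithin (uniqueDiffOn_upperHalf E p hp)]

theorem iterate_normalDeriv_eq_vertDeriv {h : E × ℝ → G} (hh : ContDiff ℝ ∞ h) (k : ℕ) :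
    EqOn (normalDeriv^[k] h) (vertDeriv^[k] h) (upperHalf E) := by
  induction k with
  | zero => exact eqOn_refl _ _
  | succ k ih =>
    rw [Function.iterate_succ_apply', Function.iterate_succ_apply']
    exact (normalDeriv_congr ih).trans (normalDeriv_eq_vertDeriv (contDiff_iterate_vertDeriv hh k))

theorem normalDeriv_sub {h g : E × ℝ → G} (hh : ContDiffOn ℝ ∞ h (upperHalf E))
    (hg : ContDiffOn ℝ ∞ g (upperHalf E)) :
    EqOn (normalDeriv (h - g)) (normalDeriv h - normalDeriv g) (upperHalf E) := fun p hp => by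
  unfold normalDeriv
  rw [fderivWithin_sub (uniqueDiffOn_upperHalf E p hp) (hh.differentiableOn (by simp) p hp)
    (hg.differentiableOn (by simp) p hp)]
  simp

theorem iterate_normalDeriv_sub {h g : E × ℝ → G} (hh : ContDiffOn ℝ ∞ h (upperHalf E))
    (hg : ContDiffOn ℝ ∞ g (upperHalf E)) (k : ℕ) :
    EqOn (normalDeriv^[k] (h - g)) (normalDeriv^[k] h - normalDeriv^[k] g) (upperHalf E) := by
  induction k with
  | zero => exact eqOn_refl _ _
  | succ k ih =>
    simp only [Function.iterate_succ_apply']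
    exact (normalDeriv_congr ih).trans (normalDeriv_sub (contDiffOn_iterate_normalDeriv hh k)
      (contDiffOn_iterate_normalDeriv hg k))

/-- Families of smooth functions with summable uniform bounds on all derivatives. -/
def SummableBounds (U : ℕ → E × ℝ → G) : Prop :=
  (∀ k, ContDiff ℝ ∞ (U k)) ∧ ∃ v : ℕ → ℕ → ℝ, (∀ i, Summable (v i)) ∧
    ∀ i k x, ‖iteratedFDeriv ℝ i (U k) x‖ ≤ v i k

/-- One normal derivative shifts the order of the bounds by one, so the class is stable under
termwise differentiation to any order. -/
theorem SummableBounds.vertDeriv {U : ℕ → E × ℝ → G} (hU : SummableBounds U) :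
    SummableBounds fun k => vertDeriv (U k) := by
  obtain ⟨h1, v, h2, h3⟩ := hU
  refine ⟨fun k => contDiff_vertDeriv (h1 k), fun i k => ‖((0 : E), (1 : ℝ))‖ * v (i + 1) k,
    fun i => (h2 (i + 1)).mul_left _, fun i k x => ?_⟩
  have := norm_iteratedFDeriv_clm_apply_const (f := fderiv ℝ (U k)) (c := ((0 : E), (1 : ℝ)))
    (x := x) (n := i) (N := ∞)
    ((h1 k).fderiv_right (m := ∞) (by simp)).contDiffAt (mod_cast le_top)
  refine this.trans ?_
  rw [norm_iteratedFDeriv_fderiv]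
  exact mul_le_mul_of_nonneg_left (h3 _ _ _) (norm_nonneg _)

variable [CompleteSpace G]

theorem SummableBounds.contDiff_tsum {U : ℕ → E × ℝ → G} (hU : SummableBounds U) :
    ContDiff ℝ ∞ fun x => ∑' k, U k x := by
  obtain ⟨h1, v, h2, h3⟩ := hU
  exact _root_.contDiff_tsum (N := ⊤) h1 (fun k _ => h2 k) fun k i x _ => h3 k i x

theorem SummableBounds.summable {U : ℕ → E × ℝ → G} (hU : SummableBounds U) (x : E × ℝ) :
    Summable fun k => U k x := by
  obtain ⟨h1, v, h2, h3⟩ := hU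
  refine Summable.of_norm_bounded (h2 0) fun k => ?_
  simpa using h3 0 k x

theorem SummableBounds.vertDeriv_tsum {U : ℕ → E × ℝ → G} (hU : SummableBounds U) :
    (CubicObstruction.vertDeriv fun x => ∑' k, U k x) =
      fun x => ∑' k, CubicObstruction.vertDeriv (U k) x := by
  funext x
  have hS := hU.summable
  obtain ⟨h1, v, h2, h3⟩ := hU
  have hb : ∀ n x, ‖fderiv ℝ (U n) x‖ ≤ v 1 n := fun n x => by
    have := h3 1 n x
    rwa [← norm_iteratedFDeriv_fderiv, norm_iteratedFDeriv_zero] at this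
  unfold CubicObstruction.vertDeriv
  rw [fderiv_tsum_apply (h2 1) (fun n => (h1 n).differentiable (by simp)) hb (hS x)]
  exact (ContinuousLinearMap.apply ℝ G ((0 : E), (1 : ℝ))).map_tsum
    (Summable.of_norm_bounded (h2 1) fun n => hb n x)

theorem SummableBounds.iterate_vertDeriv_tsum (j : ℕ) : ∀ {U : ℕ → E × ℝ → G},
    SummableBounds U → (CubicObstruction.vertDeriv^[j] fun x => ∑' k, U k x) =
      fun x => ∑' k, CubicObstruction.vertDeriv^[j] (U k) x := by
  induction j with
  | zero => intro U _; rfl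
  | succ j ih =>
    intro U hU
    rw [Function.iterate_succ_apply, hU.vertDeriv_tsum, ih hU.vertDeriv]
    rfl

theorem iterate_vertDeriv_smul {a : ℝ → ℝ} {c : E → G} (ha : ContDiff ℝ ∞ a)
    (hc : ContDiff ℝ ∞ c) (j : ℕ) :
    vertDeriv^[j] (fun p : E × ℝ => a p.2 • c p.1) =
      fun p : E × ℝ => iteratedDeriv j a p.2 • c p.1 := by
  induction j with
  | zero => simp
  | succ j ih =>
    rw [Function.iterate_succ_apply', ih]
    funext p
    unfold vertDeriv
    have hj : DifferentiableAt ℝ (iteratedDeriv j a) p.2 :=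
      (ha.differentiable_iteratedDeriv j (mod_cast ENat.natCast_lt_top j)) p.2
    have h1 : HasFDerivAt (fun q : E × ℝ => iteratedDeriv j a q.2) _ p :=
      hj.hasFDerivAt.comp p hasFDerivAt_snd
    have h2 : HasFDerivAt (fun q : E × ℝ => c q.1) _ p :=
      ((hc.differentiable (by simp)) p.1).hasFDerivAt.comp p hasFDerivAt_fst
    have h3 := (h1.smul h2).fderiv
    change (fderiv ℝ ((fun q : E × ℝ => iteratedDeriv j a q.2) • fun q => c q.1) p) (0, 1) = _
    rw [h3]
    simp [iteratedDeriv_succ]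

/-- The scale `l` does not matter: the rescaled cutoff is still `1` near `0`, where only the Taylor
monomial is left. This leaves `l` free to enforce convergence. -/
theorem iteratedDeriv_cutoff_monomial {χ : ℝ → ℝ} (hχ : χ =ᶠ[𝓝 0] fun _ => 1) (l : ℝ) (k j : ℕ) :
    iteratedDeriv j (fun t => χ (l * t) * t ^ k / k.factorial) 0 = if j = k then 1 else 0 := by
  have h1 : (fun t => χ (l * t) * t ^ k / k.factorial) =ᶠ[𝓝 0]
      fun t => (k.factorial : ℝ)⁻¹ * t ^ k := by
    have : Tendsto (fun t : ℝ => l * t) (𝓝 0) (𝓝 0) := by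
      have h := ((continuous_const (y := l)).mul continuous_id).tendsto (0 : ℝ)
      rw [Pi.mul_apply, id, mul_zero] at h
      exact h
    filter_upwards [this.eventually hχ] with t ht
    rw [ht]; ring
  rw [h1.iteratedDeriv_eq j, iteratedDeriv_const_mul_field, iteratedDeriv_eq_iterate]
  simp only [iter_deriv_pow]
  have hprod : ∏ i ∈ Finset.range j, ((k : ℝ) - i) = k.descFactorial j := by
    induction j with
    | zero => simp
    | succ j ih =>
      rw [Finset.prod_range_succ, ih, Nat.descFactorial_succ]
      rcases le_or_gt j k with h | h
      · push_cast [Nat.cast_sub h]; ring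
      · simp [Nat.descFactorial_of_lt h]
  split_ifs with h
  · subst h
    simp [hprod, Nat.descFactorial_self, Nat.factorial_ne_zero]
  · rcases lt_or_gt_of_ne h with h | h
    · simp [Nat.sub_ne_zero_of_lt h]
    · simp [hprod, Nat.descFactorial_of_lt h]

/-- Uniform bounds for the rescaled terms of a Borel series. -/
theorem norm_iteratedFDeriv_rescale_le {g : E × ℝ → G} (hg : ContDiff ℝ ∞ g) {i k : ℕ}
    (hik : i < k) {C l : ℝ} (hl : 1 ≤ l) (hC : ∀ x, ‖iteratedFDeriv ℝ i g x‖ ≤ C) (x : E × ℝ) :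
    ‖iteratedFDeriv ℝ i (fun p : E × ℝ => (l ^ k)⁻¹ • g (p.1, l * p.2)) x‖ ≤ C / l := by
  have hl0 : 0 < l := one_pos.trans_le hl
  let A : E × ℝ →L[ℝ] E × ℝ :=
    (ContinuousLinearMap.id ℝ E).prodMap (l • ContinuousLinearMap.id ℝ ℝ)
  have hA : ‖A‖ ≤ l := by
    refine A.opNorm_le_bound hl0.le fun p => ?_
    change ‖(p.1, l * p.2)‖ ≤ _
    rw [Prod.norm_mk, norm_mul, Real.norm_of_nonneg hl0.le]
    refine max_le ?_ (mul_le_mul_of_nonneg_left (norm_snd_le p) hl0.le)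
    exact (norm_fst_le p).trans (le_mul_of_one_le_left (norm_nonneg _) hl)
  have h1 : (fun p : E × ℝ => (l ^ k)⁻¹ • g (p.1, l * p.2)) = (l ^ k)⁻¹ • (g ∘ A) := rfl
  have hC0 : 0 ≤ C := (norm_nonneg _).trans (hC x)
  rw [h1, iteratedFDeriv_const_smul_apply
    ((hg.comp A.contDiff).of_le (mod_cast le_top)).contDiffAt, norm_smul,
    A.iteratedFDeriv_comp_right hg x (mod_cast le_top)]
  have h2 := (iteratedFDeriv ℝ i g (A x)).norm_compContinuousLinearMap_le fun _ => A
  rw [Finset.prod_const, Finset.card_univ, Fintype.card_fin] at h2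
  have h3 : ‖iteratedFDeriv ℝ i g (A x)‖ * ‖A‖ ^ i ≤ C * l ^ i :=
    mul_le_mul (hC _) (pow_le_pow_left₀ (norm_nonneg _) hA i) (by positivity) hC0
  -- Rescaling costs `l ^ i` while the prefactor gains `l ^ k`; since `i < k`, one factor of `l` is
  -- left over.
  have h4 : l ^ i * l ≤ l ^ k := by
    rw [← pow_succ]; exact pow_le_pow_right₀ hl hik
  rw [norm_inv, norm_pow, Real.norm_of_nonneg hl0.le, inv_mul_le_iff₀ (by positivity)]
  calc _ ≤ C * l ^ i := h2.trans h3
    _ = C / l * (l ^ i * l) := by field_simp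
    _ ≤ C / l * l ^ k := mul_le_mul_of_nonneg_left h4 (by positivity)
    _ = _ := by ring

/-- **Borel's lemma** with parameters: a sequence of compactly supported smooth functions is the
sequence of normal derivatives of a smooth function. -/
theorem exists_contDiff_iterate_vertDeriv_eq [FiniteDimensional ℝ E] (c : ℕ → E → G)
    (hc : ∀ k, ContDiff ℝ ∞ (c k)) (hs : ∀ k, HasCompactSupport (c k)) :
    ∃ B : E × ℝ → G, ContDiff ℝ ∞ B ∧ ∀ k x, vertDeriv^[k] B (x, 0) = c k x := by
  obtain ⟨χ, -, hχc, hχs, -, hχ1⟩ : ∃ χ : ℝ → ℝ, True ∧ HasCompactSupport χ ∧ ContDiff ℝ ∞ χ ∧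
      True ∧ χ =ᶠ[𝓝 0] fun _ => 1 := by
    let b : ContDiffBump (0 : ℝ) := ⟨1, 2, one_pos, one_lt_two⟩
    exact ⟨b, trivial, b.hasCompactSupport, b.contDiff, trivial, b.eventuallyEq_one⟩
  let g : ℕ → E × ℝ → G := fun k p => (χ p.2 * p.2 ^ k / k.factorial) • c k p.1
  have hg : ∀ k, ContDiff ℝ ∞ (g k) := fun k =>
    (((hχs.comp contDiff_snd).mul (contDiff_snd.pow k)).div_const _).smul
      ((hc k).comp contDiff_fst)
  have hgs : ∀ k, HasCompactSupport (g k) := fun k => by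
    refine HasCompactSupport.intro ((hs k).isCompact.prod hχc.isCompact) fun p hp => ?_
    rw [mem_prod, not_and_or] at hp
    rcases hp with hp | hp
    · simp [g, image_eq_zero_of_notMem_tsupport hp]
    · simp [g, image_eq_zero_of_notMem_tsupport hp]
  have hbd : ∀ (f : E × ℝ → G), ContDiff ℝ ∞ f → HasCompactSupport f → ∀ i : ℕ,
      ∃ C, ∀ x, ‖iteratedFDeriv ℝ i f x‖ ≤ C := fun f hf hfs i =>
    (hf.continuous_iteratedFDeriv (m := i) (mod_cast le_top)).bounded_above_of_compact_support
      (hfs.iteratedFDeriv i)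
  choose C hC using fun k i => hbd (g k) (hg k) (hgs k) i
  have hC0 : ∀ k i, 0 ≤ C k i := fun k i => (norm_nonneg _).trans (hC k i 0)
  -- Chosen so that `C k i / l k ≤ 2⁻ᵏ` for every order `i < k`.
  let l : ℕ → ℝ := fun k => 1 + 2 ^ k * ∑ i ∈ Finset.range k, C k i
  have hsum0 : ∀ k, 0 ≤ ∑ i ∈ Finset.range k, C k i :=
    fun k => Finset.sum_nonneg fun i _ => hC0 k i
  have hl : ∀ k, 1 ≤ l k := fun k =>
    le_add_of_nonneg_right (mul_nonneg (by positivity) (hsum0 k))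
  have hl0 : ∀ k, 0 < l k := fun k => one_pos.trans_le (hl k)
  -- The prefactor undoes the effect of the rescaling on the monomial, so the jet along the boundary
  -- is unchanged.
  let U : ℕ → E × ℝ → G := fun k p => (l k ^ k)⁻¹ • g k (p.1, l k * p.2)
  have hUeq : ∀ k, U k = fun p : E × ℝ =>
      (fun t => χ (l k * t) * t ^ k / k.factorial) p.2 • c k p.1 := fun k => by
    funext p
    simp only [U, g, smul_smul]
    congr 1
    have := (hl0 k).ne'
    rw [mul_pow]
    field_simp
  have ha : ∀ k, ContDiff ℝ ∞ fun t => χ (l k * t) * t ^ k / (k.factorial : ℝ) := fun k =>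
    ((hχs.comp (contDiff_const.mul contDiff_id)).mul (contDiff_id.pow k)).div_const _
  have hU : SummableBounds U := by
    have hUs : ∀ k, ContDiff ℝ ∞ (U k) := fun k =>
      ((hg k).comp (contDiff_fst.prodMk (contDiff_const.mul contDiff_snd))).const_smul _
    have hUc : ∀ k, HasCompactSupport (U k) := fun k => by
      let L : E × ℝ ≃ₜ E × ℝ := (Homeomorph.refl E).prodCongr (Homeomorph.mulLeft₀ (l k) (hl0 k).ne')
      exact ((hgs k).comp_homeomorph L).smul_left (f := fun _ => (l k ^ k)⁻¹)
    choose C' hC' using fun k i => hbd (U k) (hUs k) (hUc k) i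
    -- For each order `i` the geometric bound fails for at most the finitely many `k ≤ i`; any bound
    -- will do for those.
    refine ⟨hUs, fun i k => if i < k then (1 / 2) ^ k else C' k i, fun i => ?_, fun i k x => ?_⟩
    · refine summable_geometric_two.congr_cofinite ?_
      have : {k | ¬ i < k}.Finite := (finite_Iic i).subset fun k hk => not_lt.1 hk
      filter_upwards [this.compl_mem_cofinite] with k hk
      rw [if_pos (not_not.1 hk)]
    · beta_reduce
      split_ifs with h
      · refine (norm_iteratedFDeriv_rescale_le (hg k) h (hl k) (hC k i) x).trans ?_
        rw [div_le_iff₀ (hl0 k)]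
        have h1 : C k i ≤ ∑ i ∈ Finset.range k, C k i :=
          Finset.single_le_sum (fun i _ => hC0 k i) (Finset.mem_range.2 h)
        have h2 : (1 / 2 : ℝ) ^ k * l k = (1 / 2) ^ k + ∑ i ∈ Finset.range k, C k i := by
          simp only [l, mul_add, ← mul_assoc, ← mul_pow]; norm_num
        rw [h2]
        have : (0 : ℝ) ≤ (1 / 2) ^ k := by positivity
        linarith
      · exact hC' k i x
  refine ⟨fun p => ∑' k, U k p, hU.contDiff_tsum, fun j x => ?_⟩
  rw [hU.iterate_vertDeriv_tsum j]
  simp only [hUeq, iterate_vertDeriv_smul (ha _) (hc _), iteratedDeriv_cutoff_monomial hχ1]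
  rw [tsum_eq_single j fun k hk => by simp [hk.symm]]
  simp

/-- A compactly supported smooth function on a half-space extends to a smooth function. -/
theorem exists_contDiff_extension [FiniteDimensional ℝ E] {f : E × ℝ → G} {K : Set E}
    (hK : IsCompact K) (hf : ContDiffOn ℝ ∞ f (upperHalf E)) (hfK : ∀ p : E × ℝ, p.1 ∉ K → f p = 0) :
    ∃ F : E × ℝ → G, ContDiff ℝ ∞ F ∧ EqOn F f (upperHalf E) := by
  have hzero : ∀ k (p : E × ℝ), p ∈ upperHalf E → p.1 ∉ K → normalDeriv^[k] f p = 0 := by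
    intro k
    induction k with
    | zero => exact fun p _ hp => hfK p hp
    | succ k ih =>
      intro p hpH hp
      rw [Function.iterate_succ_apply']
      have hev : normalDeriv^[k] f =ᶠ[𝓝[upperHalf E] p] fun _ => 0 := by
        filter_upwards [self_mem_nhdsWithin, mem_nhdsWithin_of_mem_nhds
          (continuous_fst.continuousAt.preimage_mem_nhds
            (hK.isClosed.isOpen_compl.mem_nhds hp))] with q hq hq'
        exact ih q hq hq'
      change fderivWithin ℝ (normalDeriv^[k] f) (upperHalf E) p (0, 1) = 0
      rw [hev.fderivWithin_eq (ih p hpH hp)]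
      simp
  have hmap : MapsTo (fun x : E => (x, (0 : ℝ))) univ (upperHalf E) := fun _ _ => le_refl (0 : ℝ)
  obtain ⟨B, hB, hBj⟩ := exists_contDiff_iterate_vertDeriv_eq
    (fun k x => normalDeriv^[k] f (x, 0))
    (fun k => contDiffOn_univ.1 ((contDiffOn_iterate_normalDeriv hf k).comp
      (contDiff_id.prodMk contDiff_const).contDiffOn hmap))
    (fun k => HasCompactSupport.intro hK fun x hx => hzero k _ (le_refl (0 : ℝ)) hx)
  -- `B` has the same normal jet as `f` along the boundary, so `f - B` is flat there and may be
  -- continued by zero.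
  refine ⟨zeroExt (f - B) + B, (contDiff_zeroExt (hf.sub hB.contDiffOn) fun k x => ?_).add hB,
    fun p hp => ?_⟩
  · have hx : (x, (0 : ℝ)) ∈ upperHalf E := le_refl (0 : ℝ)
    change normalDeriv^[k] (f - B) (x, 0) = 0
    rw [iterate_normalDeriv_sub hf hB.contDiffOn k hx, Pi.sub_apply,
      iterate_normalDeriv_eq_vertDeriv hB k hx, hBj, sub_self]
  · have : zeroExt (f - B) p = f p - B p := if_pos hp
    simp [this]

/-- A function which is smooth on the part of a neighbourhood of a boundary point lying in the
half-space extends locally to a smooth function. -/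
theorem exists_contDiff_local_extension [FiniteDimensional ℝ E] {f : E × ℝ → G} {x₀ : E}
    {U : Set (E × ℝ)} (hU : U ∈ 𝓝 (x₀, (0 : ℝ))) (hf : ContDiffOn ℝ ∞ f (U ∩ upperHalf E)) :
    ∃ F : E × ℝ → G, ContDiff ℝ ∞ F ∧ ∀ᶠ p in 𝓝 (x₀, (0 : ℝ)), 0 ≤ p.2 → F p = f p := by
  obtain ⟨R, hR, hRU⟩ := Metric.mem_nhds_iff.1 hU
  let b : ContDiffBump (x₀, (0 : ℝ)) := ⟨R / 4, R / 2, by positivity, by linarith⟩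
  have hsm : ContDiffOn ℝ ∞ (fun p => b p • f p) (upperHalf E) := by
    intro p hp
    by_cases hpR : p ∈ Metric.ball (x₀, (0 : ℝ)) R
    · refine (b.contDiff.contDiffWithinAt).smul ((hf p ⟨hRU hpR, hp⟩).mono_of_mem_nhdsWithin ?_)
      filter_upwards [self_mem_nhdsWithin, mem_nhdsWithin_of_mem_nhds
        (Metric.isOpen_ball.mem_nhds hpR)] with q hq hq'
      exact ⟨hRU hq', hq⟩
    · have hpt : p ∉ tsupport b := by
        rw [b.tsupport_eq]
        exact fun h => hpR (Metric.closedBall_subset_ball (by simp only [b]; linarith) h)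
      have hev : (fun p => b p • f p) =ᶠ[𝓝 p] fun _ => 0 := by
        filter_upwards [(isClosed_tsupport b).isOpen_compl.mem_nhds hpt] with q hq
        rw [image_eq_zero_of_notMem_tsupport hq, zero_smul]
      exact (contDiffAt_const.congr_of_eventuallyEq hev).contDiffWithinAt
  obtain ⟨F, hF, hFe⟩ := exists_contDiff_extension (K := Metric.closedBall x₀ R)
    (isCompact_closedBall x₀ R) hsm fun p hp => by
      have : p ∉ tsupport b := fun h => hp (by
        rw [b.tsupport_eq, Metric.mem_closedBall, Prod.dist_eq] at h
        rw [Metric.mem_closedBall]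
        have h1 := (le_max_left _ _).trans h
        simp only [b] at h1
        linarith)
      simp only [image_eq_zero_of_notMem_tsupport this, zero_smul]
  refine ⟨F, hF, ?_⟩
  filter_upwards [b.eventuallyEq_one] with p hp h0
  rw [hFe h0]
  simp [hp]

end BorelSum

end CubicObstruction

namespace CubicObstruction

open Set Filter Topology

/-! ### The inverse function theorem on manifolds and local straightenings -/

section LocalInverse

variable {E : Type*} [NormedAddCommGroup E] [NormedSpace ℝ E] {H : Type*} [TopologicalSpace H]
  {I : ModelWithCorners ℝ E H} {M : Type*} [TopologicalSpace M] [ChartedSpace H M]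
  {E' : Type*} [NormedAddCommGroup E'] [NormedSpace ℝ E'] {H' : Type*} [TopologicalSpace H']
  {I' : ModelWithCorners ℝ E' H'} {M' : Type*} [TopologicalSpace M'] [ChartedSpace H' M']

theorem mdifferentiableAt_of_contMDiffOn {f : M → M'} {U : Set M} {p : M}
    (hf : ContMDiffOn I I' ∞ f U) (hU : IsOpen U) (hp : p ∈ U) : MDifferentiableAt I I' f p :=
  ((hf p hp).contMDiffAt (hU.mem_nhds hp)).mdifferentiableAt (by simp)

theorem mfderiv_comp_eq_id_of_eventually {f : M → M'} {g : M' → M} {p : M}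
    (hf : MDifferentiableAt I I' f p) (hg : MDifferentiableAt I' I g (f p))
    (h : ∀ᶠ q in 𝓝 p, g (f q) = q) (v : E) :
    mfderiv I' I g (f p) (mfderiv I I' f p v) = v := by
  have h1 : mfderiv I I (g ∘ f) p = mfderiv I I id p := Filter.EventuallyEq.mfderiv_eq h
  rw [mfderiv_comp p hg hf, mfderiv_id] at h1
  exact DFunLike.congr_fun h1 v

theorem hasMFDerivAt_prodMk_space {E'' : Type*} [NormedAddCommGroup E''] [NormedSpace ℝ E'']
    {f : M → E'} {g : M → E''} {p : M} {f' : E →L[ℝ] E'} {g' : E →L[ℝ] E''}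
    (hf : HasMFDerivAt I 𝓘(ℝ, E') f p f') (hg : HasMFDerivAt I 𝓘(ℝ, E'') g p g') :
    HasMFDerivAt I 𝓘(ℝ, E' × E'') (fun q => (f q, g q)) p (f'.prod g') :=
  ⟨hf.1.prodMk hg.1, hf.2.prodMk hg.2⟩

variable [I.Boundaryless] [IsManifold I ∞ M] [FiniteDimensional ℝ E] [FiniteDimensional ℝ E']

/-- The inverse function theorem for a smooth map from a manifold to a vector space. -/
theorem exists_local_inverse {Ψ : M → E'} {U : Set M} (hU : IsOpen U)
    (hΨ : ContMDiffOn I 𝓘(ℝ, E') ∞ Ψ U) {z : M} (hz : z ∈ U)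
    (hb : Function.Bijective (mfderiv I 𝓘(ℝ, E') Ψ z : E → E')) :
    ∃ e : OpenPartialHomeomorph M E', z ∈ e.source ∧ e.source ⊆ U ∧ (∀ p ∈ e.source, e p = Ψ p) ∧
      ContMDiffOn 𝓘(ℝ, E') I ∞ e.symm e.target := by
  have := FiniteDimensional.complete ℝ E
  have := FiniteDimensional.complete ℝ E'
  -- Without boundary, the extended chart is an open partial homeomorphism to `E`, so the inverse
  -- function theorem of vector spaces applies.
  let φ : OpenPartialHomeomorph M E := (chartAt H z).transHomeomorph I.toHomeomorph
  have hφs : ContMDiffOn 𝓘(ℝ, E) I ∞ φ.symm φ.target := by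
    have h1 : φ.target = (extChartAt I z).target := by
      ext x
      simp [φ, extChartAt, OpenPartialHomeomorph.extend, ModelWithCorners.toHomeomorph,
        I.range_eq_univ]
    rw [h1]
    exact contMDiffOn_extChartAt_symm z
  have hzs : z ∈ φ.source := mem_chart_source H z
  let f : E → E' := Ψ ∘ φ.symm
  let V : Set E := φ.target ∩ φ.symm ⁻¹' U
  have hV : IsOpen V := φ.isOpen_inter_preimage_symm hU
  have hf : ContDiffOn ℝ ∞ f V :=
    (hΨ.comp (hφs.mono inter_subset_left) inter_subset_right).contDiffOn
  have hzV : φ z ∈ V := ⟨φ.map_source hzs, by simpa [φ.left_inv hzs] using hz⟩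
  have hfz : mfderiv I 𝓘(ℝ, E') Ψ z = fderiv ℝ f (φ z) := by
    rw [(mdifferentiableAt_of_contMDiffOn hΨ hU hz).mfderiv, I.range_eq_univ, fderivWithin_univ]
    rfl
  rw [hfz] at hb
  let A : E ≃L[ℝ] E' := ContinuousLinearEquiv.ofBijective (fderiv ℝ f (φ z))
    (LinearMap.ker_eq_bot.2 hb.1) (LinearMap.range_eq_top.2 hb.2)
  have hA : (A : E →L[ℝ] E') = fderiv ℝ f (φ z) := by ext v; rfl
  have hfa : ContDiffAt ℝ ∞ f (φ z) := hf.contDiffAt (hV.mem_nhds hzV)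
  have hfd : HasFDerivAt f (A : E →L[ℝ] E') (φ z) := by
    rw [hA]; exact (hfa.differentiableAt (by simp)).hasFDerivAt
  let g := hfa.toOpenPartialHomeomorph f hfd (by simp)
  have hgc : ∀ x, g x = f x := fun x => rfl
  have hga : φ z ∈ g.source := hfa.mem_toOpenPartialHomeomorph_source hfd (by simp)
  -- The local inverse is known to be smooth only where the derivative is invertible; restricting to
  -- this open set makes it smooth on its whole domain.
  let V' : Set E := V ∩ fderiv ℝ f ⁻¹' range ((↑) : (E ≃L[ℝ] E') → E →L[ℝ] E')
  have hV' : IsOpen V' := (hf.continuousOn_fderiv_of_isOpen hV (by simp)).isOpen_inter_preimage hV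
    ContinuousLinearEquiv.isOpen
  have hzV' : φ z ∈ V' := ⟨hzV, A, hA⟩
  let g' := g.restrOpen V' hV'
  have hg's : ContDiffOn ℝ ∞ g'.symm g'.target := by
    intro y hy
    have hys : g'.symm y ∈ g'.source := g'.map_target hy
    have hys' : g'.symm y ∈ V' := by
      rw [OpenPartialHomeomorph.restrOpen_source] at hys; exact hys.2
    obtain ⟨B, hB⟩ := hys'.2
    have hfy : ContDiffAt ℝ ∞ f (g'.symm y) := hf.contDiffAt (hV.mem_nhds hys'.1)
    have hd : HasFDerivAt f (B : E →L[ℝ] E') (g'.symm y) := by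
      rw [hB]; exact (hfy.differentiableAt (by simp)).hasFDerivAt
    exact (g'.contDiffAt_symm hy hd hfy).contDiffWithinAt
  refine ⟨φ.trans g', ?_, ?_, ?_, ?_⟩
  · rw [OpenPartialHomeomorph.trans_source]
    refine ⟨hzs, ?_⟩
    rw [mem_preimage, OpenPartialHomeomorph.restrOpen_source]
    exact ⟨hga, hzV'⟩
  · intro p hp
    rw [OpenPartialHomeomorph.trans_source] at hp
    have h2 := hp.2
    rw [mem_preimage, OpenPartialHomeomorph.restrOpen_source] at h2
    have h3 := h2.2.1.2
    rwa [mem_preimage, φ.left_inv hp.1] at h3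
  · intro p hp
    rw [OpenPartialHomeomorph.trans_source] at hp
    change Ψ (φ.symm (φ p)) = Ψ p
    rw [φ.left_inv hp.1]
  · rw [OpenPartialHomeomorph.trans_target, OpenPartialHomeomorph.trans_symm_eq_symm_trans_symm]
    exact hφs.comp ((hg's.contMDiffOn).mono inter_subset_left) fun y hy => hy.2

/-- Near a point where the differential of `F` is onto, `F` is one component of a local
diffeomorphism. -/
theorem exists_straightening {F : M → E'} {U : Set M} (hU : IsOpen U)
    (hF : ContMDiffOn I 𝓘(ℝ, E') ∞ F U) {z : M} (hz : z ∈ U) {A : E →L[ℝ] E'}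
    (hA : mfderiv I 𝓘(ℝ, E') F z = A) (hs : Function.Surjective A) :
    ∃ e : OpenPartialHomeomorph M (LinearMap.ker A.toLinearMap × E'), z ∈ e.source ∧ e.source ⊆ U ∧
      (∀ p ∈ e.source, (e p).2 = F p) ∧
      ContMDiffOn I 𝓘(ℝ, LinearMap.ker A.toLinearMap × E') ∞ e e.source ∧
      ContMDiffOn 𝓘(ℝ, LinearMap.ker A.toLinearMap × E') I ∞ e.symm e.target := by
  -- A linear projection onto the kernel of `A` supplies the missing coordinates. The extended chart
  -- at `z` has identity differential, so the combined map has the bijective differential `(pr, A)`.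
  obtain ⟨pr, hpr⟩ := (LinearMap.ker A.toLinearMap).subtype.exists_leftInverse_of_injective
    (Submodule.ker_subtype _)
  let pr' : E →L[ℝ] LinearMap.ker A.toLinearMap := LinearMap.toContinuousLinearMap pr
  have hpr' : ∀ v : LinearMap.ker A.toLinearMap, pr' v = v := fun v => DFunLike.congr_fun hpr v
  let Ψ : M → LinearMap.ker A.toLinearMap × E' := fun p => (pr' (extChartAt I z p), F p)
  let U' := U ∩ (chartAt H z).source
  have hU' : IsOpen U' := hU.inter (chartAt H z).open_source
  have hΨ : ContMDiffOn I 𝓘(ℝ, LinearMap.ker A.toLinearMap × E') ∞ Ψ U' :=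
    (pr'.contMDiff.comp_contMDiffOn ((contMDiffOn_extChartAt (x := z)).mono inter_subset_right)).prodMk_space
      (hF.mono inter_subset_left)
  have hd : HasMFDerivAt I 𝓘(ℝ, LinearMap.ker A.toLinearMap × E') Ψ z (pr'.prod A) := by
    have h1 : HasMFDerivAt I 𝓘(ℝ, E) (extChartAt I z) z (ContinuousLinearMap.id ℝ E) := by
      have := (mdifferentiableAt_extChartAt (I := I) (mem_chart_source H z)).hasMFDerivAt
      rwa [mfderiv_extChartAt_self] at this
    have h2 : HasMFDerivAt I 𝓘(ℝ, E') F z A := by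
      rw [← hA]; exact (mdifferentiableAt_of_contMDiffOn hF hU hz).hasMFDerivAt
    have h4 : HasMFDerivAt I 𝓘(ℝ, LinearMap.ker A.toLinearMap)
        (fun p => pr' (extChartAt I z p)) z pr' := (pr'.hasMFDerivAt).comp z h1
    exact hasMFDerivAt_prodMk_space h4 h2
  obtain ⟨e, h1, h2, h3, h4⟩ := exists_local_inverse hU' hΨ ⟨hz, mem_chart_source H z⟩ (by
    rw [hd.mfderiv]
    refine ⟨(injective_iff_map_eq_zero (pr'.prod A)).2 fun v hv => ?_, fun w => ?_⟩
    · have hv1 : pr' v = 0 := congrArg Prod.fst hv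
      have hv2 : A v = 0 := congrArg Prod.snd hv
      have := hpr' ⟨v, hv2⟩
      rw [hv1] at this
      exact congrArg Subtype.val this.symm
    · obtain ⟨v, hv⟩ := hs w.2
      refine ⟨v + ((w.1 - pr' v : LinearMap.ker A.toLinearMap) : E), ?_⟩
      have hk : A ((w.1 - pr' v : LinearMap.ker A.toLinearMap) : E) = 0 := (w.1 - pr' v).2
      refine Prod.ext ?_ ?_
      · change pr' (v + ((w.1 - pr' v : LinearMap.ker A.toLinearMap) : E)) = w.1
        rw [map_add, hpr']; abel
      · change A (v + ((w.1 - pr' v : LinearMap.ker A.toLinearMap) : E)) = w.2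
        rw [map_add, hk, hv, add_zero])
  refine ⟨e, h1, h2.trans inter_subset_left, fun p hp => by rw [h3 p hp], ?_, h4⟩
  exact (hΨ.mono h2).congr h3

/-- A smooth map which fixes the zero set of `F` near `z` has a differential fixing the kernel of
the differential of `F`. -/
theorem mfderiv_eq_self_of_fixes_zeros {F : M → E'} {U : Set M} (hU : IsOpen U)
    (hF : ContMDiffOn I 𝓘(ℝ, E') ∞ F U) {z : M} (hz : z ∈ U) (hFz : F z = 0)
    {A : E →L[ℝ] E'} (hA : mfderiv I 𝓘(ℝ, E') F z = A) (hs : Function.Surjective A) {R : M → M}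
    (hR : MDifferentiableAt I I R z) (hfix : ∀ᶠ p in 𝓝 z, F p = 0 → R p = p)
    {v : E} (hv : A v = 0) : (mfderiv I I R z v : E) = v := by
  let K : Submodule ℝ E := LinearMap.ker A.toLinearMap
  obtain ⟨e, hze, heU, he2, hes, hei⟩ :
      ∃ e : OpenPartialHomeomorph M (K × E'), z ∈ e.source ∧ e.source ⊆ U ∧
      (∀ p ∈ e.source, (e p).2 = F p) ∧ ContMDiffOn I 𝓘(ℝ, K × E') ∞ e e.source ∧
      ContMDiffOn 𝓘(ℝ, K × E') I ∞ e.symm e.target := exists_straightening hU hF hz hA hs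
  have hed := mdifferentiableAt_of_contMDiffOn hes e.open_source hze
  have hetz : e z ∈ e.target := e.map_source hze
  have heid := mdifferentiableAt_of_contMDiffOn hei e.open_target hetz
  have h1 : mfderiv 𝓘(ℝ, K × E') I e.symm (e z) (mfderiv I 𝓘(ℝ, K × E') e z v) = v :=
    mfderiv_comp_eq_id_of_eventually hed heid (e.eventually_left_inverse hze) v
  have h2 : ((mfderiv I 𝓘(ℝ, K × E') e z v : K × E')).2 = 0 := by
    have hc : HasMFDerivAt I 𝓘(ℝ, E') (fun p => (e p).2) z
        ((ContinuousLinearMap.snd ℝ K E').comp (mfderiv I 𝓘(ℝ, K × E') e z)) :=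
      (ContinuousLinearMap.snd ℝ K E').hasMFDerivAt.comp z hed.hasMFDerivAt
    have he : F =ᶠ[𝓝 z] fun p => (e p).2 := by
      filter_upwards [e.open_source.mem_nhds hze] with p hp using (he2 p hp).symm
    have := (hc.congr_of_eventuallyEq he).mfderiv
    rw [← hA, this] at hv
    exact hv
  set u : K := ((mfderiv I 𝓘(ℝ, K × E') e z v : K × E')).1
  have h3 : (mfderiv I 𝓘(ℝ, K × E') e z v : K × E') = (u, 0) := Prod.ext rfl h2
  have hez : e z = ((e z).1, 0) := Prod.ext rfl ((he2 z hze).trans hFz)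
  -- A parametrization of the zero set near `z`. Since `R ∘ ψ = ψ` near the base point, the chain
  -- rule shows that `dR` fixes the image of `dψ`, and that image contains `v`.
  let ψ : K → M := fun x => e.symm (x, 0)
  have hL : HasMFDerivAt 𝓘(ℝ, K) 𝓘(ℝ, K × E') (fun x : K => (x, (0 : E'))) (e z).1
      (ContinuousLinearMap.inl ℝ K E') := (hasFDerivAt_prodMk_left _ _).hasMFDerivAt
  have hψ : HasMFDerivAt 𝓘(ℝ, K) I ψ (e z).1
      ((mfderiv 𝓘(ℝ, K × E') I e.symm (e z)).comp (ContinuousLinearMap.inl ℝ K E')) := by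
    have h5 : HasMFDerivAt 𝓘(ℝ, K × E') I e.symm ((e z).1, (0 : E'))
        (mfderiv 𝓘(ℝ, K × E') I e.symm (e z)) := by
      rw [← hez]; exact heid.hasMFDerivAt
    exact h5.comp (e z).1 hL
  have hψz : ψ (e z).1 = z := by
    change e.symm ((e z).1, 0) = z
    rw [← hez]; exact e.left_inv hze
  have hψd : (mfderiv 𝓘(ℝ, K) I ψ (e z).1 u : E) = v := by
    rw [hψ.mfderiv]
    change (mfderiv 𝓘(ℝ, K × E') I e.symm (e z) (u, 0) : E) = v
    rw [← h3]
    exact h1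
  have hcont : ContinuousAt ψ (e z).1 := hψ.continuousAt
  have hev : R ∘ ψ =ᶠ[𝓝 (e z).1] ψ := by
    have h6 : ∀ᶠ x in 𝓝 (e z).1, F (ψ x) = 0 → R (ψ x) = ψ x :=
      hcont.eventually (by rw [hψz]; exact hfix)
    have h7 : ∀ᶠ x : K in 𝓝 (e z).1, (x, (0 : E')) ∈ e.target :=
      (Continuous.prodMk_left (0 : E')).continuousAt.eventually
        (e.open_target.mem_nhds (by beta_reduce; rw [← hez]; exact hetz))
    filter_upwards [h6, h7] with x h6 h7
    refine h6 ?_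
    rw [← he2 _ (e.map_target h7)]
    rw [e.right_inv h7]
  have hR' : MDifferentiableAt I I R (ψ (e z).1) := by rwa [hψz]
  have h8 := hev.mfderiv_eq (I := 𝓘(ℝ, K)) (I' := I)
  rw [mfderiv_comp _ hR' hψ.mdifferentiableAt] at h8
  have h9 := DFunLike.congr_fun h8 u
  change (mfderiv I I R (ψ (e z).1) (mfderiv 𝓘(ℝ, K) I ψ (e z).1 u) : E) = _ at h9
  rw [hψd, hψz] at h9
  exact h9.trans hψd

end LocalInverse

end CubicObstruction

namespace CubicObstruction

open Set Filter Topology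

/-! ### Smooth retractions onto subsets -/

section Retraction

variable {E : Type*} [NormedAddCommGroup E] [NormedSpace ℝ E] {H : Type*} [TopologicalSpace H]
  {I : ModelWithCorners ℝ E H} {M : Type*} [TopologicalSpace M] [ChartedSpace H M]
  {E' : Type*} [NormedAddCommGroup E'] [NormedSpace ℝ E']

/-- `R` is, on the open set `O`, a smooth retraction onto the subset `Y`. -/
structure IsSmoothRetraction (I : ModelWithCorners ℝ E H) (Y : Set M) (R : M → M) (O : Set M) :
    Prop where
  isOpen : IsOpen O
  smooth : ContMDiffOn I I ∞ R O
  mem : ∀ p ∈ O, R p ∈ Y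
  fix : ∀ p ∈ O, p ∈ Y → R p = p

variable [I.Boundaryless] [IsManifold I ∞ M] [FiniteDimensional ℝ E] [FiniteDimensional ℝ E']

/-- The zero set of a map with surjective differential is locally a smooth retract. -/
theorem exists_local_retraction {F : M → E'} {U : Set M} (hU : IsOpen U)
    (hF : ContMDiffOn I 𝓘(ℝ, E') ∞ F U) {z : M} (hz : z ∈ U) (hFz : F z = 0)
    {A : E →L[ℝ] E'} (hA : mfderiv I 𝓘(ℝ, E') F z = A) (hs : Function.Surjective A)
    {Y : Set M} (hY : ∀ p ∈ U, p ∈ Y ↔ F p = 0) :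
    ∃ R O, z ∈ O ∧ IsSmoothRetraction I Y R O := by
  let K : Submodule ℝ E := LinearMap.ker A.toLinearMap
  obtain ⟨e, hze, heU, he2, hes, hei⟩ :
      ∃ e : OpenPartialHomeomorph M (K × E'), z ∈ e.source ∧ e.source ⊆ U ∧
      (∀ p ∈ e.source, (e p).2 = F p) ∧ ContMDiffOn I 𝓘(ℝ, K × E') ∞ e e.source ∧
      ContMDiffOn 𝓘(ℝ, K × E') I ∞ e.symm e.target := exists_straightening hU hF hz hA hs
  have hc : ContMDiffOn I 𝓘(ℝ, K × E') ∞ (fun p => ((e p).1, (0 : E'))) e.source :=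
    ((ContinuousLinearMap.fst ℝ K E').contMDiff.comp_contMDiffOn hes).prodMk_space contMDiffOn_const
  have hez : ((e z).1, (0 : E')) = e z := Prod.ext rfl ((he2 z hze).trans hFz).symm
  have hmem : ∀ p, ((e p).1, (0 : E')) ∈ e.target → e.symm ((e p).1, 0) ∈ Y := fun p hp => by
    have h1 := e.map_target hp
    rw [hY _ (heU h1), ← he2 _ h1, e.right_inv hp]
  -- In straightened coordinates the retraction sets the `F`-coordinate to zero.
  refine ⟨fun p => e.symm ((e p).1, 0), e.source ∩ (fun p => ((e p).1, (0 : E'))) ⁻¹' e.target,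
    ⟨hze, ?_⟩, hc.continuousOn.isOpen_inter_preimage e.open_source e.open_target,
    hei.comp (hc.mono inter_subset_left) inter_subset_right, fun p hp => hmem p hp.2,
    fun p hp hpY => ?_⟩
  · rw [mem_preimage, hez]; exact e.map_source hze
  · have h1 : ((e p).1, (0 : E')) = e p :=
      Prod.ext rfl ((he2 p hp.1).trans ((hY p (heU hp.1)).1 hpY)).symm
    rw [h1, e.left_inv hp.1]

variable [T2Space M]

/-- Extension of a smooth retraction over a neighbourhood of a point. -/
theorem IsSmoothRetraction.exists_extension_nhds {Y : Set M} {R₂ : M → M} {O₂ : Set M}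
    (h₂ : IsSmoothRetraction I Y R₂ O₂) {z : M} (hzY : z ∈ Y)
    (hz : z ∈ O₂) {C : Set M} (hC : IsClosed C) (hzC : z ∉ C) :
    ∃ s ∈ 𝓝 z, ∀ (R₁ : M → M) (O₁ : Set M), IsSmoothRetraction I Y R₁ O₁ →
      ∃ R O, IsSmoothRetraction I Y R O ∧ s ⊆ O ∧ O₁ ∩ Y ⊆ O ∧ O ∩ C = O₁ ∩ C ∧
      ∀ p ∈ O ∩ C, R p = R₁ p := by
  let φ := extChartAt I z
  have hφs : IsOpen φ.source := isOpen_extChartAt_source z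
  have hφt : IsOpen φ.target := isOpen_extChartAt_target z
  have hφsm : ContMDiffOn I 𝓘(ℝ, E) ∞ φ φ.source := by
    rw [extChartAt_source]; exact contMDiffOn_extChartAt
  have hφsymm : ContMDiffOn 𝓘(ℝ, E) I ∞ φ.symm φ.target := contMDiffOn_extChartAt_symm z
  have hzφ : z ∈ φ.source := mem_extChartAt_source z
  -- the region where the blending takes place
  let W : Set M := (O₂ ∩ R₂ ⁻¹' (φ.source ∩ O₂)) ∩ Cᶜ
  have hW : IsOpen W :=
    (h₂.smooth.continuousOn.isOpen_inter_preimage h₂.isOpen (hφs.inter h₂.isOpen)).inter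
      hC.isOpen_compl
  have hzW : z ∈ W := by
    refine ⟨⟨hz, ?_⟩, hzC⟩
    rw [mem_preimage, h₂.fix z hz hzY]
    exact ⟨hzφ, hz⟩
  obtain ⟨f, -, hfW⟩ := (SmoothBumpFunction.nhds_basis_tsupport (I := I) z).mem_iff.1
    (hW.mem_nhds hzW)
  obtain ⟨B, hB1, hBo, hzB⟩ := mem_nhds_iff.1 f.eventuallyEq_one
  refine ⟨B ∩ W, (hBo.inter hW).mem_nhds ⟨hzB, hzW⟩, fun R₁ O₁ h₁ => ?_⟩
  -- A convex combination of the two retractions in one chart. It leaves `Y` in general; a further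
  -- application of `R₂` brings it back.
  let c : M → E := fun p => (1 - f p) • φ (R₁ p) + f p • φ (R₂ p)
  let D : Set M := (O₁ ∩ R₁ ⁻¹' φ.source) ∩ W
  have hD : IsOpen D := (h₁.smooth.continuousOn.isOpen_inter_preimage h₁.isOpen hφs).inter hW
  have hf : ContMDiff I 𝓘(ℝ, ℝ) ∞ f := f.contMDiff
  have hcD : ContMDiffOn I 𝓘(ℝ, E) ∞ c D := by
    have hR1 : ContMDiffOn I 𝓘(ℝ, E) ∞ (fun p => φ (R₁ p)) D :=
      hφsm.comp (h₁.smooth.mono fun p hp => hp.1.1) fun p hp => hp.1.2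
    have hR2 : ContMDiffOn I 𝓘(ℝ, E) ∞ (fun p => φ (R₂ p)) D :=
      hφsm.comp (h₂.smooth.mono fun p hp => hp.2.1.1) fun p hp => hp.2.1.2.1
    exact ((contMDiffOn_const.sub hf.contMDiffOn).smul hR1).add (hf.contMDiffOn.smul hR2)
  let V : Set E := φ.target ∩ φ.symm ⁻¹' O₂
  have hV : IsOpen V := hφsymm.continuousOn.isOpen_inter_preimage hφt h₂.isOpen
  let b : M → M := fun p => R₂ (φ.symm (c p))
  have hbD : ContMDiffOn I I ∞ b (D ∩ c ⁻¹' V) :=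
    h₂.smooth.comp (hφsymm.comp (hcD.mono inter_subset_left) fun p hp => hp.2.1)
      fun p hp => hp.2.2
  classical
  let R : M → M := fun p => if p ∈ tsupport f then b p else R₁ p
  -- the three formulas for the new retraction
  have hout : ∀ p ∉ tsupport f, R p = R₁ p := fun p hp => if_neg hp
  -- Where `f` vanishes the blend is `R₂ (R₁ p)`, which equals `R₁ p` because `R₁ p` lies in `Y`. So
  -- the two branches of the definition agree across the boundary of the support.
  have hbl : ∀ p ∈ D ∩ c ⁻¹' V, R p = b p := fun p hp => by
    by_cases h : p ∈ tsupport f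
    · exact if_pos h
    · rw [hout p h]
      have h0 : f p = 0 := image_eq_zero_of_notMem_tsupport h
      have hc0 : c p = φ (R₁ p) := by simp [c, h0]
      have h3 := hp.2.2
      rw [mem_preimage, hc0, φ.left_inv hp.1.1.2] at h3
      change _ = R₂ (φ.symm (c p))
      rw [hc0, φ.left_inv hp.1.1.2, h₂.fix _ h3 (h₁.mem p hp.1.1.1)]
  have hin : ∀ p ∈ B ∩ W, R p = R₂ p := fun p hp => by
    have h1 : f p = 1 := hB1 hp.1
    have hs : p ∈ tsupport f := subset_tsupport f (by simp [h1])
    have hc1 : c p = φ (R₂ p) := by simp [c, h1]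
    change (if p ∈ tsupport f then b p else R₁ p) = _
    rw [if_pos hs]
    change R₂ (φ.symm (c p)) = _
    rw [hc1, φ.left_inv hp.2.1.2.1, h₂.fix _ hp.2.1.2.2 (h₂.mem p hp.2.1.1)]
  have hYD : ∀ p ∈ O₁, p ∈ Y → p ∈ W → p ∈ φ.source → p ∈ D ∩ c ⁻¹' V ∧ b p = p := by
    intro p hp hpY hpW hpφ
    have hcp : c p = φ p := by
      simp only [c, h₁.fix p hp hpY, h₂.fix p hpW.1.1 hpY, ← add_smul]
      simp
    refine ⟨⟨⟨⟨hp, ?_⟩, hpW⟩, ?_⟩, ?_⟩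
    · rwa [mem_preimage, h₁.fix p hp hpY]
    · rw [mem_preimage, hcp]
      refine ⟨φ.map_source hpφ, ?_⟩
      rw [mem_preimage, φ.left_inv hpφ]
      exact hpW.1.1
    · change R₂ (φ.symm (c p)) = p
      rw [hcp, φ.left_inv hpφ, h₂.fix p hpW.1.1 hpY]
  have hWφ : ∀ p ∈ W, p ∈ Y → p ∈ φ.source := fun p hp hpY => by
    have := hp.1.2.1
    rwa [h₂.fix p hp.1.1 hpY] at this
  have ho1 : IsOpen (O₁ ∩ (tsupport f)ᶜ) := h₁.isOpen.inter (isClosed_tsupport f).isOpen_compl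
  have ho2 : IsOpen (D ∩ c ⁻¹' V) := hcD.continuousOn.isOpen_inter_preimage hD hV
  have ho3 : IsOpen (B ∩ W) := hBo.inter hW
  refine ⟨R, O₁ ∩ (tsupport f)ᶜ ∪ (D ∩ c ⁻¹' V ∪ B ∩ W),
    ⟨ho1.union (ho2.union ho3), ?_, ?_, ?_⟩, ?_, ?_, ?_, ?_⟩
  · have s1 : ContMDiffOn I I ∞ R (O₁ ∩ (tsupport f)ᶜ) :=
      (h₁.smooth.mono inter_subset_left).congr fun p hp => hout p hp.2
    have s2 : ContMDiffOn I I ∞ R (D ∩ c ⁻¹' V) := hbD.congr hbl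
    have s3 : ContMDiffOn I I ∞ R (B ∩ W) := (h₂.smooth.mono fun p hp => hp.2.1.1).congr hin
    exact s1.union_of_isOpen (s2.union_of_isOpen s3 ho2 ho3) ho1 (ho2.union ho3)
  · rintro p (hp | hp | hp)
    · rw [hout p hp.2]; exact h₁.mem p hp.1
    · rw [hbl p hp]; exact h₂.mem _ hp.2.2
    · rw [hin p hp]; exact h₂.mem p hp.2.1.1
  · rintro p (hp | hp | hp) hpY
    · rw [hout p hp.2]; exact h₁.fix p hp.1 hpY
    · rw [hbl p hp]
      exact (hYD p hp.1.1.1 hpY hp.1.2 (hWφ p hp.1.2 hpY)).2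
    · rw [hin p hp]; exact h₂.fix p hp.2.1.1 hpY
  · exact fun p hp => Or.inr (Or.inr hp)
  · rintro p ⟨hp, hpY⟩
    by_cases h : p ∈ tsupport f
    · exact Or.inr (Or.inl (hYD p hp hpY (hfW h) (hWφ p (hfW h) hpY)).1)
    · exact Or.inl ⟨hp, h⟩
  · ext p
    constructor
    · rintro ⟨hp | hp | hp, hpC⟩
      · exact ⟨hp.1, hpC⟩
      · exact absurd hpC hp.1.2.2
      · exact absurd hpC hp.2.2
    · rintro ⟨hp, hpC⟩
      exact ⟨Or.inl ⟨hp, fun h => (hfW h).2 hpC⟩, hpC⟩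
  · rintro p ⟨-, hpC⟩
    exact hout p fun h => (hfW h).2 hpC

/-- Extension of a smooth retraction over a neighbourhood of a compact set, without changing it
on a given disjoint closed set. -/
theorem IsSmoothRetraction.exists_extension {Y K C : Set M} (hK : IsCompact K) (hKY : K ⊆ Y)
    (hloc : ∀ z ∈ K, ∃ R O, z ∈ O ∧ IsSmoothRetraction I Y R O) (hC : IsClosed C)
    (hd : Disjoint K C) {R₁ : M → M} {O₁ : Set M} (h₁ : IsSmoothRetraction I Y R₁ O₁) :
    ∃ R O, IsSmoothRetraction I Y R O ∧ K ⊆ O ∧ O₁ ∩ Y ⊆ O ∧ O ∩ C = O₁ ∩ C ∧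
      ∀ p ∈ O ∩ C, R p = R₁ p := by
  -- Compact induction is run on this form. A later extension step is only guaranteed to keep the
  -- points of `Y` in the domain, hence the intersection with `Y`.
  suffices h : ∀ (R₁ : M → M) (O₁ : Set M), IsSmoothRetraction I Y R₁ O₁ →
      ∃ R O, IsSmoothRetraction I Y R O ∧ K ∩ Y ⊆ O ∧ O₁ ∩ Y ⊆ O ∧ O ∩ C = O₁ ∩ C ∧
      ∀ p ∈ O ∩ C, R p = R₁ p by
    obtain ⟨R, O, h1, h2, h3⟩ := h R₁ O₁ h₁
    exact ⟨R, O, h1, fun p hp => h2 ⟨hp, hKY hp⟩, h3⟩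
  clear h₁ R₁ O₁
  refine hK.induction_on (p := fun s => ∀ (R₁ : M → M) (O₁ : Set M), IsSmoothRetraction I Y R₁ O₁ →
      ∃ R O, IsSmoothRetraction I Y R O ∧ s ∩ Y ⊆ O ∧ O₁ ∩ Y ⊆ O ∧ O ∩ C = O₁ ∩ C ∧
      ∀ p ∈ O ∩ C, R p = R₁ p) ?_ ?_ ?_ ?_
  · exact fun R₁ O₁ h₁ => ⟨R₁, O₁, h₁, by simp, inter_subset_left, rfl, fun _ _ => rfl⟩
  · intro s t hst ht R₁ O₁ h₁
    obtain ⟨R, O, h1, h2, h3⟩ := ht R₁ O₁ h₁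
    exact ⟨R, O, h1, (inter_subset_inter_left _ hst).trans h2, h3⟩
  · intro s t hs ht R₁ O₁ h₁
    obtain ⟨R, O, h1, h2, h3, h4, h5⟩ := hs R₁ O₁ h₁
    obtain ⟨R', O', h1', h2', h3', h4', h5'⟩ := ht R O h1
    refine ⟨R', O', h1', ?_, fun p hp => h3' ⟨h3 hp, hp.2⟩, h4'.trans h4, fun p hp => ?_⟩
    · rintro p ⟨hp | hp, hpY⟩
      · exact h3' ⟨h2 ⟨hp, hpY⟩, hpY⟩
      · exact h2' ⟨hp, hpY⟩
    · rw [h5' p hp, h5 p (h4' ▸ hp)]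
  · intro z hz
    obtain ⟨R₂, O₂, hzO, h₂⟩ := hloc z hz
    have hzC : z ∉ C := fun h => disjoint_left.1 hd hz h
    obtain ⟨s, hs, h⟩ := h₂.exists_extension_nhds (hKY hz) hzO hC hzC
    refine ⟨s, mem_nhdsWithin_of_mem_nhds hs, fun R₁ O₁ h₁ => ?_⟩
    obtain ⟨R, O, h1, h2, h3⟩ := h R₁ O₁ h₁
    exact ⟨R, O, h1, inter_subset_left.trans h2, h3⟩

end Retraction

end CubicObstruction

namespace CubicObstruction

open Set Filter Topology

/-! ### Differentials as linear maps between the model spaces -/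

section ModelDeriv

variable {E : Type*} [NormedAddCommGroup E] [NormedSpace ℝ E] {H : Type*} [TopologicalSpace H]
  {I : ModelWithCorners ℝ E H} {M : Type*} [TopologicalSpace M] [ChartedSpace H M]
  {E' : Type*} [NormedAddCommGroup E'] [NormedSpace ℝ E'] {H' : Type*} [TopologicalSpace H']
  {I' : ModelWithCorners ℝ E' H'} {M' : Type*} [TopologicalSpace M'] [ChartedSpace H' M']
  {E'' : Type*} [NormedAddCommGroup E''] [NormedSpace ℝ E''] {H'' : Type*} [TopologicalSpace H'']
  {I'' : ModelWithCorners ℝ E'' H''} {M'' : Type*} [TopologicalSpace M''] [ChartedSpace H'' M'']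

/-- The differential of `f` at `p`, regarded as a linear map between the model spaces. -/
noncomputable def mder (I : ModelWithCorners ℝ E H) (I' : ModelWithCorners ℝ E' H') (f : M → M')
    (p : M) : E →L[ℝ] E' := mfderiv I I' f p

theorem mder_comp {g : M' → M''} {f : M → M'} {p : M} (hg : MDifferentiableAt I' I'' g (f p))
    (hf : MDifferentiableAt I I' f p) (v : E) :
    mder I I'' (fun q => g (f q)) p v = mder I' I'' g (f p) (mder I I' f p v) :=
  DFunLike.congr_fun (mfderiv_comp p hg hf) v

theorem mder_congr {f g : M → M'} {p : M} (h : ∀ᶠ q in 𝓝 p, f q = g q) :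
    mder I I' f p = mder I I' g p := Filter.EventuallyEq.mfderiv_eq h

theorem mder_prodMk {f : M → E'} {g : M → E''} {p : M} (hf : MDifferentiableAt I 𝓘(ℝ, E') f p)
    (hg : MDifferentiableAt I 𝓘(ℝ, E'') g p) :
    mder I 𝓘(ℝ, E' × E'') (fun q => (f q, g q)) p =
      (mder I 𝓘(ℝ, E') f p).prod (mder I 𝓘(ℝ, E'') g p) :=
  (hasMFDerivAt_prodMk_space (f' := mder I 𝓘(ℝ, E') f p) (g' := mder I 𝓘(ℝ, E'') g p)
    hf.hasMFDerivAt hg.hasMFDerivAt).mfderiv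

theorem mder_clm_comp (L : E' →L[ℝ] E'') {f : M → E'} {p : M}
    (hf : MDifferentiableAt I 𝓘(ℝ, E') f p) :
    mder I 𝓘(ℝ, E'') (fun q => L (f q)) p = L.comp (mder I 𝓘(ℝ, E') f p) :=
  (L.hasMFDerivAt.comp p hf.hasMFDerivAt).mfderiv

theorem mder_eq_zero_of_eventually_const {f : M → M'} {p : M} {a : M'}
    (h : ∀ᶠ q in 𝓝 p, f q = a) : mder I I' f p = 0 :=
  (mder_congr h).trans (mfderiv_const (I := I) (I' := I') (x := p) (c := a))

end ModelDeriv

/-! ### Subsets cut out by equations on the members of a closed cover -/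

section Adapted

variable {E : Type*} [NormedAddCommGroup E] [NormedSpace ℝ E] {H : Type*} [TopologicalSpace H]
  {I : ModelWithCorners ℝ E H} {M : Type*} [TopologicalSpace M] [ChartedSpace H M]
  {EF : Type*} [NormedAddCommGroup EF] [NormedSpace ℝ EF]
  {EG : Type*} [NormedAddCommGroup EG] [NormedSpace ℝ EG]
  {T : Type*} [NormedAddCommGroup T] [NormedSpace ℝ T] {C : Type*}

/-- On the open set `U`, the part of `S` in `D` is the zero set of the smooth function `F`, and the
kernels of the differential of `F` at the points of `S ∩ D` are the prescribed subspaces. -/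
structure LocalEquation (I : ModelWithCorners ℝ E H) (S D : Set M) (κ : M → Submodule ℝ E)
    (F : M → EF) (U : Set M) : Prop where
  isOpen : IsOpen U
  smooth : ContMDiffOn I 𝓘(ℝ, EF) ∞ F U
  mem_iff : ∀ p ∈ U, p ∈ D → (p ∈ S ↔ F p = 0)
  ker_eq : ∀ p ∈ U, p ∈ D → p ∈ S → ∀ v, mder I 𝓘(ℝ, EF) F p v = 0 ↔ v ∈ κ p

theorem LocalEquation.mono {S D : Set M} {κ : M → Submodule ℝ E} {F : M → EF} {U V : Set M}
    (h : LocalEquation I S D κ F U) (hV : IsOpen V) (hVU : V ⊆ U) : LocalEquation I S D κ F V :=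
  ⟨hV, h.smooth.mono hVU, fun p hp => h.mem_iff p (hVU hp), fun p hp => h.ker_eq p (hVU hp)⟩

/-- The function `t` describes the stratum of the point `z` of `S`: near `z`, the values of `t`
determine membership in the sets `D c`, and `t` is transverse to the equations of `S`. -/
structure StratumPoint (I : ModelWithCorners ℝ E H) (EF : Type*) [NormedAddCommGroup EF]
    [NormedSpace ℝ EF] (S : Set M) (D : C → Set M) (κ : C → M → Submodule ℝ E) (t : M → T)
    (z : M) : Prop where
  mem : z ∈ S
  zero : t z = 0
  near : ∃ O ∈ 𝓝 z, ∀ p ∈ O, ∀ p' ∈ O, t p = t p' → ∀ c, p ∈ D c → p' ∈ D c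
  eqs : ∀ c, z ∈ D c → ∃ (F : M → EF) (U : Set M), z ∈ U ∧ LocalEquation I S (D c) (κ c) F U ∧
    ∀ (τ : T) (f : EF), ∃ v, mder I 𝓘(ℝ, T) t z v = τ ∧ mder I 𝓘(ℝ, EF) F z v = f

/-- `G` is, on the open set `O`, a submersion whose restriction to `S` is injective, and which is
complementary to the equations of `S`. -/
structure ProjChart (I : ModelWithCorners ℝ E H) (EF : Type*) [NormedAddCommGroup EF]
    [NormedSpace ℝ EF] (S : Set M) (D : C → Set M) (κ : C → M → Submodule ℝ E)
    (z : M) (G : M → EG) (O : Set M) : Prop where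
  isOpen : IsOpen O
  mem : z ∈ O
  smooth : ContMDiffOn I 𝓘(ℝ, EG) ∞ G O
  inj : InjOn G (S ∩ O)
  near : ∀ p ∈ O, ∀ c, p ∈ D c → z ∈ D c
  eqs : ∀ c, z ∈ D c → ∃ (F : M → EF) (e : OpenPartialHomeomorph M (EG × EF)), O ⊆ e.source ∧
    (∀ p ∈ e.source, e p = (G p, F p)) ∧ LocalEquation I S (D c) (κ c) F e.source ∧
    ContMDiffOn 𝓘(ℝ, EG × EF) I ∞ e.symm e.target

theorem ProjChart.mono {S : Set M} {D : C → Set M} {κ : C → M → Submodule ℝ E} {z : M} {G : M → EG}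
    {O O' : Set M} (h : ProjChart I EF S D κ z G O) (hO' : IsOpen O') (hz : z ∈ O')
    (hOO' : O' ⊆ O) : ProjChart I EF S D κ z G O' :=
  ⟨hO', hz, h.smooth.mono hOO', h.inj.mono (inter_subset_inter_right _ hOO'),
    fun p hp => h.near p (hOO' hp), fun c hc => by
      obtain ⟨F, e, h1, h2⟩ := h.eqs c hc
      exact ⟨F, e, hOO'.trans h1, h2⟩⟩

/-- A chart may be recentred at a nearby point. -/
theorem ProjChart.recenter [Finite C] {S : Set M} {D : C → Set M} (hD : ∀ c, IsClosed (D c))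
    {κ : C → M → Submodule ℝ E} {z z' : M} {G : M → EG}
    {O : Set M} (h : ProjChart I EF S D κ z G O) (hz' : z' ∈ O) :
    ∃ O' ⊆ O, ProjChart I EF S D κ z' G O' := by
  let O' := O ∩ ⋂ c : {c // z' ∉ D c}, (D c.1)ᶜ
  have hO' : IsOpen O' := h.isOpen.inter (isOpen_iInter_of_finite fun c => (hD c.1).isOpen_compl)
  refine ⟨O', inter_subset_left, hO', ⟨hz', mem_iInter.2 fun c => c.2⟩,
    h.smooth.mono inter_subset_left, h.inj.mono (inter_subset_inter_right _ inter_subset_left),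
    fun p hp c hpc => ?_, fun c hc => ?_⟩
  · by_contra hc
    exact mem_iInter.1 hp.2 ⟨c, hc⟩ hpc
  · obtain ⟨F, e, h1, h2⟩ := h.eqs c (h.near z' hz' c hc)
    exact ⟨F, e, inter_subset_left.trans h1, h2⟩

variable [I.Boundaryless] [IsManifold I ∞ M] [FiniteDimensional ℝ E] [FiniteDimensional ℝ EF]
  [FiniteDimensional ℝ EG] [FiniteDimensional ℝ T]

/-- The points of `S` at which the stratum function vanishes form locally a smooth retract. -/
theorem StratumPoint.exists_local_retraction {S : Set M} {D : C → Set M}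
    (hcov : ∀ p, ∃ c, p ∈ D c) {κ : C → M → Submodule ℝ E} {t : M → T}
    (ht : ContMDiff I 𝓘(ℝ, T) ∞ t) {z : M} (h : StratumPoint I EF S D κ t z) :
    ∃ R O, z ∈ O ∧ IsSmoothRetraction I (S ∩ {p | t p = 0}) R O := by
  obtain ⟨c, hc⟩ := hcov z
  obtain ⟨F, U, hzU, hF, hs⟩ := h.eqs c hc
  obtain ⟨O₀, hO₀, hO₀D⟩ := h.near
  obtain ⟨O, hOO₀, hO, hzO⟩ := mem_nhds_iff.1 hO₀
  have hFz : F z = 0 := (hF.mem_iff z hzU hc).1 h.mem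
  refine CubicObstruction.exists_local_retraction (F := fun p => (t p, F p)) (U := U ∩ O)
    (hF.isOpen.inter hO) (ht.contMDiffOn.prodMk_space (hF.smooth.mono inter_subset_left))
    ⟨hzU, hzO⟩ (Prod.ext h.zero hFz)
    (mder_prodMk ((ht z).mdifferentiableAt (by simp))
      (mdifferentiableAt_of_contMDiffOn hF.smooth hF.isOpen hzU))
    (fun w => ?_) fun p hp => ?_
  · obtain ⟨v, h1, h2⟩ := hs w.1 w.2
    exact ⟨v, Prod.ext h1 h2⟩
  · rw [Prod.mk_eq_zero]
    constructor
    · rintro ⟨hpS, hpt⟩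
      have hpD := hO₀D z (hOO₀ hzO) p (hOO₀ hp.2) (h.zero.trans hpt.symm) c hc
      exact ⟨hpt, (hF.mem_iff p hp.1 hpD).1 hpS⟩
    · rintro ⟨hpt, hpF⟩
      have hpD := hO₀D z (hOO₀ hzO) p (hOO₀ hp.2) (h.zero.trans hpt.symm) c hc
      exact ⟨(hF.mem_iff p hp.1 hpD).2 hpF, hpt⟩

/-- A retraction onto the stratum and the stratum function together define a chart. -/
theorem StratumPoint.exists_projChart [Finite C] {S : Set M} {D : C → Set M}
    (hD : ∀ c, IsClosed (D c))
    (hcov : ∀ p, ∃ c, p ∈ D c) {κ : C → M → Submodule ℝ E} {t : M → T}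
    (ht : ContMDiff I 𝓘(ℝ, T) ∞ t)
    (hdim : Module.finrank ℝ EG + Module.finrank ℝ EF = Module.finrank ℝ E)
    {z : M} (h : StratumPoint I EF S D κ t z)
    {R : M → M} {O₁ : Set M} (hR : IsSmoothRetraction I (S ∩ {p | t p = 0}) R O₁) (hz : z ∈ O₁) :
    ∃ (G : M → EG) (O : Set M), ProjChart I EF S D κ z G O ∧ O ⊆ O₁ ∧
      (∀ p ∈ O, ∀ p' ∈ O, G p = G p' ↔ R p = R p' ∧ t p = t p') ∧
      (∀ p ∈ O, ∀ p' ∈ O, t p = t p' → ∀ c, p ∈ D c → p' ∈ D c) ∧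
      ∃ L : EG →L[ℝ] T, ∀ p ∈ O, L (G p) = t p := by
  obtain ⟨O₀, hO₀, hO₀D⟩ := h.near
  obtain ⟨N, hNO₀, hN, hzN⟩ := mem_nhds_iff.1 hO₀
  have hND : ∀ p ∈ N, ∀ p' ∈ N, t p = t p' → ∀ c, p ∈ D c → p' ∈ D c :=
    fun p hp p' hp' => hO₀D p (hNO₀ hp) p' (hNO₀ hp')
  have hzY : z ∈ S ∩ {p | t p = 0} := ⟨h.mem, h.zero⟩
  have hRz : R z = z := hR.fix z hz hzY
  have hRd : MDifferentiableAt I I R z := mdifferentiableAt_of_contMDiffOn hR.smooth hR.isOpen hz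
  have htd : MDifferentiableAt I 𝓘(ℝ, T) t z := (ht z).mdifferentiableAt (by simp)
  have hRN : ∀ᶠ p in 𝓝 z, R p ∈ N :=
    hRd.continuousAt.eventually (by rw [hRz]; exact hN.mem_nhds hzN)
  -- `R` maps into the stratum, so the image of `P` is killed by the differentials of `t` and of
  -- each `F`; `R` fixes the stratum, so `P` is the identity on their common kernel. Thus `P` is a
  -- projection onto the tangent space of the stratum, the same for all sectors.
  let P : E →L[ℝ] E := mder I I R z
  have hPt : ∀ v, mder I 𝓘(ℝ, T) t z (P v) = 0 := fun v => by
    have h1 : ∀ᶠ p in 𝓝 z, t (R p) = 0 := by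
      filter_upwards [hR.isOpen.mem_nhds hz] with p hp using (hR.mem p hp).2
    have h2 := mder_comp (I := I) (I'' := 𝓘(ℝ, T)) (g := t) (f := R) (p := z)
      (by rw [hRz]; exact htd) hRd v
    rw [mder_eq_zero_of_eventually_const h1, hRz] at h2
    exact h2.symm
  have hPF : ∀ c (F : M → EF) (U : Set M), z ∈ D c → z ∈ U → LocalEquation I S (D c) (κ c) F U →
      (∀ v, mder I 𝓘(ℝ, EF) F z (P v) = 0) ∧
      ((∀ (τ : T) (f : EF), ∃ v, mder I 𝓘(ℝ, T) t z v = τ ∧ mder I 𝓘(ℝ, EF) F z v = f) →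
        ∀ v, mder I 𝓘(ℝ, T) t z v = 0 → mder I 𝓘(ℝ, EF) F z v = 0 → P v = v) := by
    intro c F U hc hzU hF
    have hFd := mdifferentiableAt_of_contMDiffOn hF.smooth hF.isOpen hzU
    have hFz : F z = 0 := (hF.mem_iff z hzU hc).1 h.mem
    refine ⟨fun v => ?_, fun hs v hv1 hv2 => ?_⟩
    · have h1 : ∀ᶠ p in 𝓝 z, F (R p) = 0 := by
        filter_upwards [hR.isOpen.mem_nhds hz, hRN,
          hRd.continuousAt.eventually (by rw [hRz]; exact hF.isOpen.mem_nhds hzU)] with p hp hpN hpU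
        exact (hF.mem_iff _ hpU (hND z hzN _ hpN (h.zero.trans (hR.mem p hp).2.symm) c hc)).1
          (hR.mem p hp).1
      have h2 := mder_comp (I := I) (I'' := 𝓘(ℝ, EF)) (g := F) (f := R) (p := z)
        (by rw [hRz]; exact hFd) hRd v
      rw [mder_eq_zero_of_eventually_const h1, hRz] at h2
      exact h2.symm
    · refine mfderiv_eq_self_of_fixes_zeros (F := fun p => (t p, F p)) hF.isOpen
        (ht.contMDiffOn.prodMk_space hF.smooth) hzU (Prod.ext h.zero hFz)
        (mder_prodMk htd hFd) (fun w => ?_) hRd ?_ (Prod.ext hv1 hv2)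
      · obtain ⟨v, h1, h2⟩ := hs w.1 w.2
        exact ⟨v, Prod.ext h1 h2⟩
      · filter_upwards [hR.isOpen.mem_nhds hz, hN.mem_nhds hzN, hF.isOpen.mem_nhds hzU] with
          p hp hpN hpU h0
        obtain ⟨h1, h2⟩ := Prod.mk_eq_zero.1 h0
        exact hR.fix p hp ⟨(hF.mem_iff p hpU (hND z hzN p hpN (h.zero.trans h1.symm) c hc)).2 h2, h1⟩
  choose F₀ U₀ hzU₀ hF₀ hs₀ using fun c : {c // z ∈ D c} => h.eqs c.1 c.2
  obtain ⟨c₀, hc₀⟩ := hcov z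
  let φ := extChartAt I z
  have hφs : IsOpen φ.source := isOpen_extChartAt_source z
  have hφsm : ContMDiffOn I 𝓘(ℝ, E) ∞ φ φ.source := by
    rw [extChartAt_source]; exact contMDiffOn_extChartAt
  have hzφ : z ∈ φ.source := mem_extChartAt_source z
  let V : Submodule ℝ E := LinearMap.range P.toLinearMap
  let Pc : E →L[ℝ] V := P.codRestrict V fun v => ⟨v, rfl⟩
  let OG : Set M := O₁ ∩ R ⁻¹' φ.source
  have hOG : IsOpen OG := hR.smooth.continuousOn.isOpen_inter_preimage hR.isOpen hφs
  have hzOG : z ∈ OG := ⟨hz, by rw [mem_preimage, hRz]; exact hzφ⟩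
  have hφR : ContMDiffOn I 𝓘(ℝ, E) ∞ (fun p => φ (R p)) OG :=
    hφsm.comp (hR.smooth.mono inter_subset_left) fun p hp => hp.2
  let G₀ : M → V × T := fun p => (Pc (φ (R p)), t p)
  have hG₀ : ContMDiffOn I 𝓘(ℝ, V × T) ∞ G₀ OG :=
    (Pc.contMDiff.comp_contMDiffOn hφR).prodMk_space ht.contMDiffOn
  have hG₀d : mder I 𝓘(ℝ, V × T) G₀ z = (Pc.comp P).prod (mder I 𝓘(ℝ, T) t z) := by
    have h1 := mdifferentiableAt_of_contMDiffOn hφR hOG hzOG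
    have h2 : mder I 𝓘(ℝ, E) (fun p => φ (R p)) z = P := by
      refine ContinuousLinearMap.ext fun v => ?_
      rw [mder_comp (I' := I) (g := φ) (f := R)
        (by rw [hRz]; exact mdifferentiableAt_extChartAt (mem_chart_source H z)) hRd, hRz]
      change mfderiv I 𝓘(ℝ, E) (extChartAt I z) z (P v) = P v
      rw [mfderiv_extChartAt_self]
      rfl
    have h3 : MDifferentiableAt I 𝓘(ℝ, V) (fun p => Pc (φ (R p))) z :=
      mdifferentiableAt_of_contMDiffOn (Pc.contMDiff.comp_contMDiffOn hφR) hOG hzOG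
    have h4 := mder_prodMk h3 htd
    rw [mder_clm_comp Pc h1, h2] at h4
    exact h4
  -- A vector killed by all three components is fixed by `P` and killed by `P ∘ P`. For
  -- surjectivity, `t` and `F` are prescribed first, and the component along the stratum is then
  -- corrected by a vector in the image of `P`, which affects neither.
  have hbij : ∀ c : {c // z ∈ D c}, Function.Bijective
      (((Pc.comp P).prod (mder I 𝓘(ℝ, T) t z)).prod (mder I 𝓘(ℝ, EF) (F₀ c) z)) := by
    intro c
    obtain ⟨hP1, hP2⟩ := hPF c.1 (F₀ c) (U₀ c) c.2 (hzU₀ c) (hF₀ c)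
    have hP2 := hP2 (hs₀ c)
    refine ⟨(injective_iff_map_eq_zero _).2 fun v hv => ?_, fun w => ?_⟩
    · have h1 : mder I 𝓘(ℝ, T) t z v = 0 := congrArg (fun x => x.1.2) hv
      have h2 : mder I 𝓘(ℝ, EF) (F₀ c) z v = 0 := congrArg (fun x => x.2) hv
      have h3 : P (P v) = 0 := congrArg (fun x => (x.1.1 : E)) hv
      have h4 := hP2 v h1 h2
      rwa [h4, h4] at h3
    · obtain ⟨v, hv1, hv2⟩ := hs₀ c w.1.2 w.2
      obtain ⟨u, hu⟩ := w.1.1.2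
      change P u = w.1.1 at hu
      have hfix : ∀ x, P (P x) = P x := fun x => hP2 _ (hPt x) (hP1 x)
      refine ⟨v + (P u - P v), Prod.ext (Prod.ext (Subtype.ext ?_) ?_) ?_⟩
      · change P (P (v + (P u - P v))) = w.1.1
        rw [← hu]
        simp only [map_add, map_sub, hfix]
        abel
      · change mder I 𝓘(ℝ, T) t z (v + (P u - P v)) = w.1.2
        rw [map_add, map_sub, hPt, hPt, hv1]; abel
      · change mder I 𝓘(ℝ, EF) (F₀ c) z (v + (P u - P v)) = w.2
        rw [map_add, map_sub, hP1, hP1, hv2]; abel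
  have hfin : Module.finrank ℝ (V × T) = Module.finrank ℝ EG := by
    have h1 := (LinearEquiv.ofBijective _ (hbij ⟨c₀, hc₀⟩)).finrank_eq
    rw [Module.finrank_prod] at h1
    omega
  let L₀ : (V × T) ≃L[ℝ] EG := ContinuousLinearEquiv.ofFinrankEq hfin
  let G : M → EG := fun p => L₀ (G₀ p)
  have hG : ContMDiffOn I 𝓘(ℝ, EG) ∞ G OG := (L₀ : (V × T) →L[ℝ] EG).contMDiff.comp_contMDiffOn hG₀
  have hGd : mder I 𝓘(ℝ, EG) G z =
      (L₀ : (V × T) →L[ℝ] EG).comp ((Pc.comp P).prod (mder I 𝓘(ℝ, T) t z)) := by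
    rw [← hG₀d]
    exact mder_clm_comp (L₀ : (V × T) →L[ℝ] EG) (mdifferentiableAt_of_contMDiffOn hG₀ hOG hzOG)
  have he : ∀ c : {c // z ∈ D c}, ∃ e : OpenPartialHomeomorph M (EG × EF), z ∈ e.source ∧
      e.source ⊆ OG ∩ U₀ c ∧ (∀ p ∈ e.source, e p = (G p, F₀ c p)) ∧
      ContMDiffOn 𝓘(ℝ, EG × EF) I ∞ e.symm e.target := fun c => by
    refine exists_local_inverse (Ψ := fun p => (G p, F₀ c p)) (hOG.inter (hF₀ c).isOpen)
      ((hG.mono inter_subset_left).prodMk_space ((hF₀ c).smooth.mono inter_subset_right))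
      ⟨hzOG, hzU₀ c⟩ ?_
    change Function.Bijective (mder I 𝓘(ℝ, EG × EF) (fun p => (G p, F₀ c p)) z)
    rw [mder_prodMk (mdifferentiableAt_of_contMDiffOn hG hOG hzOG)
      (mdifferentiableAt_of_contMDiffOn (hF₀ c).smooth (hF₀ c).isOpen (hzU₀ c)), hGd]
    exact (L₀.toEquiv.prodCongr (Equiv.refl EF)).bijective.comp (hbij c)
  choose e hze heU hee hei using he
  let c₁ : {c // z ∈ D c} := ⟨c₀, hc₀⟩
  let A₁ : Set M := ⋂ c : {c // z ∈ D c}, (e c).source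
  let A₂ : Set M := ⋂ c : {c // z ∉ D c}, (D c.1)ᶜ
  let B : Set M := (e c₁).source ∩ (N ∩ O₁)
  -- Keeps `R p` in the domain of a fixed local diffeomorphism and of `R` itself, so that `R p` can
  -- be recovered from `G p`.
  let A₃ : Set M := O₁ ∩ R ⁻¹' B
  have hA₁ : IsOpen A₁ := isOpen_iInter_of_finite fun c => (e c).open_source
  have hA₂ : IsOpen A₂ := isOpen_iInter_of_finite fun c => (hD c.1).isOpen_compl
  have hA₃ : IsOpen A₃ := hR.smooth.continuousOn.isOpen_inter_preimage hR.isOpen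
    ((e c₁).open_source.inter (hN.inter hR.isOpen))
  let O : Set M := (A₁ ∩ A₂) ∩ (N ∩ A₃)
  have hGiff : ∀ p ∈ O, ∀ p' ∈ O, G p = G p' ↔ R p = R p' ∧ t p = t p' := by
    intro p hp p' hp'
    constructor
    · intro hpp
      have hpp := L₀.injective hpp
      have h1 : Pc (φ (R p)) = Pc (φ (R p')) := congrArg Prod.fst hpp
      refine ⟨?_, congrArg Prod.snd hpp⟩
      -- Both `t` and the equation vanish at `R q`, and `R` fixes it; so the first component of the
      -- chart already determines `R q`.
      have key : ∀ q ∈ O, e c₁ (R q) = (L₀ (Pc (φ (R q)), 0), 0) := fun q hq => by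
        have hq1 : q ∈ O₁ := hq.2.2.1
        have hq2 : R q ∈ B := hq.2.2.2
        have hY := hR.mem q hq1
        have hqD := hND z hzN _ hq2.2.1 (h.zero.trans hY.2.symm) c₀ hc₀
        have hF := ((hF₀ c₁).mem_iff _ (heU c₁ hq2.1).2 hqD).1 hY.1
        have hYt : t (R q) = 0 := hY.2
        rw [hee c₁ _ hq2.1, hF]
        simp only [G, G₀, hYt, hR.fix _ hq2.2.2 hY]
      refine (e c₁).injOn hp.2.2.2.1 hp'.2.2.2.1 ?_
      rw [key p hp, key p' hp', h1]
    · rintro ⟨h1, h2⟩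
      simp only [G, G₀, h1, h2]
  refine ⟨G, O, ⟨(hA₁.inter hA₂).inter (hN.inter hA₃), ?_, hG.mono ?_, ?_, ?_, ?_⟩, ?_, hGiff, ?_,
    (ContinuousLinearMap.snd ℝ V T).comp (L₀.symm : EG →L[ℝ] V × T), ?_⟩
  · refine ⟨⟨mem_iInter.2 hze, mem_iInter.2 fun c => c.2⟩, hzN, hz, ?_⟩
    rw [mem_preimage, hRz]
    exact ⟨hze c₁, hzN, hz⟩
  · exact fun p hp => (heU c₁ (mem_iInter.1 hp.1.1 c₁)).1
  · rintro p ⟨hpS, hp⟩ p' ⟨hpS', hp'⟩ hpp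
    obtain ⟨c, hpc⟩ := hcov p
    have hc : z ∈ D c := by
      by_contra hc
      exact mem_iInter.1 hp.1.2 ⟨c, hc⟩ hpc
    -- Equal values of `t` put both points in the same sector, where a single pair `(G, F)` is
    -- injective and `F` vanishes at both.
    have hpc' := hND p hp.2.1 p' hp'.2.1 ((hGiff p hp p' hp').1 hpp).2 c hpc
    have h1 := mem_iInter.1 hp.1.1 ⟨c, hc⟩
    have h2 := mem_iInter.1 hp'.1.1 ⟨c, hc⟩
    refine (e ⟨c, hc⟩).injOn h1 h2 ?_
    rw [hee _ _ h1, hee _ _ h2, hpp, ((hF₀ ⟨c, hc⟩).mem_iff p (heU _ h1).2 hpc).1 hpS,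
      ((hF₀ ⟨c, hc⟩).mem_iff p' (heU _ h2).2 hpc').1 hpS']
  · intro p hp c hpc
    by_contra hc
    exact mem_iInter.1 hp.1.2 ⟨c, hc⟩ hpc
  · intro c hc
    exact ⟨F₀ ⟨c, hc⟩, e ⟨c, hc⟩, fun p hp => mem_iInter.1 hp.1.1 ⟨c, hc⟩, hee _,
      (hF₀ ⟨c, hc⟩).mono (e _).open_source fun p hp => (heU _ hp).2, hei _⟩
  · exact fun p hp => hp.2.2.1
  · exact fun p hp p' hp' => hND p hp.2.1 p' hp'.2.1
  · intro p _
    change (L₀.symm (L₀ (G₀ p))).2 = t p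
    rw [L₀.symm_apply_apply]

end Adapted

end CubicObstruction

/-! ### Lifts: points of `S` prescribed by a retraction and the stratum function -/

namespace CubicObstruction

open Set Filter Topology

/-- The neighbourhood filter is the supremum of the filters within the finitely many members, and a
closed member not containing `p` contributes the trivial filter. -/
theorem continuousAt_of_closed_cover {X Y C : Type*} [TopologicalSpace X] [TopologicalSpace Y]
    [Finite C] {D : C → Set X} (hD : ∀ c, IsClosed (D c)) (hcov : ∀ p, ∃ c, p ∈ D c) {f : X → Y}
    {p : X} (h : ∀ c, p ∈ D c → ContinuousWithinAt f (D c) p) : ContinuousAt f p := by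
  have hu : (⋃ c, D c) = univ := eq_univ_of_forall fun p => mem_iUnion.2 (hcov p)
  rw [← continuousWithinAt_univ, ← hu, ContinuousWithinAt, nhdsWithin_iUnion, tendsto_iSup]
  intro c
  by_cases hc : p ∈ D c
  · exact h c hc
  · rw [(mem_closure_iff_nhdsWithin_neBot.not.1 (by rwa [(hD c).closure_eq])
      |> not_neBot.1 : 𝓝[D c] p = ⊥)]
    exact tendsto_bot

section Adapted

variable {E : Type*} [NormedAddCommGroup E] [NormedSpace ℝ E] {H : Type*} [TopologicalSpace H]
  {I : ModelWithCorners ℝ E H} {M : Type*} [TopologicalSpace M] [ChartedSpace H M]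
  {EF : Type*} [NormedAddCommGroup EF] [NormedSpace ℝ EF]
  {EG : Type*} [NormedAddCommGroup EG] [NormedSpace ℝ EG]
  {T : Type*} [NormedAddCommGroup T] [NormedSpace ℝ T] {C : Type*}

/-- `ρ` is a map from the open set `Ω` to `S`, preserving the functions `R` and `t`, which together
are injective on the intersection of `S` with `Ω`. -/
structure IsLift (I : ModelWithCorners ℝ E H) (EF EG : Type*) [NormedAddCommGroup EF]
    [NormedSpace ℝ EF] [NormedAddCommGroup EG]
    [NormedSpace ℝ EG] (S : Set M) (D : C → Set M) (κ : C → M → Submodule ℝ E) (t : M → T)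
    (R : M → M) (ρ : M → M) (Ω : Set M) : Prop where
  isOpen : IsOpen Ω
  cont : ContinuousOn ρ Ω
  mem : ∀ p ∈ Ω, ρ p ∈ S ∩ Ω
  retr : ∀ p ∈ Ω, R (ρ p) = R p
  strat : ∀ p ∈ Ω, t (ρ p) = t p
  unique : ∀ p ∈ Ω, ∀ q ∈ S ∩ Ω, R q = R p → t q = t p → ρ p = q
  smooth : ∀ p ∈ Ω, ∀ c, p ∈ D c → ∃ (σ : M → M) (U : Set M), IsOpen U ∧ p ∈ U ∧
    ContMDiffOn I I ∞ σ U ∧ ∀ q ∈ U, q ∈ D c → ρ q = σ q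
  chart : ∀ p ∈ S ∩ Ω, ∃ (G : M → EG) (O : Set M), ProjChart I EF S D κ p G O ∧
    (∀ q ∈ O, ρ q ∈ O → G (ρ q) = G q) ∧ ∃ L : EG →L[ℝ] T, ∀ q ∈ O, L (G q) = t q

theorem IsLift.fix {S : Set M} {D : C → Set M} {κ : C → M → Submodule ℝ E} {t : M → T}
    {R : M → M} {ρ : M → M} {Ω : Set M} (h : IsLift I EF EG S D κ t R ρ Ω) {p : M}
    (hp : p ∈ S ∩ Ω) : ρ p = p := h.unique p hp.2 p hp rfl rfl

variable [I.Boundaryless] [IsManifold I ∞ M] [FiniteDimensional ℝ E] [FiniteDimensional ℝ EF]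
  [FiniteDimensional ℝ EG] [FiniteDimensional ℝ T]

/-- Near a compact part of a stratum, the points of `S` are determined by a retraction onto the
stratum and the stratum function, and these can be prescribed arbitrarily. -/
theorem exists_isLift [T2Space M] [Finite C] {S : Set M} {D : C → Set M}
    (hD : ∀ c, IsClosed (D c)) (hcov : ∀ p, ∃ c, p ∈ D c) {κ : C → M → Submodule ℝ E} {t : M → T}
    (ht : ContMDiff I 𝓘(ℝ, T) ∞ t)
    (hdim : Module.finrank ℝ EG + Module.finrank ℝ EF = Module.finrank ℝ E)
    {K : Set M} (hK : IsCompact K) (hKS : ∀ z ∈ K, StratumPoint I EF S D κ t z)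
    {R : M → M} {O₁ : Set M} (hR : IsSmoothRetraction I (S ∩ {p | t p = 0}) R O₁) (hKO : K ⊆ O₁) :
    ∃ (ρ : M → M) (Ω : Set M), K ⊆ Ω ∧ Ω ⊆ O₁ ∧ IsLift I EF EG S D κ t R ρ Ω := by
  choose G₀ O₀ hGO₀ hO₀O₁ hiff₀ hstrat₀ L₀ hL₀ using fun z : K =>
    (hKS z.1 z.2).exists_projChart (EG := EG) hD hcov ht hdim hR (hKO z.2)
  have hinj : InjOn (fun p => (R p, t p)) K := fun p hp p' hp' h => by
    have h1 : R p = R p' := congrArg Prod.fst h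
    rwa [hR.fix p (hKO hp) ⟨(hKS p hp).mem, (hKS p hp).zero⟩,
      hR.fix p' (hKO hp') ⟨(hKS p' hp').mem, (hKS p' hp').zero⟩] at h1
  -- On `K` the retraction is the identity, so `(R, t)` is injective there; the charts make it
  -- locally injective on `S`. By compactness it is injective on `S` near `K`, which makes the local
  -- lifts agree.
  obtain ⟨Ω₀, hΩ₀, hKΩ₀, hΩinj⟩ : ∃ Ω₀ : Set M, IsOpen Ω₀ ∧ K ⊆ Ω₀ ∧
      InjOn (fun p => (R p, t p)) (S ∩ Ω₀) := by
    have hKS' : K ⊆ range ((↑) : S → M) := fun z hz => ⟨⟨z, (hKS z hz).mem⟩, rfl⟩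
    obtain ⟨u, hu, hKu, hui⟩ := InjOn.exists_isOpen_superset
      (f := fun x : S => (R x, t x)) (s := ((↑) : S → M) ⁻¹' K)
      (fun x hx y hy hxy => Subtype.ext (hinj hx hy hxy))
      (IsInducing.subtypeVal.isCompact_preimage_iff hKS' |>.2 hK)
      (fun x hx => ContinuousAt.comp (f := ((↑) : S → M)) (g := fun p => (R p, t p))
        ((hR.smooth.continuousOn.continuousAt (hR.isOpen.mem_nhds (hKO hx))).prodMk
          ht.continuous.continuousAt) continuous_subtype_val.continuousAt)
      (fun x hx => ⟨((↑) : S → M) ⁻¹' O₀ ⟨x, hx⟩, continuous_subtype_val.continuousAt.preimage_mem_nhds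
          ((hGO₀ ⟨x, hx⟩).isOpen.mem_nhds (hGO₀ ⟨x, hx⟩).mem), fun y hy y' hy' h => by
        refine Subtype.ext ((hGO₀ ⟨x, hx⟩).inj ⟨y.2, hy⟩ ⟨y'.2, hy'⟩ ?_)
        exact (hiff₀ _ _ hy _ hy').2 ⟨congrArg Prod.fst h, congrArg Prod.snd h⟩⟩)
    obtain ⟨Ω₀, hΩ₀, rfl⟩ := isOpen_induced_iff.1 hu
    exact ⟨Ω₀, hΩ₀, fun z hz => hKu (show (⟨z, (hKS z hz).mem⟩ : S) ∈ _ from hz),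
      fun p hp p' hp' h => congrArg Subtype.val
        (hui (show (⟨p, hp.1⟩ : S) ∈ _ from hp.2) (show (⟨p', hp'.1⟩ : S) ∈ _ from hp'.2) h)⟩
  let O : K → Set M := fun z => O₀ z ∩ Ω₀
  have hGO : ∀ z : K, ProjChart I EF S D κ z.1 (G₀ z) (O z) := fun z =>
    (hGO₀ z).mono ((hGO₀ z).isOpen.inter hΩ₀) ⟨(hGO₀ z).mem, hKΩ₀ z.2⟩ inter_subset_left
  choose F e hOe hee hFe hei using fun (z : K) (c : {c // z.1 ∈ D c}) => (hGO z).eqs c.1 c.2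
  let Wc : (z : K) → {c // z.1 ∈ D c} → Set M := fun z c =>
    O z ∩ (fun p => (G₀ z p, (0 : EF))) ⁻¹' ((e z c).target ∩ (e z c).symm ⁻¹' O z)
  have hWc : ∀ z c, IsOpen (Wc z c) := fun z c =>
    ((hGO z).smooth.continuousOn.prodMk continuousOn_const).isOpen_inter_preimage (hGO z).isOpen
      ((e z c).isOpen_inter_preimage_symm (hGO z).isOpen)
  have hzWc : ∀ z c, z.1 ∈ Wc z c := fun z c => by
    have hs := hOe z c (hGO z).mem
    have h1 : e z c z.1 = (G₀ z z.1, 0) := by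
      rw [hee z c _ hs, ((hFe z c).mem_iff _ hs c.2).1 (hKS _ z.2).mem]
    refine ⟨(hGO z).mem, ?_⟩
    rw [mem_preimage, ← h1]
    exact ⟨(e z c).map_source hs, by rw [mem_preimage, (e z c).left_inv hs]; exact (hGO z).mem⟩
  let W : K → Set M := fun z => O z ∩ ⋂ c, Wc z c
  have hW : ∀ z, IsOpen (W z) := fun z => (hGO z).isOpen.inter (isOpen_iInter_of_finite (hWc z))
  have hzW : ∀ z, z.1 ∈ W z := fun z => ⟨(hGO z).mem, mem_iInter.2 (hzWc z)⟩
  -- The lift sets the equation to zero while keeping `G`. It preserves `t`, hence stays in the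
  -- sector whose equation was used, and therefore lies in `S`.
  have hlift : ∀ z, ∀ p ∈ W z, ∀ c : {c // z.1 ∈ D c}, p ∈ D c →
      (e z c).symm (G₀ z p, 0) ∈ S ∩ O z ∧ R ((e z c).symm (G₀ z p, 0)) = R p ∧
        t ((e z c).symm (G₀ z p, 0)) = t p := by
    intro z p hp c hpc
    obtain ⟨hpO, hpt, hpq⟩ := mem_iInter.1 hp.2 c
    have hq := (hee z c _ (hOe z c hpq)).symm.trans ((e z c).right_inv hpt)
    obtain ⟨h1, h2⟩ := (hiff₀ z _ hpq.1 _ hpO.1).1 (congrArg Prod.fst hq)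
    exact ⟨⟨((hFe z c).mem_iff _ (hOe z c hpq) (hstrat₀ z _ hpO.1 _ hpq.1 h2.symm c hpc)).2
      (congrArg Prod.snd hq), hpq⟩, h1, h2⟩
  let Ω₁ : Set M := ⋃ z, W z
  have hΩ₁ : IsOpen Ω₁ := isOpen_iUnion hW
  have hex : ∀ p : M, ∃ q, p ∈ Ω₁ → q ∈ S ∩ Ω₀ ∧ R q = R p ∧ t q = t p := fun p => by
    by_cases hp : p ∈ Ω₁
    · obtain ⟨z, hz⟩ := mem_iUnion.1 hp
      obtain ⟨c, hc⟩ := hcov p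
      obtain ⟨h1, h2⟩ := hlift z p hz ⟨c, (hGO z).near p hz.1 c hc⟩ hc
      exact ⟨_, fun _ => ⟨⟨h1.1, h1.2.2⟩, h2⟩⟩
    · exact ⟨p, fun h => absurd h hp⟩
  choose ρ hρ using hex
  have huniq : ∀ p ∈ Ω₁, ∀ q ∈ S ∩ Ω₀, R q = R p → t q = t p → ρ p = q := fun p hp q hq h1 h2 =>
    hΩinj (hρ p hp).1 hq (Prod.ext ((hρ p hp).2.1.trans h1.symm) ((hρ p hp).2.2.trans h2.symm))
  have hρe : ∀ z, ∀ p ∈ W z, ∀ c : {c // z.1 ∈ D c}, p ∈ D c → ρ p = (e z c).symm (G₀ z p, 0) :=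
    fun z p hp c hpc => by
      obtain ⟨h1, h2, h3⟩ := hlift z p hp c hpc
      exact huniq p (mem_iUnion.2 ⟨z, hp⟩) _ ⟨h1.1, h1.2.2⟩ h2 h3
  have hesm : ∀ z c, ContMDiffOn I I ∞ (fun p => (e z c).symm (G₀ z p, 0)) (W z) := fun z c =>
    (hei z c).comp (((hGO z).smooth.mono inter_subset_left).prodMk_space contMDiffOn_const)
      fun p hp => (mem_iInter.1 hp.2 c).2.1
  have hρc : ContinuousOn ρ Ω₁ := fun p hp => by
    obtain ⟨z, hz⟩ := mem_iUnion.1 hp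
    refine (continuousAt_of_closed_cover hD hcov fun c hc => ?_).continuousWithinAt
    let c' : {c // z.1 ∈ D c} := ⟨c, (hGO z).near p hz.1 c hc⟩
    refine (((hesm z c').continuousOn.continuousAt
      ((hW z).mem_nhds hz)).continuousWithinAt).congr_of_eventuallyEq_of_mem ?_ hc
    filter_upwards [self_mem_nhdsWithin, mem_nhdsWithin_of_mem_nhds ((hW z).mem_nhds hz)] with
      q hqc hq using hρe z q hq c' hqc
  -- Makes the domain invariant: `ρ` fixes its own values, so `ρ p` again satisfies both conditions.
  let Ω : Set M := Ω₁ ∩ ρ ⁻¹' Ω₁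
  have hΩ : IsOpen Ω := hρc.isOpen_inter_preimage hΩ₁ hΩ₁
  have hKΩ₁ : K ⊆ Ω₁ := fun z hz => mem_iUnion.2 ⟨⟨z, hz⟩, hzW ⟨z, hz⟩⟩
  have hΩ₁0 : Ω₁ ⊆ Ω₀ := iUnion_subset fun z p hp => hp.1.2
  have hWρ : ∀ z, ∀ p ∈ W z, ρ p ∈ O z := fun z p hp => by
    obtain ⟨c, hc⟩ := hcov p
    have hc' := (hGO z).near p hp.1 c hc
    rw [hρe z p hp ⟨c, hc'⟩ hc]
    exact (hlift z p hp ⟨c, hc'⟩ hc).1.2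
  refine ⟨ρ, Ω, fun z hz => ⟨hKΩ₁ hz, ?_⟩, fun p hp => ?_, hΩ, hρc.mono inter_subset_left,
    fun p hp => ⟨(hρ p hp.1).1.1, hp.2, ?_⟩, fun p hp => (hρ p hp.1).2.1,
    fun p hp => (hρ p hp.1).2.2, fun p hp q hq => huniq p hp.1 q ⟨hq.1, hΩ₁0 hq.2.1⟩,
    fun p hp c hpc => ?_, fun p hp => ?_⟩
  · rw [mem_preimage, huniq z (hKΩ₁ hz) z ⟨(hKS z hz).mem, hKΩ₀ hz⟩ rfl rfl]
    exact hKΩ₁ hz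
  · obtain ⟨z, hz⟩ := mem_iUnion.1 hp.1
    exact hO₀O₁ z hz.1.1
  · rw [mem_preimage, huniq (ρ p) hp.2 (ρ p) (hρ p hp.1).1 rfl rfl]
    exact hp.2
  · obtain ⟨z, hz⟩ := mem_iUnion.1 hp.1
    let c' : {c // z.1 ∈ D c} := ⟨c, (hGO z).near p hz.1 c hpc⟩
    exact ⟨_, W z, hW z, hz, hesm z c', fun q hq hqc => hρe z q hq c' hqc⟩
  · obtain ⟨z, hz⟩ := mem_iUnion.1 hp.2.1
    obtain ⟨O', hO', hpr⟩ := (hGO z).recenter hD hz.1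
    refine ⟨G₀ z, O' ∩ W z, hpr.mono (hpr.isOpen.inter (hW z)) ⟨hpr.mem, hz⟩ inter_subset_left,
      fun q hq _ => ?_, L₀ z, fun q hq => hL₀ z q (hO' hq.1).1⟩
    have hq1 : q ∈ Ω₁ := mem_iUnion.2 ⟨z, hq.2⟩
    exact (hiff₀ z _ (hWρ z q hq.2).1 _ (hO' hq.1).1).2 (hρ q hq1).2

end Adapted

end CubicObstruction

namespace CubicObstruction

open Set Filter Topology

/-! ### Retractions onto fan-like subsets -/

section Fan

variable {E : Type*} [NormedAddCommGroup E] [NormedSpace ℝ E] {H : Type*} [TopologicalSpace H]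
  {I : ModelWithCorners ℝ E H} {X : Type*} [TopologicalSpace X] [ChartedSpace H X]
  {W : Type*} [NormedAddCommGroup W] [NormedSpace ℝ W]
  {EF : Type*} [NormedAddCommGroup EF] [NormedSpace ℝ EF]
  {EG : Type*} [NormedAddCommGroup EG] [NormedSpace ℝ EG] {C : Type*}

/-- `G` is a chart of `S` on `O` which is compatible with the map `ρ` defined on `U`. -/
structure AdaptedChart {M : Type*} [TopologicalSpace M] [ChartedSpace H M]
    (I : ModelWithCorners ℝ E H) (EF : Type*) [NormedAddCommGroup EF]
    [NormedSpace ℝ EF] (S : Set M) (D : C → Set M) (κ : C → M → Submodule ℝ E) (ρ : M → M)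
    (U : Set M) (z : M) (G : M → EG) (O : Set M) : Prop where
  proj : ProjChart I EF S D κ z G O
  subset : O ⊆ U
  compat : ∀ q ∈ O, G (ρ q) = G q
  mem : ∀ q ∈ O, ρ q ∈ O

/-- The chart of the lift is restricted to the points that `ρ₀` keeps in its domain; `ρ₀` fixes its
values, so the smaller domain is preserved. -/
theorem IsLift.exists_adaptedChart {M : Type*} [TopologicalSpace M] [ChartedSpace H M]
    {T : Type*} [NormedAddCommGroup T] [NormedSpace ℝ T]
    {S : Set M} {D : C → Set M} {κ : C → M → Submodule ℝ E} {t : M → T}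
    {R : M → M} {ρ₀ : M → M} {Ω : Set M} (h : IsLift I EF EG S D κ t R ρ₀ Ω) {ρ : M → M}
    {U B : Set M} (hB : IsOpen B) (hBU : B ⊆ U) (hBΩ : B ⊆ Ω) (hρ : ∀ q ∈ B, ρ q = ρ₀ q)
    {p : M} (hpS : p ∈ S) (hpB : p ∈ B) :
    ∃ (G : M → EG) (O : Set M), AdaptedChart I EF S D κ ρ U p G O ∧
      ∃ L : EG →L[ℝ] T, ∀ q ∈ O, L (G q) = t q := by
  obtain ⟨G, O, hG, hGρ, L, hL⟩ := h.chart p ⟨hpS, hBΩ hpB⟩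
  have hpp : ρ₀ p = p := h.fix ⟨hpS, hBΩ hpB⟩
  have hc : ContinuousOn ρ₀ (O ∩ B) := h.cont.mono (inter_subset_right.trans hBΩ)
  have hO : IsOpen (O ∩ B) := hG.isOpen.inter hB
  refine ⟨G, (O ∩ B) ∩ ρ₀ ⁻¹' (O ∩ B), ⟨hG.mono (hc.isOpen_inter_preimage hO hO)
    ⟨⟨hG.mem, hpB⟩, ?_⟩ (inter_subset_left.trans inter_subset_left),
    fun q hq => hBU hq.1.2, fun q hq => ?_, fun q hq => ?_⟩, L, fun q hq => hL q hq.1.1⟩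
  · rw [mem_preimage, hpp]; exact ⟨hG.mem, hpB⟩
  · rw [hρ q hq.1.2]
    exact hGρ q hq.1.1 hq.2.1
  · rw [hρ q hq.1.2]
    refine ⟨hq.2, ?_⟩
    rw [mem_preimage, h.fix ⟨(h.mem q (hBΩ hq.1.2)).1, hBΩ hq.2.2⟩]
    exact hq.2

variable [I.Boundaryless] [IsManifold I ∞ X] [FiniteDimensional ℝ E] [FiniteDimensional ℝ EF]
  [FiniteDimensional ℝ EG] [FiniteDimensional ℝ W] [T2Space X] [Finite C]

/-- A retraction onto the vertex stratum which only depends on the first component. -/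
theorem exists_vertex_retraction {S : Set (X × W)} (hS : IsCompact S) {D : C → Set W}
    (hcov : ∀ w, ∃ c, w ∈ D c) {κ : C → X × W → Submodule ℝ (E × W)}
    (hV : ∀ p ∈ S, p.2 = 0 →
      StratumPoint (I.prod 𝓘(ℝ, W)) EF S (fun c => {p | p.2 ∈ D c}) κ (fun p => p.2) p) :
    ∃ (R : X × W → X × W) (O : Set (X × W)),
      IsSmoothRetraction (I.prod 𝓘(ℝ, W)) (S ∩ {p | p.2 = 0}) R O ∧ S ∩ {p | p.2 = 0} ⊆ O ∧
      ∀ x w w', R (x, w) = R (x, w') := by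
  have hK : IsCompact (S ∩ {p : X × W | p.2 = 0}) :=
    hS.inter_right (isClosed_singleton.preimage continuous_snd)
  obtain ⟨R, O, hR, hKO, -⟩ := IsSmoothRetraction.exists_extension (I := I.prod 𝓘(ℝ, W)) hK
    (Subset.refl (S ∩ {p : X × W | p.2 = 0}))
    (fun z hz => (hV z hz.1 hz.2).exists_local_retraction (fun p => hcov p.2) contMDiff_snd)
    isClosed_empty (disjoint_empty _) (R₁ := id) (O₁ := ∅)
    ⟨isOpen_empty, contMDiffOn_id, by simp, by simp⟩
  -- Composing with this map does not change anything on the vertex stratum and removes the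
  -- dependence on the plane coordinate, which is what allows ray retractions to be compatible with
  -- the vertex retraction.
  let i : X × W → X × W := fun p => (p.1, 0)
  have hi : ContMDiff (I.prod 𝓘(ℝ, W)) (I.prod 𝓘(ℝ, W)) ∞ i := contMDiff_fst.prodMk contMDiff_const
  have hiY : ∀ p : X × W, p.2 = 0 → i p = p := fun p hp => Prod.ext rfl hp.symm
  refine ⟨R ∘ i, i ⁻¹' O, ⟨hR.isOpen.preimage hi.continuous, hR.smooth.comp hi.contMDiffOn
    fun p hp => hp, fun p hp => hR.mem _ hp, fun p hp hpY => ?_⟩, fun p hp => ?_, fun x w w' => rfl⟩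
  · have h := hR.fix _ hp
    rw [hiY p hpY.2] at h
    rw [Function.comp_apply, hiY p hpY.2]
    exact h hpY
  · rw [mem_preimage, hiY p hp.2]; exact hKO hp

/-- The lift near a ray, compatible with a given lift near the vertex. -/
theorem exists_ray_lift {S : Set (X × W)} (hS : IsCompact S) {D : C → Set W}
    (hD : ∀ c, IsClosed (D c)) (hcov : ∀ w, ∃ c, w ∈ D c)
    {κ : C → X × W → Submodule ℝ (E × W)}
    (hdim : Module.finrank ℝ EG + Module.finrank ℝ EF = Module.finrank ℝ (E × W))
    {R ρ : X × W → X × W} {Ω : Set (X × W)}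
    (h : IsLift (I.prod 𝓘(ℝ, W)) EF EG S (fun c => {p | p.2 ∈ D c}) κ (fun p => p.2) R ρ Ω)
    (hR : ∀ x w w', R (x, w) = R (x, w')) {δ : ℝ} (hδ : 0 < δ)
    (hδΩ : ∀ p ∈ S, ‖p.2‖ ≤ δ → p ∈ Ω)
    {a b : W →L[ℝ] ℝ} {u : W} (hau : a u = 1) (hbu : b u = 0)
    (hray : ∀ w, b w = 0 → 0 ≤ a w → w = a w • u) {c : C}
    (hc : ∀ w, b w = 0 → 0 < a w → w ∈ D c)
    (hst : ∀ p ∈ S, b p.2 = 0 → 0 < a p.2 →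
      StratumPoint (I.prod 𝓘(ℝ, W)) EF S (fun c => {p | p.2 ∈ D c}) κ (fun p => b p.2) p) :
    ∃ (R' ρ' : X × W → X × W) (Ω' : Set (X × W)),
      IsLift (I.prod 𝓘(ℝ, W)) EF EG S (fun c => {p | p.2 ∈ D c}) κ (fun p => b p.2) R' ρ' Ω' ∧
      (∀ p ∈ S, b p.2 = 0 → 0 < a p.2 → δ / 4 ≤ ‖p.2‖ → p ∈ Ω') ∧
      ∀ p ∈ Ω', p ∈ Ω → ‖p.2‖ ≤ 3 * δ / 4 → ρ p ∈ Ω' → ρ' p = ρ p := by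
  let J := I.prod 𝓘(ℝ, W)
  let i : X × W → X × W := fun p => (p.1, a p.2 • u)
  have has : ContMDiff J 𝓘(ℝ, ℝ) ∞ fun p : X × W => a p.2 := a.contMDiff.comp contMDiff_snd
  have hbs : ContMDiff J 𝓘(ℝ, ℝ) ∞ fun p : X × W => b p.2 := b.contMDiff.comp contMDiff_snd
  have hi : ContMDiff J J ∞ i := contMDiff_fst.prodMk (has.smul contMDiff_const)
  have hai : ∀ p, a (i p).2 = a p.2 := fun p => by simp [i, hau]
  have hbi : ∀ p, b (i p).2 = 0 := fun p => by simp [i, hbu]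
  have hip : ∀ p : X × W, b p.2 = 0 → 0 ≤ a p.2 → i p = p := fun p h1 h2 =>
    Prod.ext rfl (hray p.2 h1 h2).symm
  let O₁ : Set (X × W) := {p | 0 < a p.2} ∩ i ⁻¹' Ω
  have hO₁ : IsOpen O₁ := (isOpen_lt continuous_const has.continuous).inter
    (h.isOpen.preimage hi.continuous)
  let Y : Set (X × W) := S ∩ {p | b p.2 = 0}
  -- `ρ` is smooth only sector by sector, but `i` takes values over the open ray, which lies in one
  -- sector; so `ρ ∘ i` is smooth. It stays over the ray since `ρ` preserves the plane coordinate.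
  have h₁ : IsSmoothRetraction J Y (ρ ∘ i) O₁ := by
    refine ⟨hO₁, fun p hp => ?_, fun p hp => ⟨(h.mem _ hp.2).1, ?_⟩, fun p hp hpY => ?_⟩
    · obtain ⟨σ, U, hU, hpU, hσ, hσρ⟩ := h.smooth (i p) hp.2 c
        (hc _ (hbi p) (by rw [hai]; exact hp.1))
      refine ContMDiffAt.contMDiffWithinAt ?_
      refine ((hσ.contMDiffAt (hU.mem_nhds hpU)).comp p hi.contMDiffAt).congr_of_eventuallyEq ?_
      filter_upwards [hO₁.mem_nhds hp, (hU.preimage hi.continuous).mem_nhds hpU] with q hq hqU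
      exact hσρ _ hqU (hc _ (hbi q) (by rw [hai]; exact hq.1))
    · have := h.strat _ hp.2
      change b (ρ (i p)).2 = 0
      rw [this, hbi]
    · have h1 := hip p hpY.2 (le_of_lt hp.1)
      have h2 := hp.2
      rw [mem_preimage, h1] at h2
      rw [Function.comp_apply, h1, h.fix ⟨hpY.1, h2⟩]
  have hcl : ∀ r : ℝ, IsClosed {p : X × W | (b p.2 = 0 ∧ 0 ≤ a p.2) ∧ r ≤ ‖p.2‖} := fun r =>
    ((isClosed_eq hbs.continuous continuous_const).inter
      (isClosed_le continuous_const has.continuous)).inter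
      (isClosed_le continuous_const continuous_snd.norm)
  have hpos : ∀ (r : ℝ) (p : X × W), 0 < r → (b p.2 = 0 ∧ 0 ≤ a p.2) ∧ r ≤ ‖p.2‖ → 0 < a p.2 :=
    fun r p hr hp => lt_of_le_of_ne hp.1.2 fun h0 => by
      have h1 := hray p.2 hp.1.1 hp.1.2
      rw [← h0, zero_smul] at h1
      have h2 := hp.2
      rw [h1, norm_zero] at h2
      linarith
  -- The formula `ρ ∘ i` covers the ray up to distance `δ`. It is extended to the remaining compact
  -- part without any change at distance at most `3δ/4`, where compatibility will be needed.
  obtain ⟨R', O', hR', hK₁, hO₁O', hOC, hRC⟩ := IsSmoothRetraction.exists_extension (Y := Y) (hS.inter_right (hcl δ)) (fun p hp => ⟨hp.1, hp.2.1.1⟩)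
    (fun z hz => (hst z hz.1 hz.2.1.1 (hpos δ z hδ hz.2)).exists_local_retraction
      (fun p => hcov p.2) hbs)
    (C := {p : X × W | ‖p.2‖ ≤ 3 * δ / 4}) (isClosed_le continuous_snd.norm continuous_const)
    (Set.disjoint_left.2 fun p hp hp' => by
      have h1 : δ ≤ ‖p.2‖ := hp.2.2
      have h2 : ‖p.2‖ ≤ 3 * δ / 4 := hp'
      linarith) h₁
  have hδ4 : 0 < δ / 4 := by linarith
  have hK' : S ∩ {p : X × W | (b p.2 = 0 ∧ 0 ≤ a p.2) ∧ δ / 4 ≤ ‖p.2‖} ⊆ O' := fun p hp => by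
    rcases le_total δ ‖p.2‖ with h1 | h1
    · exact hK₁ ⟨hp.1, hp.2.1, h1⟩
    · refine hO₁O' ⟨⟨hpos _ p hδ4 hp.2, ?_⟩, hp.1, hp.2.1.1⟩
      rw [mem_preimage, hip p hp.2.1.1 hp.2.1.2]
      exact hδΩ p hp.1 h1
  obtain ⟨ρ', Ω', hKΩ', hΩO', h'⟩ := exists_isLift (EG := EG) (I := J) (EF := EF) (S := S) (κ := κ)
    (D := fun c => {p : X × W | p.2 ∈ D c})
    (fun c => (hD c).preimage continuous_snd) (fun p => hcov p.2) hbs hdim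
    (hS.inter_right (hcl (δ / 4)))
    (fun z hz => hst z hz.1 hz.2.1.1 (hpos (δ / 4) z hδ4 hz.2)) hR' hK'
  refine ⟨R', ρ', Ω', h', fun p hp h1 h2 h3 => hKΩ' ⟨hp, ⟨h1, h2.le⟩, h3⟩,
    fun p hp hpΩ hpn hpρ => ?_⟩
  have hw : (ρ p).2 = p.2 := h.strat p hpΩ
  refine h'.unique p hp _ ⟨(h.mem p hpΩ).1, hpρ⟩ ?_ (congrArg b hw)
  have hp1 : p ∈ O' ∩ {p : X × W | ‖p.2‖ ≤ 3 * δ / 4} := ⟨hΩO' hp, hpn⟩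
  have hp2 : ρ p ∈ O' ∩ {p : X × W | ‖p.2‖ ≤ 3 * δ / 4} :=
    ⟨hΩO' hpρ, by rw [Set.mem_ofPred_eq, hw]; exact hpn⟩
  rw [hRC _ hp1, hRC _ hp2]
  rw [hOC] at hp1 hp2
  -- Both sides are lifts with the same data: `i` alters only the plane coordinate, on which `R`
  -- does not depend, and `ρ` preserves both `R` and the plane coordinate.
  change ρ (i (ρ p)) = ρ (i p)
  refine (h.unique (i p) hp1.1.2 _ (h.mem _ hp2.1.2) ?_ ?_).symm
  · rw [h.retr _ hp2.1.2]
    exact (hR _ _ (ρ p).2).trans ((h.retr p hpΩ).trans (hR p.1 p.2 _))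
  · refine (h.strat _ hp2.1.2).trans ?_
    change a (ρ p).2 • u = a p.2 • u
    rw [hw]

end Fan

end CubicObstruction

/-! ### Gluing the retractions near the vertex, the rays and the generic points -/

namespace CubicObstruction

open Set Filter Topology

section Fan

variable {E : Type*} [NormedAddCommGroup E] [NormedSpace ℝ E] {H : Type*} [TopologicalSpace H]
  {I : ModelWithCorners ℝ E H} {X : Type*} [TopologicalSpace X] [ChartedSpace H X]
  {W : Type*} [NormedAddCommGroup W] [NormedSpace ℝ W]
  {EF : Type*} [NormedAddCommGroup EF] [NormedSpace ℝ EF]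
  {EG : Type*} [NormedAddCommGroup EG] [NormedSpace ℝ EG] {C : Type*} {Λ : Type*}

/-- A lift is continuous across the sectors but smooth only within each; smoothness at a point is
therefore claimed only if one sector is a neighbourhood of it. -/
theorem IsLift.local_properties {M : Type*} [TopologicalSpace M] [ChartedSpace H M]
    {T : Type*} [NormedAddCommGroup T] [NormedSpace ℝ T]
    {S : Set M} {D : C → Set M} {κ : C → M → Submodule ℝ E} {t : M → T}
    {R : M → M} {ρ₀ ρ : M → M} {Ω B : Set M} (h : IsLift I EF EG S D κ t R ρ Ω)
    (hB : IsOpen B) (hBΩ : B ⊆ Ω) (heq : ∀ p ∈ B, ρ₀ p = ρ p) {p : M} (hp : p ∈ B) :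
    ContinuousAt ρ₀ p ∧ ρ₀ p ∈ S ∧ (p ∈ S → ρ₀ p = p) ∧
      ∀ c, D c ∈ 𝓝 p → ContMDiffAt I I ∞ ρ₀ p := by
  have he : ρ₀ =ᶠ[𝓝 p] ρ := by filter_upwards [hB.mem_nhds hp] with q hq using heq q hq
  refine ⟨(h.cont.continuousAt (h.isOpen.mem_nhds (hBΩ hp))).congr he.symm, ?_,
    fun hpS => ?_, fun c hc => ?_⟩
  · rw [heq p hp]; exact (h.mem p (hBΩ hp)).1
  · rw [heq p hp]; exact h.fix ⟨hpS, hBΩ hp⟩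
  · obtain ⟨σ, U, hU, hpU, hσ, hσρ⟩ := h.smooth p (hBΩ hp) c (mem_of_mem_nhds hc)
    refine (hσ.contMDiffAt (hU.mem_nhds hpU)).congr_of_eventuallyEq ?_
    filter_upwards [he, hU.mem_nhds hpU, hc] with q h1 h2 h3
    rw [h1, hσρ q h2 h3]

/-- The compact subset `S` of `X × W` is stratified by the vertex `0`, the rays `b k = 0 < a k`, and
their complement in `W`, and it is cut out transversally by equations on each of the sectors
`D c`. -/
structure IsFan (I : ModelWithCorners ℝ E H) (EF : Type*) [NormedAddCommGroup EF]
    [NormedSpace ℝ EF] (S : Set (X × W)) (D : C → Set W) (κ : C → X × W → Submodule ℝ (E × W))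
    (a b : Λ → W →L[ℝ] ℝ) (u : Λ → W) : Prop where
  compact : IsCompact S
  closed : ∀ c, IsClosed (D c)
  cover : ∀ w, ∃ c, w ∈ D c
  a_u : ∀ k, a k (u k) = 1
  b_u : ∀ k, b k (u k) = 0
  ray_eq : ∀ k w, b k w = 0 → 0 ≤ a k w → w = a k w • u k
  ray_ne : ∀ k l, k ≠ l → ∀ w, b k w = 0 → 0 < a k w → b l w = 0 → 0 ≤ a l w → False
  ray_mem : ∀ k, ∃ c, ∀ w, b k w = 0 → 0 < a k w → w ∈ D c
  open_mem : ∀ w, w ≠ 0 → (∀ k, b k w = 0 → ¬ 0 < a k w) → ∃ c, D c ∈ 𝓝 w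
  vertex : ∀ p ∈ S, p.2 = 0 →
    StratumPoint (I.prod 𝓘(ℝ, W)) EF S (fun c => {p | p.2 ∈ D c}) κ (fun p => p.2) p
  ray : ∀ k, ∀ p ∈ S, b k p.2 = 0 → 0 < a k p.2 →
    StratumPoint (I.prod 𝓘(ℝ, W)) EF S (fun c => {p | p.2 ∈ D c}) κ (fun p => b k p.2) p
  generic : ∀ p ∈ S, p.2 ≠ 0 → (∀ k, b k p.2 = 0 → ¬ 0 < a k p.2) →
    StratumPoint (I.prod 𝓘(ℝ, W)) EF S (fun c => {p | p.2 ∈ D c}) κ (fun _ => (0 : Fin 0 → ℝ)) p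

variable [I.Boundaryless] [IsManifold I ∞ X] [FiniteDimensional ℝ E] [FiniteDimensional ℝ EF]
  [FiniteDimensional ℝ EG] [FiniteDimensional ℝ W] [T2Space X] [LocallyCompactSpace X] [Finite C]
  [Finite Λ]

/-- A retraction of a neighbourhood of a fan onto the fan, with compatible charts. -/
theorem IsFan.exists_retraction {S : Set (X × W)} {D : C → Set W}
    {κ : C → X × W → Submodule ℝ (E × W)} {a b : Λ → W →L[ℝ] ℝ} {u : Λ → W}
    (h : IsFan I EF S D κ a b u)
    (hdim : Module.finrank ℝ EG + Module.finrank ℝ EF = Module.finrank ℝ (E × W)) :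
    ∃ (ρ : X × W → X × W) (U OV : Set (X × W)) (OR : Λ → Set (X × W)),
      IsOpen U ∧ S ⊆ U ∧ ContinuousOn ρ U ∧ (∀ p ∈ U, ρ p ∈ S) ∧ (∀ p ∈ S, ρ p = p) ∧
      IsOpen OV ∧ (∀ k, IsOpen (OR k)) ∧ (∀ p ∈ S, p.2 = 0 → p ∈ OV) ∧
      (∀ k, ∀ p ∈ S, b k p.2 = 0 → 0 < a k p.2 → p ∈ OV ∪ OR k) ∧
      (∀ p ∈ S, ∃ (G : X × W → EG) (O : Set (X × W)),
        AdaptedChart (I.prod 𝓘(ℝ, W)) EF S (fun c => {p | p.2 ∈ D c}) κ ρ U p G O) ∧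
      (∀ p ∈ S ∩ OV, ∃ (G : X × W → EG) (O : Set (X × W)),
        AdaptedChart (I.prod 𝓘(ℝ, W)) EF S (fun c => {p | p.2 ∈ D c}) κ ρ U p G O ∧
        ∃ L : EG →L[ℝ] W, ∀ q ∈ O, L (G q) = q.2) ∧
      (∀ k, ∀ p ∈ S ∩ OR k, ∃ (G : X × W → EG) (O : Set (X × W)),
        AdaptedChart (I.prod 𝓘(ℝ, W)) EF S (fun c => {p | p.2 ∈ D c}) κ ρ U p G O ∧
        ∃ L : EG →L[ℝ] ℝ, ∀ q ∈ O, L (G q) = b k q.2) := by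
  have : ProperSpace W := FiniteDimensional.proper ℝ W
  let J := I.prod 𝓘(ℝ, W)
  let D' : C → Set (X × W) := fun c => {p | p.2 ∈ D c}
  have hD' : ∀ c, IsClosed (D' c) := fun c => (h.closed c).preimage continuous_snd
  have hcov' : ∀ p, ∃ c, p ∈ D' c := fun p => h.cover p.2
  -- the lift near the vertex
  obtain ⟨RV, O', hRV, hVO', hRVx⟩ := exists_vertex_retraction (I := I) h.compact h.cover h.vertex
  have hKV : IsCompact (S ∩ {p : X × W | p.2 = 0}) :=
    h.compact.inter_right (isClosed_singleton.preimage continuous_snd)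
  obtain ⟨ρV, ΩV, hVΩ, -, hV⟩ := exists_isLift (EG := EG) (I := J) (EF := EF) (S := S) (κ := κ)
    (D := D') hD' hcov' contMDiff_snd hdim hKV (fun z hz => h.vertex z hz.1 hz.2) hRV hVO'
  -- The part of `S` outside the domain of the vertex lift is compact and misses the vertex, so the
  -- norm of its plane coordinate is bounded below.
  obtain ⟨δ, hδ, hδΩ⟩ : ∃ δ : ℝ, 0 < δ ∧ ∀ p ∈ S, ‖p.2‖ ≤ δ → p ∈ ΩV := by
    have hc : IsCompact (S \ ΩV) := h.compact.diff hV.isOpen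
    rcases (S \ ΩV).eq_empty_or_nonempty with he | hne
    · exact ⟨1, one_pos, fun p hp _ => by_contra fun hpΩ => he.subset ⟨hp, hpΩ⟩⟩
    · obtain ⟨q, hq, hqmin⟩ := hc.exists_isMinOn hne (f := fun p : X × W => ‖p.2‖)
        continuous_snd.norm.continuousOn
      have hq0 : 0 < ‖q.2‖ := norm_pos_iff.2 fun h0 => hq.2 (hVΩ ⟨hq.1, h0⟩)
      refine ⟨‖q.2‖ / 2, by linarith, fun p hp hpn => by_contra fun hpΩ => ?_⟩
      have := hqmin (show p ∈ S \ ΩV from ⟨hp, hpΩ⟩)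
      simp only [Set.mem_ofPred_eq] at this
      linarith
  -- the lifts near the rays
  choose cR hcR using h.ray_mem
  choose RR ρR ΩR hR hRΩ hRV using fun k => exists_ray_lift (I := I) h.compact h.closed h.cover hdim
    hV hRVx hδ hδΩ (h.a_u k) (h.b_u k) (h.ray_eq k) (hcR k) (h.ray k)
  let ray : Λ → Set W := fun k => {w | b k w = 0 ∧ 0 ≤ a k w}
  have hrayc : ∀ k, IsClosed (ray k) := fun k =>
    (isClosed_eq (b k).continuous continuous_const).inter
      (isClosed_le continuous_const (a k).continuous)
  have hray0 : ∀ k, (0 : W) ∈ ray k := fun k => by simp [ray]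
  -- Disjoint open neighbourhoods of the open rays: the points strictly nearer to one closed ray
  -- than to all the others.
  let Q : Λ → Set W := fun k =>
    {w | ∀ l, k ≠ l → Metric.infDist w (ray k) < Metric.infDist w (ray l)}
  have hQo : ∀ k, IsOpen (Q k) := fun k => by
    have : Q k = ⋂ l : {l // k ≠ l},
        {w | Metric.infDist w (ray k) < Metric.infDist w (ray l)} := by
      ext w; simp [Q]
    rw [this]
    exact isOpen_iInter_of_finite fun l => isOpen_lt (Metric.continuous_infDist_pt _)
      (Metric.continuous_infDist_pt _)
  have hQd : ∀ k l w, w ∈ Q k → w ∈ Q l → k = l := fun k l w hk hl => by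
    by_contra hkl
    exact lt_asymm (hk l hkl) (hl k (Ne.symm hkl))
  have hQr : ∀ k w, b k w = 0 → 0 < a k w → w ∈ Q k := fun k w h1 h2 l hkl => by
    rw [Metric.infDist_zero_of_mem (show w ∈ ray k from ⟨h1, h2.le⟩)]
    exact ((hrayc l).notMem_iff_infDist_pos ⟨0, hray0 l⟩).1 fun hl =>
      h.ray_ne k l hkl w h1 h2 hl.1 hl.2
  -- gluing the lifts
  let BV : Set (X × W) := ΩV ∩ {p | ‖p.2‖ < δ / 2}
  have hBV : IsOpen BV := hV.isOpen.inter (isOpen_lt continuous_snd.norm continuous_const)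
  -- The set on which the ray lift is known to equal the vertex lift. It reaches beyond `δ/2`, so it
  -- overlaps the region where the vertex lift is no longer used.
  let A : Λ → Set (X × W) := fun k => (ΩR k ∩ {p | ‖p.2‖ < 3 * δ / 4}) ∩ (ΩV ∩ ρV ⁻¹' ΩR k)
  have hA : ∀ k, IsOpen (A k) := fun k => ((hR k).isOpen.inter
    (isOpen_lt continuous_snd.norm continuous_const)).inter
    (hV.cont.isOpen_inter_preimage hV.isOpen (hR k).isOpen)
  -- The ray lift is admitted where it equals the vertex lift, or so far out that the vertex lift is
  -- not in use; different rays are kept apart by `Q`.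
  let B : Λ → Set (X × W) := fun k => ΩR k ∩ {p | p.2 ∈ Q k} ∩ (A k ∪ {p | δ / 2 < ‖p.2‖})
  have hB : ∀ k, IsOpen (B k) := fun k => ((hR k).isOpen.inter ((hQo k).preimage continuous_snd)).inter
    ((hA k).union (isOpen_lt continuous_const continuous_snd.norm))
  have hBA : ∀ k, ∀ p ∈ B k, p ∈ BV → ρR k p = ρV p := fun k p hp hpV => by
    rcases hp.2 with h1 | h1
    · exact hRV k p h1.1.1 h1.2.1 (le_of_lt h1.1.2) h1.2.2
    · exact absurd (show ‖p.2‖ < δ / 2 from hpV.2) (not_lt.2 (le_of_lt h1))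
  obtain ⟨ρ₀, hρV, hρR⟩ : ∃ ρ₀ : X × W → X × W, (∀ p ∈ BV, ρ₀ p = ρV p) ∧
      ∀ k, ∀ p ∈ B k, ρ₀ p = ρR k p := by
    have hex : ∀ p, ∃ q, (p ∈ BV → q = ρV p) ∧ ∀ k, p ∈ B k → q = ρR k p := fun p => by
      by_cases hp : p ∈ BV
      · exact ⟨ρV p, fun _ => rfl, fun k hk => (hBA k p hk hp).symm⟩
      · by_cases hk : ∃ k, p ∈ B k
        · obtain ⟨k, hk⟩ := hk
          refine ⟨ρR k p, fun h => absurd h hp, fun l hl => ?_⟩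
          rw [hQd k l p.2 hk.1.2 hl.1.2]
        · exact ⟨p, fun h => absurd h hp, fun k h => absurd ⟨k, h⟩ hk⟩
    choose ρ₀ h1 h2 using hex
    exact ⟨ρ₀, h1, fun k p => h2 p k⟩
  let BB : Set (X × W) := BV ∪ ⋃ k, B k
  have hBB : IsOpen BB := hBV.union (isOpen_iUnion hB)
  have hloc : ∀ p ∈ BB, ContinuousAt ρ₀ p ∧ ρ₀ p ∈ S ∧ (p ∈ S → ρ₀ p = p) ∧
      ∀ c, D' c ∈ 𝓝 p → ContMDiffAt J J ∞ ρ₀ p := by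
    rintro p (hp | hp)
    · exact hV.local_properties hBV inter_subset_left hρV hp
    · obtain ⟨k, hk⟩ := mem_iUnion.1 hp
      exact (hR k).local_properties (hB k) (fun q hq => hq.1.1) (hρR k) hk
  let Sing : Set (X × W) := {p | p.2 = 0} ∪ ⋃ k, {p | p.2 ∈ ray k}
  have hSing : IsClosed Sing := (isClosed_singleton.preimage continuous_snd).union
    (isClosed_iUnion_of_finite fun k => (hrayc k).preimage continuous_snd)
  have hSing' : ∀ p : X × W, p ∉ Sing → p.2 ≠ 0 ∧ ∀ k, b k p.2 = 0 → ¬ 0 < a k p.2 := fun p hp =>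
    ⟨fun h0 => hp (Or.inl h0), fun k h1 h2 => hp (Or.inr (mem_iUnion.2 ⟨k, h1, h2.le⟩))⟩
  have hrayB : ∀ k, ∀ p ∈ S, b k p.2 = 0 → 0 < a k p.2 → p ∈ BV ∪ B k := by
    intro k p hpS h1 h2
    rcases lt_or_ge ‖p.2‖ (δ / 2) with h3 | h3
    · exact Or.inl ⟨hδΩ p hpS (by linarith), h3⟩
    · have hpR : p ∈ ΩR k := hRΩ k p hpS h1 h2 (by linarith)
      refine Or.inr ⟨⟨hpR, hQr k _ h1 h2⟩, ?_⟩
      rcases h3.lt_or_eq with h3 | h3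
      · exact Or.inr h3
      · have hpV : p ∈ ΩV := hδΩ p hpS (by linarith)
        refine Or.inl ⟨⟨hpR, ?_⟩, hpV, ?_⟩
        · rw [Set.mem_ofPred_eq]; linarith
        · rw [mem_preimage, hV.fix ⟨hpS, hpV⟩]; exact hpR
  have hVB : ∀ p ∈ S, p.2 = 0 → p ∈ BV := fun p hp h0 =>
    ⟨hVΩ ⟨hp, h0⟩, by rw [Set.mem_ofPred_eq, h0, norm_zero]; linarith⟩
  have hSB : S ∩ Sing ⊆ BB := by
    rintro p ⟨hpS, hp⟩
    by_cases h0 : p.2 = 0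
    · exact Or.inl (hVB p hpS h0)
    · obtain ⟨k, h1, h2⟩ := mem_iUnion.1 (hp.resolve_left h0)
      refine (hrayB k p hpS h1 (lt_of_le_of_ne h2 fun h3 => h0 ?_)).imp id
        fun h => mem_iUnion.2 ⟨k, h⟩
      have := h.ray_eq k p.2 h1 h2
      rwa [← h3, zero_smul] at this
  -- On this compact neighbourhood of the singular part the glued lift will be kept. Off the
  -- singular part it is an honest smooth retraction, which can be extended over the rest of `S`
  -- without changing it on `L`.
  obtain ⟨L, hL, hSL, hLB⟩ := exists_compact_between (h.compact.inter_right hSing) hBB hSB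
  -- Generic points use the map to a zero-dimensional space as stratum function, so their stratum is
  -- all of `S`.
  have hS0 : S ∩ {_p : X × W | (0 : Fin 0 → ℝ) = 0} = S := by simp
  have h₁ : IsSmoothRetraction J S ρ₀ (BB \ Sing) := by
    refine ⟨hBB.sdiff hSing, fun p hp => ?_, fun p hp => (hloc p hp.1).2.1,
      fun p hp => (hloc p hp.1).2.2.1⟩
    obtain ⟨c, hc⟩ := h.open_mem p.2 (hSing' p hp.2).1 (hSing' p hp.2).2
    exact ((hloc p hp.1).2.2.2 c (continuous_snd.continuousAt.preimage_mem_nhds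
      hc)).contMDiffWithinAt
  have hst : ∀ z ∈ S \ Sing, StratumPoint J EF S D' κ (fun _ => (0 : Fin 0 → ℝ)) z := fun z hz =>
    h.generic z hz.1 (hSing' z hz.2).1 (hSing' z hz.2).2
  obtain ⟨R, O, hRr, hKO, hOO, hOL, hRL⟩ := IsSmoothRetraction.exists_extension
    (h.compact.diff hBB) sdiff_subset (fun z hz => by
      have := (hst z ⟨hz.1, fun h => hz.2 (hSB ⟨hz.1, h⟩)⟩).exists_local_retraction
        hcov' contMDiff_const
      rwa [hS0] at this) hL.isClosed (Set.disjoint_left.2 fun p hp hpL => hp.2 (hLB hpL)) h₁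
  classical
  let ρ : X × W → X × W := fun p => if p ∈ L then ρ₀ p else R p
  have hρL : ∀ p ∈ L, ρ p = ρ₀ p := fun p hp => if_pos hp
  have hρO : ∀ p ∈ O, ρ p = R p := fun p hp => by
    by_cases hpL : p ∈ L
    · rw [hρL p hpL, hRL p ⟨hp, hpL⟩]
    · exact if_neg hpL
  let U : Set (X × W) := interior L ∪ O
  have hSO : ∀ p ∈ S, p ∉ Sing → p ∈ O := fun p hp hps => by
    by_cases hpB : p ∈ BB
    · exact hOO ⟨⟨hpB, hps⟩, hp⟩
    · exact hKO ⟨hp, hpB⟩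
  have hSU : S ⊆ U := fun p hp => by
    by_cases hps : p ∈ Sing
    · exact Or.inl (hSL ⟨hp, hps⟩)
    · exact Or.inr (hSO p hp hps)
  have hρS : ∀ p ∈ S, ρ p = p := fun p hp => by
    rcases hSU hp with hp' | hp'
    · have := interior_subset hp'
      rw [hρL p this, (hloc p (hLB this)).2.2.1 hp]
    · rw [hρO p hp', hRr.fix p hp' hp]
  have hchV : ∀ p ∈ S ∩ (interior L ∩ BV), ∃ (G : X × W → EG) (O : Set (X × W)),
      AdaptedChart J EF S D' κ ρ U p G O ∧ ∃ L : EG →L[ℝ] W, ∀ q ∈ O, L (G q) = q.2 :=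
    fun p hp => hV.exists_adaptedChart (isOpen_interior.inter hBV)
      (inter_subset_left.trans subset_union_left) (fun q hq => hq.2.1)
      (fun q hq => (hρL q (interior_subset hq.1)).trans (hρV q hq.2)) hp.1 hp.2
  have hchR : ∀ k, ∀ p ∈ S ∩ (interior L ∩ B k), ∃ (G : X × W → EG) (O : Set (X × W)),
      AdaptedChart J EF S D' κ ρ U p G O ∧ ∃ L : EG →L[ℝ] ℝ, ∀ q ∈ O, L (G q) = b k q.2 :=
    fun k p hp => (hR k).exists_adaptedChart (isOpen_interior.inter (hB k))
      (inter_subset_left.trans subset_union_left) (fun q hq => hq.2.1.1)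
      (fun q hq => (hρL q (interior_subset hq.1)).trans (hρR k q hq.2)) hp.1 hp.2
  refine ⟨ρ, U, interior L ∩ BV, fun k => interior L ∩ B k, isOpen_interior.union hRr.isOpen, hSU,
    ?_, ?_, hρS, isOpen_interior.inter hBV, fun k => isOpen_interior.inter (hB k), fun p hp h0 =>
    ⟨hSL ⟨hp, Or.inl h0⟩, hVB p hp h0⟩, fun k p hp h1 h2 => ?_, fun p hp => ?_, hchV, hchR⟩
  · rintro p (hp | hp)
    · refine ((hloc p (hLB (interior_subset hp))).1.congr ?_).continuousWithinAt
      filter_upwards [isOpen_interior.mem_nhds hp] with q hq using (hρL q (interior_subset hq)).symm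
    · refine ((hRr.smooth.continuousOn.continuousAt (hRr.isOpen.mem_nhds hp)).congr
        ?_).continuousWithinAt
      filter_upwards [hRr.isOpen.mem_nhds hp] with q hq using (hρO q hq).symm
  · rintro p (hp | hp)
    · rw [hρL p (interior_subset hp)]
      exact (hloc p (hLB (interior_subset hp))).2.1
    · rw [hρO p hp]
      exact hRr.mem p hp
  · have hpL : p ∈ interior L := hSL ⟨hp, Or.inr (mem_iUnion.2 ⟨k, h1, h2.le⟩)⟩
    exact (hrayB k p hp h1 h2).imp (fun h => ⟨hpL, h⟩) fun h => ⟨hpL, h⟩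
  · by_cases hps : p ∈ Sing
    · have hpL := hSL ⟨hp, hps⟩
      rcases hSB ⟨hp, hps⟩ with hpB | hpB
      · obtain ⟨G, O, h1, -⟩ := hchV p ⟨hp, hpL, hpB⟩
        exact ⟨G, O, h1⟩
      · obtain ⟨k, hk⟩ := mem_iUnion.1 hpB
        obtain ⟨G, O, h1, -⟩ := hchR k p ⟨hp, hpL, hk⟩
        exact ⟨G, O, h1⟩
    · have hpO := hSO p hp hps
      obtain ⟨G, O₁, h1, h2, h3, -, -⟩ := (hst p ⟨hp, hps⟩).exists_projChart (EG := EG)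
        hD' hcov' contMDiff_const hdim (by rw [hS0]; exact hRr) hpO
      have hRp : R p = p := hRr.fix p hpO hp
      have hO₂ : IsOpen (O₁ ∩ R ⁻¹' O₁) :=
        (hRr.smooth.continuousOn.mono h2).isOpen_inter_preimage h1.isOpen h1.isOpen
      have hρR : ∀ q ∈ O₁, ρ q = R q := fun q hq => hρO q (h2 hq)
      refine ⟨G, O₁ ∩ R ⁻¹' O₁, h1.mono hO₂ ⟨h1.mem, ?_⟩ inter_subset_left,
        inter_subset_left.trans (h2.trans subset_union_right), fun q hq => ?_, fun q hq => ?_⟩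
      · rw [mem_preimage, hRp]; exact h1.mem
      · rw [hρR q hq.1]
        exact (h3 _ hq.2 _ hq.1).2 ⟨hRr.fix _ (h2 hq.2) (hRr.mem q (h2 hq.1)), rfl⟩
      · rw [hρR q hq.1]
        refine ⟨hq.2, ?_⟩
        rw [mem_preimage, hRr.fix _ (h2 hq.2) (hRr.mem q (h2 hq.1))]
        exact hq.2

end Fan

end CubicObstruction

namespace CubicObstruction

open Set Filter Topology

/-! ### The smooth structure on a space embedded with adapted charts -/

section SmoothStructure

variable {E : Type*} [NormedAddCommGroup E] [NormedSpace ℝ E] {H : Type*} [TopologicalSpace H]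
  {I : ModelWithCorners ℝ E H} {M : Type*} [TopologicalSpace M] [ChartedSpace H M]
  {EF : Type*} [NormedAddCommGroup EF] [NormedSpace ℝ EF]
  {EG : Type*} [NormedAddCommGroup EG] [NormedSpace ℝ EG] {C : Type*}
  {S : Set M} {D : C → Set M} {κ : C → M → Submodule ℝ E} {ρ : M → M} {U : Set M}

/-- The slice `F = 0` in the coordinates `(G, F)` of one sector is a smooth section of `G`. Outside
that sector its values need not lie in `S`; applying `ρ` corrects this without changing `G`. -/
theorem AdaptedChart.exists_section (hcov : ∀ p, ∃ c, p ∈ D c) {z : M} {G : M → EG} {O : Set M}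
    (h : AdaptedChart I EF S D κ ρ U z G O) {p : M} (hpS : p ∈ S) (hp : p ∈ O) :
    ∃ (s : EG → M) (V : Set EG), IsOpen V ∧ G p ∈ V ∧ ContMDiffOn 𝓘(ℝ, EG) I ∞ s V ∧
      s (G p) = p ∧ ∀ y ∈ V, s y ∈ O ∧ G (s y) = y := by
  obtain ⟨c, hc⟩ := hcov p
  obtain ⟨F, e, hOe, hee, hF, hei⟩ := h.proj.eqs c (h.proj.near p hp c hc)
  have hep : e p = (G p, 0) := by
    rw [hee p (hOe hp), (hF.mem_iff p (hOe hp) hc).1 hpS]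
  have hi : Continuous fun y : EG => (y, (0 : EF)) := by fun_prop
  have his : ContMDiff 𝓘(ℝ, EG) 𝓘(ℝ, EG × EF) ∞ fun y : EG => (y, (0 : EF)) :=
    ContDiff.contMDiff (by fun_prop)
  refine ⟨fun y => e.symm (y, 0), (fun y => (y, (0 : EF))) ⁻¹' (e.target ∩ e.symm ⁻¹' O),
    (e.isOpen_inter_preimage_symm h.proj.isOpen).preimage hi, ?_, hei.comp his.contMDiffOn
    fun y hy => hy.1, ?_, fun y hy => ⟨hy.2, ?_⟩⟩
  · rw [mem_preimage, ← hep]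
    exact ⟨e.map_source (hOe hp), by rw [mem_preimage, e.left_inv (hOe hp)]; exact hp⟩
  · change e.symm (G p, 0) = p
    rw [← hep, e.left_inv (hOe hp)]
  · have := (hee _ (e.map_target hy.1)).symm.trans (e.right_inv hy.1)
    exact congrArg Prod.fst this

variable {Z : Type*} [TopologicalSpace Z] {j : Z → M}

/-- The chart of `Z` induced by an adapted chart. -/
theorem AdaptedChart.exists_chart (hcov : ∀ p, ∃ c, p ∈ D c) (hj : IsEmbedding j)
    (hjS : range j = S) {r : M → Z} (hr : ContinuousOn r U) (hjr : ∀ p ∈ U, j (r p) = ρ p)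
    {z : Z} {G : M → EG} {O : Set M} (h : AdaptedChart I EF S D κ ρ U (j z) G O) :
    ∃ φ : OpenPartialHomeomorph Z EG, z ∈ φ.source ∧ (∀ z', φ z' = G (j z')) ∧
      (∀ z' ∈ φ.source, j z' ∈ O) := by
  have hS : ∀ z, j z ∈ S := fun z => hjS ▸ mem_range_self z
  obtain ⟨s, V, hV, hzV, hs, hsz, hsV⟩ := h.exists_section hcov (hS z) h.proj.mem
  have hjrs : ∀ y ∈ V, j (r (s y)) = ρ (s y) := fun y hy => hjr _ (h.subset (hsV y hy).1)
  have hGr : ∀ y ∈ V, G (j (r (s y))) = y := fun y hy => by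
    rw [hjrs y hy, h.compat _ (hsV y hy).1, (hsV y hy).2]
  have hGc : ContinuousOn (fun z' => G (j z')) (j ⁻¹' O) :=
    h.proj.smooth.continuousOn.comp hj.continuous.continuousOn fun _ h => h
  refine ⟨{ toFun := fun z' => G (j z')
            invFun := fun y => r (s y)
            source := j ⁻¹' O ∩ (fun z' => G (j z')) ⁻¹' V
            target := V
            map_source' := fun z' hz' => hz'.2
            map_target' := fun y hy => ⟨?_, ?_⟩
            left_inv' := fun z' hz' => ?_
            right_inv' := fun y hy => hGr y hy
            open_source := hGc.isOpen_inter_preimage (h.proj.isOpen.preimage hj.continuous) hV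
            open_target := hV
            continuousOn_toFun := hGc.mono inter_subset_left
            continuousOn_invFun := hr.comp hs.continuousOn fun y hy => h.subset (hsV y hy).1 },
    ⟨h.proj.mem, hzV⟩, fun _ => rfl, fun z' hz' => hz'.1⟩
  · rw [mem_preimage, hjrs y hy]; exact h.mem _ (hsV y hy).1
  · rw [mem_preimage, hGr y hy]; exact hy
  · refine hj.injective (h.proj.inj ⟨hS _, ?_⟩ ⟨hS _, hz'.1⟩ (hGr _ hz'.2))
    rw [hjrs _ hz'.2]; exact h.mem _ (hsV _ hz'.2).1

/-- The smooth structure on a space embedded in a manifold with adapted charts. -/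
theorem exists_smooth_structure [Nonempty Z] (hcov : ∀ p, ∃ c, p ∈ D c) (hj : IsEmbedding j)
    (hjS : range j = S) (hSU : S ⊆ U) (hρc : ContinuousOn ρ U)
    (hρS : ∀ p ∈ U, ρ p ∈ S) (hρ : ∀ p ∈ S, ρ p = p)
    (hch : ∀ p ∈ S, ∃ (G : M → EG) (O : Set M), AdaptedChart I EF S D κ ρ U p G O) :
    ∃ (_ : ChartedSpace EG Z) (_ : IsManifold 𝓘(ℝ, EG) ∞ Z) (r : M → Z) (U' : Set M),
      IsOpen U' ∧ S ⊆ U' ∧ ContMDiffOn I 𝓘(ℝ, EG) ∞ r U' ∧ (∀ z, r (j z) = z) ∧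
      (∀ (z : Z) (G : M → EG) (O : Set M), AdaptedChart I EF S D κ ρ U (j z) G O →
        ContMDiffOn 𝓘(ℝ, EG) 𝓘(ℝ, EG) ∞ (fun z' => G (j z')) (j ⁻¹' O)) ∧
      ∀ (z : Z) (G : M → EG) (O : Set M), AdaptedChart I EF S D κ ρ U (j z) G O →
        ∀ v, mder I 𝓘(ℝ, EG) r (j z) v = 0 → mder I 𝓘(ℝ, EG) G (j z) v = 0 := by
  have hS : ∀ z, j z ∈ S := fun z => hjS ▸ mem_range_self z
  have hex : ∀ p, ∃ q : Z, p ∈ U → j q = ρ p := fun p => by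
    by_cases hp : p ∈ U
    · have := hρS p hp
      rw [← hjS] at this
      obtain ⟨q, hq⟩ := this
      exact ⟨q, fun _ => hq⟩
    · exact ⟨Classical.arbitrary Z, fun h => absurd h hp⟩
  choose r hjr using hex
  have hrc : ContinuousOn r U := by
    rw [hj.continuousOn_iff]
    exact hρc.congr hjr
  have hrj : ∀ z, r (j z) = z := fun z => hj.injective ((hjr _ (hSU (hS z))).trans (hρ _ (hS z)))
  choose G O hGO using fun z => hch (j z) (hS z)
  choose φ hzφ hφ hφO using fun z => (hGO z).exists_chart hcov hj hjS hrc hjr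
  have hsym : ∀ z, ∀ y ∈ (φ z).target, ∃ (s : EG → M) (V : Set EG), IsOpen V ∧ y ∈ V ∧
      ContMDiffOn 𝓘(ℝ, EG) I ∞ s V ∧ s y = j ((φ z).symm y) ∧
      ∀ y' ∈ V, s y' ∈ O z ∧ (y' ∈ (φ z).target → j ((φ z).symm y') = ρ (s y')) := by
    intro z y hy
    have hp := hφO z _ ((φ z).map_target hy)
    obtain ⟨s, V, hV, hyV, hs, hsy, hsV⟩ := (hGO z).exists_section hcov (hS _) hp
    rw [← hφ, (φ z).right_inv hy] at hyV hsy
    refine ⟨s, V, hV, hyV, hs, hsy, fun y' hy' => ⟨(hsV y' hy').1, fun hy'' => ?_⟩⟩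
    refine (hGO z).proj.inj ⟨hS _, hφO z _ ((φ z).map_target hy'')⟩
      ⟨hρS _ ((hGO z).subset (hsV y' hy').1), (hGO z).mem _ (hsV y' hy').1⟩ ?_
    rw [(hGO z).compat _ (hsV y' hy').1, (hsV y' hy').2, ← hφ, (φ z).right_inv hy'']
  -- Seen in `M`, the inverse of a chart is `ρ` after a smooth section. Although `ρ` is not smooth,
  -- another adapted chart satisfies `G₁ ∘ ρ = G₁`, so the transition map is smooth.
  have key : ∀ z, ∀ y ∈ (φ z).target, ∀ (z₁ : Z) (G₁ : M → EG) (O₁ : Set M),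
      AdaptedChart I EF S D κ ρ U (j z₁) G₁ O₁ → j ((φ z).symm y) ∈ O₁ →
      ContDiffAt ℝ ∞ (fun y' => G₁ (j ((φ z).symm y'))) y := by
    intro z y hy z₁ G₁ O₁ h₁ hyO
    obtain ⟨s, V, hV, hyV, hs, hsy, hsV⟩ := hsym z y hy
    rw [← hsy] at hyO
    have hsm := ((h₁.proj.smooth.contMDiffAt (h₁.proj.isOpen.mem_nhds hyO)).comp y
      (hs.contMDiffAt (hV.mem_nhds hyV))).contDiffAt
    refine hsm.congr_of_eventuallyEq ?_
    filter_upwards [hV.mem_nhds hyV, (φ z).open_target.mem_nhds hy,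
      (hs.continuousOn.continuousAt (hV.mem_nhds hyV)).preimage_mem_nhds
        (h₁.proj.isOpen.mem_nhds hyO)] with y' h2 h3 h4
    rw [(hsV y' h2).2 h3, h₁.compat _ h4]
    rfl
  let cs : ChartedSpace EG Z :=
    { atlas := range φ
      chartAt := φ
      mem_chart_source := hzφ
      chart_mem_atlas := mem_range_self }
  have hman : IsManifold 𝓘(ℝ, EG) ∞ Z := by
    refine isManifold_of_contDiffOn 𝓘(ℝ, EG) ∞ Z ?_
    rintro _ _ ⟨z, rfl⟩ ⟨z₁, rfl⟩
    intro y hy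
    have hy' : y ∈ (φ z).target ∧ (φ z).symm y ∈ (φ z₁).source := by simpa using hy
    have := key z y hy'.1 z₁ (G z₁) (O z₁) (hGO z₁) (hφO z₁ _ hy'.2)
    refine (this.congr_of_eventuallyEq (Eventually.of_forall fun y' => ?_)).contDiffWithinAt
    exact hφ z₁ _
  have hchart : ∀ z : Z, chartAt EG z = φ z := fun _ => rfl
  have hGj : ∀ (z : Z) (G₁ : M → EG) (O₁ : Set M), AdaptedChart I EF S D κ ρ U (j z) G₁ O₁ →
      ContMDiffOn 𝓘(ℝ, EG) 𝓘(ℝ, EG) ∞ (fun z' => G₁ (j z')) (j ⁻¹' O₁) := by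
    intro z₁ G₁ O₁ h₁ z hz
    have hyt := (φ z).map_source (hzφ z)
    have h2 := key z _ hyt z₁ G₁ O₁ h₁ (by rw [(φ z).left_inv (hzφ z)]; exact hz)
    have h3 : ContMDiffAt 𝓘(ℝ, EG) 𝓘(ℝ, EG) ∞ (φ z) z :=
      contMDiffAt_of_mem_maximalAtlas (IsManifold.chart_mem_maximalAtlas z) (hzφ z)
    refine ((h2.contMDiffAt.comp z h3).congr_of_eventuallyEq ?_).contMDiffWithinAt
    filter_upwards [(φ z).open_source.mem_nhds (hzφ z)] with z' hz'
    simp only [Function.comp_apply, (φ z).left_inv hz']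
  have hrS : ∀ z, ContMDiffAt I 𝓘(ℝ, EG) ∞ r (j z) := by
    intro z
    rw [contMDiffAt_iff_target]
    refine ⟨(hrc.mono (hGO z).subset).continuousAt
      ((hGO z).proj.isOpen.mem_nhds (hGO z).proj.mem), ?_⟩
    refine ((hGO z).proj.smooth.contMDiffAt ((hGO z).proj.isOpen.mem_nhds
      (hGO z).proj.mem)).congr_of_eventuallyEq ?_
    filter_upwards [(hGO z).proj.isOpen.mem_nhds (hGO z).proj.mem] with q hq
    have h1 : extChartAt 𝓘(ℝ, EG) (r (j z)) (r q) = φ z (r q) := by rw [hrj z]; rfl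
    rw [Function.comp_apply, h1, hφ, hjr _ ((hGO z).subset hq), (hGO z).compat q hq]
  -- Locally `r` factors through `G₁`, since `G₁` determines the value of `ρ` by injectivity on `S`.
  -- This carries smoothness of `r` from the points of `S` to the points around them.
  have hfac : ∀ (z₁ : Z) (G₁ : M → EG) (O₁ : Set M), AdaptedChart I EF S D κ ρ U (j z₁) G₁ O₁ →
      ∀ q₀ ∈ O₁, ∃ s : EG → M, ContMDiffAt 𝓘(ℝ, EG) I ∞ s (G₁ q₀) ∧ s (G₁ q₀) = j (r q₀) ∧
        ∀ᶠ q in 𝓝 q₀, r q = r (s (G₁ q)) := by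
    intro z₁ G₁ O₁ h₁ q₀ hq₀
    have hρq := h₁.mem q₀ hq₀
    have hjq := hjr q₀ (h₁.subset hq₀)
    obtain ⟨s, V, hV, hyV, hs, hsy, hsV⟩ := h₁.exists_section hcov (hρS _ (h₁.subset hq₀)) hρq
    rw [h₁.compat q₀ hq₀] at hyV hsy
    refine ⟨s, hs.contMDiffAt (hV.mem_nhds hyV), hsy.trans hjq.symm, ?_⟩
    filter_upwards [h₁.proj.isOpen.mem_nhds hq₀,
      (h₁.proj.smooth.continuousOn.continuousAt (h₁.proj.isOpen.mem_nhds hq₀)).preimage_mem_nhds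
        (hV.mem_nhds hyV)] with q hq hqV
    have h3 := hsV _ hqV
    refine hj.injective ?_
    rw [hjr q (h₁.subset hq), hjr _ (h₁.subset h3.1)]
    refine h₁.proj.inj ⟨hρS _ (h₁.subset hq), h₁.mem q hq⟩
      ⟨hρS _ (h₁.subset h3.1), h₁.mem _ h3.1⟩ ?_
    rw [h₁.compat q hq, h₁.compat _ h3.1, h3.2]
  refine ⟨cs, hman, r, ⋃ z, O z, isOpen_iUnion fun z => (hGO z).proj.isOpen, fun p hp => ?_,
    fun q₀ hq₀ => ?_, hrj, hGj, fun z₁ G₁ O₁ h₁ v hv => ?_⟩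
  · rw [← hjS] at hp
    obtain ⟨z, rfl⟩ := hp
    exact mem_iUnion.2 ⟨z, (hGO z).proj.mem⟩
  · obtain ⟨z, hz⟩ := mem_iUnion.1 hq₀
    obtain ⟨s, hs, hsq, hsr⟩ := hfac z _ _ (hGO z) q₀ hz
    have h1 := (hGO z).proj.smooth.contMDiffAt ((hGO z).proj.isOpen.mem_nhds hz)
    have h2 : ContMDiffAt I 𝓘(ℝ, EG) ∞ r (s (G z q₀)) := by rw [hsq]; exact hrS _
    exact ((h2.comp q₀ (hs.comp q₀ h1)).congr_of_eventuallyEq hsr).contMDiffWithinAt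
  · have h2 : MDifferentiableAt I 𝓘(ℝ, EG) r (j z₁) := (hrS z₁).mdifferentiableAt (by simp)
    have h3 : MDifferentiableAt 𝓘(ℝ, EG) 𝓘(ℝ, EG) (fun z' => G₁ (j z')) (r (j z₁)) := by
      rw [hrj]
      exact mdifferentiableAt_of_contMDiffOn (hGj z₁ G₁ O₁ h₁)
        (h₁.proj.isOpen.preimage hj.continuous) h₁.proj.mem
    -- Near `j z₁` the chart is `(G₁ ∘ j) ∘ r`, so its differential vanishes on the kernel of `dr`.
    have h4 := mder_comp (I := I) (I'' := 𝓘(ℝ, EG)) h3 h2 v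
    rw [hv, map_zero] at h4
    rw [← h4]
    refine DFunLike.congr_fun (mder_congr ?_) v
    filter_upwards [h₁.proj.isOpen.mem_nhds h₁.proj.mem] with q hq
    rw [hjr q (h₁.subset hq), h₁.compat q hq]

end SmoothStructure

end CubicObstruction

namespace CubicObstruction

open Set Filter Topology

/-! ### The sectors of the parameter plane -/

section Sectors

/-- Three linear coordinates of the plane, with sum zero. -/
noncomputable def yc : Fin 3 → (ℝ × ℝ) →L[ℝ] ℝ
  | 0 => ContinuousLinearMap.fst ℝ ℝ ℝ
  | 1 => ContinuousLinearMap.snd ℝ ℝ ℝ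
  | 2 => -(ContinuousLinearMap.fst ℝ ℝ ℝ + ContinuousLinearMap.snd ℝ ℝ ℝ)

theorem fin_add_three (h : Fin 3) : h + 1 + 1 + 1 = h := by fin_cases h <;> rfl

theorem yc_sum (h : Fin 3) (w : ℝ × ℝ) : yc h w + yc (h + 1) w + yc (h + 1 + 1) w = 0 := by
  fin_cases h
  · change w.1 + w.2 + -(w.1 + w.2) = 0; ring
  · change w.2 + -(w.1 + w.2) + w.1 = 0; ring
  · change -(w.1 + w.2) + w.1 + w.2 = 0; ring

theorem eq_zero_of_yc {h : Fin 3} {w : ℝ × ℝ} (h0 : yc h w = 0) (h1 : yc (h + 1 + 1) w = 0) :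
    w = 0 := by
  have h2 := yc_sum h w
  rw [h0, h1] at h2
  fin_cases h
  · exact Prod.ext h0 (by simpa using h2 : yc 1 w = 0)
  · exact Prod.ext h1 h0
  · exact Prod.ext (by simpa using h2 : yc 0 w = 0) h1

/-- The parameters `(s, t)` of a piece, as functions on the plane. -/
noncomputable def paramMap : Piece → (ℝ × ℝ) →L[ℝ] ℝ × ℝ
  | .W h => (yc (h + 1)).prod (yc (h + 1 + 1))
  | .X₁ h => (-yc h).prod (-yc (h + 1 + 1))
  | .X₂ h => (-yc h).prod (-yc (h + 1 + 1))

theorem paramMap_injective (c : Piece) : Function.Injective (paramMap c) := by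
  refine (injective_iff_map_eq_zero _).2 fun w hw => ?_
  rcases c with h | h | h
  · have h1 : yc (h + 1) w = 0 := congrArg Prod.fst hw
    have h2 : yc (h + 1 + 1) w = 0 := congrArg Prod.snd hw
    exact eq_zero_of_yc (h := h) (by linarith [yc_sum h w]) h2
  · exact eq_zero_of_yc (neg_eq_zero.1 (congrArg Prod.fst hw)) (neg_eq_zero.1 (congrArg Prod.snd hw))
  · exact eq_zero_of_yc (neg_eq_zero.1 (congrArg Prod.fst hw)) (neg_eq_zero.1 (congrArg Prod.snd hw))

/-- The parameters of a piece as linear coordinates of the plane. -/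
noncomputable def sec (c : Piece) : (ℝ × ℝ) ≃L[ℝ] ℝ × ℝ :=
  (LinearEquiv.ofInjectiveEndo (paramMap c).toLinearMap
    (paramMap_injective c)).toContinuousLinearEquiv

/-- The linear functions which are nonnegative on the cone spanned by the region of a piece. -/
noncomputable def wall : Piece → Bool → (ℝ × ℝ) →L[ℝ] ℝ
  | .W _, false => ContinuousLinearMap.fst ℝ ℝ ℝ
  | .W _, true => ContinuousLinearMap.snd ℝ ℝ ℝ
  | .X₁ _, false => ContinuousLinearMap.fst ℝ ℝ ℝ
  | .X₁ _, true => ContinuousLinearMap.snd ℝ ℝ ℝ - ContinuousLinearMap.fst ℝ ℝ ℝ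
  | .X₂ _, false => ContinuousLinearMap.snd ℝ ℝ ℝ
  | .X₂ _, true => ContinuousLinearMap.fst ℝ ℝ ℝ - ContinuousLinearMap.snd ℝ ℝ ℝ

theorem wall_nonneg {c : Piece} {σ : ℝ × ℝ} (hσ : σ ∈ c.region) (i : Bool) : 0 ≤ wall c i σ := by
  rcases c with h | h | h <;> cases i
  · exact hσ.1.1
  · exact hσ.2.1
  · exact hσ.1
  · exact sub_nonneg.2 hσ.2.1
  · exact hσ.1
  · exact sub_nonneg.2 hσ.2.1

theorem mem_region_iff {c : Piece} {σ : ℝ × ℝ} (h1 : σ.1 ≤ 1) (h2 : σ.2 ≤ 1) :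
    σ ∈ c.region ↔ ∀ i, 0 ≤ wall c i σ := by
  refine ⟨wall_nonneg, fun h => ?_⟩
  have h3 := h false
  have h4 := h true
  rcases c with k | k | k
  · exact ⟨⟨h3, h1⟩, h4, h2⟩
  · exact ⟨h3, sub_nonneg.1 h4, h2⟩
  · exact ⟨h3, sub_nonneg.1 h4, h1⟩

theorem region_le_one {c : Piece} {σ : ℝ × ℝ} (hσ : σ ∈ c.region) : σ.1 ≤ 1 ∧ σ.2 ≤ 1 := by
  rcases c with h | h | h
  · exact ⟨hσ.1.2, hσ.2.2⟩
  · exact ⟨hσ.2.1.trans hσ.2.2, hσ.2.2⟩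
  · exact ⟨hσ.2.2, hσ.2.1.trans hσ.2.2⟩

theorem region_nonneg {c : Piece} {σ : ℝ × ℝ} (hσ : ∀ i, 0 ≤ wall c i σ) : 0 ≤ σ.1 ∧ 0 ≤ σ.2 := by
  have h3 := hσ false
  have h4 := hσ true
  rcases c with k | k | k
  · exact ⟨h3, h4⟩
  · exact ⟨h3, le_trans (show (0 : ℝ) ≤ σ.1 from h3) (sub_nonneg.1 h4)⟩
  · exact ⟨le_trans (show (0 : ℝ) ≤ σ.2 from h3) (sub_nonneg.1 h4), h3⟩

theorem wall_injective (c : Piece) {σ : ℝ × ℝ} (hσ : ∀ i, wall c i σ = 0) : σ = 0 := by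
  have h3 := hσ false
  have h4 := hσ true
  rcases c with k | k | k
  · exact Prod.ext h3 h4
  · change σ.1 = 0 at h3
    change σ.2 - σ.1 = 0 at h4
    exact Prod.ext h3 (by simp; linarith)
  · change σ.2 = 0 at h3
    change σ.1 - σ.2 = 0 at h4
    exact Prod.ext (by simp; linarith) h3

theorem exists_wall_ne_zero (c : Piece) (i : Bool) : ∃ σ, wall c i σ ≠ 0 := by
  rcases c with k | k | k <;> cases i
  · exact ⟨(1, 0), one_ne_zero⟩
  · exact ⟨(0, 1), one_ne_zero⟩
  · exact ⟨(1, 0), one_ne_zero⟩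
  · exact ⟨(0, 1), by change (1 : ℝ) - 0 ≠ 0; norm_num⟩
  · exact ⟨(0, 1), one_ne_zero⟩
  · exact ⟨(1, 0), by change (1 : ℝ) - 0 ≠ 0; norm_num⟩

/-- The sector of the plane in which the piece `c` is placed. -/
def sector (c : Piece) : Set (ℝ × ℝ) := {w | ∀ i, 0 ≤ wall c i (sec c w)}

theorem isClosed_sector (c : Piece) : IsClosed (sector c) := by
  have : sector c = ⋂ i, {w | 0 ≤ wall c i (sec c w)} := by ext; simp [sector]
  rw [this]
  exact isClosed_iInter fun i => isClosed_le continuous_const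
    ((wall c i).continuous.comp (sec c).continuous)

/-- Two sectors meet along an edge. -/
inductive EdgeAt : Piece → Piece → ℝ × ℝ → Prop
  | edge_t (h : Fin 3) (w : ℝ × ℝ) (h0 : yc (h + 1 + 1) w = 0) : EdgeAt (.W h) (.X₂ h) w
  | edge_s (h : Fin 3) (w : ℝ × ℝ) (h0 : yc (h + 1) w = 0) : EdgeAt (.W h) (.X₁ (h + 1)) w
  | edge_st (h : Fin 3) (w : ℝ × ℝ) (h0 : yc h w = yc (h + 1 + 1) w) : EdgeAt (.X₁ h) (.X₂ h) w

theorem mem_sector_W {h : Fin 3} {w : ℝ × ℝ} :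
    w ∈ sector (.W h) ↔ 0 ≤ yc (h + 1) w ∧ 0 ≤ yc (h + 1 + 1) w :=
  ⟨fun H => ⟨H false, H true⟩, fun H => by rintro (_ | _); exacts [H.1, H.2]⟩

theorem mem_sector_X₁ {h : Fin 3} {w : ℝ × ℝ} :
    w ∈ sector (.X₁ h) ↔ yc h w ≤ 0 ∧ yc (h + 1 + 1) w ≤ yc h w := by
  have h1 : wall (.X₁ h) false (sec (.X₁ h) w) = -yc h w := rfl
  have h2 : wall (.X₁ h) true (sec (.X₁ h) w) = -yc (h + 1 + 1) w - -yc h w := rfl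
  refine ⟨fun H => ?_, fun H => ?_⟩
  · have h3 := H false
    have h4 := H true
    rw [h1] at h3; rw [h2] at h4
    constructor <;> linarith
  · rintro (_ | _)
    · rw [h1]; linarith [H.1]
    · rw [h2]; linarith [H.2]

theorem mem_sector_X₂ {h : Fin 3} {w : ℝ × ℝ} :
    w ∈ sector (.X₂ h) ↔ yc (h + 1 + 1) w ≤ 0 ∧ yc h w ≤ yc (h + 1 + 1) w := by
  have h1 : wall (.X₂ h) false (sec (.X₂ h) w) = -yc (h + 1 + 1) w := rfl
  have h2 : wall (.X₂ h) true (sec (.X₂ h) w) = -yc h w - -yc (h + 1 + 1) w := rfl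
  refine ⟨fun H => ?_, fun H => ?_⟩
  · have h3 := H false
    have h4 := H true
    rw [h1] at h3; rw [h2] at h4
    constructor <;> linarith
  · rintro (_ | _)
    · rw [h1]; linarith [H.1]
    · rw [h2]; linarith [H.2]

theorem fin_three_cases (h k : Fin 3) : k = h ∨ k = h + 1 ∨ k = h + 1 + 1 := by
  fin_cases h <;> fin_cases k <;> simp

theorem sector_cover (w : ℝ × ℝ) : ∃ c, w ∈ sector c := by
  have h0 := yc_sum 0 w
  simp only [zero_add, show (1 : Fin 3) + 1 = 2 from rfl] at h0
  -- Two of the three coordinates have a common weak sign, and any two indices are cyclically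
  -- adjacent. Two nonnegative coordinates give a sector of type `W`; for two nonpositive ones their
  -- comparison decides between `X₁` and `X₂`.
  have key : ∀ h : Fin 3, yc h w ≤ 0 → yc (h + 1 + 1) w ≤ 0 → ∃ c, w ∈ sector c := by
    intro h h1 h2
    rcases le_total (yc h w) (yc (h + 1 + 1) w) with h3 | h3
    · exact ⟨.X₂ h, mem_sector_X₂.2 ⟨h2, h3⟩⟩
    · exact ⟨.X₁ h, mem_sector_X₁.2 ⟨h1, h3⟩⟩
  rcases le_total 0 (yc 0 w) with a | a <;> rcases le_total 0 (yc 1 w) with b | b <;>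
    rcases le_total 0 (yc 2 w) with c | c
  · exact ⟨.W 0, mem_sector_W.2 ⟨b, c⟩⟩
  · exact ⟨.W 2, mem_sector_W.2 ⟨a, b⟩⟩
  · exact ⟨.W 1, mem_sector_W.2 ⟨c, a⟩⟩
  · exact key 2 c b
  · exact ⟨.W 0, mem_sector_W.2 ⟨b, c⟩⟩
  · exact key 0 a c
  · exact key 1 b a
  · exact key 0 a c

/-- Distinct sectors meet in an edge or in the origin. -/
theorem edgeAt_of_mem_sector {c c' : Piece} {w : ℝ × ℝ} (hc : w ∈ sector c) (hc' : w ∈ sector c') :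
    c = c' ∨ w = 0 ∨ EdgeAt c c' w ∨ EdgeAt c' c w := by
  -- Two pairs of indices out of three share an index, and the coordinate with a shared index must
  -- vanish. If the pairs coincide, both coordinates vanish and `w = 0`.
  have WX : ∀ h k, ∀ w, w ∈ sector (.W h) → (yc k w ≤ 0 ∧ yc (k + 1 + 1) w ≤ 0) →
      w = 0 ∨ (k = h ∧ yc (h + 1 + 1) w = 0) ∨ (k = h + 1 ∧ yc (h + 1) w = 0) := by
    intro h k w hw hk
    obtain ⟨h1, h2⟩ := mem_sector_W.1 hw
    have h3 := yc_sum h w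
    rcases fin_three_cases h k with rfl | rfl | rfl
    · exact Or.inr (Or.inl ⟨rfl, le_antisymm hk.2 h2⟩)
    · exact Or.inr (Or.inr ⟨rfl, le_antisymm hk.1 h1⟩)
    · rw [show h + 1 + 1 + 1 + 1 = h + 1 by rw [fin_add_three]] at hk
      have h4 := le_antisymm hk.1 h2
      have h5 := le_antisymm hk.2 h1
      exact Or.inl (eq_zero_of_yc (h := h) (by linarith) h4)
  have XX : ∀ h k, ∀ w, (yc h w ≤ 0 ∧ yc (h + 1 + 1) w ≤ 0) →
      (yc k w ≤ 0 ∧ yc (k + 1 + 1) w ≤ 0) → h = k ∨ w = 0 := by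
    intro h k w hh hk
    have h3 := yc_sum h w
    rcases fin_three_cases h k with rfl | rfl | rfl
    · exact Or.inl rfl
    · exact Or.inr (eq_zero_of_yc (h := h) (by linarith [hk.1]) (by linarith [hk.1]))
    · rw [show h + 1 + 1 + 1 + 1 = h + 1 by rw [fin_add_three]] at hk
      exact Or.inr (eq_zero_of_yc (h := h) (by linarith [hk.2]) (by linarith [hk.2]))
  have X1 : ∀ h w, w ∈ sector (.X₁ h) → (yc h w ≤ 0 ∧ yc (h + 1 + 1) w ≤ 0) := fun h w hw =>
    ⟨(mem_sector_X₁.1 hw).1, (mem_sector_X₁.1 hw).2.trans (mem_sector_X₁.1 hw).1⟩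
  have X2 : ∀ h w, w ∈ sector (.X₂ h) → (yc h w ≤ 0 ∧ yc (h + 1 + 1) w ≤ 0) := fun h w hw =>
    ⟨(mem_sector_X₂.1 hw).2.trans (mem_sector_X₂.1 hw).1, (mem_sector_X₂.1 hw).1⟩
  have W1 : ∀ h k, w ∈ sector (.W h) → w ∈ sector (.X₁ k) → w = 0 ∨ EdgeAt (.W h) (.X₁ k) w := by
    intro h k hc hc'
    rcases WX h k w hc (X1 k w hc') with h1 | ⟨rfl, h1⟩ | ⟨rfl, h1⟩
    · exact Or.inl h1
    · refine Or.inl (eq_zero_of_yc (h := k) (le_antisymm (X1 k w hc').1 ?_) h1)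
      rw [← h1]; exact (mem_sector_X₁.1 hc').2
    · exact Or.inr (.edge_s h w h1)
  have W2 : ∀ h k, w ∈ sector (.W h) → w ∈ sector (.X₂ k) → w = 0 ∨ EdgeAt (.W h) (.X₂ k) w := by
    intro h k hc hc'
    rcases WX h k w hc (X2 k w hc') with h1 | ⟨rfl, h1⟩ | ⟨rfl, h1⟩
    · exact Or.inl h1
    · exact Or.inr (.edge_t k w h1)
    · refine Or.inl (eq_zero_of_yc (h := h + 1) h1 (le_antisymm (X2 (h + 1) w hc').2 ?_))
      rw [← h1]; exact (mem_sector_X₂.1 hc').2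
  have X12 : ∀ h k, w ∈ sector (.X₁ h) → w ∈ sector (.X₂ k) → w = 0 ∨ EdgeAt (.X₁ h) (.X₂ k) w := by
    intro h k hc hc'
    rcases XX h k w (X1 h w hc) (X2 k w hc') with rfl | h1
    · exact Or.inr (.edge_st h w (le_antisymm (mem_sector_X₂.1 hc').2 (mem_sector_X₁.1 hc).2))
    · exact Or.inl h1
  rcases c with h | h | h <;> rcases c' with k | k | k
  · obtain ⟨h1, h2⟩ := mem_sector_W.1 hc
    obtain ⟨k1, k2⟩ := mem_sector_W.1 hc'
    have h3 := yc_sum h w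
    rcases fin_three_cases h k with rfl | rfl | rfl
    · exact Or.inl rfl
    · rw [fin_add_three] at k2
      exact Or.inr (Or.inl (eq_zero_of_yc (h := h) (by linarith) (by linarith)))
    · rw [fin_add_three] at k1
      exact Or.inr (Or.inl (eq_zero_of_yc (h := h) (by linarith) (by linarith)))
  · exact Or.inr ((W1 h k hc hc').imp id Or.inl)
  · exact Or.inr ((W2 h k hc hc').imp id Or.inl)
  · exact Or.inr ((W1 k h hc' hc).imp id Or.inr)
  · exact (XX h k w (X1 h w hc) (X1 k w hc')).imp (congrArg _) Or.inl
  · exact Or.inr ((X12 h k hc hc').imp id Or.inl)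
  · exact Or.inr ((W2 k h hc' hc).imp id Or.inr)
  · exact Or.inr ((X12 k h hc' hc).imp id Or.inr)
  · exact (XX h k w (X2 h w hc) (X2 k w hc')).imp (congrArg _) Or.inl

/-- On a common edge, the parameters of two pieces agree. -/
theorem EdgeAt.sec_eq {c c' : Piece} {w : ℝ × ℝ} (h : EdgeAt c c' w) : sec c w = sec c' w := by
  rcases h with ⟨h, _, h0⟩ | ⟨h, _, h0⟩ | ⟨h, _, h0⟩
  · exact Prod.ext (show yc (h + 1) w = -yc h w by linarith [yc_sum h w])
      (show yc (h + 1 + 1) w = -yc (h + 1 + 1) w by linarith)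
  · refine Prod.ext (show yc (h + 1) w = -yc (h + 1) w by linarith)
      (show yc (h + 1 + 1) w = -yc (h + 1 + 1 + 1) w from ?_)
    rw [fin_add_three]; linarith [yc_sum h w]
  · rfl

theorem EdgeAt.wall_eq_zero {c c' : Piece} {w : ℝ × ℝ} (h : EdgeAt c c' w) :
    (∃ i, wall c i (sec c w) = 0) ∧ ∃ i, wall c' i (sec c' w) = 0 := by
  rcases h with ⟨h, _, h0⟩ | ⟨h, _, h0⟩ | ⟨h, _, h0⟩
  · exact ⟨⟨true, h0⟩, false, show -yc (h + 1 + 1) w = 0 by rw [h0, neg_zero]⟩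
  · exact ⟨⟨false, h0⟩, false, show -yc (h + 1) w = 0 by rw [h0, neg_zero]⟩
  · exact ⟨⟨true, show -yc (h + 1 + 1) w - -yc h w = 0 by rw [h0, sub_self]⟩, true,
      show -yc h w - -yc (h + 1 + 1) w = 0 by rw [h0, sub_self]⟩

/-! ### The rays -/

/-- The function vanishing on the ray with label `k`. -/
noncomputable def rayEq : Piece → (ℝ × ℝ) →L[ℝ] ℝ
  | .W h => yc (h + 1 + 1)
  | .X₁ h => yc h
  | .X₂ h => yc h - yc (h + 1 + 1)

/-- The function which is positive on the ray with label `k`. -/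
noncomputable def rayPos : Piece → (ℝ × ℝ) →L[ℝ] ℝ
  | .W h => yc (h + 1)
  | .X₁ h => yc (h + 1)
  | .X₂ h => yc (h + 1)

theorem ray_injective (k : Piece) {w : ℝ × ℝ} (ha : rayPos k w = 0) (hb : rayEq k w = 0) :
    w = 0 := by
  rcases k with h | h | h
  · change yc (h + 1) w = 0 at ha
    change yc (h + 1 + 1) w = 0 at hb
    exact eq_zero_of_yc (h := h) (by linarith [yc_sum h w]) hb
  · change yc (h + 1) w = 0 at ha
    change yc h w = 0 at hb
    exact eq_zero_of_yc (h := h) hb (by linarith [yc_sum h w])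
  · change yc (h + 1) w = 0 at ha
    change yc h w - yc (h + 1 + 1) w = 0 at hb
    exact eq_zero_of_yc (h := h) (by linarith [yc_sum h w]) (by linarith [yc_sum h w])

theorem exists_ray_vector (k : Piece) : ∃ u, rayPos k u = 1 ∧ rayEq k u = 0 := by
  let f : (ℝ × ℝ) →ₗ[ℝ] ℝ × ℝ := ((rayPos k).prod (rayEq k)).toLinearMap
  have hf : Function.Injective f := (injective_iff_map_eq_zero f).2 fun w hw =>
    ray_injective k (congrArg Prod.fst hw) (congrArg Prod.snd hw)
  obtain ⟨u, hu⟩ := LinearMap.surjective_of_injective hf (1, 0)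
  exact ⟨u, congrArg Prod.fst hu, congrArg Prod.snd hu⟩

/-- Each ray is the edge of two distinct sectors. -/
theorem exists_ray_sectors (k : Piece) : ∃ c c', c ≠ c' ∧ ∀ w, rayEq k w = 0 → 0 < rayPos k w →
    w ∈ sector c ∧ w ∈ sector c' := by
  rcases k with h | h | h
  · refine ⟨.W h, .X₂ h, nofun, fun w h1 h2 => ?_⟩
    change yc (h + 1 + 1) w = 0 at h1
    change 0 < yc (h + 1) w at h2
    have := yc_sum h w
    exact ⟨mem_sector_W.2 ⟨h2.le, h1.ge⟩, mem_sector_X₂.2 ⟨h1.le, by linarith⟩⟩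
  · refine ⟨.W (h + 1 + 1), .X₁ h, nofun, fun w h1 h2 => ?_⟩
    change yc h w = 0 at h1
    change 0 < yc (h + 1) w at h2
    have := yc_sum h w
    refine ⟨mem_sector_W.2 ?_, mem_sector_X₁.2 ⟨h1.le, by linarith⟩⟩
    rw [fin_add_three]
    exact ⟨h1.ge, h2.le⟩
  · refine ⟨.X₁ h, .X₂ h, nofun, fun w h1 h2 => ?_⟩
    change yc h w - yc (h + 1 + 1) w = 0 at h1
    change 0 < yc (h + 1) w at h2
    have := yc_sum h w
    exact ⟨mem_sector_X₁.2 ⟨by linarith, by linarith⟩, mem_sector_X₂.2 ⟨by linarith, by linarith⟩⟩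

/-- The edges of the sectors are the rays. -/
theorem EdgeAt.exists_ray {c c' : Piece} {w : ℝ × ℝ} (h : EdgeAt c c' w) (hc : w ∈ sector c)
    (hc' : w ∈ sector c') (hw : w ≠ 0) : ∃ k, rayEq k w = 0 ∧ 0 < rayPos k w := by
  rcases h with ⟨h, _, h0⟩ | ⟨h, _, h0⟩ | ⟨h, _, h0⟩
  · obtain ⟨h1, -⟩ := mem_sector_W.1 hc
    exact ⟨.W h, h0, lt_of_le_of_ne h1 fun h2 => hw (ray_injective (.W h) h2.symm h0)⟩
  · obtain ⟨-, h1⟩ := mem_sector_W.1 hc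
    exact ⟨.X₁ (h + 1), h0, lt_of_le_of_ne h1 fun h2 => hw (ray_injective (.X₁ (h + 1)) h2.symm h0)⟩
  · obtain ⟨h1, h2⟩ := mem_sector_X₁.1 hc
    have h3 : rayEq (.X₂ h) w = 0 := sub_eq_zero.2 h0
    exact ⟨.X₂ h, h3, lt_of_le_of_ne (show 0 ≤ yc (h + 1) w by linarith [yc_sum h w])
      fun h4 => hw (ray_injective (.X₂ h) h4.symm h3)⟩

theorem ray_eq_smul {k : Piece} {u w : ℝ × ℝ} (hu : rayPos k u = 1 ∧ rayEq k u = 0)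
    (hw : rayEq k w = 0) : w = rayPos k w • u := by
  rw [← sub_eq_zero]
  refine ray_injective k ?_ ?_
  · rw [map_sub, map_smul, hu.1, smul_eq_mul, mul_one, sub_self]
  · rw [map_sub, map_smul, hu.2, hw, smul_zero, sub_self]

theorem ray_disjoint {k l : Piece} (hkl : k ≠ l) {w : ℝ × ℝ} (h1 : rayEq k w = 0)
    (h2 : 0 < rayPos k w) (h3 : rayEq l w = 0) (h4 : 0 ≤ rayPos l w) : False := by
  rcases k with h | h | h <;> rcases l with m | m | m <;>
    rcases fin_three_cases h m with rfl | rfl | rfl <;>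
    simp only [rayEq, rayPos, fin_add_three, _root_.sub_apply] at h1 h2 h3 h4 <;>
    first | exact hkl rfl | linarith [yc_sum h w] | linarith [yc_sum m w]

end Sectors

end CubicObstruction

namespace CubicObstruction

open Set Filter Topology

/-! ### Local properties of the sectors -/

section Sectors

instance : Finite Piece := by
  refine Finite.of_injective (β := Fin 3 × Fin 3) (fun c => match c with
    | .W h => (0, h)
    | .X₁ h => (1, h)
    | .X₂ h => (2, h)) ?_
  rintro (_ | _ | _) (_ | _ | _) h <;> simp_all

/-- A wall functional that is nonzero at `w₀` keeps its sign nearby. One that vanishes at `w₀`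
vanishes along the whole ray, so its value depends only on the ray equation. -/
theorem sector_eventually_iff_of_ray {k : Piece} {w₀ : ℝ × ℝ} (h1 : rayEq k w₀ = 0)
    (h2 : 0 < rayPos k w₀) :
    ∃ O ∈ 𝓝 w₀, ∀ w ∈ O, ∀ w' ∈ O, rayEq k w = rayEq k w' → ∀ c, w ∈ sector c → w' ∈ sector c := by
  obtain ⟨u, hu⟩ := exists_ray_vector k
  have hw₀ : w₀ = rayPos k w₀ • u := ray_eq_smul hu h1
  have key : ∀ ℓ : (ℝ × ℝ) →L[ℝ] ℝ, ∃ O ∈ 𝓝 w₀, ∀ w ∈ O, ∀ w' ∈ O, rayEq k w = rayEq k w' →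
      0 ≤ ℓ w → 0 ≤ ℓ w' := by
    intro ℓ
    rcases lt_trichotomy (ℓ w₀) 0 with h | h | h
    · exact ⟨_, (ℓ.continuous.tendsto w₀).eventually (gt_mem_nhds h), fun w hw _ _ _ hn =>
        absurd hn (not_le.2 hw)⟩
    · refine ⟨univ, univ_mem, fun w _ w' _ hww hn => ?_⟩
      have h3 : ℓ u = 0 := by
        rw [hw₀, map_smul, smul_eq_mul] at h
        exact (mul_eq_zero.1 h).resolve_left h2.ne'
      have h4 := ray_eq_smul hu (w := w' - w) (by rw [map_sub, hww, sub_self])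
      have h5 : ℓ (w' - w) = 0 := by rw [h4, map_smul, h3, smul_zero]
      rw [map_sub] at h5
      linarith
    · exact ⟨_, (ℓ.continuous.tendsto w₀).eventually (lt_mem_nhds h), fun w _ w' hw' _ _ => le_of_lt hw'⟩
  choose O hO hOk using fun (x : Piece × Bool) => key ((wall x.1 x.2).comp (sec x.1 : _ →L[ℝ] _))
  exact ⟨⋂ x, O x, (iInter_mem.2 hO), fun w hw w' hw' hww c hc i =>
    hOk (c, i) w (mem_iInter.1 hw _) w' (mem_iInter.1 hw' _) hww (hc i)⟩

/-- A ray bounds two different sectors, so `w` also lies in a sector other than `c`; away from the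
origin the two can only meet in an edge. -/
theorem exists_wall_eq_zero_of_ray {k c : Piece} {w : ℝ × ℝ} (h1 : rayEq k w = 0)
    (h2 : 0 < rayPos k w) (hc : w ∈ sector c) : ∃ i, wall c i (sec c w) = 0 := by
  have hw : w ≠ 0 := fun h0 => by simp [h0] at h2
  obtain ⟨c₁, c₂, hne, hk⟩ := exists_ray_sectors k
  obtain ⟨c', hcc, hc'⟩ : ∃ c', c ≠ c' ∧ w ∈ sector c' := by
    by_cases h : c = c₁
    · exact ⟨c₂, by rw [h]; exact hne, (hk w h1 h2).2⟩
    · exact ⟨c₁, h, (hk w h1 h2).1⟩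
  rcases edgeAt_of_mem_sector hc hc' with h | h | h | h
  · exact absurd h hcc
  · exact absurd h hw
  · exact h.wall_eq_zero.1
  · exact h.wall_eq_zero.2

theorem sector_mem_nhds {c : Piece} {w : ℝ × ℝ} (h : ∀ i, 0 < wall c i (sec c w)) :
    sector c ∈ 𝓝 w := by
  have : ∀ i, ∀ᶠ w' in 𝓝 w, 0 < wall c i (sec c w') := fun i =>
    (((wall c i).continuous.comp (sec c).continuous).tendsto w).eventually (lt_mem_nhds (h i))
  filter_upwards [this false, this true] with w' h1 h2
  rintro (_ | _)
  exacts [h1.le, h2.le]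

/-- Every wall of a sector is shared with an explicit neighbour, and apart from the origin the
shared edges are the rays. -/
theorem mem_ray_of_wall_eq_zero {c : Piece} {w : ℝ × ℝ} (hc : w ∈ sector c) (hw : w ≠ 0) {i : Bool}
    (hi : wall c i (sec c w) = 0) : ∃ k, rayEq k w = 0 ∧ 0 < rayPos k w := by
  have key : ∃ c', w ∈ sector c' ∧ (EdgeAt c c' w ∨ EdgeAt c' c w) := by
    rcases c with h | h | h
    · obtain ⟨h1, h2⟩ := mem_sector_W.1 hc
      have h3 := yc_sum h w
      cases i
      · have hi' : yc (h + 1) w = 0 := hi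
        refine ⟨.X₁ (h + 1), mem_sector_X₁.2 ⟨hi'.le, ?_⟩, Or.inl (.edge_s h w hi')⟩
        rw [fin_add_three]; linarith
      · have hi' : yc (h + 1 + 1) w = 0 := hi
        exact ⟨.X₂ h, mem_sector_X₂.2 ⟨hi'.le, by linarith⟩, Or.inl (.edge_t h w hi')⟩
    · obtain ⟨h1, h2⟩ := mem_sector_X₁.1 hc
      have h3 := yc_sum h w
      cases i
      · have hi' : -yc h w = 0 := hi
        have hi2 : yc h w = 0 := by linarith
        obtain ⟨k, rfl⟩ : ∃ k, h = k + 1 := ⟨h + 1 + 1, (fin_add_three h).symm⟩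
        refine ⟨.W k, mem_sector_W.2 ⟨by linarith, ?_⟩, Or.inr (.edge_s k w hi2)⟩
        linarith
      · have hi' : -yc (h + 1 + 1) w - -yc h w = 0 := hi
        exact ⟨.X₂ h, mem_sector_X₂.2 ⟨by linarith, by linarith⟩,
          Or.inl (.edge_st h w (by linarith))⟩
    · obtain ⟨h1, h2⟩ := mem_sector_X₂.1 hc
      have h3 := yc_sum h w
      cases i
      · have hi' : -yc (h + 1 + 1) w = 0 := hi
        exact ⟨.W h, mem_sector_W.2 ⟨by linarith, by linarith⟩, Or.inr (.edge_t h w (by linarith))⟩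
      · have hi' : -yc h w - -yc (h + 1 + 1) w = 0 := hi
        exact ⟨.X₁ h, mem_sector_X₁.2 ⟨by linarith, by linarith⟩,
          Or.inr (.edge_st h w (by linarith))⟩
  obtain ⟨c', hc', h | h⟩ := key
  · exact h.exists_ray hc hc' hw
  · exact h.exists_ray hc' hc hw

/-- Off the rays no wall vanishes, so a sector containing the point is a neighbourhood of it; every
other sector is closed and avoids a neighbourhood. -/
theorem sector_eventually_of_generic {w₀ : ℝ × ℝ} (hw : w₀ ≠ 0)
    (hk : ∀ k, rayEq k w₀ = 0 → ¬ 0 < rayPos k w₀) :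
    (∃ c, sector c ∈ 𝓝 w₀) ∧
    ∃ O ∈ 𝓝 w₀, ∀ w ∈ O, ∀ w' ∈ O, ∀ c, w ∈ sector c → w' ∈ sector c := by
  have h1 : ∀ c, w₀ ∈ sector c → sector c ∈ 𝓝 w₀ := fun c hc =>
    sector_mem_nhds fun i => lt_of_le_of_ne (hc i) fun h0 => by
      obtain ⟨k, h1, h2⟩ := mem_ray_of_wall_eq_zero hc hw h0.symm
      exact hk k h1 h2
  have h2 : ∀ c, ∃ O ∈ 𝓝 w₀, ∀ w ∈ O, ∀ w' ∈ O, w ∈ sector c → w' ∈ sector c := fun c => by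
    by_cases hc : w₀ ∈ sector c
    · exact ⟨_, h1 c hc, fun _ _ _ h _ => h⟩
    · exact ⟨_, (isClosed_sector c).isOpen_compl.mem_nhds hc, fun w hw _ _ h => absurd h hw⟩
  choose O hO hOc using h2
  obtain ⟨c, hc⟩ := sector_cover w₀
  exact ⟨⟨c, h1 c hc⟩, ⋂ c, O c, iInter_mem.2 hO, fun w hw w' hw' c =>
    hOc c w (mem_iInter.1 hw c) w' (mem_iInter.1 hw' c)⟩

/-- Face directions annihilate the functions bounding a region which vanish at the point. -/
theorem wall_eq_zero_of_faceDirection {c : Piece} {σ τ : ℝ × ℝ}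
    (hτ : τ ∈ faceDirections c.region σ) {i : Bool} (hi : wall c i σ = 0) : wall c i τ = 0 := by
  obtain ⟨ε, hε, h1, h2⟩ := hτ
  have h3 := wall_nonneg h1 i
  have h4 := wall_nonneg h2 i
  rw [map_add, map_smul, hi, zero_add, smul_eq_mul] at h3
  rw [map_sub, map_smul, hi, zero_sub, smul_eq_mul] at h4
  have h5 : ε * wall c i τ = 0 := by linarith
  exact (mul_eq_zero.1 h5).resolve_left hε.ne'

theorem faceDirection_eq_zero {c : Piece} {τ : ℝ × ℝ} (hτ : τ ∈ faceDirections c.region 0) :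
    τ = 0 :=
  wall_injective c fun _ => wall_eq_zero_of_faceDirection hτ (map_zero _)

/-- Some wall of `c` vanishes on the ray and on the face direction. If the latter were not parallel
to the ray, the two would span the plane and the wall functional would be zero. -/
theorem rayEq_eq_zero_of_faceDirection {k c : Piece} {w τ : ℝ × ℝ} (h1 : rayEq k w = 0)
    (h2 : 0 < rayPos k w) (hc : w ∈ sector c)
    (hτ : sec c τ ∈ faceDirections c.region (sec c w)) : rayEq k τ = 0 := by
  obtain ⟨i, hi⟩ := exists_wall_eq_zero_of_ray h1 h2 hc
  have h3 := wall_eq_zero_of_faceDirection hτ hi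
  have hw : w ≠ 0 := fun h0 => by simp [h0] at h2
  by_contra hne
  have hsurj : ∀ v : ℝ × ℝ, wall c i (sec c v) = 0 := by
    intro v
    obtain ⟨u, hu⟩ := exists_ray_vector k
    have hw' := ray_eq_smul hu h1
    have hlu : wall c i (sec c u) = 0 := by
      rw [hw', map_smul, map_smul, smul_eq_mul] at hi
      exact (mul_eq_zero.1 hi).resolve_left h2.ne'
    have h4 := ray_eq_smul hu (w := v - (rayEq k v / rayEq k τ) • τ)
      (by rw [map_sub, map_smul, smul_eq_mul, div_mul_cancel₀ _ hne, sub_self])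
    have h5 := congrArg (fun x => wall c i (sec c x)) h4
    simp only [map_sub, map_smul, h3, hlu, smul_zero, sub_zero] at h5
    exact h5
  obtain ⟨σ, hσ⟩ := exists_wall_ne_zero c i
  exact hσ (by simpa using hsurj ((sec c).symm σ))

end Sectors

/-! ### The embedding of the glued space -/

section Embedding

variable {P : Fin 3 → Type u} {p : Fin 3 → ℕ} {N : Type v} {n : ℕ}
  [∀ i, TopologicalSpace (P i)] [∀ i, ChartedSpace (EuclideanSpace ℝ (Fin (p i))) (P i)]
  [TopologicalSpace N] [ChartedSpace (EuclideanSpace ℝ (Fin n)) N]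

theorem contMDiff_coord (i : Fin 3) : ContMDiff (baseModel p) (𝓡 (p i)) ∞
    (coord i : Base P → P i) := by
  match i with
  | 0 => exact contMDiff_fst
  | 1 => exact contMDiff_fst.comp contMDiff_snd
  | 2 => exact contMDiff_snd.comp contMDiff_snd

theorem isClosed_region (c : Piece) : IsClosed c.region := by
  rcases c with h | h | h
  · exact ((isClosed_le continuous_const continuous_fst).inter
      (isClosed_le continuous_fst continuous_const)).inter
      ((isClosed_le continuous_const continuous_snd).inter
      (isClosed_le continuous_snd continuous_const))
  · exact (isClosed_le continuous_const continuous_fst).inter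
      ((isClosed_le continuous_fst continuous_snd).inter
      (isClosed_le continuous_snd continuous_const))
  · exact (isClosed_le continuous_const continuous_snd).inter
      ((isClosed_le continuous_snd continuous_fst).inter
      (isClosed_le continuous_fst continuous_const))

theorem isCompact_region (c : Piece) : IsCompact c.region := by
  refine ((isCompact_Icc (a := (0 : ℝ)) (b := 1)).prod
    (isCompact_Icc (a := (0 : ℝ)) (b := 1))).of_isClosed_subset (isClosed_region c) fun σ hσ => ?_
  have h1 := region_nonneg (wall_nonneg hσ)
  have h2 := region_le_one hσ
  exact ⟨⟨h1.1, h2.1⟩, h1.2, h2.2⟩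

namespace QuadraticLink

variable (α : QuadraticLink P p N n)

theorem contMDiffOn_htpy (h : Fin 3) :
    ContMDiffOn ((baseModel p).prod 𝓘(ℝ, ℝ)) ((𝓡 n).prod (𝓡 n)) ∞
      (fun q : Base P × ℝ => α.htpy h q.1 q.2) {q | q.2 ∈ Icc (0 : ℝ) 1} :=
  (α.H_smooth h).comp ((((contMDiff_coord h).comp contMDiff_fst).prodMk
    (((contMDiff_coord (h + 1)).comp contMDiff_fst).prodMk contMDiff_snd)).contMDiffOn) fun _ hq => hq

theorem contMDiff_f_coord (h : Fin 3) : ContMDiff (baseModel p) (𝓡 n) ∞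
    (fun x : Base P => α.f h (coord h x)) := (α.f_smooth h).comp (contMDiff_coord h)

theorem contMDiffOn_htpy_comp (h : Fin 3) (c : Piece) {g : ℝ × ℝ → ℝ}
    (hg : ContDiff ℝ ∞ g) (hc : ∀ σ ∈ c.region, g σ ∈ Icc (0 : ℝ) 1) :
    ContMDiffOn (ambientModel p) ((𝓡 n).prod (𝓡 n)) ∞
      (fun q : Ambient P => α.htpy h q.1 (g q.2)) (univ ×ˢ c.region) :=
  (α.contMDiffOn_htpy h).comp ((contMDiff_fst.prodMk (hg.contMDiff.comp contMDiff_snd)).contMDiffOn)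
    fun q hq => hc q.2 hq.2

theorem contMDiffOn_Φ (c : Piece) :
    ContMDiffOn (ambientModel p) (fourModel n) ∞ (α.Φ c) (univ ×ˢ c.region) := by
  have hs : ∀ h, ContMDiffOn (ambientModel p) ((𝓡 n).prod (𝓡 n)) ∞
      (fun q : Ambient P => α.htpy h q.1 q.2.1) (univ ×ˢ c.region) := fun h =>
    α.contMDiffOn_htpy_comp h c contDiff_fst fun σ hσ =>
      ⟨(region_nonneg (wall_nonneg hσ)).1, (region_le_one hσ).1⟩
  have ht : ∀ h, ContMDiffOn (ambientModel p) ((𝓡 n).prod (𝓡 n)) ∞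
      (fun q : Ambient P => α.htpy h q.1 q.2.2) (univ ×ˢ c.region) := fun h =>
    α.contMDiffOn_htpy_comp h c contDiff_snd fun σ hσ =>
      ⟨(region_nonneg (wall_nonneg hσ)).2, (region_le_one hσ).2⟩
  have hf : ∀ h, ContMDiffOn (ambientModel p) (𝓡 n) ∞
      (fun q : Ambient P => α.f h (coord h q.1)) (univ ×ˢ c.region) := fun h =>
    ((α.contMDiff_f_coord h).comp contMDiff_fst).contMDiffOn
  rcases c with h | h | h
  · exact (hs h).prodMk (ht (h + 1))
  · exact ((hf (h + 1 + 1)).prodMk (contMDiff_fst.comp_contMDiffOn (hs h))).prodMk (ht h)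
  · exact (hs h).prodMk ((contMDiff_snd.comp_contMDiffOn (ht h)).prodMk (hf (h + 1 + 1)))

/-- At time `1` a homotopy misses the diagonal, while the larger parameter of a triangle, and each
parameter of the square, appears in a diagonal condition on both components of one homotopy. So the
outer edges of the regions carry no points. -/
theorem lt_one_of_mem_piece {c : Piece} {q : Ambient P} (hq : q ∈ α.piece c) :
    q.2.1 < 1 ∧ q.2.2 < 1 := by
  obtain ⟨x, s, t⟩ := q
  obtain ⟨hr, h1, h2⟩ := hq
  have hle := region_le_one hr
  rcases c with h | h | h
  · exact ⟨lt_of_le_of_ne hle.1 fun hs => α.H_one h _ _ (by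
        change s = 1 at hs; subst hs; exact h1),
      lt_of_le_of_ne hle.2 fun ht => α.H_one (h + 1) _ _ (by
        change t = 1 at ht; subst ht; exact h2)⟩
  · have ht : t < 1 := lt_of_le_of_ne hle.2 fun ht => α.H_one h _ _ (by
        change t = 1 at ht; subst ht; exact h2)
    exact ⟨lt_of_le_of_lt hr.2.1 ht, ht⟩
  · have hs : s < 1 := lt_of_le_of_ne hle.1 fun hs => α.H_one h _ _ (by
        change s = 1 at hs; subst hs; exact h1)
    exact ⟨hs, lt_of_le_of_lt hr.2.1 hs⟩

theorem isClosed_piece [T2Space N] (c : Piece) : IsClosed (α.piece c) := by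
  have hcl : IsClosed ((univ : Set (Base P)) ×ˢ c.region) := isClosed_univ.prod (isClosed_region c)
  have hd : IsClosed (diagSq N) :=
    (isClosed_eq (continuous_fst.comp continuous_fst) (continuous_snd.comp continuous_fst)).inter
      (isClosed_eq (continuous_fst.comp continuous_snd) (continuous_snd.comp continuous_snd))
  have : α.piece c = (univ ×ˢ c.region) ∩ α.Φ c ⁻¹' diagSq N := by
    ext q; simp [piece]
  rw [this]
  exact (α.contMDiffOn_Φ c).continuousOn.preimage_isClosed_of_isClosed hcl hd

theorem isCompact_piece [T2Space N] [∀ i, CompactSpace (P i)] (c : Piece) :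
    IsCompact (α.piece c) :=
  ((isCompact_univ (X := Base P)).prod (isCompact_region c)).of_isClosed_subset
    (α.isClosed_piece c) fun _ hq => ⟨mem_univ _, hq.1⟩

instance [T2Space N] [∀ i, CompactSpace (P i)] : CompactSpace α.Z := by
  have : ∀ c, CompactSpace (α.piece c) := fun c => isCompact_iff_compactSpace.1 (α.isCompact_piece c)
  infer_instance

theorem mem_piece_iff_of_edgeAt {c c' : Piece} {x : Base P} {w : ℝ × ℝ} (h : EdgeAt c c' w) :
    (x, sec c w) ∈ α.piece c ↔ (x, sec c' w) ∈ α.piece c' := by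
  rw [← h.sec_eq]
  rcases h with ⟨h, _, h0⟩ | ⟨h, _, h0⟩ | ⟨h, _, h0⟩
  · exact α.mem_piece_edge_t h _ h0
  · exact α.mem_piece_edge_s h _ h0
  · refine α.mem_piece_edge_st h _ (show -yc h w = -yc (h + 1 + 1) w by rw [h0])

theorem toZ_eq_of_edgeAt {c c' : Piece} {x : Base P} {w : ℝ × ℝ} (h : EdgeAt c c' w)
    (h1 : (x, sec c w) ∈ α.piece c) (h2 : (x, sec c' w) ∈ α.piece c') :
    α.toZ c ⟨_, h1⟩ = α.toZ c' ⟨_, h2⟩ := by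
  have he := h.sec_eq
  have : ∀ σ (hσ : (x, σ) ∈ α.piece c'), sec c w = σ →
      α.toZ c ⟨_, h1⟩ = α.toZ c' ⟨_, hσ⟩ := by
    rintro _ hσ rfl
    rcases h with ⟨h, _, h0⟩ | ⟨h, _, h0⟩ | ⟨h, _, h0⟩
    · exact Quot.sound (Glue.edge_t h _ h1 hσ h0)
    · exact Quot.sound (Glue.edge_s h _ h1 hσ h0)
    · exact Quot.sound (Glue.edge_st h _ h1 hσ (show -yc h w = -yc (h + 1 + 1) w by rw [h0]))
  exact this _ h2 he

/-- At the origin all edge conditions hold, and through the shared edges the nine pieces form one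
closed ring. -/
theorem edgeAt_zero_chain {r : Piece → Piece → Prop} (hr : Equivalence r)
    (h : ∀ c c', EdgeAt c c' 0 → r c c') (c c' : Piece) : r c c' := by
  have e1 : ∀ h, r (.W h) (.X₂ h) := fun k => h _ _ (.edge_t k 0 (map_zero _))
  have e2 : ∀ h, r (.W h) (.X₁ (h + 1)) := fun k => h _ _ (.edge_s k 0 (map_zero _))
  have e3 : ∀ h, r (.X₁ h) (.X₂ h) := fun k => h _ _ (.edge_st k 0 (by simp))
  have e4 : ∀ h, r (.W h) (.W (h + 1)) := fun h =>
    hr.trans (hr.trans (e2 h) (e3 (h + 1))) (hr.symm (e1 (h + 1)))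
  have e5 : ∀ h k, r (.W h) (.W k) := fun h k => by
    rcases fin_three_cases h k with rfl | rfl | rfl
    · exact hr.refl _
    · exact e4 h
    · exact hr.trans (e4 h) (e4 _)
  have e6 : ∀ c, ∃ h, r (.W h) c := by
    rintro (h | h | h)
    · exact ⟨h, hr.refl _⟩
    · exact ⟨h, hr.trans (e1 h) (hr.symm (e3 h))⟩
    · exact ⟨h, e1 h⟩
  obtain ⟨h, hh⟩ := e6 c
  obtain ⟨k, hk⟩ := e6 c'
  exact hr.trans (hr.symm hh) (hr.trans (e5 h k) hk)

/-- Distinct sectors meet in an edge, where the gluing applies directly, or at the origin, where it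
applies along a chain of edges. -/
theorem mem_piece_iff_of_mem_sector {c c' : Piece} {x : Base P} {w : ℝ × ℝ} (hc : w ∈ sector c)
    (hc' : w ∈ sector c') : (x, sec c w) ∈ α.piece c ↔ (x, sec c' w) ∈ α.piece c' := by
  rcases edgeAt_of_mem_sector hc hc' with rfl | rfl | h | h
  · exact Iff.rfl
  · exact edgeAt_zero_chain (r := fun c c' => (x, sec c 0) ∈ α.piece c ↔ (x, sec c' 0) ∈ α.piece c')
      ⟨fun _ => Iff.rfl, Iff.symm, Iff.trans⟩ (fun c c' h => α.mem_piece_iff_of_edgeAt h) c c'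
  · exact α.mem_piece_iff_of_edgeAt h
  · exact (α.mem_piece_iff_of_edgeAt h).symm

theorem toZ_eq_of_mem_sector {c c' : Piece} {x : Base P} {w : ℝ × ℝ} (hc : w ∈ sector c)
    (hc' : w ∈ sector c') (h1 : (x, sec c w) ∈ α.piece c) (h2 : (x, sec c' w) ∈ α.piece c') :
    α.toZ c ⟨_, h1⟩ = α.toZ c' ⟨_, h2⟩ := by
  rcases edgeAt_of_mem_sector hc hc' with rfl | rfl | h | h
  · rfl
  · have := edgeAt_zero_chain (r := fun c c' => ((x, sec c 0) ∈ α.piece c ↔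
        (x, sec c' 0) ∈ α.piece c') ∧ ∀ h1 h2, α.toZ c ⟨(x, sec c 0), h1⟩ = α.toZ c' ⟨(x, sec c' 0), h2⟩)
      ⟨fun _ => ⟨Iff.rfl, fun _ _ => rfl⟩, fun h => ⟨h.1.symm, fun h1 h2 => (h.2 h2 h1).symm⟩,
        fun h h' => ⟨h.1.trans h'.1, fun h1 h2 => (h.2 h1 (h.1.1 h1)).trans (h'.2 _ h2)⟩⟩
      (fun c c' h => ⟨α.mem_piece_iff_of_edgeAt h, fun h1 h2 => α.toZ_eq_of_edgeAt h h1 h2⟩) c c'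
    exact this.2 h1 h2
  · exact α.toZ_eq_of_edgeAt h h1 h2
  · exact (α.toZ_eq_of_edgeAt h h2 h1).symm

/-- The image of the glued space in `P₁ × P₂ × P₃ × ℝ²`. -/
def fan : Set (Ambient P) := {q | ∃ c, q.2 ∈ sector c ∧ (q.1, sec c q.2) ∈ α.piece c}

theorem mem_fan_iff {c : Piece} {q : Ambient P} (hc : q.2 ∈ sector c) :
    q ∈ α.fan ↔ (q.1, sec c q.2) ∈ α.piece c :=
  ⟨fun ⟨_, hc', h⟩ => (α.mem_piece_iff_of_mem_sector hc' hc).1 h, fun h => ⟨c, hc, h⟩⟩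

theorem mem_sector_of_mem_piece {c : Piece} {q : Ambient P} (hq : q ∈ α.piece c) :
    (sec c).symm q.2 ∈ sector c := fun i => by
  rw [ContinuousLinearEquiv.apply_symm_apply]; exact wall_nonneg hq.1 i

/-- The embedding of the glued space in `P₁ × P₂ × P₃ × ℝ²`. -/
noncomputable def emb : α.Z → Ambient P :=
  Quot.lift (fun q => (q.2.1.1, (sec q.1).symm q.2.1.2)) (by
    have key : ∀ c c' (σ : ℝ × ℝ), EdgeAt c c' ((sec c).symm σ) →
        (sec c).symm σ = (sec c').symm σ := fun c c' σ h => by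
      have := h.sec_eq
      rw [ContinuousLinearEquiv.apply_symm_apply] at this
      rw [eq_comm, ContinuousLinearEquiv.symm_apply_eq]
      exact this
    have ha : ∀ c (σ : ℝ × ℝ), paramMap c ((sec c).symm σ) = σ := fun c σ =>
      (sec c).apply_symm_apply σ
    rintro _ _ (⟨h, q, hW, hX, h0⟩ | ⟨h, q, hW, hX, h0⟩ | ⟨h, q, hW, hX, h0⟩)
    · exact Prod.ext rfl (key _ _ _ (.edge_t h _ ((congrArg Prod.snd (ha (.W h) q.2)).trans h0)))
    · exact Prod.ext rfl (key _ _ _ (.edge_s h _ ((congrArg Prod.fst (ha (.W h) q.2)).trans h0)))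
    · refine Prod.ext rfl (key _ _ _ (.edge_st h _ ?_))
      have h1 : -yc h ((sec (.X₁ h)).symm q.2) = q.2.1 := congrArg Prod.fst (ha (.X₁ h) q.2)
      have h2 : -yc (h + 1 + 1) ((sec (.X₁ h)).symm q.2) = q.2.2 :=
        congrArg Prod.snd (ha (.X₁ h) q.2)
      linarith)

theorem emb_toZ (c : Piece) (q : α.piece c) :
    α.emb (α.toZ c q) = (q.1.1, (sec c).symm q.1.2) := rfl

theorem exists_toZ (z : α.Z) : ∃ c q, α.toZ c q = z := by
  obtain ⟨⟨c, q⟩, rfl⟩ := Quot.exists_rep z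
  exact ⟨c, q, rfl⟩

/-- A point of `Z` whose image lies in a sector comes from the piece with the same label. -/
theorem exists_toZ_of_mem_sector {c : Piece} {z : α.Z} (hz : (α.emb z).2 ∈ sector c) :
    ∃ h : ((α.emb z).1, sec c (α.emb z).2) ∈ α.piece c, α.toZ c ⟨_, h⟩ = z := by
  obtain ⟨c', q, rfl⟩ := α.exists_toZ z
  rw [emb_toZ] at hz
  have hs := α.mem_sector_of_mem_piece q.2
  have hq : (q.1.1, sec c' ((sec c').symm q.1.2)) ∈ α.piece c' := by
    rw [ContinuousLinearEquiv.apply_symm_apply]; exact q.2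
  have h1 := (α.mem_piece_iff_of_mem_sector hz hs (x := q.1.1)).2 hq
  refine ⟨h1, (α.toZ_eq_of_mem_sector hz hs h1 hq).trans ?_⟩
  congr 1
  exact Subtype.ext (Prod.ext rfl (ContinuousLinearEquiv.apply_symm_apply _ _))

theorem emb_injective : Function.Injective α.emb := by
  intro z z' h
  obtain ⟨c, hc⟩ := sector_cover (α.emb z).2
  obtain ⟨h1, h2⟩ := α.exists_toZ_of_mem_sector hc
  obtain ⟨h3, h4⟩ := α.exists_toZ_of_mem_sector (z := z') (by rw [← h]; exact hc)
  rw [← h2, ← h4]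
  congr 1
  exact Subtype.ext (congrArg (fun m => (m.1, sec c m.2)) h)

theorem range_emb : range α.emb = α.fan := by
  ext q
  constructor
  · rintro ⟨z, rfl⟩
    obtain ⟨c, q, rfl⟩ := α.exists_toZ z
    refine ⟨c, α.mem_sector_of_mem_piece q.2, ?_⟩
    rw [emb_toZ]
    simp
  · rintro ⟨c, hc, h⟩
    exact ⟨α.toZ c ⟨_, h⟩, by rw [emb_toZ]; simp⟩

theorem continuous_emb : Continuous α.emb := by
  refine continuous_quot_lift _ (continuous_sigma fun c => ?_)
  exact (continuous_fst.comp continuous_subtype_val).prodMk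
    ((sec c).symm.continuous.comp (continuous_snd.comp continuous_subtype_val))

variable [T2Space N] [∀ i, CompactSpace (P i)] [∀ i, T2Space (P i)]

instance : T2Space α.Z := T2Space.of_injective_continuous α.emb_injective α.continuous_emb

/-- A continuous injection from a compact space to a Hausdorff space. -/
theorem isEmbedding_emb : IsEmbedding α.emb :=
  (α.continuous_emb.isClosedEmbedding α.emb_injective).isEmbedding

theorem isCompact_fan : IsCompact α.fan := by
  rw [← range_emb]
  exact isCompact_range α.continuous_emb

end QuadraticLink

end Embedding

end CubicObstruction

namespace CubicObstruction

open Set Filter Topology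

/-! ### Local extensions of maps which are smooth up to the boundary -/

section Extension

/-- The differential of `f` at `p` within a subset, as a linear map between the model spaces. -/
noncomputable def mderWithin {E : Type*} [NormedAddCommGroup E] [NormedSpace ℝ E] {H : Type*}
    [TopologicalSpace H] (I : ModelWithCorners ℝ E H) {M : Type*} [TopologicalSpace M]
    [ChartedSpace H M] {E' : Type*} [NormedAddCommGroup E'] [NormedSpace ℝ E'] {H' : Type*}
    [TopologicalSpace H'] (I' : ModelWithCorners ℝ E' H') {M' : Type*} [TopologicalSpace M']
    [ChartedSpace H' M'] (f : M → M') (s : Set M) (p : M) : E →L[ℝ] E' := mfderivWithin I I' f s p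

variable {E : Type} [NormedAddCommGroup E] [NormedSpace ℝ E] [FiniteDimensional ℝ E]
  {H : Type*} [TopologicalSpace H]
  {I : ModelWithCorners ℝ E H} [I.Boundaryless] {X : Type*} [TopologicalSpace X] [ChartedSpace H X]
  [IsManifold I ∞ X]
  {E' : Type} [NormedAddCommGroup E'] [NormedSpace ℝ E'] [FiniteDimensional ℝ E'] {H' : Type*}
  [TopologicalSpace H'] {I' : ModelWithCorners ℝ E' H'} [I'.Boundaryless] {X' : Type*}
  [TopologicalSpace X'] [ChartedSpace H' X'] [IsManifold I' ∞ X']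

/-- A family of maps smooth on a closed interval of parameters extends locally beyond its start. -/
theorem exists_local_extension_of_contMDiffOn_Icc {f : X × ℝ → X'}
    (hf : ContMDiffOn (I.prod 𝓘(ℝ, ℝ)) I' ∞ f {q | q.2 ∈ Icc (0 : ℝ) 1}) (x₀ : X) {s₀ : ℝ}
    (h0 : 0 ≤ s₀) (h1 : s₀ < 1) :
    ∃ (g : X × ℝ → X') (U : Set (X × ℝ)), IsOpen U ∧ (x₀, s₀) ∈ U ∧
      ContMDiffOn (I.prod 𝓘(ℝ, ℝ)) I' ∞ g U ∧ ∀ q ∈ U, 0 ≤ q.2 → g q = f q := by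
  rcases h0.lt_or_eq with h0 | rfl
  · exact ⟨f, {q | 0 < q.2} ∩ {q | q.2 < 1}, (isOpen_lt continuous_const continuous_snd).inter
      (isOpen_lt continuous_snd continuous_const), ⟨h0, h1⟩,
      hf.mono fun q hq => ⟨le_of_lt hq.1, le_of_lt hq.2⟩, fun _ _ _ => rfl⟩
  let φ := extChartAt I x₀
  let ψ := extChartAt I' (f (x₀, 0))
  have hφ : ContMDiffOn I 𝓘(ℝ, E) ∞ φ φ.source := by
    rw [extChartAt_source]; exact contMDiffOn_extChartAt
  have hφi : ContMDiffOn 𝓘(ℝ, E) I ∞ φ.symm φ.target := contMDiffOn_extChartAt_symm x₀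
  have hψ : ContMDiffOn I' 𝓘(ℝ, E') ∞ ψ ψ.source := by
    rw [extChartAt_source]; exact contMDiffOn_extChartAt
  have hψi : ContMDiffOn 𝓘(ℝ, E') I' ∞ ψ.symm ψ.target := contMDiffOn_extChartAt_symm _
  have hφt : IsOpen φ.target := isOpen_extChartAt_target x₀
  have hψt : IsOpen ψ.target := isOpen_extChartAt_target _
  have hφs : IsOpen φ.source := isOpen_extChartAt_source x₀
  have hψs : IsOpen ψ.source := isOpen_extChartAt_source _
  have hx₀ : x₀ ∈ φ.source := mem_extChartAt_source x₀
  have hy₀ : f (x₀, 0) ∈ ψ.source := mem_extChartAt_source _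
  obtain ⟨V, hV, hxV, hVf⟩ : ∃ V : Set (X × ℝ), IsOpen V ∧ (x₀, 0) ∈ V ∧
      ∀ q ∈ V, q.2 ∈ Icc (0 : ℝ) 1 → f q ∈ ψ.source := by
    have := (hf.continuousOn (x₀, 0) ⟨le_rfl, zero_le_one⟩).preimage_mem_nhdsWithin
      (hψs.mem_nhds hy₀)
    obtain ⟨V, hV, hxV, hVs⟩ := mem_nhdsWithin.1 this
    exact ⟨V, hV, hxV, fun q hq hq' => hVs ⟨hq, hq'⟩⟩
  let i : E × ℝ → X × ℝ := fun q => (φ.symm q.1, q.2)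
  have hi : ContMDiffOn 𝓘(ℝ, E × ℝ) (I.prod 𝓘(ℝ, ℝ)) ∞ i (φ.target ×ˢ univ) :=
    (hφi.comp contDiff_fst.contMDiff.contMDiffOn fun q hq => hq.1).prodMk
      contDiff_snd.contMDiff.contMDiffOn
  let Û : Set (E × ℝ) := (φ.target ×ˢ univ) ∩ i ⁻¹' (V ∩ {q | q.2 < 1})
  have hÛ : IsOpen Û := hi.continuousOn.isOpen_inter_preimage (hφt.prod isOpen_univ)
    (hV.inter (isOpen_lt continuous_snd continuous_const))
  have hix : i (φ x₀, 0) = (x₀, 0) := Prod.ext (φ.left_inv hx₀) rfl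
  have hxÛ : (φ x₀, (0 : ℝ)) ∈ Û := by
    refine ⟨⟨φ.map_source hx₀, trivial⟩, ?_⟩
    rw [mem_preimage, hix]
    exact ⟨hxV, h1⟩
  have hUI : ∀ q ∈ Û ∩ upperHalf E, (i q).2 ∈ Icc (0 : ℝ) 1 := fun q hq => ⟨hq.2, le_of_lt hq.1.2.2⟩
  have hfh : ContDiffOn ℝ ∞ (fun q => ψ (f (i q))) (Û ∩ upperHalf E) := by
    rw [← contMDiffOn_iff_contDiffOn]
    exact hψ.comp (hf.comp (hi.mono (inter_subset_left.trans inter_subset_left)) hUI)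
      fun q hq => hVf _ hq.1.2.1 (hUI q hq)
  -- In charts the family is smooth on one side of the hyperplane of time `0`, so Borel's lemma
  -- continues it to the other side.
  obtain ⟨F, hF, hFe⟩ := exists_contDiff_local_extension (hÛ.mem_nhds hxÛ) hfh
  obtain ⟨O, hOF, hO, hxO⟩ := mem_nhds_iff.1 hFe
  let k : X × ℝ → E × ℝ := fun q => (φ q.1, q.2)
  have hk : ContMDiffOn (I.prod 𝓘(ℝ, ℝ)) 𝓘(ℝ, E × ℝ) ∞ k (φ.source ×ˢ univ) :=
    (hφ.comp contMDiff_fst.contMDiffOn fun q hq => hq.1).prodMk_space contMDiff_snd.contMDiffOn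
  have hik : ∀ q ∈ φ.source ×ˢ (univ : Set ℝ), i (k q) = q := fun q hq =>
    Prod.ext (φ.left_inv hq.1) rfl
  let A : Set (E × ℝ) := (O ∩ Û) ∩ F ⁻¹' ψ.target
  have hA : IsOpen A := (hO.inter hÛ).inter (hψt.preimage hF.continuous)
  refine ⟨fun q => ψ.symm (F (k q)), (φ.source ×ˢ univ) ∩ k ⁻¹' A,
    hk.continuousOn.isOpen_inter_preimage (hφs.prod isOpen_univ) hA,
    ⟨⟨hx₀, trivial⟩, ⟨hxO, hxÛ⟩, ?_⟩, ?_, fun q hq hq0 => ?_⟩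
  · rw [mem_preimage, show F (k (x₀, 0)) = ψ (f (i (φ x₀, 0))) from hOF hxO le_rfl, hix]
    exact ψ.map_source hy₀
  · exact hψi.comp (hF.contMDiff.comp_contMDiffOn (hk.mono inter_subset_left)) fun q hq => hq.2.2
  · have h2 : F (k q) = ψ (f (i (k q))) := hOF hq.2.1.1 hq0
    rw [hik q hq.1] at h2
    have h3 : q ∈ V ∩ {q | q.2 < 1} := by
      have := hq.2.1.2.2
      rwa [mem_preimage, hik q hq.1] at this
    change ψ.symm (F (k q)) = f q
    rw [h2, ψ.left_inv (hVf q h3.1 ⟨hq0, le_of_lt h3.2⟩)]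

end Extension

/-! ### Extensions of the maps `Φ` and transversality in the coordinates of the plane -/

section Link

variable {P : Fin 3 → Type u} {p : Fin 3 → ℕ} {N : Type v} {n : ℕ}
  [∀ i, TopologicalSpace (P i)] [∀ i, ChartedSpace (EuclideanSpace ℝ (Fin (p i))) (P i)]
  [∀ i, IsManifold (𝓡 (p i)) ∞ (P i)]
  [TopologicalSpace N] [ChartedSpace (EuclideanSpace ℝ (Fin n)) N] [IsManifold (𝓡 n) ∞ N]

namespace QuadraticLink

variable (α : QuadraticLink P p N n)

/-- Each component of `Φ` involves a homotopy at a single time, which is either `s` or `t`.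
Extending across one hyperplane at a time therefore suffices, even at the corner of a region. -/
theorem exists_local_extension_htpy (h : Fin 3) (x₀ : Base P) {s₀ : ℝ} (h0 : 0 ≤ s₀) (h1 : s₀ < 1)
    {g : ℝ × ℝ → ℝ} (hg : ContDiff ℝ ∞ g) {σ₀ : ℝ × ℝ} (hσ : g σ₀ = s₀) :
    ∃ (f : Ambient P → N × N) (U : Set (Ambient P)), IsOpen U ∧ (x₀, σ₀) ∈ U ∧
      ContMDiffOn (ambientModel p) ((𝓡 n).prod (𝓡 n)) ∞ f U ∧
      ∀ q ∈ U, 0 ≤ g q.2 → f q = α.htpy h q.1 (g q.2) := by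
  obtain ⟨f, U, hU, hxU, hf, hfe⟩ :=
    exists_local_extension_of_contMDiffOn_Icc (α.contMDiffOn_htpy h) x₀ h0 h1
  have hk : ContMDiff (ambientModel p) ((baseModel p).prod 𝓘(ℝ, ℝ)) ∞
      (fun q : Ambient P => (q.1, g q.2)) :=
    contMDiff_fst.prodMk (hg.contMDiff.comp contMDiff_snd)
  refine ⟨fun q => f (q.1, g q.2), (fun q : Ambient P => (q.1, g q.2)) ⁻¹' U,
    hU.preimage hk.continuous, by rw [mem_preimage]; simp only [hσ]; exact hxU,
    hf.comp hk.contMDiffOn fun q hq => hq, fun q hq h0 => hfe _ hq h0⟩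

/-- The maps defining the pieces extend locally to smooth maps. -/
theorem exists_local_extension_Φ (c : Piece) (q₀ : Ambient P) (hq : q₀.2 ∈ c.region)
    (hlt : q₀.2.1 < 1 ∧ q₀.2.2 < 1) :
    ∃ (f : Ambient P → (N × N) × (N × N)) (U : Set (Ambient P)), IsOpen U ∧ q₀ ∈ U ∧
      ContMDiffOn (ambientModel p) (fourModel n) ∞ f U ∧
      ∀ q ∈ U, 0 ≤ q.2.1 → 0 ≤ q.2.2 → f q = α.Φ c q := by
  obtain ⟨x₀, σ₀⟩ := q₀
  have h0 := region_nonneg (wall_nonneg hq)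
  have hs := fun h => α.exists_local_extension_htpy h x₀ h0.1 hlt.1 contDiff_fst (σ₀ := σ₀) rfl
  have ht := fun h => α.exists_local_extension_htpy h x₀ h0.2 hlt.2 contDiff_snd (σ₀ := σ₀) rfl
  have hf : ∀ h, ContMDiff (ambientModel p) (𝓡 n) ∞
      (fun q : Ambient P => α.f h (coord h q.1)) := fun h =>
    (α.contMDiff_f_coord h).comp contMDiff_fst
  rcases c with h | h | h
  · obtain ⟨f, U, hU, hxU, hf, hfe⟩ := hs h
    obtain ⟨g, V, hV, hxV, hg, hge⟩ := ht (h + 1)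
    exact ⟨fun q => (f q, g q), U ∩ V, hU.inter hV, ⟨hxU, hxV⟩,
      (hf.mono inter_subset_left).prodMk (hg.mono inter_subset_right), fun q hq h1 h2 =>
      Prod.ext (hfe q hq.1 h1) (hge q hq.2 h2)⟩
  · obtain ⟨f, U, hU, hxU, hf', hfe⟩ := hs h
    obtain ⟨g, V, hV, hxV, hg, hge⟩ := ht h
    exact ⟨fun q => ((α.f (h + 1 + 1) (coord (h + 1 + 1) q.1), (f q).1), g q), U ∩ V, hU.inter hV,
      ⟨hxU, hxV⟩, ((hf _).contMDiffOn.prodMk (contMDiff_fst.comp_contMDiffOn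
      (hf'.mono inter_subset_left))).prodMk (hg.mono inter_subset_right), fun q hq h1 h2 =>
      Prod.ext (Prod.ext rfl (congrArg Prod.fst (hfe q hq.1 h1))) (hge q hq.2 h2)⟩
  · obtain ⟨f, U, hU, hxU, hf', hfe⟩ := hs h
    obtain ⟨g, V, hV, hxV, hg, hge⟩ := ht h
    exact ⟨fun q => (f q, ((g q).2, α.f (h + 1 + 1) (coord (h + 1 + 1) q.1))), U ∩ V, hU.inter hV,
      ⟨hxU, hxV⟩, (hf'.mono inter_subset_left).prodMk ((contMDiff_snd.comp_contMDiffOn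
      (hg.mono inter_subset_right)).prodMk (hf _).contMDiffOn), fun q hq h1 h2 =>
      Prod.ext (hfe q hq.1 h1) (Prod.ext (congrArg Prod.snd (hge q hq.2 h2)) rfl)⟩

end QuadraticLink

/-- The model space of `P₁ × P₂ × P₃`. -/
abbrev BaseSpace (p : Fin 3 → ℕ) : Type :=
  EuclideanSpace ℝ (Fin (p 0)) × EuclideanSpace ℝ (Fin (p 1)) × EuclideanSpace ℝ (Fin (p 2))

/-- The model space of `N × N`. -/
abbrev TwoSpace (n : ℕ) : Type := EuclideanSpace ℝ (Fin n) × EuclideanSpace ℝ (Fin n)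

/-- `((a, b), (c, d)) ↦ (a - b, c - d)`. -/
noncomputable def diffMap (n : ℕ) : (TwoSpace n × TwoSpace n) →L[ℝ] TwoSpace n :=
  let δ : TwoSpace n →L[ℝ] EuclideanSpace ℝ (Fin n) :=
    ContinuousLinearMap.fst ℝ _ _ - ContinuousLinearMap.snd ℝ _ _
  δ.prodMap δ

theorem diffMap_apply (v : TwoSpace n × TwoSpace n) :
    diffMap n v = (v.1.1 - v.1.2, v.2.1 - v.2.2) := rfl

/-- The region is convex with nonempty interior. -/
theorem uniqueDiffOn_region (c : Piece) : UniqueDiffOn ℝ c.region := by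
  refine uniqueDiffOn_convex ?_ ?_
  · rintro x hx y hy a b ha hb hab
    have h1 := region_le_one hx
    have h2 := region_le_one hy
    refine (mem_region_iff ?_ ?_).2 fun i => ?_
    · change a * x.1 + b * y.1 ≤ 1
      nlinarith [h1.1, h2.1]
    · change a * x.2 + b * y.2 ≤ 1
      nlinarith [h1.2, h2.2]
    · rw [map_add, map_smul, map_smul]
      exact add_nonneg (mul_nonneg ha (wall_nonneg hx i)) (mul_nonneg hb (wall_nonneg hy i))
  · have key : ∀ σ : ℝ × ℝ, σ.1 < 1 → σ.2 < 1 → (∀ i, 0 < wall c i σ) →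
        (interior c.region).Nonempty := fun σ h1 h2 h3 => by
      refine ⟨σ, mem_interior_iff_mem_nhds.2 ?_⟩
      have hw : ∀ i, ∀ᶠ σ' in 𝓝 σ, 0 < wall c i σ' := fun i =>
        ((wall c i).continuous.tendsto σ).eventually (lt_mem_nhds (h3 i))
      filter_upwards [(continuous_fst.tendsto σ).eventually (gt_mem_nhds h1),
        (continuous_snd.tendsto σ).eventually (gt_mem_nhds h2), hw true, hw false] with σ' a b c d
      refine (mem_region_iff a.le b.le).2 ?_
      rintro (_ | _)
      exacts [d.le, c.le]
    rcases c with h | h | h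
    · refine key (1 / 2, 1 / 2) (by norm_num) (by norm_num) ?_
      rintro (_ | _)
      · change (0 : ℝ) < 1 / 2; norm_num
      · change (0 : ℝ) < 1 / 2; norm_num
    · refine key (1 / 4, 1 / 2) (by norm_num) (by norm_num) ?_
      rintro (_ | _)
      · change (0 : ℝ) < 1 / 4; norm_num
      · change (0 : ℝ) < 1 / 2 - 1 / 4; norm_num
    · refine key (1 / 2, 1 / 4) (by norm_num) (by norm_num) ?_
      rintro (_ | _)
      · change (0 : ℝ) < 1 / 4; norm_num
      · change (0 : ℝ) < 1 / 2 - 1 / 4; norm_num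

theorem uniqueMDiffOn_univ_prod_region (c : Piece) :
    UniqueMDiffOn (ambientModel p) ((univ : Set (Base P)) ×ˢ c.region) := by
  exact (uniqueMDiffOn_univ (I := baseModel p)).prod (UniqueDiffOn.uniqueMDiffOn
    (uniqueDiffOn_region c))

namespace QuadraticLink

variable (α : QuadraticLink P p N n)

/-- The differential of the map defining a piece, in the coordinates of the plane. -/
noncomputable def dΦ (c : Piece) (q : Ambient P) :
    (BaseSpace p × (ℝ × ℝ)) →L[ℝ] (TwoSpace n × TwoSpace n) :=
  (mderWithin (ambientModel p) (fourModel n) (α.Φ c) (univ ×ˢ c.region) (q.1, sec c q.2)).comp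
    ((ContinuousLinearMap.id ℝ (BaseSpace p)).prodMap (sec c : (ℝ × ℝ) →L[ℝ] ℝ × ℝ))

theorem dΦ_apply (c : Piece) (q : Ambient P) (v : BaseSpace p × (ℝ × ℝ)) :
    α.dΦ c q v = mderWithin (ambientModel p) (fourModel n) (α.Φ c) (univ ×ˢ c.region)
      (q.1, sec c q.2) (v.1, sec c v.2) := rfl

/-- The tangent spaces of the pieces. -/
noncomputable def tangentPiece (c : Piece) (q : Ambient P) : Submodule ℝ (BaseSpace p × (ℝ × ℝ)) :=
  LinearMap.ker ((diffMap n).comp (α.dΦ c q)).toLinearMap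

theorem mem_tangentPiece {c : Piece} {q : Ambient P} {v : BaseSpace p × (ℝ × ℝ)} :
    v ∈ α.tangentPiece c q ↔ diffMap n (α.dΦ c q v) = 0 := Iff.rfl

/-- Transversality at a point of a piece. -/
theorem IsTransverse.exists_face (hα : α.IsTransverse) {c : Piece} {q : Ambient P}
    (hq : (q.1, sec c q.2) ∈ α.piece c) (f : TwoSpace n) :
    ∃ (ξ : BaseSpace p) (τ : ℝ × ℝ), sec c τ ∈ faceDirections c.region (sec c q.2) ∧
      diffMap n (α.dΦ c q (ξ, τ)) = f := by
  obtain ⟨hr, hd1, hd2⟩ := hq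
  let y : N × N := ((α.Φ c (q.1, sec c q.2)).1.1, (α.Φ c (q.1, sec c q.2)).2.1)
  have hy : α.Φ c (q.1, sec c q.2) = diagSqMap y :=
    Prod.ext (Prod.ext rfl hd1.symm) (Prod.ext rfl hd2.symm)
  -- Transversality is applied to a vector whose two differences are the components of `f`. Vectors
  -- tangent to `Δ_N × Δ_N` have zero differences and drop out.
  obtain ⟨ξ, τ, η, hτ, hw⟩ : ∃ (ξ : BaseSpace p) (τ : ℝ × ℝ) (η : TwoSpace n),
      τ ∈ faceDirections c.region (sec c q.2) ∧
      (((f.1, 0), (f.2, 0)) : TwoSpace n × TwoSpace n) =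
        mderWithin (ambientModel p) (fourModel n) (α.Φ c) (univ ×ˢ c.region) (q.1, sec c q.2) (ξ, τ)
        + mder ((𝓡 n).prod (𝓡 n)) (fourModel n) diagSqMap y η :=
    hα c (q.1, sec c q.2) hr y hy (((f.1, 0), (f.2, 0)) : TwoSpace n × TwoSpace n)
  have hdiag : ∀ η : TwoSpace n, mder ((𝓡 n).prod (𝓡 n)) (fourModel n) diagSqMap y η =
      ((η.1, η.1), (η.2, η.2)) := by
    intro η
    have h1 : HasMFDerivAt ((𝓡 n).prod (𝓡 n)) (fourModel n) diagSqMap y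
        (((ContinuousLinearMap.fst ℝ _ _).prod (ContinuousLinearMap.fst ℝ _ _)).prod
          ((ContinuousLinearMap.snd ℝ _ _).prod (ContinuousLinearMap.snd ℝ _ _))) :=
      ((hasMFDerivAt_fst y).prodMk (hasMFDerivAt_fst y)).prodMk
        ((hasMFDerivAt_snd y).prodMk (hasMFDerivAt_snd y))
    rw [mder, h1.mfderiv]
    rfl
  refine ⟨ξ, (sec c).symm τ, by rw [ContinuousLinearEquiv.apply_symm_apply]; exact hτ, ?_⟩
  have h3 := hw
  rw [hdiag] at h3
  rw [dΦ_apply]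
  simp only [ContinuousLinearEquiv.apply_symm_apply]
  have h4 := congrArg (diffMap n) h3
  rw [map_add, diffMap_apply ((η.1, η.1), (η.2, η.2)), diffMap_apply ((f.1, 0), (f.2, 0))] at h4
  simp only [sub_self, sub_zero] at h4
  rw [← Prod.zero_eq_mk, add_zero] at h4
  exact h4.symm

end QuadraticLink

end Link

end CubicObstruction

/-! ### Local equations of the pieces; the image of `Z` is a fan -/

namespace CubicObstruction

open Set Filter Topology

section Components

variable {E : Type*} [NormedAddCommGroup E] [NormedSpace ℝ E] {H : Type*} [TopologicalSpace H]
  {I : ModelWithCorners ℝ E H} {M : Type*} [TopologicalSpace M] [ChartedSpace H M]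
  {E' : Type*} [NormedAddCommGroup E'] [NormedSpace ℝ E'] {H' : Type*} [TopologicalSpace H']
  {I' : ModelWithCorners ℝ E' H'} {M' : Type*} [TopologicalSpace M'] [ChartedSpace H' M']
  {E'' : Type*} [NormedAddCommGroup E''] [NormedSpace ℝ E''] {H'' : Type*} [TopologicalSpace H'']
  {I'' : ModelWithCorners ℝ E'' H''} {M'' : Type*} [TopologicalSpace M''] [ChartedSpace H'' M'']

theorem mder_fst_comp {f : M → M' × M''} {p : M} (hf : MDifferentiableAt I (I'.prod I'') f p)
    (v : E) : mder I I' (fun q => (f q).1) p v = (mder I (I'.prod I'') f p v).1 := by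
  have h : mder (I'.prod I'') I' Prod.fst (f p) = ContinuousLinearMap.fst ℝ E' E'' := mfderiv_fst
  rw [mder_comp (I' := I'.prod I'') (g := Prod.fst) mdifferentiableAt_fst hf, h]
  rfl

theorem mder_snd_comp {f : M → M' × M''} {p : M} (hf : MDifferentiableAt I (I'.prod I'') f p)
    (v : E) : mder I I'' (fun q => (f q).2) p v = (mder I (I'.prod I'') f p v).2 := by
  have h : mder (I'.prod I'') I'' Prod.snd (f p) = ContinuousLinearMap.snd ℝ E' E'' := mfderiv_snd
  rw [mder_comp (I' := I'.prod I'') (g := Prod.snd) mdifferentiableAt_snd hf, h]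
  rfl

theorem mder_extChartAt_injective [IsManifold I ∞ M] {x y : M} (hy : y ∈ (extChartAt I x).source) :
    Function.Injective (mder I 𝓘(ℝ, E) (extChartAt I x) y) :=
  have : IsManifold I 1 M := .of_le (n := ∞) (by simp)
  (isInvertible_mfderiv_extChartAt hy).injective

end Components

section Link

variable {P : Fin 3 → Type u} {p : Fin 3 → ℕ} {N : Type v} {n : ℕ}
  [∀ i, TopologicalSpace (P i)] [∀ i, ChartedSpace (EuclideanSpace ℝ (Fin (p i))) (P i)]
  [∀ i, IsManifold (𝓡 (p i)) ∞ (P i)]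
  [TopologicalSpace N] [ChartedSpace (EuclideanSpace ℝ (Fin n)) N] [IsManifold (𝓡 n) ∞ N]

/-- A piece in its coordinates `(s, t)`, in terms of the coordinates of the plane. -/
noncomputable def secMap (c : Piece) (q : Ambient P) : Ambient P := (q.1, sec c q.2)

theorem contMDiff_secMap (c : Piece) :
    ContMDiff (ambientModel p) (ambientModel p) ∞ (secMap c : Ambient P → Ambient P) :=
  contMDiff_fst.prodMk ((sec c).contDiff.contMDiff.comp contMDiff_snd)

theorem mder_secMap (c : Piece) (q : Ambient P) (v : BaseSpace p × (ℝ × ℝ)) :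
    mder (ambientModel p) (ambientModel p) (secMap c : Ambient P → Ambient P) q v =
      (v.1, sec c v.2) := by
  have h := (hasMFDerivAt_fst (I := baseModel p) (I' := 𝓘(ℝ, ℝ × ℝ)) q).prodMk
    ((sec c : (ℝ × ℝ) →L[ℝ] ℝ × ℝ).hasMFDerivAt.comp q
      (hasMFDerivAt_snd (I := baseModel p) (I' := 𝓘(ℝ, ℝ × ℝ)) q))
  exact DFunLike.congr_fun h.mfderiv v

namespace QuadraticLink

variable (α : QuadraticLink P p N n)

/-- The differential of a local extension of the map defining a piece. -/
theorem mder_extension {c : Piece} {f : Ambient P → (N × N) × (N × N)} {U : Set (Ambient P)}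
    (hU : IsOpen U) (hf : ContMDiffOn (ambientModel p) (fourModel n) ∞ f U)
    (hfe : ∀ q ∈ U, 0 ≤ q.2.1 → 0 ≤ q.2.2 → f q = α.Φ c q) {q : Ambient P} (hq : secMap c q ∈ U)
    (hr : sec c q.2 ∈ c.region) (v : BaseSpace p × (ℝ × ℝ)) :
    mder (ambientModel p) (fourModel n) (fun q => f (secMap c q)) q v = α.dΦ c q v := by
  have hfd := mdifferentiableAt_of_contMDiffOn hf hU hq
  have hm : secMap c q ∈ (univ : Set (Base P)) ×ˢ c.region := ⟨trivial, hr⟩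
  rw [mder_comp hfd ((contMDiff_secMap c q).mdifferentiableAt (by simp)), mder_secMap, dΦ_apply]
  have h1 : mfderivWithin (ambientModel p) (fourModel n) f (univ ×ˢ c.region) (secMap c q) =
      mfderiv (ambientModel p) (fourModel n) f (secMap c q) :=
    mfderivWithin_eq_mfderiv (uniqueMDiffOn_univ_prod_region c _ hm) hfd
  have h2 : α.Φ c =ᶠ[𝓝[univ ×ˢ c.region] (secMap c q)] f := by
    filter_upwards [self_mem_nhdsWithin, mem_nhdsWithin_of_mem_nhds (hU.mem_nhds hq)] with q' h1 h2
    have := region_nonneg (wall_nonneg h1.2)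
    exact (hfe q' h2 this.1 this.2).symm
  have h3 := h2.mfderivWithin_eq (I := ambientModel p) (I' := fourModel n) (h2.self_of_nhdsWithin hm)
  refine DFunLike.congr_fun (f := mder (ambientModel p) (fourModel n) f (secMap c q))
    (g := mderWithin (ambientModel p) (fourModel n) (α.Φ c) (univ ×ˢ c.region) (secMap c q)) ?_ _
  exact h1.symm.trans h3.symm

/-- The local equations of the pieces. -/
theorem exists_localEquation {c : Piece} {q₀ : Ambient P} (hq₀ : q₀ ∈ α.fan)
    (hc₀ : q₀.2 ∈ sector c) :
    ∃ (F : Ambient P → TwoSpace n) (U : Set (Ambient P)), q₀ ∈ U ∧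
      LocalEquation (ambientModel p) α.fan {q | q.2 ∈ sector c} (α.tangentPiece c) F U ∧
      ∀ v, mder (ambientModel p) 𝓘(ℝ, TwoSpace n) F q₀ v = diffMap n (α.dΦ c q₀ v) := by
  have hp₀ : secMap c q₀ ∈ α.piece c := (α.mem_fan_iff hc₀).1 hq₀
  obtain ⟨f, U₀, hU₀, hqU₀, hf, hfe⟩ := α.exists_local_extension_Φ c _ hp₀.1
    (α.lt_one_of_mem_piece hp₀)
  have hn₀ := region_nonneg (wall_nonneg hp₀.1)
  have hf₀ := hfe _ hqU₀ hn₀.1 hn₀.2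
  have hs := contMDiff_secMap (P := P) (p := p) c
  let k : Ambient P → (N × N) × (N × N) := fun q => f (secMap c q)
  let V₀ : Set (Ambient P) := secMap c ⁻¹' U₀
  have hV₀ : IsOpen V₀ := hU₀.preimage hs.continuous
  have hk : ContMDiffOn (ambientModel p) (fourModel n) ∞ k V₀ :=
    hf.comp hs.contMDiffOn fun q hq => hq
  let ψ₁ := extChartAt (𝓡 n) (k q₀).1.1
  let ψ₂ := extChartAt (𝓡 n) (k q₀).2.1
  have hψ₁ : ContMDiffOn (𝓡 n) 𝓘(ℝ, EuclideanSpace ℝ (Fin n)) ∞ ψ₁ ψ₁.source := by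
    rw [extChartAt_source]; exact contMDiffOn_extChartAt
  have hψ₂ : ContMDiffOn (𝓡 n) 𝓘(ℝ, EuclideanSpace ℝ (Fin n)) ∞ ψ₂ ψ₂.source := by
    rw [extChartAt_source]; exact contMDiffOn_extChartAt
  have hψ₁s : IsOpen ψ₁.source := isOpen_extChartAt_source _
  have hψ₂s : IsOpen ψ₂.source := isOpen_extChartAt_source _
  let B : Set ((N × N) × (N × N)) := (ψ₁.source ×ˢ ψ₁.source) ×ˢ (ψ₂.source ×ˢ ψ₂.source)
  have hB : IsOpen B := (hψ₁s.prod hψ₁s).prod (hψ₂s.prod hψ₂s)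
  -- Each pair of components stays in one chart of `N`, so lying on the diagonal becomes the
  -- vanishing of a difference. With both times below `1`, lying in the sector is the same as lying
  -- in the region.
  let V : Set (Ambient P) := (V₀ ∩ k ⁻¹' B) ∩ {q | (sec c q.2).1 < 1 ∧ (sec c q.2).2 < 1}
  have hsc : Continuous fun q : Ambient P => sec c q.2 := (sec c).continuous.comp continuous_snd
  have hV : IsOpen V := (hk.continuousOn.isOpen_inter_preimage hV₀ hB).inter
    ((isOpen_lt (continuous_fst.comp hsc) continuous_const).inter
      (isOpen_lt (continuous_snd.comp hsc) continuous_const))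
  have hkΦ : ∀ q ∈ V, q.2 ∈ sector c → sec c q.2 ∈ c.region ∧ k q = α.Φ c (secMap c q) := by
    intro q hq hc
    have h1 := region_nonneg hc
    exact ⟨(mem_region_iff hq.2.1.le hq.2.2.le).2 hc, hfe _ hq.1.1 h1.1 h1.2⟩
  have hd₀ : (k q₀).1.1 = (k q₀).1.2 ∧ (k q₀).2.1 = (k q₀).2.2 := by
    have := hp₀.2
    rw [← hf₀] at this
    exact this
  have hqV : q₀ ∈ V := by
    have h1 : (k q₀).1.1 ∈ ψ₁.source := mem_extChartAt_source _
    have h2 : (k q₀).2.1 ∈ ψ₂.source := mem_extChartAt_source _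
    exact ⟨⟨hqU₀, ⟨h1, hd₀.1 ▸ h1⟩, h2, hd₀.2 ▸ h2⟩, α.lt_one_of_mem_piece hp₀⟩
  have hkV : ContMDiffOn (ambientModel p) (fourModel n) ∞ k V :=
    hk.mono (inter_subset_left.trans inter_subset_left)
  have h11 : ContMDiffOn (ambientModel p) (𝓡 n) ∞ (fun q => (k q).1.1) V :=
    (contMDiff_fst.comp contMDiff_fst).comp_contMDiffOn hkV
  have h12 : ContMDiffOn (ambientModel p) (𝓡 n) ∞ (fun q => (k q).1.2) V :=
    (contMDiff_snd.comp contMDiff_fst).comp_contMDiffOn hkV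
  have h21 : ContMDiffOn (ambientModel p) (𝓡 n) ∞ (fun q => (k q).2.1) V :=
    (contMDiff_fst.comp contMDiff_snd).comp_contMDiffOn hkV
  have h22 : ContMDiffOn (ambientModel p) (𝓡 n) ∞ (fun q => (k q).2.2) V :=
    (contMDiff_snd.comp contMDiff_snd).comp_contMDiffOn hkV
  have s11 := hψ₁.comp h11 fun q hq => hq.1.2.1.1
  have s12 := hψ₁.comp h12 fun q hq => hq.1.2.1.2
  have s21 := hψ₂.comp h21 fun q hq => hq.1.2.2.1
  have s22 := hψ₂.comp h22 fun q hq => hq.1.2.2.2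
  let F₀ : Ambient P → TwoSpace n × TwoSpace n := fun q =>
    ((ψ₁ (k q).1.1, ψ₁ (k q).1.2), (ψ₂ (k q).2.1, ψ₂ (k q).2.2))
  have hF₀ : ContMDiffOn (ambientModel p) 𝓘(ℝ, TwoSpace n × TwoSpace n) ∞ F₀ V :=
    (s11.prodMk_space s12).prodMk_space (s21.prodMk_space s22)
  have hFd : ∀ q ∈ V, q.2 ∈ sector c → ∀ v,
      mder (ambientModel p) 𝓘(ℝ, TwoSpace n) (fun q => diffMap n (F₀ q)) q v = diffMap n
        ((mder (𝓡 n) 𝓘(ℝ, EuclideanSpace ℝ (Fin n)) ψ₁ (k q).1.1 (α.dΦ c q v).1.1,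
          mder (𝓡 n) 𝓘(ℝ, EuclideanSpace ℝ (Fin n)) ψ₁ (k q).1.2 (α.dΦ c q v).1.2),
         (mder (𝓡 n) 𝓘(ℝ, EuclideanSpace ℝ (Fin n)) ψ₂ (k q).2.1 (α.dΦ c q v).2.1,
          mder (𝓡 n) 𝓘(ℝ, EuclideanSpace ℝ (Fin n)) ψ₂ (k q).2.2 (α.dΦ c q v).2.2)) := by
    intro q hq hc v
    have hkd : MDifferentiableAt (ambientModel p) (fourModel n) k q :=
      mdifferentiableAt_of_contMDiffOn hkV hV hq
    have hA : mder (ambientModel p) (fourModel n) k q v = α.dΦ c q v :=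
      α.mder_extension hU₀ hf hfe hq.1.1 (hkΦ q hq hc).1 v
    have hk1 : MDifferentiableAt (ambientModel p) ((𝓡 n).prod (𝓡 n)) (fun q => (k q).1) q :=
      mdifferentiableAt_fst.comp q hkd
    have hk2 : MDifferentiableAt (ambientModel p) ((𝓡 n).prod (𝓡 n)) (fun q => (k q).2) q :=
      mdifferentiableAt_snd.comp q hkd
    have a11 := mder_comp (I'' := 𝓘(ℝ, EuclideanSpace ℝ (Fin n))) (f := fun q => (k q).1.1)
      (mdifferentiableAt_of_contMDiffOn hψ₁ hψ₁s hq.1.2.1.1)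
      (mdifferentiableAt_of_contMDiffOn h11 hV hq) v
    have a12 := mder_comp (I'' := 𝓘(ℝ, EuclideanSpace ℝ (Fin n))) (f := fun q => (k q).1.2)
      (mdifferentiableAt_of_contMDiffOn hψ₁ hψ₁s hq.1.2.1.2)
      (mdifferentiableAt_of_contMDiffOn h12 hV hq) v
    have a21 := mder_comp (I'' := 𝓘(ℝ, EuclideanSpace ℝ (Fin n))) (f := fun q => (k q).2.1)
      (mdifferentiableAt_of_contMDiffOn hψ₂ hψ₂s hq.1.2.2.1)
      (mdifferentiableAt_of_contMDiffOn h21 hV hq) v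
    have a22 := mder_comp (I'' := 𝓘(ℝ, EuclideanSpace ℝ (Fin n))) (f := fun q => (k q).2.2)
      (mdifferentiableAt_of_contMDiffOn hψ₂ hψ₂s hq.1.2.2.2)
      (mdifferentiableAt_of_contMDiffOn h22 hV hq) v
    rw [mder_fst_comp hk1, mder_fst_comp hkd, hA] at a11
    rw [mder_snd_comp hk1, mder_fst_comp hkd, hA] at a12
    rw [mder_fst_comp hk2, mder_snd_comp hkd, hA] at a21
    rw [mder_snd_comp hk2, mder_snd_comp hkd, hA] at a22
    rw [mder_clm_comp (diffMap n) (mdifferentiableAt_of_contMDiffOn hF₀ hV hq), ← a11, ← a12, ← a21, ← a22]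
    have hp := mder_prodMk (mdifferentiableAt_of_contMDiffOn (s11.prodMk_space s12) hV hq)
      (mdifferentiableAt_of_contMDiffOn (s21.prodMk_space s22) hV hq)
    rw [mder_prodMk (mdifferentiableAt_of_contMDiffOn s11 hV hq)
        (mdifferentiableAt_of_contMDiffOn s12 hV hq),
      mder_prodMk (mdifferentiableAt_of_contMDiffOn s21 hV hq)
        (mdifferentiableAt_of_contMDiffOn s22 hV hq)] at hp
    exact congrArg (diffMap n) (DFunLike.congr_fun hp v)
  refine ⟨fun q => diffMap n (F₀ q), V, hqV, ⟨hV, (diffMap n).contMDiff.comp_contMDiffOn hF₀,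
    fun q hq hc => ?_, fun q hq hc hqS v => ?_⟩, fun v => ?_⟩
  · rw [α.mem_fan_iff hc]
    obtain ⟨h1, h2⟩ := hkΦ q hq hc
    have h3 : (q.1, sec c q.2) ∈ α.piece c ↔ (k q).1.1 = (k q).1.2 ∧ (k q).2.1 = (k q).2.2 := by
      rw [h2]
      exact ⟨fun h => h.2, fun h => ⟨h1, h⟩⟩
    rw [h3, diffMap_apply, Prod.mk_eq_zero, sub_eq_zero, sub_eq_zero]
    exact and_congr ⟨fun h => congrArg ψ₁ h, fun h => ψ₁.injOn hq.1.2.1.1 hq.1.2.1.2 h⟩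
      ⟨fun h => congrArg ψ₂ h, fun h => ψ₂.injOn hq.1.2.2.1 hq.1.2.2.2 h⟩
  · obtain ⟨h1, h2⟩ := hkΦ q hq hc
    have h3 : (k q).1.1 = (k q).1.2 ∧ (k q).2.1 = (k q).2.2 := by
      rw [h2]; exact ((α.mem_fan_iff hc).1 hqS).2
    rw [hFd q hq hc, mem_tangentPiece, ← h3.1, ← h3.2, diffMap_apply, diffMap_apply,
      Prod.mk_eq_zero, Prod.mk_eq_zero, sub_eq_zero, sub_eq_zero, sub_eq_zero, sub_eq_zero]
    exact and_congr (mder_extChartAt_injective hq.1.2.1.1).eq_iff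
      (mder_extChartAt_injective hq.1.2.2.1).eq_iff
  -- The charts are centred at the point considered, where their differentials are the identity of
  -- the model space.
  · have e1 : ∀ v, mder (𝓡 n) 𝓘(ℝ, EuclideanSpace ℝ (Fin n)) ψ₁ (k q₀).1.1 v = v := fun v => by
      have : IsManifold (𝓡 n) 1 N := .of_le (n := ∞) (by simp)
      rw [mder, mfderiv_extChartAt_self]; rfl
    have e2 : ∀ v, mder (𝓡 n) 𝓘(ℝ, EuclideanSpace ℝ (Fin n)) ψ₂ (k q₀).2.1 v = v := fun v => by
      have : IsManifold (𝓡 n) 1 N := .of_le (n := ∞) (by simp)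
      rw [mder, mfderiv_extChartAt_self]; rfl
    rw [hFd q₀ hqV hc₀, ← hd₀.1, ← hd₀.2, e1, e1, e2, e2]

variable [T2Space N] [∀ i, CompactSpace (P i)] [∀ i, T2Space (P i)]

/-- The image of the glued space is a fan. -/
theorem isFan (hα : α.IsTransverse) :
    ∃ u, IsFan (baseModel p) (TwoSpace n) α.fan sector α.tangentPiece rayPos rayEq u := by
  choose u hu using exists_ray_vector
  -- All three kinds of strata are handled together: the stratum function is a linear map of the
  -- plane coordinate which annihilates the face directions at the point.
  have hst : ∀ {T : Type} [NormedAddCommGroup T] [NormedSpace ℝ T] (t : (ℝ × ℝ) →L[ℝ] T)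
      (ht : Function.Surjective t) (q : Ambient P) (hq : q ∈ α.fan) (h0 : t q.2 = 0)
      (hface : ∀ c τ, q.2 ∈ sector c → sec c τ ∈ faceDirections c.region (sec c q.2) → t τ = 0)
      (O : Set (ℝ × ℝ)) (hO : O ∈ 𝓝 q.2)
      (hnear : ∀ w ∈ O, ∀ w' ∈ O, t w = t w' → ∀ c, w ∈ sector c → w' ∈ sector c),
      StratumPoint (ambientModel p) (TwoSpace n) α.fan (fun c => {p | p.2 ∈ sector c})
        α.tangentPiece (fun q => t q.2) q := by
    intro T _ _ t ht q hq h0 hface O hO hnear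
    refine ⟨hq, h0, ⟨Prod.snd ⁻¹' O, continuous_snd.continuousAt.preimage_mem_nhds hO,
      fun p hp p' hp' h c hc => hnear _ hp _ hp' h c hc⟩, fun c hc => ?_⟩
    obtain ⟨F, U, hqU, hF, hFd⟩ := α.exists_localEquation hq hc
    refine ⟨F, U, hqU, hF, fun τ f => ?_⟩
    have htd : ∀ v : BaseSpace p × (ℝ × ℝ),
        mder (ambientModel p) 𝓘(ℝ, T) (fun q : Ambient P => t q.2) q v = t v.2 := fun v =>
      DFunLike.congr_fun (t.hasMFDerivAt.comp q
        (hasMFDerivAt_snd (I := baseModel p) (I' := 𝓘(ℝ, ℝ × ℝ)) q)).mfderiv v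
    obtain ⟨w, hw⟩ := ht τ
    -- The vector `(0, w)` realizes the value of `t`. The error in the equations is then corrected
    -- by a vector whose plane component is a face direction, on which `t` vanishes.
    obtain ⟨ξ, τ', hτ', hξ⟩ := IsTransverse.exists_face α hα ((α.mem_fan_iff hc).1 hq)
      (f - diffMap n (α.dΦ c q (0, w)))
    refine ⟨((0, w) : BaseSpace p × (ℝ × ℝ)) + (ξ, τ'), ?_, ?_⟩
    · rw [htd]
      change t (w + τ') = τ
      rw [map_add, hw, hface c τ' hc hτ', add_zero]
    · rw [hFd, map_add, map_add, hξ]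
      abel
  refine ⟨u, α.isCompact_fan, isClosed_sector, sector_cover, fun k => (hu k).1, fun k => (hu k).2,
    fun k w h1 _ => ray_eq_smul (hu k) h1, fun k l hkl w h1 h2 h3 h4 => ray_disjoint hkl h1 h2 h3 h4,
    fun k => ?_, fun w hw hk => (sector_eventually_of_generic hw hk).1, fun q hq h0 => ?_,
    fun k q hq h1 h2 => ?_, fun q hq hw hk => ?_⟩
  · obtain ⟨c, _, _, hc⟩ := exists_ray_sectors k
    exact ⟨c, fun w h1 h2 => (hc w h1 h2).1⟩
  · refine hst (ContinuousLinearMap.id ℝ (ℝ × ℝ)) Function.surjective_id q hq h0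
      (fun c τ _ hτ => ?_) univ univ_mem fun w _ w' _ h c hc => ?_
    · rw [h0, map_zero] at hτ
      have := faceDirection_eq_zero hτ
      exact (sec c).injective (this.trans (map_zero _).symm)
    · have h : w = w' := h
      rwa [← h]
  · obtain ⟨O, hO, hOn⟩ := sector_eventually_iff_of_ray h1 h2
    refine hst (rayEq k) (fun r => ?_) q hq h1
      (fun c τ hc hτ => rayEq_eq_zero_of_faceDirection h1 h2 hc hτ) O hO hOn
    obtain ⟨w, hw⟩ : ∃ w, rayEq k w ≠ 0 := by
      by_contra hcon
      push Not at hcon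
      obtain ⟨w, hw, hw0⟩ : ∃ w : ℝ × ℝ, w ≠ 0 ∧ rayPos k w = 0 := by
        by_cases h : rayPos k (1, 0) = 0
        · exact ⟨(1, 0), by simp, h⟩
        · refine ⟨(0, 1) - (rayPos k (0, 1) / rayPos k (1, 0)) • (1, 0), fun h0 => ?_, ?_⟩
          · have := congrArg Prod.snd h0
            simp at this
          · rw [map_sub, map_smul, smul_eq_mul, div_mul_cancel₀ _ h, sub_self]
      exact hw (ray_injective k hw0 (hcon w))
    exact ⟨(r / rayEq k w) • w, by rw [map_smul, smul_eq_mul, div_mul_cancel₀ _ hw]⟩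
  · obtain ⟨O, hO, hOn⟩ := (sector_eventually_of_generic hw hk).2
    exact hst (0 : (ℝ × ℝ) →L[ℝ] (Fin 0 → ℝ)) (fun r => ⟨0, Subsingleton.elim _ _⟩) q hq rfl
      (fun _ _ _ _ => rfl) O hO fun w hw w' hw' _ => hOn w hw w' hw'

end QuadraticLink

end Link

end CubicObstruction

/-! ### The smooth structure of `Z` -/

namespace CubicObstruction

open Set Filter Topology

section Link

variable {P : Fin 3 → Type u} {p : Fin 3 → ℕ} {N : Type v} {n : ℕ}
  [∀ i, TopologicalSpace (P i)] [∀ i, ChartedSpace (EuclideanSpace ℝ (Fin (p i))) (P i)]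
  [∀ i, IsManifold (𝓡 (p i)) ∞ (P i)]
  [TopologicalSpace N] [ChartedSpace (EuclideanSpace ℝ (Fin n)) N] [IsManifold (𝓡 n) ∞ N]

theorem finrank_baseSpace_prod (p : Fin 3 → ℕ) :
    Module.finrank ℝ (BaseSpace p × (ℝ × ℝ)) = p 0 + p 1 + p 2 + 2 := by
  simp only [Module.finrank_prod, finrank_euclideanSpace_fin, Module.finrank_self]
  omega

theorem finrank_twoSpace (n : ℕ) : Module.finrank ℝ (TwoSpace n) = 2 * n := by
  simp only [Module.finrank_prod, finrank_euclideanSpace_fin]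
  omega

namespace QuadraticLink

variable (α : QuadraticLink P p N n)

/-- At a point of a piece, transversality gives a linear surjection from the ambient tangent space
to a space of dimension `2n`. -/
theorem isEmpty_Z (hα : α.IsTransverse) (h : p 0 + p 1 + p 2 + 2 < 2 * n) : IsEmpty α.Z := by
  refine ⟨fun z => ?_⟩
  obtain ⟨c, q, -⟩ := α.exists_toZ z
  have hq : (q.1.1, sec c ((sec c).symm q.1.2)) ∈ α.piece c := by
    rw [ContinuousLinearEquiv.apply_symm_apply]; exact q.2
  have hs : Function.Surjective
      (((diffMap n).comp (α.dΦ c (q.1.1, (sec c).symm q.1.2))).toLinearMap) := fun f => by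
    obtain ⟨ξ, τ, -, hf⟩ := IsTransverse.exists_face α hα (q := (q.1.1, (sec c).symm q.1.2)) hq f
    exact ⟨(ξ, τ), hf⟩
  have := LinearMap.finrank_le_finrank_of_surjective hs
  rw [finrank_baseSpace_prod, finrank_twoSpace] at this
  omega

variable [T2Space N] [∀ i, CompactSpace (P i)] [∀ i, T2Space (P i)]

/-- `r` is a smooth retraction of a neighbourhood of the fan to `Z`, which near the vertex stratum is
compatible with the projection to the plane, and near each ray with the equation of the ray. -/
structure IsResolution (d : ℕ) [ChartedSpace (EuclideanSpace ℝ (Fin d)) α.Z]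
    (r : Ambient P → α.Z) (U OV : Set (Ambient P)) (OR : Piece → Set (Ambient P)) : Prop where
  isOpen : IsOpen U
  subset : α.fan ⊆ U
  smooth : ContMDiffOn (ambientModel p) (𝓡 d) ∞ r U
  r_emb : ∀ z, r (α.emb z) = z
  ker_inter : ∀ c z, (α.emb z).2 ∈ sector c → ∀ v, mder (ambientModel p) (𝓡 d) r (α.emb z) v = 0 →
    v ∈ α.tangentPiece c (α.emb z) → v = 0
  isOpen_vertex : IsOpen OV
  isOpen_ray : ∀ k, IsOpen (OR k)
  vertex_mem : ∀ z, (α.emb z).2 = 0 → α.emb z ∈ OV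
  ray_mem : ∀ k z, rayEq k (α.emb z).2 = 0 → 0 < rayPos k (α.emb z).2 → α.emb z ∈ OV ∪ OR k
  ker_vertex : ∀ z, α.emb z ∈ OV → ∀ v, mder (ambientModel p) (𝓡 d) r (α.emb z) v = 0 → v.2 = 0
  ker_ray : ∀ k z, α.emb z ∈ OR k → ∀ v, mder (ambientModel p) (𝓡 d) r (α.emb z) v = 0 →
    rayEq k v.2 = 0

/-- The smooth structure of `Z`. -/
theorem exists_isResolution [Nonempty α.Z] (hα : α.IsTransverse) {d : ℕ}
    (hd : d + 2 * n = p 0 + p 1 + p 2 + 2) :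
    ∃ (_ : ChartedSpace (EuclideanSpace ℝ (Fin d)) α.Z) (_ : IsManifold (𝓡 d) ∞ α.Z)
      (r : Ambient P → α.Z) (U OV : Set (Ambient P)) (OR : Piece → Set (Ambient P)),
      (∀ c, IsDiffeoOntoImage p d (α.piece c) (α.toZ c)) ∧ α.IsResolution d r U OV OR := by
  obtain ⟨u, hfan⟩ := α.isFan hα
  have hdim : Module.finrank ℝ (EuclideanSpace ℝ (Fin d)) + Module.finrank ℝ (TwoSpace n) =
      Module.finrank ℝ (BaseSpace p × (ℝ × ℝ)) := by
    rw [finrank_baseSpace_prod, finrank_twoSpace, finrank_euclideanSpace_fin, hd]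
  have hlc : ∀ i, LocallyCompactSpace (P i) := fun i => inferInstance
  obtain ⟨ρ, U, OV, OR, hU, hSU, hρc, hρS, hρ, hOV, hOR, hvm, hrm, hch, hchV, hchR⟩ :=
    hfan.exists_retraction (EG := EuclideanSpace ℝ (Fin d)) hdim
  have hcov : ∀ q : Ambient P, ∃ c, q ∈ (fun c => {q : Ambient P | q.2 ∈ sector c}) c :=
    fun q => sector_cover q.2
  have hS : ∀ z, α.emb z ∈ α.fan := fun z => α.range_emb ▸ mem_range_self z
  obtain ⟨cs, hman, r, U', hU', hSU', hr, hrz, hGj, hGker⟩ := exists_smooth_structure hcov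
    α.isEmbedding_emb α.range_emb hSU hρc hρS hρ hch
  have hmz : ∀ z {G : Ambient P → EuclideanSpace ℝ (Fin d)} {O : Set (Ambient P)},
      AdaptedChart (ambientModel p) (TwoSpace n) α.fan (fun c => {q : Ambient P | q.2 ∈ sector c})
        α.tangentPiece ρ U (α.emb z) G O → MDifferentiableAt (ambientModel p) (𝓡 d) G (α.emb z) :=
    fun z G O h => mdifferentiableAt_of_contMDiffOn h.proj.smooth h.proj.isOpen h.proj.mem
  refine ⟨cs, hman, r, U', OV, OR, fun c => ⟨fun q => ?_, fun q => ?_⟩, hU', hSU', hr, hrz,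
    fun c z hz v hv hvt => ?_, hOV, hOR, fun z => hvm _ (hS z), fun k z => hrm k _ (hS z),
    fun z hz v hv => ?_, fun k z hz v hv => ?_⟩
  · have hk : ContMDiff (ambientModel p) (ambientModel p) ∞
        (fun q : Ambient P => (q.1, (sec c).symm q.2)) :=
      contMDiff_fst.prodMk ((sec c).symm.contDiff.contMDiff.comp contMDiff_snd)
    refine ⟨(fun q : Ambient P => (q.1, (sec c).symm q.2)) ⁻¹' U',
      fun q => r (q.1, (sec c).symm q.2), hU'.preimage hk.continuous, ?_,
      hr.comp hk.contMDiffOn fun q hq => hq, fun q' _ => ?_⟩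
    · exact hSU' (hS (α.toZ c q))
    · exact hrz (α.toZ c q')
  · have hsec : ∀ q : α.piece c, (α.emb (α.toZ c q)).2 ∈ sector c := fun q =>
      α.mem_sector_of_mem_piece q.2
    obtain ⟨G, O, hG⟩ := hch _ (hS (α.toZ c q))
    obtain ⟨F, e, hOe, he, hF, hes⟩ := hG.proj.eqs c (hsec q)
    have hpt : ∀ q' : α.piece c, α.emb (α.toZ c q') ∈ O →
        e (α.emb (α.toZ c q')) = (G (α.emb (α.toZ c q')), 0) := fun q' h => by
      rw [he _ (hOe h), (hF.mem_iff _ (hOe h) (hsec q')).1 (hS _)]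
    have hi : ContMDiff 𝓘(ℝ, EuclideanSpace ℝ (Fin d))
        𝓘(ℝ, EuclideanSpace ℝ (Fin d) × TwoSpace n) ∞ fun y => (y, (0 : TwoSpace n)) :=
      ContDiff.contMDiff (by fun_prop)
    have hGj' := hi.comp_contMDiffOn (hGj _ G O hG)
    -- On the piece the equation of its own sector vanishes, so the chart value together with zero
    -- recovers the point smoothly. Other sectors may give values off the fan, which is irrelevant
    -- for a local extension.
    refine ⟨α.emb ⁻¹' O ∩ (fun z => (G (α.emb z), (0 : TwoSpace n))) ⁻¹' e.target,
      fun z => secMap c (e.symm (G (α.emb z), 0)),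
      hGj'.continuousOn.isOpen_inter_preimage (hG.proj.isOpen.preimage α.continuous_emb)
        e.open_target, ⟨hG.proj.mem, ?_⟩, ?_, fun q' hq' => ?_⟩
    · rw [mem_preimage, ← hpt q hG.proj.mem]
      exact e.map_source (hOe hG.proj.mem)
    · exact (contMDiff_secMap c).comp_contMDiffOn
        (hes.comp (hGj'.mono inter_subset_left) fun z hz => hz.2)
    · change secMap c (e.symm (G (α.emb (α.toZ c q')), 0)) = _
      rw [← hpt q' hq'.1, e.left_inv (hOe hq'.1), α.emb_toZ, secMap]
      simp
  · obtain ⟨G, O, hG⟩ := hch _ (hS z)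
    obtain ⟨F, e, hOe, he, hF, hes⟩ := hG.proj.eqs c hz
    have hze := hOe hG.proj.mem
    have h1 := hGker z G O hG v hv
    have h2 := (hF.ker_eq _ hze hz (hS z) v).2 hvt
    have hFd := mdifferentiableAt_of_contMDiffOn hF.smooth e.open_source hze
    -- The kernel of `dr` lies in that of `dG`, and the tangent space of the piece is the kernel of
    -- `dF`; as `(G, F)` is a local diffeomorphism, a vector in both is zero.
    have h3 : mder (ambientModel p) 𝓘(ℝ, EuclideanSpace ℝ (Fin d) × TwoSpace n) e (α.emb z) v =
        0 := by
      have : ∀ᶠ q in 𝓝 (α.emb z), e q = (G q, F q) := by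
        filter_upwards [e.open_source.mem_nhds hze] with q hq using he q hq
      rw [mder_congr (I' := 𝓘(ℝ, EuclideanSpace ℝ (Fin d) × TwoSpace n)) this,
        mder_prodMk (hmz z hG) hFd]
      exact Prod.ext h1 h2
    have hsd : MDifferentiableAt 𝓘(ℝ, EuclideanSpace ℝ (Fin d) × TwoSpace n) (ambientModel p)
        e.symm (e (α.emb z)) :=
      mdifferentiableAt_of_contMDiffOn hes e.open_target (e.map_source hze)
    have hed : MDifferentiableAt (ambientModel p) 𝓘(ℝ, EuclideanSpace ℝ (Fin d) × TwoSpace n)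
        e (α.emb z) := by
      refine MDifferentiableAt.congr_of_eventuallyEq
        ((hmz z hG).prodMk_space hFd) ?_
      filter_upwards [e.open_source.mem_nhds hze] with q hq using he q hq
    have h4 := mder_comp (I := ambientModel p) (I'' := ambientModel p) hsd hed v
    rw [h3, map_zero] at h4
    have h5 : ∀ᶠ q in 𝓝 (α.emb z), e.symm (e q) = id q := by
      filter_upwards [e.open_source.mem_nhds hze] with q hq using e.left_inv hq
    rw [mder_congr (I := ambientModel p) (I' := ambientModel p) h5] at h4
    have h6 : mder (ambientModel p) (ambientModel p) (id : Ambient P → Ambient P) (α.emb z) =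
      ContinuousLinearMap.id ℝ _ := mfderiv_id
    rw [h6] at h4
    exact h4
  · obtain ⟨G, O, hG, L, hL⟩ := hchV _ ⟨hS z, hz⟩
    have h1 := hGker z G O hG v hv
    have h2 := mder_clm_comp L (hmz z hG)
    have h3 : ∀ᶠ q in 𝓝 (α.emb z), L (G q) = q.2 := by
      filter_upwards [hG.proj.isOpen.mem_nhds hG.proj.mem] with q hq using hL q hq
    rw [mder_congr (I' := 𝓘(ℝ, ℝ × ℝ)) h3] at h2
    have h4 : mder (ambientModel p) 𝓘(ℝ, ℝ × ℝ) (fun q : Ambient P => q.2) (α.emb z) =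
      ContinuousLinearMap.snd ℝ _ _ := mfderiv_snd
    rw [h4] at h2
    have := DFunLike.congr_fun h2 v
    exact this.trans ((congrArg L h1).trans (map_zero L))
  · obtain ⟨G, O, hG, L, hL⟩ := hchR k _ ⟨hS z, hz⟩
    have h1 := hGker z G O hG v hv
    have h2 := mder_clm_comp L (hmz z hG)
    have h3 : ∀ᶠ q in 𝓝 (α.emb z), L (G q) = rayEq k q.2 := by
      filter_upwards [hG.proj.isOpen.mem_nhds hG.proj.mem] with q hq using hL q hq
    rw [mder_congr (I' := 𝓘(ℝ, ℝ)) h3, mder_clm_comp (I := ambientModel p) (rayEq k)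
      (f := fun q : Ambient P => q.2) mdifferentiableAt_snd] at h2
    have h4 : mder (ambientModel p) 𝓘(ℝ, ℝ × ℝ) (fun q : Ambient P => q.2) (α.emb z) =
      ContinuousLinearMap.snd ℝ _ _ := mfderiv_snd
    rw [h4] at h2
    have := DFunLike.congr_fun h2 v
    exact this.trans ((congrArg L h1).trans (map_zero L))

end QuadraticLink

end Link

end CubicObstruction

/-! ### Inverses of continuous isomorphisms of vector bundles -/

namespace CubicObstruction

open Set Filter Topology

section BundleMaps

variable {B F₁ F₂ : Type*} [TopologicalSpace B]
  [NormedAddCommGroup F₁] [NormedSpace ℝ F₁] [FiniteDimensional ℝ F₁]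
  [NormedAddCommGroup F₂] [NormedSpace ℝ F₂] [FiniteDimensional ℝ F₂]
  {E₁ E₂ : B → Type*}
  [∀ b, AddCommMonoid (E₁ b)] [∀ b, Module ℝ (E₁ b)] [∀ b, TopologicalSpace (E₁ b)]
  [∀ b, AddCommMonoid (E₂ b)] [∀ b, Module ℝ (E₂ b)] [∀ b, TopologicalSpace (E₂ b)]
  [TopologicalSpace (Bundle.TotalSpace F₁ E₁)] [TopologicalSpace (Bundle.TotalSpace F₂ E₂)]
  [FiberBundle F₁ E₁] [VectorBundle ℝ F₁ E₁] [FiberBundle F₂ E₂] [VectorBundle ℝ F₂ E₂]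

/-- The inverse of a continuous bijective homomorphism of vector bundles is continuous. -/
theorem continuous_bundle_symm (φ : ∀ b, E₁ b ≃ₗ[ℝ] E₂ b)
    (h : Continuous fun w : Bundle.TotalSpace F₁ E₁ =>
      (⟨w.proj, φ w.proj w.snd⟩ : Bundle.TotalSpace F₂ E₂)) :
    Continuous fun w : Bundle.TotalSpace F₂ E₂ =>
      (⟨w.proj, (φ w.proj).symm w.snd⟩ : Bundle.TotalSpace F₁ E₁) := by
  refine continuous_iff_continuousAt.2 fun w₀ => ?_
  let e₁ := trivializationAt F₁ E₁ w₀.proj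
  let e₂ := trivializationAt F₂ E₂ w₀.proj
  let U := e₁.baseSet ∩ e₂.baseSet
  have hU : IsOpen U := e₁.open_baseSet.inter e₂.open_baseSet
  have hw₀ : w₀.proj ∈ U := ⟨FiberBundle.mem_baseSet_trivializationAt' _,
    FiberBundle.mem_baseSet_trivializationAt' _⟩
  -- The family in local trivializations. In finite dimensions pointwise continuity gives continuity
  -- in operator norm, and inversion is continuous at invertible operators.
  let A : B → F₁ →L[ℝ] F₂ := fun b => LinearMap.toContinuousLinearMap
    (e₂.linearMapAt ℝ b ∘ₗ (φ b).toLinearMap ∘ₗ e₁.symmₗ ℝ b)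
  have hA : ∀ b ∈ U, ∀ v, A b v = (e₂ ⟨b, φ b (e₁.symm b v)⟩).2 := fun b hb v => by
    change e₂.linearMapAt ℝ b (φ b (e₁.symmₗ ℝ b v)) = _
    rw [e₁.symmₗ_apply hb.1, e₂.linearMapAt_apply, if_pos hb.2]
  have hAc : ContinuousOn A U := by
    refine continuousOn_clm_apply.2 fun v => ?_
    have h1 : ContinuousOn (fun b => (e₂ ⟨b, φ b (e₁.symm b v)⟩).2) U := by
      refine continuous_snd.comp_continuousOn (e₂.continuousOn.comp (h.comp_continuousOn
        (f := fun b => (⟨b, e₁.symm b v⟩ : Bundle.TotalSpace F₁ E₁)) ?_) fun b hb => ?_)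
      · exact e₁.continuousOn_symm.comp (f := fun b => (b, v)) (by fun_prop)
          fun b hb => ⟨hb.1, trivial⟩
      · exact e₂.mem_source.2 hb.2
    exact h1.congr fun b hb => hA b hb v
  let Ae : ∀ b, b ∈ U → F₁ ≃L[ℝ] F₂ := fun b hb => ((e₁.linearEquivAt ℝ b hb.1).symm.trans
    ((φ b).trans (e₂.linearEquivAt ℝ b hb.2))).toContinuousLinearEquiv
  have hAe : ∀ b (hb : b ∈ U), A b = Ae b hb := fun b hb => by
    ext v
    rw [hA b hb]
    rfl
  have hBc : ContinuousAt (fun b => ContinuousLinearMap.inverse (A b)) w₀.proj := by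
    have h1 := (contDiffAt_map_inverse (𝕜 := ℝ) (n := 0) (Ae _ hw₀)).continuousAt
    rw [← hAe _ hw₀] at h1
    exact h1.comp_of_eq (hAc.continuousAt (hU.mem_nhds hw₀)) rfl
  have hproj : ContinuousAt (Bundle.TotalSpace.proj : Bundle.TotalSpace F₂ E₂ → B) w₀ :=
    (FiberBundle.continuous_proj F₂ E₂).continuousAt
  have h2 : ContinuousAt (fun w : Bundle.TotalSpace F₂ E₂ => (e₂ w).2) w₀ :=
    continuous_snd.continuousAt.comp (e₂.continuousOn.continuousAt
      (e₂.open_source.mem_nhds (e₂.mem_source.2 hw₀.2)))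
  have h3 : ContinuousAt (fun w : Bundle.TotalSpace F₂ E₂ =>
      (w.proj, ContinuousLinearMap.inverse (A w.proj) (e₂ w).2)) w₀ :=
    hproj.prodMk ((hBc.comp hproj).clm_apply h2)
  have h4 := ContinuousAt.comp (f := fun w : Bundle.TotalSpace F₂ E₂ =>
      (w.proj, ContinuousLinearMap.inverse (A w.proj) (e₂ w).2))
    (g := fun x : B × F₁ => (⟨x.1, e₁.symm x.1 x.2⟩ : Bundle.TotalSpace F₁ E₁))
    (e₁.continuousOn_symm.continuousAt ((e₁.open_baseSet.prod isOpen_univ).mem_nhds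
      (show (w₀.proj, _) ∈ _ from ⟨hw₀.1, trivial⟩))) h3
  refine h4.congr ?_
  filter_upwards [hproj.preimage_mem_nhds (hU.mem_nhds hw₀)] with w hw
  have hw : w.proj ∈ U := hw
  have h5 : ContinuousLinearMap.inverse (A w.proj) (e₂ w).2 =
      (e₁.linearEquivAt ℝ w.proj hw.1) ((φ w.proj).symm w.snd) := by
    rw [hAe _ hw, ContinuousLinearMap.inverse_equiv]
    change (e₁.linearEquivAt ℝ w.proj hw.1) ((φ w.proj).symm
      ((e₂.linearEquivAt ℝ w.proj hw.2).symm (e₂.linearEquivAt ℝ w.proj hw.2 w.snd))) = _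
    rw [LinearEquiv.symm_apply_apply]
  simp only [Function.comp_apply, h5]
  congr 1
  exact (e₁.linearEquivAt ℝ w.proj hw.1).symm_apply_apply _

end BundleMaps

namespace QuadraticLink

variable {P : Fin 3 → Type u} {p : Fin 3 → ℕ} {N : Type v} {n : ℕ}
  [∀ i, TopologicalSpace (P i)] [∀ i, ChartedSpace (EuclideanSpace ℝ (Fin (p i))) (P i)]
  [∀ i, IsManifold (𝓡 (p i)) ∞ (P i)]
  [TopologicalSpace N] [ChartedSpace (EuclideanSpace ℝ (Fin n)) N] [IsManifold (𝓡 n) ∞ N]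
  (α : QuadraticLink P p N n)

/-- Pullbacks along the continuous maps `e` and `π_i` are vector bundles, so continuity in one
direction implies continuity in the other. -/
theorem tangentBundleIso_of_continuous {d : ℕ} [ChartedSpace (EuclideanSpace ℝ (Fin d)) α.Z]
    [IsManifold (𝓡 d) ∞ α.Z] (he : Continuous α.e)
    (hb : ∀ i, Continuous fun z => coord i (α.base z))
    (φ : ∀ z, α.targetBundle z ≃ₗ[ℝ]
      ((TangentSpace (𝓡 d) : α.Z → Type) ×ᵇ (α.pullTN ×ᵇ α.pullTN)) z)
    (h : Continuous fun w : Bundle.TotalSpace (TargetFibre p) α.targetBundle =>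
      (⟨w.proj, φ w.proj w.snd⟩ : Bundle.TotalSpace
        (EuclideanSpace ℝ (Fin d) × EuclideanSpace ℝ (Fin n) × EuclideanSpace ℝ (Fin n))
        ((TangentSpace (𝓡 d) : α.Z → Type) ×ᵇ (α.pullTN ×ᵇ α.pullTN)))) :
    α.TangentBundleIso d := by
  refine ⟨fun z => (φ z).symm, ?_, h⟩
  have : IsManifold (𝓡 d) 1 α.Z := .of_le (n := ∞) (by simp)
  have : IsManifold (𝓡 n) 1 N := .of_le (n := ∞) (by simp)
  have : ∀ i, IsManifold (𝓡 (p i)) 1 (P i) := fun i => .of_le (n := ∞) (by simp)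
  let ec : C(α.Z, N) := ⟨α.e, he⟩
  let bc : ∀ i, C(α.Z, P i) := fun i => ⟨fun z => coord i (α.base z), hb i⟩
  let i1 : FiberBundle (EuclideanSpace ℝ (Fin n)) α.pullTN :=
    FiberBundle.pullback (F := EuclideanSpace ℝ (Fin n)) (E := (TangentSpace (𝓡 n) : N → Type)) ec
  have i2 : VectorBundle ℝ (EuclideanSpace ℝ (Fin n)) α.pullTN :=
    VectorBundle.pullback (𝕜 := ℝ) (F := EuclideanSpace ℝ (Fin n))
      (E := (TangentSpace (𝓡 n) : N → Type)) ec
  let i3 : ∀ i, FiberBundle (EuclideanSpace ℝ (Fin (p i))) (α.pullTP i) := fun i =>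
    FiberBundle.pullback (F := EuclideanSpace ℝ (Fin (p i)))
      (E := (TangentSpace (𝓡 (p i)) : P i → Type)) (bc i)
  have i4 : ∀ i, VectorBundle ℝ (EuclideanSpace ℝ (Fin (p i))) (α.pullTP i) := fun i =>
    VectorBundle.pullback (𝕜 := ℝ) (F := EuclideanSpace ℝ (Fin (p i)))
      (E := (TangentSpace (𝓡 (p i)) : P i → Type)) (bc i)
  exact continuous_bundle_symm φ h

end QuadraticLink

end CubicObstruction

/-! ### Continuity into tangent bundles and reduction to the model fibres -/

namespace CubicObstruction

open Set Filter Topology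

section Tangent

variable {E : Type*} [NormedAddCommGroup E] [NormedSpace ℝ E] {H : Type*} [TopologicalSpace H]
  {I : ModelWithCorners ℝ E H} {M : Type*} [TopologicalSpace M] [ChartedSpace H M]
  {E' : Type*} [NormedAddCommGroup E'] [NormedSpace ℝ E'] {H' : Type*} [TopologicalSpace H']
  {I' : ModelWithCorners ℝ E' H'} {M' : Type*} [TopologicalSpace M'] [ChartedSpace H' M']

/-- The tangent vector `v` at `x`. -/
abbrev tvec (I : ModelWithCorners ℝ E H) {M : Type*} [TopologicalSpace M] [ChartedSpace H M]
    (x : M) (v : E) : TangentBundle I M := ⟨x, v⟩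

/-- Tangent vectors are carried as a base point with a vector of the model space, and continuity
always refers to the total space. Products are handled through the homeomorphism with the product of
the tangent bundles. -/
theorem continuous_tvec_prod [IsManifold I ∞ M] [IsManifold I' ∞ M'] {X : Type*}
    [TopologicalSpace X] {x : X → M} {v : X → E} {y : X → M'} {w : X → E'}
    (h1 : Continuous fun a => tvec I (x a) (v a)) (h2 : Continuous fun a => tvec I' (y a) (w a)) :
    Continuous fun a => tvec (I.prod I') (x a, y a) (v a, w a) := by
  have : IsManifold I 1 M := .of_le (n := ∞) (by simp)
  have : IsManifold I' 1 M' := .of_le (n := ∞) (by simp)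
  exact (contMDiff_equivTangentBundleProd_symm (n := 0)).continuous.comp (h1.prodMk h2)

theorem continuous_tvec_fst [IsManifold I ∞ M] [IsManifold I' ∞ M'] {X : Type*}
    [TopologicalSpace X] {x : X → M × M'} {v : X → E × E'}
    (h : Continuous fun a => tvec (I.prod I') (x a) (v a)) :
    Continuous fun a => tvec I (x a).1 (v a).1 := by
  have : IsManifold I 1 M := .of_le (n := ∞) (by simp)
  have : IsManifold I' 1 M' := .of_le (n := ∞) (by simp)
  exact continuous_fst.comp ((contMDiff_equivTangentBundleProd (n := 0)).continuous.comp h)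

theorem continuous_tvec_snd [IsManifold I ∞ M] [IsManifold I' ∞ M'] {X : Type*}
    [TopologicalSpace X] {x : X → M × M'} {v : X → E × E'}
    (h : Continuous fun a => tvec (I.prod I') (x a) (v a)) :
    Continuous fun a => tvec I' (x a).2 (v a).2 := by
  have : IsManifold I 1 M := .of_le (n := ∞) (by simp)
  have : IsManifold I' 1 M' := .of_le (n := ∞) (by simp)
  exact continuous_snd.comp ((contMDiff_equivTangentBundleProd (n := 0)).continuous.comp h)

theorem continuous_tvec_model {X : Type*} [TopologicalSpace X] {x v : X → E} :
    Continuous (fun a => tvec 𝓘(ℝ, E) (x a) (v a)) ↔ Continuous x ∧ Continuous v := by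
  have : IsInducing (tangentBundleModelSpaceHomeomorph 𝓘(ℝ, E)) := Homeomorph.isInducing _
  rw [this.continuous_iff]
  exact ⟨fun h => ⟨(continuous_fst (X := E) (Y := E)).comp h, (continuous_snd (X := E) (Y := E)).comp h⟩,
    fun h => h.1.prodMk h.2⟩

end Tangent

/-- A fibre of the target bundle as a tangent space of `P₁ × P₂ × P₃ × ℝ²`. -/
noncomputable def fibreEquiv (p : Fin 3 → ℕ) :
    QuadraticLink.TargetFibre p ≃ₗ[ℝ] BaseSpace p × (ℝ × ℝ) where
  toFun v := ((v.1, v.2.1, v.2.2.1), (v.2.2.2 0, v.2.2.2 1))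
  invFun v := (v.1.1, v.1.2.1, v.1.2.2, !₂[v.2.1, v.2.2])
  map_add' _ _ := rfl
  map_smul' _ _ := rfl
  left_inv v := by
    refine Prod.ext rfl (Prod.ext rfl (Prod.ext rfl ?_))
    ext i
    fin_cases i <;> rfl
  right_inv _ := rfl

namespace QuadraticLink

variable {P : Fin 3 → Type u} {p : Fin 3 → ℕ} {N : Type v} {n : ℕ}
  [∀ i, TopologicalSpace (P i)] [∀ i, ChartedSpace (EuclideanSpace ℝ (Fin (p i))) (P i)]
  [∀ i, IsManifold (𝓡 (p i)) ∞ (P i)]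
  [TopologicalSpace N] [ChartedSpace (EuclideanSpace ℝ (Fin n)) N] [IsManifold (𝓡 n) ∞ N]
  (α : QuadraticLink P p N n)

theorem emb_fst (z : α.Z) : (α.emb z).1 = α.base z := by
  obtain ⟨c, q, rfl⟩ := α.exists_toZ z
  rfl

theorem continuous_e : Continuous α.e := by
  refine continuous_quot_lift _ (continuous_sigma fun c => ?_)
  have h := fun i => (α.contMDiff_f_coord i).continuous.comp
    (continuous_fst.comp (continuous_subtype_val (p := fun q => q ∈ α.piece c)))
  rcases c with i | i | i
  exacts [h _, h _, h _]

theorem continuous_base : Continuous α.base := by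
  have := continuous_fst.comp α.continuous_emb
  exact this.congr α.emb_fst

/-- A vector bundle isomorphism from a family of isomorphisms of the model fibres. -/
theorem tangentBundleIso_of_model {d : ℕ} [ChartedSpace (EuclideanSpace ℝ (Fin d)) α.Z]
    [IsManifold (𝓡 d) ∞ α.Z]
    (Ψ : ∀ _ : α.Z, (BaseSpace p × (ℝ × ℝ)) ≃ₗ[ℝ] EuclideanSpace ℝ (Fin d) × TwoSpace n)
    (h : ∀ (X : Type u) [TopologicalSpace X] (z : X → α.Z) (v : X → BaseSpace p × (ℝ × ℝ)),
      Continuous z → Continuous (fun a => tvec (ambientModel p) (α.emb (z a)) (v a)) →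
      Continuous (fun a => tvec (𝓡 d) (z a) (Ψ (z a) (v a)).1) ∧
      Continuous (fun a => tvec (𝓡 n) (α.e (z a)) (Ψ (z a) (v a)).2.1) ∧
      Continuous (fun a => tvec (𝓡 n) (α.e (z a)) (Ψ (z a) (v a)).2.2)) :
    α.TangentBundleIso d := by
  have hbase : ∀ i, Continuous fun z => coord i (α.base z) := fun i =>
    (contMDiff_coord (p := p) i).continuous.comp α.continuous_base
  let φ : ∀ z, α.targetBundle z ≃ₗ[ℝ]
      ((TangentSpace (𝓡 d) : α.Z → Type) ×ᵇ (α.pullTN ×ᵇ α.pullTN)) z := fun z =>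
    (fibreEquiv p).trans (Ψ z)
  refine α.tangentBundleIso_of_continuous α.continuous_e hbase φ ?_
  let 𝒲 := Bundle.TotalSpace (TargetFibre p) α.targetBundle
  let t₂ : TopologicalSpace (Bundle.TotalSpace
      (EuclideanSpace ℝ (Fin (p 2)) × EuclideanSpace ℝ (Fin 2))
      (α.pullTP 2 ×ᵇ Bundle.Trivial α.Z (EuclideanSpace ℝ (Fin 2)))) :=
    FiberBundle.Prod.topologicalSpace _ _ _ _
  let t₁ : TopologicalSpace (Bundle.TotalSpace
      (EuclideanSpace ℝ (Fin (p 1)) × EuclideanSpace ℝ (Fin (p 2)) × EuclideanSpace ℝ (Fin 2))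
      (α.pullTP 1 ×ᵇ (α.pullTP 2 ×ᵇ Bundle.Trivial α.Z (EuclideanSpace ℝ (Fin 2))))) :=
    FiberBundle.Prod.topologicalSpace _ _ _ _
  have hd := FiberBundle.Prod.isInducing_diag (EuclideanSpace ℝ (Fin (p 0))) (α.pullTP 0)
    (EuclideanSpace ℝ (Fin (p 1)) × EuclideanSpace ℝ (Fin (p 2)) × EuclideanSpace ℝ (Fin 2))
    (α.pullTP 1 ×ᵇ (α.pullTP 2 ×ᵇ Bundle.Trivial α.Z (EuclideanSpace ℝ (Fin 2))))
  have hd' := FiberBundle.Prod.isInducing_diag (EuclideanSpace ℝ (Fin (p 1))) (α.pullTP 1)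
    (EuclideanSpace ℝ (Fin (p 2)) × EuclideanSpace ℝ (Fin 2))
    (α.pullTP 2 ×ᵇ Bundle.Trivial α.Z (EuclideanSpace ℝ (Fin 2)))
  have hd'' := FiberBundle.Prod.isInducing_diag (EuclideanSpace ℝ (Fin (p 2))) (α.pullTP 2)
    (EuclideanSpace ℝ (Fin 2)) (Bundle.Trivial α.Z (EuclideanSpace ℝ (Fin 2)))
  have h0 := continuous_fst.comp hd.continuous
  have h0' := continuous_snd.comp hd.continuous
  have h1 := continuous_fst.comp (hd'.continuous.comp h0')
  have h1' := continuous_snd.comp (hd'.continuous.comp h0')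
  have h2 := continuous_fst.comp (hd''.continuous.comp h1')
  have h2' := continuous_snd.comp (hd''.continuous.comp h1')
  have hz : Continuous (fun w : 𝒲 => w.proj) :=
    (Pullback.continuous_proj _ _ _).comp h0
  have hη : Continuous (fun w : 𝒲 => (w.snd.2.2.2 : EuclideanSpace ℝ (Fin 2))) :=
    (continuous_snd (X := α.Z) (Y := EuclideanSpace ℝ (Fin 2))).comp
      ((Bundle.Trivial.homeomorphProd _ _).continuous.comp h2')
  have t0 : Continuous fun w : 𝒲 => tvec (𝓡 (p 0)) (α.base w.proj).1 w.snd.1 :=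
    (Pullback.continuous_lift _ _ _).comp h0
  have t1 : Continuous fun w : 𝒲 => tvec (𝓡 (p 1)) (α.base w.proj).2.1 w.snd.2.1 :=
    (Pullback.continuous_lift _ _ _).comp h1
  have t2 : Continuous fun w : 𝒲 => tvec (𝓡 (p 2)) (α.base w.proj).2.2 w.snd.2.2.1 :=
    (Pullback.continuous_lift _ _ _).comp h2
  have t3 : Continuous fun w : 𝒲 => tvec 𝓘(ℝ, ℝ × ℝ) (α.emb w.proj).2
      (w.snd.2.2.2 0, w.snd.2.2.2 1) := by
    refine continuous_tvec_model.2 ⟨continuous_snd.comp (α.continuous_emb.comp hz), ?_⟩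
    have hc : ∀ i, Continuous fun η : EuclideanSpace ℝ (Fin 2) => η i := fun i => by fun_prop
    exact ((hc 0).comp hη).prodMk ((hc 1).comp hη)
  have tb := continuous_tvec_prod (continuous_tvec_prod t0 (continuous_tvec_prod t1 t2)) t3
  have hemb : ∀ w : 𝒲, (((α.base w.proj).1, ((α.base w.proj).2.1, (α.base w.proj).2.2)),
      (α.emb w.proj).2) = α.emb w.proj := fun w => Prod.ext (α.emb_fst w.proj).symm rfl
  simp only [hemb] at tb
  obtain ⟨k1, k2, k3⟩ := h 𝒲 (fun w => w.proj) (fun w => fibreEquiv p w.snd) hz tb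
  have hs := FiberBundle.Prod.isInducing_diag (EuclideanSpace ℝ (Fin d))
    (TangentSpace (𝓡 d) : α.Z → Type) (EuclideanSpace ℝ (Fin n) × EuclideanSpace ℝ (Fin n))
    (α.pullTN ×ᵇ α.pullTN)
  have hs' := FiberBundle.Prod.isInducing_diag (EuclideanSpace ℝ (Fin n)) α.pullTN
    (EuclideanSpace ℝ (Fin n)) α.pullTN
  have hp := inducing_pullbackTotalSpaceEmbedding (EuclideanSpace ℝ (Fin n))
    (TangentSpace (𝓡 n) : N → Type) α.e
  refine hs.continuous_iff.2 (k1.prodMk (hs'.continuous_iff.2 (Continuous.prodMk ?_ ?_)))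
  · exact hp.continuous_iff.2 (hz.prodMk k2)
  · exact hp.continuous_iff.2 (hz.prodMk k3)

end QuadraticLink

end CubicObstruction

/-! ### The tangent bundle over a compact set as a summand of a trivial bundle -/

namespace CubicObstruction

open Set Filter Topology

/-- Outside the closed set the product is locally zero; inside it, `g` is continuous. -/
theorem continuous_smul_of_eq_zero_off {X V : Type*} [TopologicalSpace X] [NormedAddCommGroup V]
    [NormedSpace ℝ V] {χ : X → ℝ} (hχ : Continuous χ) {g : X → V} {C U : Set X} (hC : IsClosed C)
    (hU : IsOpen U) (hCU : C ⊆ U) (h0 : ∀ x ∉ C, χ x = 0) (hg : ContinuousOn g U) :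
    Continuous fun x => χ x • g x := by
  refine continuous_iff_continuousAt.2 fun x => ?_
  by_cases hx : x ∈ C
  · exact hχ.continuousAt.smul (hg.continuousAt (hU.mem_nhds (hCU hx)))
  · refine (continuousAt_const (y := (0 : V))).congr ?_
    filter_upwards [hC.isOpen_compl.mem_nhds hx] with y hy
    rw [h0 y hy, zero_smul]

section Stabilization

variable {E : Type*} [NormedAddCommGroup E] [NormedSpace ℝ E] [FiniteDimensional ℝ E]
  {H : Type*} [TopologicalSpace H]
  {I : ModelWithCorners ℝ E H} {M : Type*} [TopologicalSpace M] [ChartedSpace H M]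
  [IsManifold I ∞ M]

/-- `J` and `κ` exhibit the tangent bundle over `K` as a direct summand of the trivial bundle with
fibre `V`. -/
structure IsStabilization {V : Type*} [NormedAddCommGroup V] [NormedSpace ℝ V]
    (I : ModelWithCorners ℝ E H) {M : Type*} [TopologicalSpace M] [ChartedSpace H M]
    [IsManifold I ∞ M] (K : Set M)
    (J : M → E →L[ℝ] V) (κ : M → V →L[ℝ] E) : Prop where
  retract : ∀ y ∈ K, ∀ v, κ y (J y v) = v
  continuous : Continuous fun w : TangentBundle I M => J w.proj w.snd
  continuous_comp : Continuous fun y => (J y).comp (κ y)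
  comap_le : ∀ w₀ : TangentBundle I M, w₀.proj ∈ K →
    comap (fun w : TangentBundle I M => (w.proj, (J w.proj w.snd : V)))
      (𝓝 (w₀.proj, (J w₀.proj w₀.snd : V))) ≤ 𝓝 w₀

/-- Over finitely many trivializing sets, `J` lists the coordinates of a vector and `κ` recombines
them, both weighted by square roots of a partition of unity. The weights multiply to sum `1` on `K`,
and each factor alone is continuous since it vanishes off the trivializing set. -/
theorem exists_isStabilization [T2Space M] [LocallyCompactSpace M] {K : Set M}
    (hK : IsCompact K) :
    ∃ (k : ℕ) (J : M → E →L[ℝ] (Fin k → E)) (κ : M → (Fin k → E) →L[ℝ] E),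
      IsStabilization I K J κ := by
  have : IsManifold I 1 M := .of_le (n := ∞) (by simp)
  obtain ⟨t, -, ht⟩ := hK.elim_nhds_subcover
    (fun y => (trivializationAt E (TangentSpace I) y).baseSet) fun y _ =>
      (trivializationAt E (TangentSpace I) y).open_baseSet.mem_nhds
        (FiberBundle.mem_baseSet_trivializationAt' y)
  let e := fun i : Fin t.card => trivializationAt E (TangentSpace I) ((t.equivFin.symm i : M))
  obtain ⟨f, hfs, hf1, hf01, -⟩ := exists_continuous_sum_one_of_isOpen_isCompact
    (s := fun i => (e i).baseSet) (fun i => (e i).open_baseSet) hK (fun y hy => by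
      obtain ⟨c, hc, hyc⟩ := mem_iUnion₂.1 (ht hy)
      refine mem_iUnion.2 ⟨t.equivFin ⟨c, hc⟩, ?_⟩
      simpa [e] using hyc)
  have hf1' : ∀ y ∈ K, ∑ i, f i y = 1 := fun y hy => by
    have := hf1 hy
    simpa using this
  let g : Fin t.card → M → ℝ := fun i y => √(f i y)
  have hg : ∀ i, Continuous (g i) := fun i => (f i).continuous.sqrt
  have hgg : ∀ i y, g i y * g i y = f i y := fun i y => Real.mul_self_sqrt (hf01 i y).1
  have hg0 : ∀ i, ∀ y ∉ tsupport (f i), g i y = 0 := fun i y hy => by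
    change √(f i y) = 0
    rw [image_eq_zero_of_notMem_tsupport hy, Real.sqrt_zero]
  let a : Fin t.card → M → E →L[ℝ] E := fun i y => (e i).continuousLinearMapAt ℝ y
  let b : Fin t.card → M → E →L[ℝ] E := fun i y => (e i).symmL ℝ y
  have hba : ∀ i, ∀ y ∈ (e i).baseSet, ∀ v, b i y (a i y v) = v := fun i y hy v =>
    (e i).symmL_continuousLinearMapAt (R := ℝ) hy v
  have ha : ∀ i (w : TangentBundle I M), w.proj ∈ (e i).baseSet → a i w.proj w.snd = (e i w).2 :=
    fun i w hw => (e i).continuousLinearMapAt_apply_of_mem (R := ℝ) hw w.snd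
  have hac : ∀ i, ContinuousOn (fun w : TangentBundle I M => a i w.proj w.snd)
      (Bundle.TotalSpace.proj ⁻¹' (e i).baseSet) := fun i =>
    (continuous_snd.comp_continuousOn ((e i).continuousOn.mono fun w hw =>
      (e i).mem_source.2 hw)).congr fun w hw => ha i w hw
  have hbc : ∀ i u, ContinuousOn (fun y => tvec I y (b i y u)) (e i).baseSet := fun i u => by
    refine ((e i).continuousOn_symm.comp (f := fun y => (y, u)) (by fun_prop)
      fun y hy => ⟨hy, trivial⟩).congr fun y hy => ?_
    exact congrArg (fun v : E => tvec I y v) ((e i).symmL_apply (R := ℝ) hy u)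
  have hp : Continuous (Bundle.TotalSpace.proj : TangentBundle I M → M) :=
    FiberBundle.continuous_proj E (TangentSpace I)
  let J : M → E →L[ℝ] (Fin t.card → E) := fun y => ContinuousLinearMap.pi fun i => g i y • a i y
  let κ : M → (Fin t.card → E) →L[ℝ] E := fun y =>
    ∑ i, g i y • (b i y).comp (ContinuousLinearMap.proj i)
  have hJ : Continuous fun w : TangentBundle I M => J w.proj w.snd := continuous_pi fun i =>
    continuous_smul_of_eq_zero_off ((hg i).comp hp) ((isClosed_tsupport (f i)).preimage hp)
      ((e i).open_baseSet.preimage hp) (preimage_mono (hfs i)) (fun w hw => hg0 i _ hw) (hac i)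
  refine ⟨t.card, J, κ, fun y hy v => ?_, hJ, ?_, fun w₀ hw₀ => ?_⟩
  · have h1 : κ y (J y v) = ∑ i, f i y • v := by
      simp only [κ, J, sum_apply, FunLike.coe_smul, Pi.smul_apply,
        ContinuousLinearMap.comp_apply, ContinuousLinearMap.proj_apply, ContinuousLinearMap.pi_apply,
        map_smul]
      refine Finset.sum_congr rfl fun i _ => ?_
      rw [smul_smul, hgg]
      by_cases hi : y ∈ tsupport (f i)
      · rw [hba i y (hfs i hi)]
      · rw [image_eq_zero_of_notMem_tsupport hi, zero_smul, zero_smul]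
    rw [h1, ← Finset.sum_smul, hf1' y hy, one_smul]
  · refine continuous_clm_apply.2 fun u => ?_
    have h1 : ∀ y, (J y).comp (κ y) u = ∑ i, g i y • J y (b i y (u i)) := fun y => by
      simp [κ, sum_apply, map_sum]
    simp only [h1]
    refine continuous_finsetSum _ fun i _ => continuous_smul_of_eq_zero_off (hg i)
      (isClosed_tsupport (f i)) (e i).open_baseSet (hfs i) (hg0 i) ?_
    exact hJ.comp_continuousOn (hbc i (u i))
  -- Where one weight is nonzero, dividing the corresponding component of `J` by it recovers the
  -- vector in that trivialization, hence the topology of the total space.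
  · obtain ⟨i, hi⟩ : ∃ i, f i w₀.proj ≠ 0 := by
      by_contra hcon
      push Not at hcon
      have := hf1' _ hw₀
      rw [Finset.sum_eq_zero fun i _ => hcon i] at this
      exact zero_ne_one this
    have hib : w₀.proj ∈ (e i).baseSet := hfs i (subset_tsupport _ hi)
    have hgi : g i w₀.proj ≠ 0 := fun h => hi (by rw [← hgg, h, zero_mul])
    set Fl := comap (fun w : TangentBundle I M => (w.proj, (J w.proj w.snd : Fin t.card → E)))
      (𝓝 (w₀.proj, J w₀.proj w₀.snd)) with hFl
    have h0 : Tendsto (fun w : TangentBundle I M => (w.proj, (J w.proj w.snd : Fin t.card → E))) Fl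
      (𝓝 (w₀.proj, J w₀.proj w₀.snd)) := tendsto_comap
    have h1 : Tendsto (fun w : TangentBundle I M => w.proj) Fl (𝓝 w₀.proj) :=
      (continuous_fst.tendsto _).comp h0
    have h2 : Tendsto (fun w : TangentBundle I M => J w.proj w.snd i) Fl
        (𝓝 (J w₀.proj w₀.snd i)) :=
      (((continuous_apply i).comp continuous_snd).tendsto
        (w₀.proj, (J w₀.proj w₀.snd : Fin t.card → E))).comp h0
    have hgt := ((hg i).tendsto w₀.proj).comp h1
    have h3 := (hgt.inv₀ hgi).smul h2
    have key : ∀ w : TangentBundle I M, w.proj ∈ (e i).baseSet → g i w.proj ≠ 0 →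
        (g i w.proj)⁻¹ • J w.proj w.snd i = (e i w).2 := fun w hw hgw => by
      rw [← ha i w hw]
      exact inv_smul_smul₀ hgw _
    have h4 : ∀ᶠ w in Fl, w.proj ∈ (e i).baseSet :=
      h1.eventually ((e i).open_baseSet.mem_nhds hib)
    rw [(e i).toOpenPartialHomeomorph.nhds_eq_comap_inf_principal ((e i).mem_source.2 hib)]
    refine le_inf ?_ (le_principal_iff.2 (h4.mono fun w hw => (e i).mem_source.2 hw))
    rw [← tendsto_iff_comap]
    have h5 : Tendsto (fun w => (w.proj, (e i w).2)) Fl (𝓝 (w₀.proj, (e i w₀).2)) := by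
      refine h1.prodMk_nhds ?_
      rw [← key w₀ hib hgi]
      refine h3.congr' ?_
      filter_upwards [h4, hgt.eventually_ne hgi] with w hw hw' using key w hw hw'
    have h6 : (e i).toOpenPartialHomeomorph w₀ = (w₀.proj, (e i w₀).2) :=
      Prod.ext ((e i).coe_fst ((e i).mem_source.2 hib)) rfl
    rw [h6]
    refine h5.congr' ?_
    filter_upwards [h4] with w hw
    exact (Prod.ext ((e i).coe_fst ((e i).mem_source.2 hw)) rfl : (e i) w = _).symm

variable {V : Type*} [NormedAddCommGroup V] [NormedSpace ℝ V] {K : Set M} {J : M → E →L[ℝ] V}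
  {κ : M → V →L[ℝ] E}

theorem IsStabilization.idem (h : IsStabilization I K J κ) {y : M} (hy : y ∈ K) (u : V) :
    J y (κ y (J y (κ y u))) = J y (κ y u) := by
  rw [h.retract y hy]

/-- Over `K` continuity into the tangent bundle may be tested after `J`, and `J ∘ κ` is a continuous
family of operators of the fixed space `V`. -/
theorem IsStabilization.continuous_tvec (h : IsStabilization I K J κ) {X : Type*}
    [TopologicalSpace X] {y : X → M} {q : X → V} (hy : Continuous y) (hyK : ∀ x, y x ∈ K)
    (hq : Continuous q) :
    Continuous fun x => tvec I (y x) (κ (y x) (q x)) := by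
  refine continuous_iff_continuousAt.2 fun x => ?_
  refine Tendsto.mono_right ?_ (h.comap_le (tvec I (y x) (κ (y x) (q x))) (hyK x))
  rw [tendsto_comap_iff]
  have : Continuous fun x => (y x, ((J (y x)).comp (κ (y x))) (q x)) :=
    hy.prodMk ((h.continuous_comp.comp hy).clm_apply hq)
  exact this.tendsto x

end Stabilization

end CubicObstruction

namespace CubicObstruction

open Set Filter Topology

/-! ### Discrete parallel transport in a family of projections -/

section Transport

variable {V : Type*} [NormedAddCommGroup V] [NormedSpace ℝ V]

/-- The composition of the first `i` of the projections `G` at `m` equidistant points between `s`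
and `s'`. -/
noncomputable def transportAux (G : ℝ → V →L[ℝ] V) (m : ℕ) (s s' : ℝ) : ℕ → V →L[ℝ] V
  | 0 => ContinuousLinearMap.id ℝ V
  | i + 1 => (G (s + ((i + 1 : ℕ) / m : ℝ) * (s' - s))).comp (transportAux G m s s' i)

/-- The transport from the image of `G s` to the image of `G s'`. -/
noncomputable def transport (G : ℝ → V →L[ℝ] V) (m : ℕ) (s s' : ℝ) : V →L[ℝ] V :=
  transportAux G m s s' m

variable {G : ℝ → V →L[ℝ] V} {m : ℕ} {s s' : ℝ} {u : V}

theorem transport_self (hu : G s u = u) : transport G m s s u = u := by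
  have : ∀ i, transportAux G m s s i u = u := fun i => by
    induction i with
    | zero => rfl
    | succ i ih => rw [transportAux, ContinuousLinearMap.comp_apply, ih, sub_self, mul_zero,
        add_zero, hu]
  exact this m

theorem transportAux_mem (hG : ∀ a w, G a (G a w) = G a w) (hu : G s u = u) (i : ℕ) :
    G (s + (i / m : ℝ) * (s' - s)) (transportAux G m s s' i u) = transportAux G m s s' i u := by
  cases i with
  | zero => simpa [transportAux] using hu
  | succ i => exact hG _ _

theorem transport_mem (hm : m ≠ 0) (hG : ∀ a w, G a (G a w) = G a w) (hu : G s u = u) :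
    G s' (transport G m s s' u) = transport G m s s' u := by
  have := transportAux_mem (m := m) (s' := s') hG hu m
  rwa [div_self (by exact_mod_cast hm), one_mul, add_sub_cancel] at this

/-- For a single step: if `w` is fixed by `G a` and killed by `G b`, then `w = (G a - G b) w`, which
forces `w = 0` when the operator has norm less than `1`. Times in `[0, 1]` keep each step no longer
than `1 / m`. -/
theorem eq_zero_of_transport_eq_zero (hm : m ≠ 0) (hG : ∀ a w, G a (G a w) = G a w)
    (hd : ∀ a b : ℝ, |a - b| ≤ 1 / m → ‖G a - G b‖ < 1) (hs : s ∈ Icc (0 : ℝ) 1)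
    (hs' : s' ∈ Icc (0 : ℝ) 1) (hu : G s u = u) (h0 : transport G m s s' u = 0) : u = 0 := by
  have hm' : (0 : ℝ) < m := by exact_mod_cast Nat.pos_of_ne_zero hm
  have key : ∀ i, transportAux G m s s' i u = 0 → u = 0 := fun i => by
    induction i with
    | zero => exact id
    | succ i ih =>
      intro h
      refine ih ?_
      set w := transportAux G m s s' i u with hw
      have h1 := transportAux_mem (m := m) (s' := s') hG hu i
      have h2 : G (s + ((i + 1 : ℕ) / m : ℝ) * (s' - s)) w = 0 := h
      rw [← hw] at h1
      by_contra hne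
      have h3 : w = (G (s + (i / m : ℝ) * (s' - s)) - G (s + ((i + 1 : ℕ) / m : ℝ) * (s' - s))) w := by
        rw [sub_apply, h1, h2, sub_zero]
      have h4 := ContinuousLinearMap.le_opNorm
        (G (s + (i / m : ℝ) * (s' - s)) - G (s + ((i + 1 : ℕ) / m : ℝ) * (s' - s))) w
      rw [← h3] at h4
      have h5 := hd (s + (i / m : ℝ) * (s' - s)) (s + ((i + 1 : ℕ) / m : ℝ) * (s' - s)) (by
        have h6 : s + (i / m : ℝ) * (s' - s) - (s + ((i + 1 : ℕ) / m : ℝ) * (s' - s)) =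
            (1 / m) * (s - s') := by
          push_cast
          field_simp
          ring
        rw [h6, abs_mul, abs_of_pos (by positivity)]
        refine mul_le_of_le_one_right (by positivity) (abs_le.2 ⟨?_, ?_⟩)
        · linarith [hs.1, hs'.2]
        · linarith [hs.2, hs'.1])
      have h7 : 0 < ‖w‖ := norm_pos_iff.2 hne
      nlinarith
  exact key m h0

theorem continuous_transport {X : Type*} [TopologicalSpace X] {G : X → ℝ → V →L[ℝ] V}
    (hG : Continuous fun x : X × ℝ => G x.1 x.2) (m : ℕ) {s s' : X → ℝ} (hs : Continuous s)
    (hs' : Continuous s') : Continuous fun x => transport (G x) m (s x) (s' x) := by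
  have : ∀ i, Continuous fun x => transportAux (G x) m (s x) (s' x) i := fun i => by
    induction i with
    | zero => exact continuous_const
    | succ i ih =>
      exact (hG.comp (continuous_id.prodMk (hs.add (continuous_const.mul (hs'.sub hs))))).clm_comp ih
  exact this m

/-- Uniform continuity in the parameter. Clamping reduces all times to `[0, 1]`, where the triples
violating the bound form a compact set on which the two times stay apart. -/
theorem exists_transport_step {X Λ : Type*} [TopologicalSpace X] [CompactSpace X] [Finite Λ]
    {G : Λ → X → ℝ → V →L[ℝ] V} (hG : ∀ l, Continuous fun x : X × ℝ => G l x.1 x.2)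
    (hcl : ∀ l x a, G l x a = G l x (projIcc (0 : ℝ) 1 zero_le_one a)) :
    ∃ m : ℕ, m ≠ 0 ∧ ∀ l x (a b : ℝ), |a - b| ≤ 1 / m → ‖G l x a - G l x b‖ < 1 := by
  have h1 : ∀ l, ∃ δ : ℝ, 0 < δ ∧ ∀ x, ∀ a ∈ Icc (0 : ℝ) 1, ∀ b ∈ Icc (0 : ℝ) 1, |a - b| < δ →
      ‖G l x a - G l x b‖ < 1 := fun l => by
    let C : Set (X × ℝ × ℝ) := (univ ×ˢ (Icc 0 1 ×ˢ Icc 0 1)) ∩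
      {q | 1 ≤ ‖G l q.1 q.2.1 - G l q.1 q.2.2‖}
    have hc1 : Continuous fun q : X × ℝ × ℝ => G l q.1 q.2.1 :=
      (hG l).comp (continuous_fst.prodMk (continuous_fst.comp continuous_snd))
    have hc2 : Continuous fun q : X × ℝ × ℝ => G l q.1 q.2.2 :=
      (hG l).comp (continuous_fst.prodMk (continuous_snd.comp continuous_snd))
    have hC : IsCompact C := (isCompact_univ.prod (isCompact_Icc.prod isCompact_Icc)).inter_right
      (isClosed_le continuous_const (hc1.sub hc2).norm)
    rcases C.eq_empty_or_nonempty with he | hne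
    · refine ⟨1, one_pos, fun x a ha b hb _ => ?_⟩
      by_contra hcon
      have : (x, a, b) ∈ C := ⟨⟨trivial, ha, hb⟩, not_lt.1 hcon⟩
      rw [he] at this
      exact this
    · obtain ⟨q, hq, hmin⟩ := hC.exists_isMinOn hne
        (f := fun q : X × ℝ × ℝ => |q.2.1 - q.2.2|) (by fun_prop)
      refine ⟨|q.2.1 - q.2.2|, abs_pos.2 (sub_ne_zero.2 fun h => ?_), fun x a ha b hb hab => ?_⟩
      · have h2 : 1 ≤ ‖G l q.1 q.2.1 - G l q.1 q.2.2‖ := hq.2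
        rw [h, sub_self, norm_zero] at h2
        linarith
      · by_contra hcon
        have : (x, a, b) ∈ C := ⟨⟨trivial, ha, hb⟩, not_lt.1 hcon⟩
        exact absurd (hmin this) (not_le.2 hab)
  choose δ hδ h2 using h1
  choose k hk using fun l => exists_nat_gt (1 / δ l)
  obtain ⟨K, hK⟩ := (finite_range k).bddAbove
  refine ⟨K + 1, K.succ_ne_zero, fun l x a b hab => ?_⟩
  rw [hcl l x a, hcl l x b]
  refine h2 l x _ (projIcc _ _ _ a).2 _ (projIcc _ _ _ b).2 ?_
  refine (abs_projIcc_sub_projIcc zero_le_one).trans_lt (hab.trans_lt ?_)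
  have h3 : (k l : ℝ) ≤ K := by exact_mod_cast hK (mem_range_self l)
  rw [div_lt_comm₀ (by positivity) (hδ l)]
  push_cast
  linarith [hk l]

end Transport

/-! ### Derivatives in the direction of a common edge -/

section EdgeDerivative

variable {E : Type*} [NormedAddCommGroup E] [NormedSpace ℝ E] {H : Type*} [TopologicalSpace H]
  {I : ModelWithCorners ℝ E H} {M : Type*} [TopologicalSpace M] [ChartedSpace H M]
  {E' : Type*} [NormedAddCommGroup E'] [NormedSpace ℝ E'] {H' : Type*} [TopologicalSpace H']
  {I' : ModelWithCorners ℝ E' H'} {M' : Type*} [TopologicalSpace M'] [ChartedSpace H' M']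
  {E'' : Type*} [NormedAddCommGroup E''] [NormedSpace ℝ E''] {H'' : Type*} [TopologicalSpace H'']
  {I'' : ModelWithCorners ℝ E'' H''} {M'' : Type*} [TopologicalSpace M''] [ChartedSpace H'' M'']
  {W : Type*} [NormedAddCommGroup W] [NormedSpace ℝ W]

/-- Maps which agree along a segment have the same derivatives in the directions of the segment. -/
theorem mderWithin_eq_of_segment {f f' : M × W → M'} {A A' : Set W} {τ : W} {x : M} {a : ℝ}
    (ha : a ∈ Icc (0 : ℝ) 1) (hA : ∀ r ∈ Icc (0 : ℝ) 1, r • τ ∈ A)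
    (hA' : ∀ r ∈ Icc (0 : ℝ) 1, r • τ ∈ A')
    (hf : MDifferentiableWithinAt (I.prod 𝓘(ℝ, W)) I' f (univ ×ˢ A) (x, a • τ))
    (hf' : MDifferentiableWithinAt (I.prod 𝓘(ℝ, W)) I' f' (univ ×ˢ A') (x, a • τ))
    (heq : ∀ y, ∀ r ∈ Icc (0 : ℝ) 1, f (y, r • τ) = f' (y, r • τ)) (ξ : E) (b : ℝ) :
    mderWithin (I.prod 𝓘(ℝ, W)) I' f (univ ×ˢ A) (x, a • τ) (ξ, b • τ) =
      mderWithin (I.prod 𝓘(ℝ, W)) I' f' (univ ×ˢ A') (x, a • τ) (ξ, b • τ) := by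
  -- By the chain rule both derivatives are those of the compositions with this parametrization of
  -- the edge, and the two compositions agree on `M × [0, 1]`.
  let γ : M × ℝ → M × W := fun q => (q.1, q.2 • τ)
  let S : Set (M × ℝ) := univ ×ˢ Icc 0 1
  have hS : UniqueMDiffWithinAt (I.prod 𝓘(ℝ, ℝ)) S (x, a) :=
    (uniqueMDiffOn_univ (I := I)).prod
      (UniqueDiffOn.uniqueMDiffOn (uniqueDiffOn_Icc zero_lt_one)) _ ⟨trivial, ha⟩
  have hγ : HasMFDerivAt (I.prod 𝓘(ℝ, ℝ)) (I.prod 𝓘(ℝ, W)) γ (x, a)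
      ((ContinuousLinearMap.fst ℝ E ℝ).prod
        ((ContinuousLinearMap.toSpanSingleton ℝ τ).comp (ContinuousLinearMap.snd ℝ E ℝ))) :=
    (hasMFDerivAt_fst (I := I) (I' := 𝓘(ℝ, ℝ)) (x, a)).prodMk
      ((ContinuousLinearMap.toSpanSingleton ℝ τ).hasMFDerivAt.comp (x, a)
        (hasMFDerivAt_snd (I := I) (I' := 𝓘(ℝ, ℝ)) (x, a)))
  have key : ∀ (g : M × W → M') (A : Set W), (∀ r ∈ Icc (0 : ℝ) 1, r • τ ∈ A) →
      MDifferentiableWithinAt (I.prod 𝓘(ℝ, W)) I' g (univ ×ˢ A) (x, a • τ) →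
      mderWithin (I.prod 𝓘(ℝ, W)) I' g (univ ×ˢ A) (x, a • τ) (ξ, b • τ) =
        mderWithin (I.prod 𝓘(ℝ, ℝ)) I' (fun q => g (γ q)) S (x, a) (ξ, b) := by
    intro g A hA hg
    have h1 := HasMFDerivWithinAt.comp (f := γ) (x, a) hg.hasMFDerivWithinAt
      (hγ.hasMFDerivWithinAt (s := S)) (fun q hq => ⟨trivial, hA q.2 hq.2⟩)
    exact (DFunLike.congr_fun (h1.mfderivWithin hS) ((ξ, b) : E × ℝ)).symm
  rw [key f A hA hf, key f' A' hA' hf']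
  have h2 : mfderivWithin (I.prod 𝓘(ℝ, ℝ)) I' (fun q => f (γ q)) S (x, a) =
      mfderivWithin (I.prod 𝓘(ℝ, ℝ)) I' (fun q => f' (γ q)) S (x, a) :=
    mfderivWithin_congr (fun q hq => heq q.1 q.2 hq.2) (heq x a ha)
  exact DFunLike.congr_fun (f := mderWithin (I.prod 𝓘(ℝ, ℝ)) I' (fun q => f (γ q)) S (x, a)) h2 _

end EdgeDerivative

end CubicObstruction

/-! ### Normal differences of the pieces and their behaviour along the edges -/

namespace CubicObstruction

open Set Filter Topology

namespace QuadraticLink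

variable {P : Fin 3 → Type u} {p : Fin 3 → ℕ} {N : Type v} {n : ℕ}
  [∀ i, TopologicalSpace (P i)] [∀ i, ChartedSpace (EuclideanSpace ℝ (Fin (p i))) (P i)]
  [∀ i, IsManifold (𝓡 (p i)) ∞ (P i)]
  [TopologicalSpace N] [ChartedSpace (EuclideanSpace ℝ (Fin n)) N] [IsManifold (𝓡 n) ∞ N]
  (α : QuadraticLink P p N n)

theorem mdifferentiableWithinAt_Φ {c : Piece} {q : Ambient P} (hq : q.2 ∈ c.region) :
    MDifferentiableWithinAt (ambientModel p) (fourModel n) (α.Φ c) (univ ×ˢ c.region) q :=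
  (α.contMDiffOn_Φ c q ⟨trivial, hq⟩).mdifferentiableWithinAt (by simp)

/-- Components of the maps defining two pieces which agree along a common edge have the same
derivatives in the directions of the edge. -/
theorem clm_dΦ_eq {E' : Type*} [NormedAddCommGroup E'] [NormedSpace ℝ E'] {H' : Type*}
    [TopologicalSpace H'] {I' : ModelWithCorners ℝ E' H'} {M' : Type*} [TopologicalSpace M']
    [ChartedSpace H' M'] {c c' : Piece} {f f' : (N × N) × (N × N) → M'}
    {L L' : (TwoSpace n × TwoSpace n) →L[ℝ] E'}
    (hf : ∀ y, HasMFDerivAt (fourModel n) I' f y L) (hf' : ∀ y, HasMFDerivAt (fourModel n) I' f' y L')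
    {τ : ℝ × ℝ} (hA : ∀ r ∈ Icc (0 : ℝ) 1, r • τ ∈ c.region)
    (hA' : ∀ r ∈ Icc (0 : ℝ) 1, r • τ ∈ c'.region)
    (heq : ∀ y, ∀ r ∈ Icc (0 : ℝ) 1, f (α.Φ c (y, r • τ)) = f' (α.Φ c' (y, r • τ)))
    {x : Base P} {w w' : ℝ × ℝ} {a b : ℝ} (ha : a ∈ Icc (0 : ℝ) 1) (hw : sec c w = a • τ)
    (hw' : sec c' w = a • τ) (hv : sec c w' = b • τ) (hv' : sec c' w' = b • τ) (ξ : BaseSpace p) :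
    L (α.dΦ c (x, w) (ξ, w')) = L' (α.dΦ c' (x, w) (ξ, w')) := by
  have key : ∀ {c : Piece} {f : (N × N) × (N × N) → M'} {L : (TwoSpace n × TwoSpace n) →L[ℝ] E'},
      (∀ y, HasMFDerivAt (fourModel n) I' f y L) → (∀ r ∈ Icc (0 : ℝ) 1, r • τ ∈ c.region) →
      sec c w = a • τ → sec c w' = b • τ →
      MDifferentiableWithinAt (ambientModel p) I' (fun q => f (α.Φ c q)) (univ ×ˢ c.region)
        (x, a • τ) ∧
      L (α.dΦ c (x, w) (ξ, w')) = mderWithin (ambientModel p) I' (fun q => f (α.Φ c q))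
        (univ ×ˢ c.region) (x, a • τ) (ξ, b • τ) := by
    intro c f L hf hA hw hv
    have h1 := α.mdifferentiableWithinAt_Φ (q := (x, a • τ)) (hA a ha)
    have h2 := (hf (α.Φ c (x, a • τ))).comp_hasMFDerivWithinAt (x, a • τ) h1.hasMFDerivWithinAt
    refine ⟨h2.mdifferentiableWithinAt, ?_⟩
    rw [dΦ_apply]
    simp only [hw, hv]
    exact (DFunLike.congr_fun (h2.mfderivWithin (uniqueMDiffOn_univ_prod_region c _
      ⟨trivial, hA a ha⟩)) ((ξ, b • τ) : BaseSpace p × (ℝ × ℝ))).symm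
  obtain ⟨h1, h2⟩ := key hf hA hw hv
  obtain ⟨h1', h2'⟩ := key hf' hA' hw' hv'
  rw [h2, h2']
  exact mderWithin_eq_of_segment (I := baseModel p) (f := fun q => f (α.Φ c q))
    (f' := fun q => f' (α.Φ c' q)) ha hA hA' h1 h1' heq ξ b

section Gap

variable {V : Type*} [NormedAddCommGroup V] [NormedSpace ℝ V]

/-- The differences of the two pairs of components of the differential of the map defining a piece,
measured in the stabilization `J` of `TN`. -/
noncomputable def gap (J : N → EuclideanSpace ℝ (Fin n) →L[ℝ] V) (c : Piece) (q : Ambient P) :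
    (BaseSpace p × (ℝ × ℝ)) →L[ℝ] V × V :=
  let y := α.Φ c (secMap c q)
  let D : N × N → (TwoSpace n →L[ℝ] V) := fun y =>
    (J y.1).comp (ContinuousLinearMap.fst ℝ _ _) - (J y.2).comp (ContinuousLinearMap.snd ℝ _ _)
  ((D y.1).prodMap (D y.2)).comp (α.dΦ c q)

variable {J : N → EuclideanSpace ℝ (Fin n) →L[ℝ] V}

theorem gap_apply (c : Piece) (q : Ambient P) (v : BaseSpace p × (ℝ × ℝ)) :
    α.gap J c q v =
      (J (α.Φ c (secMap c q)).1.1 (α.dΦ c q v).1.1 - J (α.Φ c (secMap c q)).1.2 (α.dΦ c q v).1.2,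
       J (α.Φ c (secMap c q)).2.1 (α.dΦ c q v).2.1 - J (α.Φ c (secMap c q)).2.2 (α.dΦ c q v).2.2) :=
  rfl

/-- The rotation of order three of `V × V`, the complement of the diagonal of `V × V × V`. -/
noncomputable def rotate (V : Type*) [NormedAddCommGroup V] [NormedSpace ℝ V] :
    V × V →L[ℝ] V × V :=
  (ContinuousLinearMap.snd ℝ V V).prod
    (-(ContinuousLinearMap.fst ℝ V V) - ContinuousLinearMap.snd ℝ V V)

theorem rotate_apply (x : V × V) : rotate V x = (x.2, -x.1 - x.2) := rfl

theorem rotate_rotate_rotate (x : V × V) : rotate V (rotate V (rotate V x)) = x := by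
  simp only [rotate_apply]
  exact Prod.ext (by dsimp only; abel) (by dsimp only; abel)

theorem region_edge_t (h : Fin 3) : ∀ r ∈ Icc (0 : ℝ) 1, r • ((1, 0) : ℝ × ℝ) ∈ (Piece.W h).region ∧
    r • ((1, 0) : ℝ × ℝ) ∈ (Piece.X₂ h).region := fun r hr => by
  simp [Piece.region, hr.1, hr.2]

theorem region_edge_s (h : Fin 3) : ∀ r ∈ Icc (0 : ℝ) 1, r • ((0, 1) : ℝ × ℝ) ∈ (Piece.W h).region ∧
    r • ((0, 1) : ℝ × ℝ) ∈ (Piece.X₁ (h + 1)).region := fun r hr => by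
  simp [Piece.region, hr.1, hr.2]

theorem region_edge_st (h : Fin 3) : ∀ r ∈ Icc (0 : ℝ) 1,
    r • ((1, 1) : ℝ × ℝ) ∈ (Piece.X₁ h).region ∧ r • ((1, 1) : ℝ × ℝ) ∈ (Piece.X₂ h).region :=
  fun r hr => by
  simp [Piece.region, hr.1, hr.2]

theorem htpy_zero (h : Fin 3) (x : Base P) :
    α.htpy h x 0 = (α.f h (coord h x), α.f (h + 1) (coord (h + 1) x)) := α.H_zero h _ _

theorem Φ_edge_t (h : Fin 3) (x : Base P) (r : ℝ) :
    α.Φ (.W h) (x, (r, 0)) = α.Φ (.X₂ h) (x, (r, 0)) := by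
  simp only [Φ, htpy_zero]

theorem Φ_edge_s (h : Fin 3) (x : Base P) (r : ℝ) :
    α.Φ (.W h) (x, (0, r)) = α.Φ (.X₁ (h + 1)) (x, (0, r)) := by
  simp only [Φ, htpy_zero, α.f_coord_succ h x]

/-- Since the homotopies start at the product of the `f`, the two maps to `N⁴` coincide on the edge.
Only the directions of the edge are compared, since transverse derivatives may differ. -/
theorem gap_edge_t {h : Fin 3} {x : Base P} {w : ℝ × ℝ} (h0 : yc (h + 1 + 1) w = 0)
    (hr : sec (.W h) w ∈ (Piece.W h).region) (ξ : BaseSpace p) (r : ℝ) :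
    α.gap J (.W h) (x, w) (ξ, r • w) = α.gap J (.X₂ h) (x, w) (ξ, r • w) := by
  have hs := (EdgeAt.edge_t h w h0).sec_eq
  have ha : sec (.W h) w = yc (h + 1) w • ((1, 0) : ℝ × ℝ) := by
    rw [Prod.smul_mk, smul_eq_mul, mul_one, smul_zero]
    exact Prod.ext rfl h0
  have hI : yc (h + 1) w ∈ Icc (0 : ℝ) 1 := hr.1
  have hd := α.clm_dΦ_eq (c := .W h) (c' := .X₂ h) (L := ContinuousLinearMap.id ℝ _)
    (L' := ContinuousLinearMap.id ℝ _) (I' := fourModel n)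
    (fun y => hasMFDerivAt_id y) (fun y => hasMFDerivAt_id y)
    (fun r hr => (region_edge_t h r hr).1) (fun r hr => (region_edge_t h r hr).2)
    (fun y r _ => by simpa using α.Φ_edge_t h y r) hI ha (hs ▸ ha)
    (w' := r • w) (b := r * yc (h + 1) w) (by rw [map_smul, ha, smul_smul])
    (by rw [map_smul, ← hs, ha, smul_smul]) ξ (x := x)
  have hd : α.dΦ (.W h) (x, w) (ξ, r • w) = α.dΦ (.X₂ h) (x, w) (ξ, r • w) := hd
  have hy : α.Φ (.W h) (secMap (.W h) (x, w)) = α.Φ (.X₂ h) (secMap (.X₂ h) (x, w)) := by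
    have := α.Φ_edge_t h x (yc (h + 1) w)
    simp only [secMap, ← hs]
    rw [ha]
    simpa using this
  rw [gap_apply, gap_apply, hd, hy]

theorem gap_edge_s {h : Fin 3} {x : Base P} {w : ℝ × ℝ} (h0 : yc (h + 1) w = 0)
    (hr : sec (.W h) w ∈ (Piece.W h).region) (ξ : BaseSpace p) (r : ℝ) :
    α.gap J (.W h) (x, w) (ξ, r • w) = α.gap J (.X₁ (h + 1)) (x, w) (ξ, r • w) := by
  have hs := (EdgeAt.edge_s h w h0).sec_eq
  have ha : sec (.W h) w = yc (h + 1 + 1) w • ((0, 1) : ℝ × ℝ) := by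
    rw [Prod.smul_mk, smul_zero, smul_eq_mul, mul_one]
    exact Prod.ext h0 rfl
  have hI : yc (h + 1 + 1) w ∈ Icc (0 : ℝ) 1 := hr.2
  have hd := α.clm_dΦ_eq (c := .W h) (c' := .X₁ (h + 1)) (L := ContinuousLinearMap.id ℝ _)
    (L' := ContinuousLinearMap.id ℝ _) (I' := fourModel n)
    (fun y => hasMFDerivAt_id y) (fun y => hasMFDerivAt_id y)
    (fun r hr => (region_edge_s h r hr).1) (fun r hr => (region_edge_s h r hr).2)
    (fun y r _ => by simpa using α.Φ_edge_s h y r) hI ha (hs ▸ ha)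
    (w' := r • w) (b := r * yc (h + 1 + 1) w) (by rw [map_smul, ha, smul_smul])
    (by rw [map_smul, ← hs, ha, smul_smul]) ξ (x := x)
  have hd : α.dΦ (.W h) (x, w) (ξ, r • w) = α.dΦ (.X₁ (h + 1)) (x, w) (ξ, r • w) := hd
  have hy : α.Φ (.W h) (secMap (.W h) (x, w)) =
      α.Φ (.X₁ (h + 1)) (secMap (.X₁ (h + 1)) (x, w)) := by
    have := α.Φ_edge_s h x (yc (h + 1 + 1) w)
    simp only [secMap, ← hs]
    rw [ha]
    simpa using this
  rw [gap_apply, gap_apply, hd, hy]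

/-- On the diagonal edge the pairs are `(f_j, H¹), (H¹, H²)` on one side and `(H¹, H²), (H², f_j)`
on the other. If the first differences are `(a, b)`, the second are `(b, -a - b)`. -/
theorem gap_edge_st {h : Fin 3} {x : Base P} {w : ℝ × ℝ} (h0 : yc h w = yc (h + 1 + 1) w)
    (hr : sec (.X₁ h) w ∈ (Piece.X₁ h).region) (ξ : BaseSpace p) (r : ℝ) :
    α.gap J (.X₂ h) (x, w) (ξ, r • w) = rotate V (α.gap J (.X₁ h) (x, w) (ξ, r • w)) := by
  have hs : sec (.X₁ h) w = sec (.X₂ h) w := rfl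
  set a := -yc h w with ha_def
  have ha : sec (.X₁ h) w = a • ((1, 1) : ℝ × ℝ) := by
    rw [Prod.smul_mk, smul_eq_mul, mul_one]
    exact Prod.ext rfl (by rw [ha_def, h0]; rfl)
  have hI : a ∈ Icc (0 : ℝ) 1 := ⟨hr.1, le_trans hr.2.1 hr.2.2⟩
  have hv : sec (.X₁ h) (r • w) = (r * a) • ((1, 1) : ℝ × ℝ) := by rw [map_smul, ha, smul_smul]
  have r1 := fun r hr => (region_edge_st h r hr).1
  have r2 := fun r hr => (region_edge_st h r hr).2
  let l₁ := ContinuousLinearMap.fst ℝ (EuclideanSpace ℝ (Fin n)) (EuclideanSpace ℝ (Fin n))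
  let l₂ := ContinuousLinearMap.snd ℝ (EuclideanSpace ℝ (Fin n)) (EuclideanSpace ℝ (Fin n))
  let m₁ := ContinuousLinearMap.fst ℝ (TwoSpace n) (TwoSpace n)
  let m₂ := ContinuousLinearMap.snd ℝ (TwoSpace n) (TwoSpace n)
  have p1 : ∀ y : (N × N) × (N × N), HasMFDerivAt (fourModel n) ((𝓡 n).prod (𝓡 n)) Prod.fst y
    m₁ := fun y => hasMFDerivAt_fst y
  have p2 : ∀ y : (N × N) × (N × N), HasMFDerivAt (fourModel n) ((𝓡 n).prod (𝓡 n)) Prod.snd y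
    m₂ := fun y => hasMFDerivAt_snd y
  have p11 : ∀ y : (N × N) × (N × N), HasMFDerivAt (fourModel n) (𝓡 n) (fun y => y.1.1) y
    (l₁.comp m₁) :=
    fun y => HasMFDerivAt.comp y (hasMFDerivAt_fst (I := 𝓡 n) (I' := 𝓡 n) y.1) (p1 y)
  have p12 : ∀ y : (N × N) × (N × N), HasMFDerivAt (fourModel n) (𝓡 n) (fun y => y.1.2) y
    (l₂.comp m₁) :=
    fun y => HasMFDerivAt.comp y (hasMFDerivAt_snd (I := 𝓡 n) (I' := 𝓡 n) y.1) (p1 y)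
  have p21 : ∀ y : (N × N) × (N × N), HasMFDerivAt (fourModel n) (𝓡 n) (fun y => y.2.1) y
    (l₁.comp m₂) :=
    fun y => HasMFDerivAt.comp y (hasMFDerivAt_fst (I := 𝓡 n) (I' := 𝓡 n) y.2) (p2 y)
  have p22 : ∀ y : (N × N) × (N × N), HasMFDerivAt (fourModel n) (𝓡 n) (fun y => y.2.2) y
    (l₂.comp m₂) :=
    fun y => HasMFDerivAt.comp y (hasMFDerivAt_snd (I := 𝓡 n) (I' := 𝓡 n) y.2) (p2 y)
  -- Five coincidences of components along the edge express all derivatives on both sides through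
  -- those of `f_j`, `H¹` and `H²`.
  have d1 := α.clm_dΦ_eq (c := .X₂ h) (c' := .X₁ h)
    (f := fun y => y.1.1) (f' := fun y => y.2.1) (I' := 𝓡 n)
    (L := l₁.comp m₁) (L' := l₁.comp m₂) p11 p21 r2 r1
    (fun y r _ => by simp [Φ]) hI ha ha hv hv ξ (x := x)
  have d2 := α.clm_dΦ_eq (c := .X₂ h) (c' := .X₁ h)
    (f := fun y => y.1.2) (f' := fun y => y.2.2) (I' := 𝓡 n)
    (L := l₂.comp m₁) (L' := l₂.comp m₂) p12 p22 r2 r1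
    (fun y r _ => by simp [Φ]) hI ha ha hv hv ξ (x := x)
  have d3 := α.clm_dΦ_eq (c := .X₂ h) (c' := .X₁ h)
    (f := fun y => y.2.1) (f' := fun y => y.2.2) (I' := 𝓡 n)
    (L := l₁.comp m₂) (L' := l₂.comp m₂) p21 p22 r2 r1
    (fun y r _ => by simp [Φ]) hI ha ha hv hv ξ (x := x)
  have d4 := α.clm_dΦ_eq (c := .X₂ h) (c' := .X₁ h)
    (f := fun y => y.2.2) (f' := fun y => y.1.1) (I' := 𝓡 n)
    (L := l₂.comp m₂) (L' := l₁.comp m₁) p22 p11 r2 r1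
    (fun y r _ => by simp [Φ]) hI ha ha hv hv ξ (x := x)
  have d5 := α.clm_dΦ_eq (c := .X₁ h) (c' := .X₁ h)
    (f := fun y => y.1.2) (f' := fun y => y.2.1) (I' := 𝓡 n)
    (L := l₂.comp m₁) (L' := l₁.comp m₂) p12 p21 r1 r1
    (fun y r _ => by simp [Φ]) hI ha ha hv hv ξ (x := x)
  simp only [l₁, l₂, m₁, m₂, ContinuousLinearMap.comp_apply, ContinuousLinearMap.coe_fst',
    ContinuousLinearMap.coe_snd'] at d1 d2 d3 d4 d5
  have e2 : α.Φ (.X₂ h) (secMap (.X₂ h) (x, w)) = α.Φ (.X₂ h) (x, a • (1, 1)) :=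
    congrArg (fun σ => α.Φ (.X₂ h) (x, σ)) (hs ▸ ha)
  have e1 : α.Φ (.X₁ h) (secMap (.X₁ h) (x, w)) = α.Φ (.X₁ h) (x, a • (1, 1)) :=
    congrArg (fun σ => α.Φ (.X₁ h) (x, σ)) ha
  rw [rotate_apply, gap_apply, gap_apply, d1, d2, d3, d4, d5, e1, e2]
  refine Prod.ext ?_ ?_
  · simp [Φ]
  · simp [Φ]

end Gap

end QuadraticLink

end CubicObstruction

/-! ### Transport to the common endpoint and the twisted normal differential -/

namespace CubicObstruction

open Set Filter Topology

namespace QuadraticLink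

variable {P : Fin 3 → Type u} {p : Fin 3 → ℕ} {N : Type v} {n : ℕ}
  [∀ i, TopologicalSpace (P i)] [∀ i, ChartedSpace (EuclideanSpace ℝ (Fin (p i))) (P i)]
  [∀ i, IsManifold (𝓡 (p i)) ∞ (P i)]
  [TopologicalSpace N] [ChartedSpace (EuclideanSpace ℝ (Fin n)) N] [IsManifold (𝓡 n) ∞ N]
  (α : QuadraticLink P p N n)

/-- The components of the homotopies, with the time clamped to `[0, 1]`. -/
noncomputable def leg (h : Fin 3) : Bool → Base P → ℝ → N
  | false, x, s => (α.htpy h x (projIcc (0 : ℝ) 1 zero_le_one s)).1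
  | true, x, s => (α.htpy h x (projIcc (0 : ℝ) 1 zero_le_one s)).2

theorem leg_false (h : Fin 3) (x : Base P) {s : ℝ} (hs : s ∈ Icc (0 : ℝ) 1) :
    α.leg h false x s = (α.htpy h x s).1 := by
  rw [leg, projIcc_of_mem _ hs]

theorem leg_true (h : Fin 3) (x : Base P) {s : ℝ} (hs : s ∈ Icc (0 : ℝ) 1) :
    α.leg h true x s = (α.htpy h x s).2 := by
  rw [leg, projIcc_of_mem _ hs]

theorem leg_projIcc (h : Fin 3) (i : Bool) (x : Base P) (s : ℝ) :
    α.leg h i x s = α.leg h i x (projIcc (0 : ℝ) 1 zero_le_one s) := by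
  cases i <;> simp [leg]

theorem leg_false_zero (h : Fin 3) (x : Base P) : α.leg h false x 0 = α.f h (coord h x) := by
  rw [α.leg_false h x (by simp), α.htpy_zero]

theorem leg_true_zero (h : Fin 3) (x : Base P) :
    α.leg h true x 0 = α.f (h + 1) (coord (h + 1) x) := by
  rw [α.leg_true h x (by simp), α.htpy_zero]

theorem continuous_leg (h : Fin 3) (i : Bool) : Continuous fun q : Base P × ℝ => α.leg h i q.1 q.2 := by
  have h1 : Continuous fun q : Base P × ℝ =>
      α.htpy h q.1 (projIcc (0 : ℝ) 1 zero_le_one q.2) :=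
    (α.contMDiffOn_htpy h).continuousOn.comp_continuous
      (f := fun q : Base P × ℝ => (q.1, ((projIcc (0 : ℝ) 1 zero_le_one q.2 : Icc (0 : ℝ) 1) : ℝ)))
      (continuous_fst.prodMk (continuous_subtype_val.comp (continuous_projIcc.comp continuous_snd)))
      fun q => (projIcc (0 : ℝ) 1 zero_le_one q.2).2
  cases i
  exacts [continuous_fst.comp h1, continuous_snd.comp h1]

section Transport

variable {V : Type*} [NormedAddCommGroup V] [NormedSpace ℝ V]

/-- The projections to the tangent spaces of `N` along the homotopies. -/
noncomputable def legProj (J : N → EuclideanSpace ℝ (Fin n) →L[ℝ] V)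
    (κ : N → V →L[ℝ] EuclideanSpace ℝ (Fin n)) (h : Fin 3) (i : Bool) (x : Base P) (s : ℝ) :
    V →L[ℝ] V :=
  (J (α.leg h i x s)).comp (κ (α.leg h i x s))

/-- Stabilization data for `TN` along the homotopies, with a number of steps which is large enough for
the transport along the homotopies to be injective. -/
structure IsTransportData (K : Set N) (J : N → EuclideanSpace ℝ (Fin n) →L[ℝ] V)
    (κ : N → V →L[ℝ] EuclideanSpace ℝ (Fin n)) (m : ℕ) : Prop where
  stab : IsStabilization (𝓡 n) K J κ
  mem : ∀ h i x s, α.leg h i x s ∈ K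
  ne_zero : m ≠ 0
  step : ∀ h i x (a b : ℝ), |a - b| ≤ 1 / m → ‖α.legProj J κ h i x a - α.legProj J κ h i x b‖ < 1

/-- The paths of the homotopies cover only a compact part of `N`, over which `TN` can be stabilized
and a uniform number of transport steps chosen. -/
theorem exists_isTransportData [T2Space N] [∀ i, CompactSpace (P i)] :
    ∃ (k : ℕ) (K : Set N) (J : N → EuclideanSpace ℝ (Fin n) →L[ℝ] (Fin k → EuclideanSpace ℝ (Fin n)))
      (κ : N → (Fin k → EuclideanSpace ℝ (Fin n)) →L[ℝ] EuclideanSpace ℝ (Fin n)) (m : ℕ),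
      α.IsTransportData K J κ m := by
  have : LocallyCompactSpace N := Manifold.locallyCompact_of_finiteDimensional (𝓡 n)
  let K : Set N := ⋃ l : Fin 3 × Bool,
    (fun q : Base P × ℝ => α.leg l.1 l.2 q.1 q.2) '' (univ ×ˢ Icc 0 1)
  have hK : IsCompact K := isCompact_iUnion fun l =>
    (isCompact_univ.prod isCompact_Icc).image (α.continuous_leg l.1 l.2)
  have hmem : ∀ h i x s, α.leg h i x s ∈ K := fun h i x s => by
    rw [leg_projIcc]
    exact mem_iUnion.2 ⟨(h, i), (x, _), ⟨trivial, (projIcc (0 : ℝ) 1 zero_le_one s).2⟩, rfl⟩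
  obtain ⟨k, J, κ, hs⟩ := exists_isStabilization (I := 𝓡 n) hK
  obtain ⟨m, hm, hstep⟩ := exists_transport_step
    (G := fun l : Fin 3 × Bool => α.legProj J κ l.1 l.2)
    (fun l => hs.continuous_comp.comp (α.continuous_leg l.1 l.2))
    (fun l x a => by rw [legProj, leg_projIcc]; rfl)
  exact ⟨k, K, J, κ, m, hs, hmem, hm, fun h i => hstep (h, i)⟩

/-- The transport of the first difference of a piece to the endpoint. -/
noncomputable def transport₁ (J : N → EuclideanSpace ℝ (Fin n) →L[ℝ] V)
    (κ : N → V →L[ℝ] EuclideanSpace ℝ (Fin n)) (m : ℕ) : Piece → Ambient P → V →L[ℝ] V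
  | .W h, q => transport (α.legProj J κ h true q.1) m q.2.1 0
  | .X₁ _, _ => ContinuousLinearMap.id ℝ V
  | .X₂ h, q => transport (α.legProj J κ h true q.1) m q.2.1 q.2.2

/-- The transport of the second difference of a piece to the endpoint. -/
noncomputable def transport₂ (J : N → EuclideanSpace ℝ (Fin n) →L[ℝ] V)
    (κ : N → V →L[ℝ] EuclideanSpace ℝ (Fin n)) (m : ℕ) : Piece → Ambient P → V →L[ℝ] V
  | .W h, q => transport (α.legProj J κ (h + 1) false q.1) m q.2.2 0
  | .X₁ h, q => transport (α.legProj J κ h false q.1) m q.2.2 q.2.1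
  | .X₂ _, _ => ContinuousLinearMap.id ℝ V

/-- The power of the rotation which makes the pieces agree along the edges. -/
noncomputable def twist (V : Type*) [NormedAddCommGroup V] [NormedSpace ℝ V] :
    Fin 3 → V × V →L[ℝ] V × V
  | 0 => ContinuousLinearMap.id ℝ (V × V)
  | 1 => (rotate V).comp (rotate V)
  | 2 => rotate V

/-- Passing a diagonal edge costs one rotation, and there are three such edges around the origin.
The powers close up cyclically because the rotation has order three. -/
theorem twist_add_two (h : Fin 3) (x : V × V) :
    twist V (h + 1 + 1) x = twist V h (rotate V x) := by
  fin_cases h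
  · rfl
  · exact (rotate_rotate_rotate x).symm
  · rfl

theorem twist_injective (h : Fin 3) : Function.Injective (twist V h) := by
  have h1 : Function.Injective (rotate V) := fun x y hxy => by
    rw [← rotate_rotate_rotate x, hxy, rotate_rotate_rotate]
  fin_cases h
  · exact fun _ _ h => h
  · exact h1.comp h1
  · exact h1

/-- The power of the rotation for a piece. -/
noncomputable def pieceTwist (V : Type*) [NormedAddCommGroup V] [NormedSpace ℝ V] :
    Piece → V × V →L[ℝ] V × V
  | .W h => twist V h
  | .X₁ h => twist V (h + 1 + 1)
  | .X₂ h => twist V h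

/-- The normal differential of a piece, with values in the sum of two copies of the tangent space of
`N` at the endpoint. -/
noncomputable def normal (J : N → EuclideanSpace ℝ (Fin n) →L[ℝ] V)
    (κ : N → V →L[ℝ] EuclideanSpace ℝ (Fin n)) (m : ℕ) (c : Piece) (q : Ambient P) :
    (BaseSpace p × (ℝ × ℝ)) →L[ℝ] V × V :=
  (pieceTwist V c).comp (((α.transport₁ J κ m c (secMap c q)).prodMap
    (α.transport₂ J κ m c (secMap c q))).comp (α.gap J c q))

variable {K : Set N} {J : N → EuclideanSpace ℝ (Fin n) →L[ℝ] V}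
  {κ : N → V →L[ℝ] EuclideanSpace ℝ (Fin n)} {m : ℕ}

theorem normal_apply (c : Piece) (q : Ambient P) (v : BaseSpace p × (ℝ × ℝ)) :
    α.normal J κ m c q v = pieceTwist V c (α.transport₁ J κ m c (secMap c q) (α.gap J c q v).1,
      α.transport₂ J κ m c (secMap c q) (α.gap J c q v).2) := rfl

theorem pieceTwist_injective (c : Piece) : Function.Injective (pieceTwist V c) := by
  rcases c with h | h | h <;> exact twist_injective _

variable {α}

theorem IsTransportData.legProj_idem (h : α.IsTransportData K J κ m) (l : Fin 3) (i : Bool)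
    (x : Base P) (s : ℝ) (u : V) :
    α.legProj J κ l i x s (α.legProj J κ l i x s u) = α.legProj J κ l i x s u :=
  h.stab.idem (h.mem l i x s) u

/-- The transport follows the second component of `H_{hi}` from time `s`, and it ends at the
endpoint: at time `0` this component is `f_i`, and on `X₂` at time `t` it is `f_j` by the other
diagonal condition. -/
theorem IsTransportData.transport₁_spec (hd : α.IsTransportData K J κ m) {c : Piece} {q : Ambient P}
    (hq : q ∈ α.piece c) {u : V} (hu : J (α.Φ c q).1.1 (κ (α.Φ c q).1.1 u) = u) :
    J (α.endpt c q.1) (κ (α.endpt c q.1) (α.transport₁ J κ m c q u)) = α.transport₁ J κ m c q u ∧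
      (α.transport₁ J κ m c q u = 0 → u = 0) := by
  obtain ⟨x, s, t⟩ := q
  obtain ⟨hr, h1, h2⟩ := hq
  have h0 := region_nonneg (wall_nonneg hr)
  have hl := region_le_one hr
  have hs : s ∈ Icc (0 : ℝ) 1 := ⟨h0.1, hl.1⟩
  have ht : t ∈ Icc (0 : ℝ) 1 := ⟨h0.2, hl.2⟩
  rcases c with h | h | h
  · have hu' : α.legProj J κ h true x s u = u := by
      rw [legProj, α.leg_true h x hs]
      rw [h1] at hu
      exact hu
    refine ⟨?_, eq_zero_of_transport_eq_zero hd.ne_zero (hd.legProj_idem h true x)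
      (hd.step h true x) hs (by simp) hu'⟩
    have := transport_mem (s' := 0) hd.ne_zero (hd.legProj_idem h true x) hu'
    rwa [legProj, α.leg_true_zero h x] at this
  · exact ⟨hu, id⟩
  · have hu' : α.legProj J κ h true x s u = u := by
      rw [legProj, α.leg_true h x hs]
      rw [h1] at hu
      exact hu
    refine ⟨?_, eq_zero_of_transport_eq_zero hd.ne_zero (hd.legProj_idem h true x)
      (hd.step h true x) hs ht hu'⟩
    have := transport_mem (s' := t) hd.ne_zero (hd.legProj_idem h true x) hu'
    have h3 : (α.htpy h x t).2 = α.f (h + 1 + 1) (coord (h + 1 + 1) x) := h2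
    rwa [legProj, α.leg_true h x ht, h3] at this

/-- Here the path is the first component of a homotopy, from time `t`. On `W` it runs back to time
`0`; on `X₁` it runs to time `s`, where the first diagonal condition identifies it with `f_j`. -/
theorem IsTransportData.transport₂_spec (hd : α.IsTransportData K J κ m) {c : Piece} {q : Ambient P}
    (hq : q ∈ α.piece c) {u : V} (hu : J (α.Φ c q).2.1 (κ (α.Φ c q).2.1 u) = u) :
    J (α.endpt c q.1) (κ (α.endpt c q.1) (α.transport₂ J κ m c q u)) = α.transport₂ J κ m c q u ∧
      (α.transport₂ J κ m c q u = 0 → u = 0) := by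
  obtain ⟨x, s, t⟩ := q
  obtain ⟨hr, h1, h2⟩ := hq
  have h0 := region_nonneg (wall_nonneg hr)
  have hl := region_le_one hr
  have hs : s ∈ Icc (0 : ℝ) 1 := ⟨h0.1, hl.1⟩
  have ht : t ∈ Icc (0 : ℝ) 1 := ⟨h0.2, hl.2⟩
  rcases c with h | h | h
  · have hu' : α.legProj J κ (h + 1) false x t u = u := by
      rw [legProj, α.leg_false (h + 1) x ht]
      exact hu
    refine ⟨?_, eq_zero_of_transport_eq_zero hd.ne_zero (hd.legProj_idem (h + 1) false x)
      (hd.step (h + 1) false x) ht (by simp) hu'⟩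
    have := transport_mem (s' := 0) hd.ne_zero (hd.legProj_idem (h + 1) false x) hu'
    rwa [legProj, α.leg_false_zero (h + 1) x] at this
  · have hu' : α.legProj J κ h false x t u = u := by
      rw [legProj, α.leg_false h x ht]
      exact hu
    refine ⟨?_, eq_zero_of_transport_eq_zero hd.ne_zero (hd.legProj_idem h false x)
      (hd.step h false x) ht hs hu'⟩
    have := transport_mem (s' := s) hd.ne_zero (hd.legProj_idem h false x) hu'
    have h3 : α.f (h + 1 + 1) (coord (h + 1 + 1) x) = (α.htpy h x s).1 := h1
    rwa [legProj, α.leg_false h x hs, ← h3] at this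
  · have h3 : (α.htpy h x t).2 = α.f (h + 1 + 1) (coord (h + 1 + 1) x) := h2
    have hu : J (α.htpy h x t).2 (κ (α.htpy h x t).2 u) = u := hu
    rw [h3] at hu
    exact ⟨hu, id⟩

theorem IsTransportData.f_mem (hd : α.IsTransportData K J κ m) (i : Fin 3) (x : Base P) :
    α.f i (coord i x) ∈ K := α.leg_false_zero i x ▸ hd.mem i false x 0

/-- The points of a piece are mapped to the diagonals over `K`. -/
theorem IsTransportData.Φ_mem (hd : α.IsTransportData K J κ m) {c : Piece} {q : Ambient P}
    (hq : q.2 ∈ c.region) : (α.Φ c q).1.1 ∈ K ∧ (α.Φ c q).2.1 ∈ K := by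
  obtain ⟨x, s, t⟩ := q
  have h0 := region_nonneg (wall_nonneg hq)
  have hl := region_le_one hq
  have hs : s ∈ Icc (0 : ℝ) 1 := ⟨h0.1, hl.1⟩
  have ht : t ∈ Icc (0 : ℝ) 1 := ⟨h0.2, hl.2⟩
  have h1 : ∀ h, ∀ s ∈ Icc (0 : ℝ) 1, (α.htpy h x s).1 ∈ K := fun h s hs =>
    α.leg_false h x hs ▸ hd.mem h false x s
  rcases c with h | h | h
  · exact ⟨h1 h s hs, h1 (h + 1) t ht⟩
  · exact ⟨hd.f_mem _ x, h1 h t ht⟩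
  · have h2 := hd.mem h true x t
    rw [α.leg_true h x ht] at h2
    exact ⟨h1 h s hs, h2⟩

theorem IsTransportData.endpt_mem (hd : α.IsTransportData K J κ m) (c : Piece) (x : Base P) :
    α.endpt c x ∈ K := by
  rcases c with h | h | h
  exacts [hd.f_mem _ x, hd.f_mem _ x, hd.f_mem _ x]

/-- On a piece the two points of each pair coincide, so the gap is `J` at that point applied to a
difference of vectors; over `K` the map `J` has the left inverse `κ`. -/
theorem IsTransportData.gap_spec (hd : α.IsTransportData K J κ m) {c : Piece} {q : Ambient P}
    (hq : secMap c q ∈ α.piece c) (v : BaseSpace p × (ℝ × ℝ)) :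
    (J (α.Φ c (secMap c q)).1.1 (κ (α.Φ c (secMap c q)).1.1 (α.gap J c q v).1) = (α.gap J c q v).1 ∧
      J (α.Φ c (secMap c q)).2.1 (κ (α.Φ c (secMap c q)).2.1 (α.gap J c q v).2) =
        (α.gap J c q v).2) ∧ (α.gap J c q v = 0 → v ∈ α.tangentPiece c q) := by
  obtain ⟨hr, h1, h2⟩ := hq
  have hK := hd.Φ_mem hr
  rw [gap_apply, ← h1, ← h2, ← map_sub, ← map_sub]
  refine ⟨⟨by rw [hd.stab.retract _ hK.1], by rw [hd.stab.retract _ hK.2]⟩, fun h0 => ?_⟩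
  have e1 := congrArg (κ (α.Φ c (secMap c q)).1.1) (congrArg Prod.fst h0)
  have e2 := congrArg (κ (α.Φ c (secMap c q)).2.1) (congrArg Prod.snd h0)
  rw [Prod.fst_zero, map_zero, hd.stab.retract _ hK.1] at e1
  rw [Prod.snd_zero, map_zero, hd.stab.retract _ hK.2] at e2
  exact (α.mem_tangentPiece).2 (Prod.ext e1 e2)

/-- The normal differential is injective modulo the tangent space of the piece, and takes values in
the tangent space at the endpoint. -/
theorem IsTransportData.normal_spec (hd : α.IsTransportData K J κ m) {c : Piece} {q : Ambient P}
    (hq : secMap c q ∈ α.piece c) (v : BaseSpace p × (ℝ × ℝ)) :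
    (J (α.endpt c q.1) (κ (α.endpt c q.1) (α.normal J κ m c q v).1) = (α.normal J κ m c q v).1 ∧
      J (α.endpt c q.1) (κ (α.endpt c q.1) (α.normal J κ m c q v).2) = (α.normal J κ m c q v).2) ∧
      (α.normal J κ m c q v = 0 → v ∈ α.tangentPiece c q) := by
  obtain ⟨⟨g1, g2⟩, g3⟩ := hd.gap_spec hq v
  have t1 := hd.transport₁_spec hq g1
  have t2 := hd.transport₂_spec hq g2
  have t1' : J (α.endpt c q.1) (κ (α.endpt c q.1) _) = _ := t1.1
  have t2' : J (α.endpt c q.1) (κ (α.endpt c q.1) _) = _ := t2.1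
  rw [normal_apply]
  set A := α.transport₁ J κ m c (secMap c q) (α.gap J c q v).1
  set B := α.transport₂ J κ m c (secMap c q) (α.gap J c q v).2
  refine ⟨?_, fun h0 => g3 ?_⟩
  -- The twists form integral combinations of the two components, so they preserve any condition of
  -- being fixed by a linear map.
  · have key : ∀ (E : V →L[ℝ] V) (x : V × V), E x.1 = x.1 → E x.2 = x.2 → ∀ h,
        E (twist V h x).1 = (twist V h x).1 ∧ E (twist V h x).2 = (twist V h x).2 := by
      intro E
      have hrot : ∀ x : V × V, E x.1 = x.1 → E x.2 = x.2 →
          E (rotate V x).1 = (rotate V x).1 ∧ E (rotate V x).2 = (rotate V x).2 := fun x h1 h2 => by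
        rw [rotate_apply]
        exact ⟨h2, by rw [map_sub, map_neg, h1, h2]⟩
      intro x h1 h2 h
      have r1 := hrot x h1 h2
      have r2 := hrot _ r1.1 r1.2
      fin_cases h
      exacts [⟨h1, h2⟩, r2, r1]
    have := key ((J (α.endpt c q.1)).comp (κ (α.endpt c q.1))) (A, B) t1' t2'
    rcases c with h | h | h
    exacts [this h, this (h + 1 + 1), this h]
  · have h4 := pieceTwist_injective c (h0.trans (map_zero (pieceTwist V c)).symm)
    exact Prod.ext (t1.2 (congrArg Prod.fst h4)) (t2.2 (congrArg Prod.snd h4))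

/-- The normal differentials of two pieces agree along a common edge. -/
theorem IsTransportData.normal_eq_of_edgeAt (hd : α.IsTransportData K J κ m) {c c' : Piece}
    {x : Base P} {w : ℝ × ℝ} (hE : EdgeAt c c' w) (hc : (x, sec c w) ∈ α.piece c)
    (hc' : (x, sec c' w) ∈ α.piece c') (ξ : BaseSpace p) (r : ℝ) :
    α.normal J κ m c (x, w) (ξ, r • w) = α.normal J κ m c' (x, w) (ξ, r • w) := by
  have hs := hE.sec_eq
  have g := (hd.gap_spec (q := (x, w)) hc (ξ, r • w)).1
  rw [normal_apply, normal_apply]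
  have h0 := region_nonneg (wall_nonneg hc.1)
  have hl := region_le_one hc.1
  rcases hE with ⟨h, _, h0'⟩ | ⟨h, _, h0'⟩ | ⟨h, _, h0'⟩
  · rw [α.gap_edge_t h0' hc.1] at g ⊢
    set u := α.gap J (.X₂ h) (x, w) (ξ, r • w)
    have hσ : (sec (.W h) w).2 = 0 := h0'
    have hσ' : (sec (.X₂ h) w).2 = 0 := hs ▸ hσ
    have e1 : α.transport₁ J κ m (.W h) (secMap (.W h) (x, w)) u.1 =
        α.transport₁ J κ m (.X₂ h) (secMap (.X₂ h) (x, w)) u.1 := by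
      simp only [transport₁, secMap, ← hs, hσ]
    have e2 : α.transport₂ J κ m (.W h) (secMap (.W h) (x, w)) u.2 = u.2 := by
      simp only [transport₂, secMap, hσ]
      refine transport_self ?_
      rw [legProj, α.leg_false (h + 1) x (by simp)]
      have := g.2
      simp only [secMap, Φ, hσ] at this
      exact this
    rw [e1, e2]
    rfl
  · rw [α.gap_edge_s h0' hc.1] at g ⊢
    set u := α.gap J (.X₁ (h + 1)) (x, w) (ξ, r • w)
    have hσ : (sec (.W h) w).1 = 0 := h0'
    have e1 : α.transport₁ J κ m (.W h) (secMap (.W h) (x, w)) u.1 = u.1 := by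
      simp only [transport₁, secMap, hσ]
      refine transport_self ?_
      rw [legProj, α.leg_true h x (by simp)]
      have h1 := g.1
      have h2 := hc.2.1
      simp only [Φ] at h2
      simp only [secMap, Φ] at h1
      rw [h2, hσ] at h1
      exact h1
    have e2 : α.transport₂ J κ m (.W h) (secMap (.W h) (x, w)) u.2 =
        α.transport₂ J κ m (.X₁ (h + 1)) (secMap (.X₁ (h + 1)) (x, w)) u.2 := by
      simp only [transport₂, secMap, ← hs, hσ]
    rw [e1, e2]
    have : pieceTwist V (.X₁ (h + 1)) = pieceTwist V (.W h) := by
      change twist V (h + 1 + 1 + 1) = twist V h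
      rw [fin_add_three]
    rw [this]
    rfl
  · rw [α.gap_edge_st h0' hc.1]
    set u := α.gap J (.X₁ h) (x, w) (ξ, r • w)
    have hσ : (sec (.X₁ h) w).1 = (sec (.X₁ h) w).2 := by
      change -yc h w = -yc (h + 1 + 1) w
      rw [h0']
    have hI : (sec (.X₁ h) w).2 ∈ Icc (0 : ℝ) 1 := ⟨h0.2, hl.2⟩
    have g2 : J (α.htpy h x (sec (.X₁ h) w).2).1 (κ (α.htpy h x (sec (.X₁ h) w).2).1 u.2) = u.2 := g.2
    have e2 : α.transport₂ J κ m (.X₁ h) (secMap (.X₁ h) (x, w)) u.2 = u.2 := by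
      simp only [transport₂, secMap, hσ]
      refine transport_self ?_
      rw [legProj, α.leg_false h x hI]
      exact g2
    have e1 : α.transport₁ J κ m (.X₂ h) (secMap (.X₂ h) (x, w)) (rotate V u).1 = u.2 := by
      simp only [transport₁, secMap, ← hs, hσ]
      refine transport_self ?_
      rw [legProj, α.leg_true h x hI]
      have h2 : (α.htpy h x (sec (.X₁ h) w).2).1 = (α.htpy h x (sec (.X₁ h) w).2).2 := hc.2.2
      rw [h2] at g2
      exact g2
    rw [e1, e2]
    -- As `s = t`, both transports are trivial on the vectors in question; the rotation between the
    -- gaps is absorbed by the difference of the twists.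
    exact twist_add_two h u

/-- The normal differentials of two pieces agree on the radial directions. -/
theorem IsTransportData.normal_eq (hd : α.IsTransportData K J κ m) {c c' : Piece} {q : Ambient P}
    (hq : q ∈ α.fan) (hc : q.2 ∈ sector c) (hc' : q.2 ∈ sector c') {v : BaseSpace p × (ℝ × ℝ)} {r : ℝ}
    (hv : v.2 = r • q.2) : α.normal J κ m c q v = α.normal J κ m c' q v := by
  obtain ⟨x, w⟩ := q
  obtain ⟨ξ, _⟩ := v
  obtain rfl := hv
  have hp : ∀ c, w ∈ sector c → (x, sec c w) ∈ α.piece c := fun c hc => (α.mem_fan_iff hc).1 hq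
  rcases edgeAt_of_mem_sector hc hc' with rfl | rfl | hE | hE
  · rfl
  · have h0 : ∀ c, (0 : ℝ × ℝ) ∈ sector c := fun c i => by simp
    exact edgeAt_zero_chain (r := fun c c' => α.normal J κ m c (x, 0) (ξ, r • (0 : ℝ × ℝ)) =
      α.normal J κ m c' (x, 0) (ξ, r • (0 : ℝ × ℝ))) ⟨fun _ => rfl, fun h => h.symm, fun h h' => h.trans h'⟩
      (fun c c' hE => hd.normal_eq_of_edgeAt hE (hp c (h0 c)) (hp c' (h0 c')) ξ r) c c'
  · exact hd.normal_eq_of_edgeAt hE (hp c hc) (hp c' hc') ξ r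
  · exact (hd.normal_eq_of_edgeAt hE (hp c' hc') (hp c hc) ξ r).symm

end Transport

end QuadraticLink

end CubicObstruction

/-! ### Continuity of the normal differentials; projections adapted to the kernel of `dr` -/

namespace CubicObstruction

open Set Filter Topology

namespace QuadraticLink

variable {P : Fin 3 → Type u} {p : Fin 3 → ℕ} {N : Type v} {n : ℕ}
  [∀ i, TopologicalSpace (P i)] [∀ i, ChartedSpace (EuclideanSpace ℝ (Fin (p i))) (P i)]
  [∀ i, IsManifold (𝓡 (p i)) ∞ (P i)]
  [TopologicalSpace N] [ChartedSpace (EuclideanSpace ℝ (Fin n)) N] [IsManifold (𝓡 n) ∞ N]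
  {α : QuadraticLink P p N n} {V : Type*} [NormedAddCommGroup V] [NormedSpace ℝ V]
  {K : Set N} {J : N → EuclideanSpace ℝ (Fin n) →L[ℝ] V}
  {κ : N → V →L[ℝ] EuclideanSpace ℝ (Fin n)} {m : ℕ}

theorem continuous_tvec_map_snd {X : Type*} [TopologicalSpace X] {q : X → Ambient P}
    {v : X → BaseSpace p × (ℝ × ℝ)} (hv : Continuous fun a => tvec (ambientModel p) (q a) (v a))
    (f : (ℝ × ℝ) →L[ℝ] ℝ × ℝ) (g : (ℝ × ℝ) →L[ℝ] ℝ × ℝ) :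
    Continuous fun a => tvec (ambientModel p) ((q a).1, f (q a).2) ((v a).1, g (v a).2) := by
  have h1 := continuous_tvec_fst (I := baseModel p) (I' := 𝓘(ℝ, ℝ × ℝ)) hv
  have h2 := continuous_tvec_model.1
    (continuous_tvec_snd (I := baseModel p) (I' := 𝓘(ℝ, ℝ × ℝ)) hv)
  exact continuous_tvec_prod h1 (continuous_tvec_model.2
    ⟨f.continuous.comp h2.1, g.continuous.comp h2.2⟩)

theorem continuous_tvec_proj {X : Type*} [TopologicalSpace X] {q : X → Ambient P}
    {v : X → BaseSpace p × (ℝ × ℝ)} (hv : Continuous fun a => tvec (ambientModel p) (q a) (v a)) :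
    Continuous q := by
  have : ∀ i, IsManifold (𝓡 (p i)) 1 (P i) := fun i => .of_le (n := ∞) (by simp)
  exact (FiberBundle.continuous_proj (BaseSpace p × (ℝ × ℝ))
    (TangentSpace (ambientModel p) : Ambient P → Type)).comp hv

/-- The tangent map of `Φ` within the region is continuous, and `J` takes tangent vectors at varying
points to one fixed vector space, where they can be subtracted. -/
theorem IsTransportData.continuous_gap (hd : α.IsTransportData K J κ m) (c : Piece) {X : Type*}
    [TopologicalSpace X] {q : X → Ambient P} {v : X → BaseSpace p × (ℝ × ℝ)}
    (hv : Continuous fun a => tvec (ambientModel p) (q a) (v a))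
    (hr : ∀ a, sec c (q a).2 ∈ c.region) : Continuous fun a => α.gap J c (q a) (v a) := by
  have h1 := (α.contMDiffOn_Φ c).continuousOn_tangentMapWithin (by simp)
    (uniqueMDiffOn_univ_prod_region c)
  have h2 := continuous_tvec_map_snd hv (sec c : (ℝ × ℝ) →L[ℝ] ℝ × ℝ) (sec c : (ℝ × ℝ) →L[ℝ] ℝ × ℝ)
  have h3 : Continuous fun a => tvec (fourModel n) (α.Φ c (secMap c (q a))) (α.dΦ c (q a) (v a)) :=
    h1.comp_continuous h2 fun a => ⟨trivial, hr a⟩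
  have k1 := continuous_tvec_fst (I := (𝓡 n).prod (𝓡 n)) (I' := (𝓡 n).prod (𝓡 n)) h3
  have k2 := continuous_tvec_snd (I := (𝓡 n).prod (𝓡 n)) (I' := (𝓡 n).prod (𝓡 n)) h3
  have j := hd.stab.continuous
  exact ((j.comp (continuous_tvec_fst k1)).sub (j.comp (continuous_tvec_snd k1))).prodMk
    ((j.comp (continuous_tvec_fst k2)).sub (j.comp (continuous_tvec_snd k2)))

theorem IsTransportData.continuous_legProj (hd : α.IsTransportData K J κ m) {X : Type*}
    [TopologicalSpace X] {x : X → Base P} (hx : Continuous x) (h : Fin 3) (i : Bool) :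
    Continuous fun a : X × ℝ => α.legProj J κ h i (x a.1) a.2 :=
  hd.stab.continuous_comp.comp ((α.continuous_leg h i).comp
    ((hx.comp continuous_fst).prodMk continuous_snd))

theorem IsTransportData.continuous_normal (hd : α.IsTransportData K J κ m) (c : Piece) {X : Type*}
    [TopologicalSpace X] {q : X → Ambient P} {v : X → BaseSpace p × (ℝ × ℝ)}
    (hv : Continuous fun a => tvec (ambientModel p) (q a) (v a))
    (hr : ∀ a, sec c (q a).2 ∈ c.region) : Continuous fun a => α.normal J κ m c (q a) (v a) := by
  have hq := continuous_tvec_proj hv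
  have hx : Continuous fun a => (q a).1 := continuous_fst.comp hq
  have hσ : Continuous fun a => sec c (q a).2 := (sec c).continuous.comp (continuous_snd.comp hq)
  have hσ1 := continuous_fst.comp hσ
  have hσ2 := continuous_snd.comp hσ
  have t1 : Continuous fun a => α.transport₁ J κ m c (secMap c (q a)) := by
    rcases c with h | h | h
    · exact continuous_transport (hd.continuous_legProj hx h true) m hσ1 continuous_const
    · exact continuous_const
    · exact continuous_transport (hd.continuous_legProj hx h true) m hσ1 hσ2
  have t2 : Continuous fun a => α.transport₂ J κ m c (secMap c (q a)) := by
    rcases c with h | h | h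
    · exact continuous_transport (hd.continuous_legProj hx (h + 1) false) m hσ2 continuous_const
    · exact continuous_transport (hd.continuous_legProj hx h false) m hσ2 hσ1
    · exact continuous_const
  have g := hd.continuous_gap c hv hr
  exact (pieceTwist V c).continuous.comp ((t1.clm_apply (continuous_fst.comp g)).prodMk
    (t2.clm_apply (continuous_snd.comp g)))

variable [T2Space N] [∀ i, CompactSpace (P i)] [∀ i, T2Space (P i)]

/-- Near each point of `Z` there is a projection of the plane which is the identity on the kernel of
the differential of the resolution, and has radial values at the points in more than one sector. -/
theorem IsResolution.exists_projection {d : ℕ} [ChartedSpace (EuclideanSpace ℝ (Fin d)) α.Z]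
    {r : Ambient P → α.Z} {U OV : Set (Ambient P)} {OR : Piece → Set (Ambient P)}
    (h : α.IsResolution d r U OV OR) (z₀ : α.Z) :
    ∃ (O : Set α.Z) (L : (ℝ × ℝ) →L[ℝ] ℝ × ℝ), IsOpen O ∧ z₀ ∈ O ∧ ∀ z ∈ O,
      (∀ v, mder (ambientModel p) (𝓡 d) r (α.emb z) v = 0 → L v.2 = v.2) ∧
      ∀ c c' w, (α.emb z).2 ∈ sector c → (α.emb z).2 ∈ sector c' →
        c = c' ∨ ∃ a : ℝ, L w = a • (α.emb z).2 := by
  have hemb := α.continuous_emb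
  let R : Piece → Set α.Z := fun k => {z | rayEq k (α.emb z).2 = 0 ∧ 0 ≤ rayPos k (α.emb z).2}
  have hR : ∀ k, IsClosed (R k) := fun k =>
    (isClosed_eq ((rayEq k).continuous.comp (continuous_snd.comp hemb)) continuous_const).inter
      (isClosed_le continuous_const ((rayPos k).continuous.comp (continuous_snd.comp hemb)))
  by_cases hV : α.emb z₀ ∈ OV
  -- Near the vertex the kernel has no component in the plane, so the zero projection is the
  -- identity on it.
  · exact ⟨α.emb ⁻¹' OV, 0, h.isOpen_vertex.preimage hemb, hV, fun z hz =>
      ⟨fun v hv => (h.ker_vertex z hz v hv).symm, fun c c' w _ _ => Or.inr ⟨0, by simp⟩⟩⟩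
  by_cases hk : ∃ k, rayEq k (α.emb z₀).2 = 0 ∧ 0 < rayPos k (α.emb z₀).2
  · obtain ⟨k, hk1, hk2⟩ := hk
    obtain ⟨u, hu⟩ := exists_ray_vector k
    obtain ⟨l₀, hl₀⟩ : ∃ l, l ≠ k := by
      by_cases hk : k = .W 0
      · exact ⟨.W 1, by rw [hk]; simp⟩
      · exact ⟨.W 0, fun h => hk h.symm⟩
    have hcl : IsClosed (⋃ l : {l // l ≠ k}, R l) := isClosed_iUnion_of_finite fun l => hR l.1
    -- Near a ray the kernel is parallel to it, so the projection onto the line of the ray will do.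
    -- Removing the other closed rays, and with them the origin, leaves this ray as the only place
    -- where sectors meet.
    refine ⟨α.emb ⁻¹' OR k ∩ (⋃ l : {l // l ≠ k}, R l)ᶜ, (rayPos k).smulRight u,
      ((h.isOpen_ray k).preimage hemb).inter hcl.isOpen_compl,
      ⟨(h.ray_mem k z₀ hk1 hk2).resolve_left hV, fun hz => ?_⟩, fun z hz => ⟨fun v hv => ?_,
        fun c c' w hc hc' => ?_⟩⟩
    · obtain ⟨l, hl⟩ := mem_iUnion.1 hz
      exact ray_disjoint (Ne.symm l.2) hk1 hk2 hl.1 hl.2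
    · exact (ray_eq_smul hu (h.ker_ray k z hz.1 v hv)).symm
    · have hno : ∀ l, l ≠ k → z ∉ R l := fun l hl hzl => hz.2 (mem_iUnion.2 ⟨⟨l, hl⟩, hzl⟩)
      have hw0 : (α.emb z).2 ≠ 0 := fun h0 => hno l₀ hl₀ ⟨by simp [h0], by simp [h0]⟩
      have hE : ∀ {c c'}, EdgeAt c c' (α.emb z).2 → (α.emb z).2 ∈ sector c →
          (α.emb z).2 ∈ sector c' → ∃ a : ℝ, (rayPos k).smulRight u w = a • (α.emb z).2 := by
        intro c c' hE hc hc'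
        obtain ⟨l, hl1, hl2⟩ := hE.exists_ray hc hc' hw0
        obtain rfl : l = k := by
          by_contra hlk
          exact hno l hlk ⟨hl1, hl2.le⟩
        refine ⟨rayPos l w / rayPos l (α.emb z).2, ?_⟩
        have e1 : (rayPos l w / rayPos l (α.emb z).2) • (α.emb z).2 =
            (rayPos l w / rayPos l (α.emb z).2) • rayPos l (α.emb z).2 • u :=
          congrArg _ (ray_eq_smul hu hl1)
        rw [e1, smul_smul, div_mul_cancel₀ _ hl2.ne']
        rfl
      rcases edgeAt_of_mem_sector hc hc' with h1 | h1 | h1 | h1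
      exacts [Or.inl h1, absurd h1 hw0, Or.inr (hE h1 hc hc'), Or.inr (hE h1 hc' hc)]
  · have hgen : ∀ z, z ∉ ⋃ l, R l ↔ ((α.emb z).2 ≠ 0 ∧
        ¬ ∃ k, rayEq k (α.emb z).2 = 0 ∧ 0 < rayPos k (α.emb z).2) := fun z => by
      constructor
      · refine fun hz => ⟨fun h0 => hz (mem_iUnion.2 ⟨.W 0, by simp [h0], by simp [h0]⟩), ?_⟩
        rintro ⟨k, h1, h2⟩
        exact hz (mem_iUnion.2 ⟨k, h1, h2.le⟩)
      · rintro ⟨h0, h1⟩ hz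
        obtain ⟨k, hk1, hk2⟩ := mem_iUnion.1 hz
        exact h1 ⟨k, hk1, lt_of_le_of_ne hk2 fun h2 => h0 (ray_injective k h2.symm hk1)⟩
    -- Away from the rays and the origin each point lies in one sector only, and no projection is
    -- needed.
    refine ⟨(⋃ l, R l)ᶜ, ContinuousLinearMap.id ℝ (ℝ × ℝ),
      (isClosed_iUnion_of_finite fun l => hR l).isOpen_compl,
      (hgen z₀).2 ⟨fun h0 => hV (h.vertex_mem z₀ h0), hk⟩, fun z hz => ⟨fun v _ => rfl,
      fun c c' w hc hc' => Or.inl ?_⟩⟩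
    obtain ⟨h0, hno⟩ := (hgen z).1 hz
    rcases edgeAt_of_mem_sector hc hc' with h1 | h1 | h1 | h1
    exacts [h1, absurd h1 h0, absurd (h1.exists_ray hc hc' h0) hno,
      absurd (h1.exists_ray hc' hc h0) hno]

end QuadraticLink

end CubicObstruction

/-! ### A continuous family of normal differentials and the bundle isomorphism -/

namespace CubicObstruction

open Set Filter Topology

namespace QuadraticLink

variable {P : Fin 3 → Type u} {p : Fin 3 → ℕ} {N : Type v} {n : ℕ}
  [∀ i, TopologicalSpace (P i)] [∀ i, ChartedSpace (EuclideanSpace ℝ (Fin (p i))) (P i)]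
  [∀ i, IsManifold (𝓡 (p i)) ∞ (P i)]
  [TopologicalSpace N] [ChartedSpace (EuclideanSpace ℝ (Fin n)) N] [IsManifold (𝓡 n) ∞ N]
  {α : QuadraticLink P p N n} {V : Type*} [NormedAddCommGroup V] [NormedSpace ℝ V]
  {K : Set N} {J : N → EuclideanSpace ℝ (Fin n) →L[ℝ] V}
  {κ : N → V →L[ℝ] EuclideanSpace ℝ (Fin n)} {m : ℕ}

theorem secMap_emb_mem {c : Piece} {z : α.Z} (hz : (α.emb z).2 ∈ sector c) :
    secMap c (α.emb z) ∈ α.piece c :=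
  (α.exists_toZ_of_mem_sector hz).1

theorem endpt_emb {c : Piece} {z : α.Z} (hz : (α.emb z).2 ∈ sector c) :
    α.endpt c (α.emb z).1 = α.e z := by
  obtain ⟨h1, h2⟩ := α.exists_toZ_of_mem_sector hz
  conv_rhs => rw [← h2]
  rfl

theorem IsTransportData.e_mem (hd : α.IsTransportData K J κ m) (z : α.Z) : α.e z ∈ K := by
  obtain ⟨c, hc⟩ := sector_cover (α.emb z).2
  exact endpt_emb hc ▸ hd.endpt_mem c _

/-- Where `L` has radial values at the points in more than one sector, the normal differentials of
the pieces combine to a continuous family after composition with `L`. -/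
theorem IsTransportData.continuousOn_normal (hd : α.IsTransportData K J κ m) {O : Set α.Z}
    {L : (ℝ × ℝ) →L[ℝ] ℝ × ℝ} (hL : ∀ z ∈ O, ∀ c c' w, (α.emb z).2 ∈ sector c →
      (α.emb z).2 ∈ sector c' → c = c' ∨ ∃ a : ℝ, L w = a • (α.emb z).2)
    {c : α.Z → Piece} (hc : ∀ z, (α.emb z).2 ∈ sector (c z)) {X : Type*} [TopologicalSpace X]
    {z : X → α.Z} {v : X → BaseSpace p × (ℝ × ℝ)} (hz : Continuous z)
    (hv : Continuous fun a => tvec (ambientModel p) (α.emb (z a)) (v a)) :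
    ContinuousOn (fun a => α.normal J κ m (c (z a)) (α.emb (z a)) ((v a).1, L (v a).2))
      (z ⁻¹' O) := by
  rw [continuousOn_iff_continuous_domRestrict]
  let S : Piece → Set (z ⁻¹' O) := fun c' => {a | (α.emb (z a)).2 ∈ sector c'}
  have hzc : Continuous fun a : z ⁻¹' O => z a := hz.comp continuous_subtype_val
  -- Continuity is checked on the finite closed cover by sectors. Where the chosen piece differs
  -- from that of the sector, the plane component after `L` is radial and the normal differentials
  -- agree.
  refine (locallyFinite_of_finite S).continuous (iUnion_eq_univ_iff.2 fun a => sector_cover _)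
    (fun c' => (isClosed_sector c').preimage (continuous_snd.comp (α.continuous_emb.comp hzc)))
    fun c' => ?_
  rw [continuousOn_iff_continuous_domRestrict]
  have h1 : Continuous fun a : S c' =>
      tvec (ambientModel p) (α.emb (z a.1.1)) ((v a.1.1).1, L (v a.1.1).2) :=
    continuous_tvec_map_snd (hv.comp (continuous_subtype_val.comp continuous_subtype_val))
      (ContinuousLinearMap.id ℝ (ℝ × ℝ)) L
  refine (hd.continuous_normal c' h1 fun a => (secMap_emb_mem a.2).1).congr fun a => ?_
  have hf : α.emb (z a.1.1) ∈ α.fan := α.range_emb ▸ mem_range_self _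
  rcases hL _ a.1.2 c' (c (z a.1.1)) (v a.1.1).2 a.2 (hc _) with h | ⟨r, hr⟩
  · exact congrArg (fun c => α.normal J κ m c (α.emb (z a.1.1))
      ((v a.1.1).1, L (v a.1.1).2)) h
  · exact hd.normal_eq hf a.2 (hc _) hr

variable [T2Space N] [∀ i, CompactSpace (P i)] [∀ i, T2Space (P i)]

/-- The normal differentials of the pieces can be replaced by a continuous family which agrees with
them on the kernel of the differential of the resolution. -/
theorem IsResolution.exists_continuous_normal {d : ℕ}
    [ChartedSpace (EuclideanSpace ℝ (Fin d)) α.Z]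
    {r : Ambient P → α.Z} {U OV : Set (Ambient P)} {OR : Piece → Set (Ambient P)}
    (h : α.IsResolution d r U OV OR) (hd : α.IsTransportData K J κ m) :
    ∃ A : α.Z → (BaseSpace p × (ℝ × ℝ)) →L[ℝ] V × V,
      (∀ z v, J (α.e z) (κ (α.e z) (A z v).1) = (A z v).1 ∧
        J (α.e z) (κ (α.e z) (A z v).2) = (A z v).2) ∧
      (∀ z v, mder (ambientModel p) (𝓡 d) r (α.emb z) v = 0 → A z v = 0 → v = 0) ∧
      ∀ (X : Type u) [TopologicalSpace X] (z : X → α.Z) (v : X → BaseSpace p × (ℝ × ℝ)),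
        Continuous z → Continuous (fun a => tvec (ambientModel p) (α.emb (z a)) (v a)) →
        Continuous fun a => A (z a) (v a) := by
  -- An arbitrary, discontinuous choice of a sector for every point.
  choose c hc using fun z : α.Z => sector_cover (α.emb z).2
  choose O L hO hzO hker hL using h.exists_projection
  obtain ⟨t, ht⟩ := isCompact_univ.elim_finite_subcover O hO
    fun z _ => mem_iUnion.2 ⟨z, hzO z⟩
  let ι : Fin t.card → α.Z := fun i => (t.equivFin.symm i : α.Z)
  have hcov : (univ : Set α.Z) ⊆ ⋃ i, O (ι i) := fun z hz => by
    obtain ⟨y, hy, hzy⟩ := mem_iUnion₂.1 (ht hz)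
    exact mem_iUnion.2 ⟨t.equivFin ⟨y, hy⟩, by simpa [ι] using hzy⟩
  obtain ⟨χ, hχs, hχ1, -, -⟩ := exists_continuous_sum_one_of_isOpen_isCompact
    (fun i => hO (ι i)) isCompact_univ hcov
  have hχ0 : ∀ i, ∀ z ∉ tsupport (χ i), χ i z = 0 := fun i z hz => image_eq_zero_of_notMem_tsupport hz
  have hsum : ∀ z, ∑ i, χ i z = 1 := fun z => by simpa using hχ1 (mem_univ z)
  let B : Fin t.card → α.Z → (BaseSpace p × (ℝ × ℝ)) →L[ℝ] V × V := fun i z =>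
    (α.normal J κ m (c z) (α.emb z)).comp
      ((ContinuousLinearMap.id ℝ (BaseSpace p)).prodMap (L (ι i)))
  have hB : ∀ i z v, B i z v = α.normal J κ m (c z) (α.emb z) (v.1, L (ι i) v.2) :=
    fun _ _ _ => rfl
  -- Each summand is continuous because its local projection makes the choice of sector irrelevant.
  let A : α.Z → (BaseSpace p × (ℝ × ℝ)) →L[ℝ] V × V := fun z => ∑ i, χ i z • B i z
  have hA : ∀ z v, A z v = ∑ i, χ i z • B i z v := fun z v => by
    simp [A]
  have hspec := fun z v => endpt_emb (hc z) ▸ hd.normal_spec (secMap_emb_mem (hc z)) v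
  refine ⟨A, fun z v => ?_, fun z v hv hAv => ?_, fun X _ z v hz hv => ?_⟩
  · rw [hA]
    simp only [Prod.fst_sum, Prod.snd_sum, Prod.smul_fst, Prod.smul_snd, map_sum, map_smul, hB]
    simp only [(hspec z _).1.1, (hspec z _).1.2, and_self]
  -- On the kernel of `dr` every local projection is the identity, so the weighted sum is the normal
  -- differential itself, whose kernel is tangent to the piece.
  · have h1 : ∀ i, χ i z • B i z v = χ i z • α.normal J κ m (c z) (α.emb z) v := fun i => by
      by_cases hi : z ∈ tsupport (χ i)
      · rw [hB, hker (ι i) z (hχs i hi) v hv]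
      · rw [hχ0 i z hi, zero_smul, zero_smul]
    rw [hA, Finset.sum_congr rfl fun i _ => h1 i, ← Finset.sum_smul, hsum, one_smul] at hAv
    exact h.ker_inter (c z) z (hc z) v hv ((hspec z v).2 hAv)
  · simp only [hA]
    refine continuous_finsetSum _ fun i _ => ?_
    exact continuous_smul_of_eq_zero_off ((χ i).continuous.comp hz)
      ((isClosed_tsupport (χ i)).preimage hz) ((hO (ι i)).preimage hz)
      (preimage_mono (hχs i)) (fun a ha => hχ0 i _ ha) (hd.continuousOn_normal (hL (ι i)) hc hz hv)

/-- `emb` need not be smooth, but only the tangent map of the smooth map `r` on an open set is used.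
-/
theorem IsResolution.continuous_tvec {d : ℕ} [ChartedSpace (EuclideanSpace ℝ (Fin d)) α.Z]
    [IsManifold (𝓡 d) ∞ α.Z] {r : Ambient P → α.Z} {U OV : Set (Ambient P)}
    {OR : Piece → Set (Ambient P)} (h : α.IsResolution d r U OV OR) {X : Type*} [TopologicalSpace X]
    {z : X → α.Z} {v : X → BaseSpace p × (ℝ × ℝ)}
    (hv : Continuous fun a => tvec (ambientModel p) (α.emb (z a)) (v a)) :
    Continuous fun a => tvec (𝓡 d) (z a) (mder (ambientModel p) (𝓡 d) r (α.emb (z a)) (v a)) := by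
  have hU : ∀ a, α.emb (z a) ∈ U := fun a => h.subset (α.range_emb ▸ mem_range_self _)
  have h1 := h.smooth.continuousOn_tangentMapWithin (by simp) h.isOpen.uniqueMDiffOn
  have h2 : Continuous fun a => tangentMapWithin (ambientModel p) (𝓡 d) r U
      (tvec (ambientModel p) (α.emb (z a)) (v a)) := h1.comp_continuous hv fun a => hU a
  refine h2.congr fun a => ?_
  have h3 : tangentMapWithin (ambientModel p) (𝓡 d) r U (tvec (ambientModel p) (α.emb (z a)) (v a)) =
      tvec (𝓡 d) (r (α.emb (z a))) (mder (ambientModel p) (𝓡 d) r (α.emb (z a)) (v a)) := by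
    rw [mder, ← mfderivWithin_of_isOpen h.isOpen (hU a)]
    rfl
  rw [h3]
  have h4 := h.r_emb (z a)
  exact congrArg (fun y => tvec (𝓡 d) y
    (mder (ambientModel p) (𝓡 d) r (α.emb (z a)) (v a))) h4

/-- The tangent bundle of `Z` is stably the pullback of the tangent bundles of the factors. -/
theorem IsResolution.tangentBundleIso {d : ℕ} [ChartedSpace (EuclideanSpace ℝ (Fin d)) α.Z]
    [IsManifold (𝓡 d) ∞ α.Z] {r : Ambient P → α.Z} {U OV : Set (Ambient P)}
    {OR : Piece → Set (Ambient P)} (h : α.IsResolution d r U OV OR)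
    (hd : d + 2 * n = p 0 + p 1 + p 2 + 2) : α.TangentBundleIso d := by
  obtain ⟨k, K, J, κ, m, ht⟩ := α.exists_isTransportData
  obtain ⟨A, hA, hker, hAc⟩ := h.exists_continuous_normal ht
  -- Since `A` takes values in vectors fixed by `J ∘ κ`, applying `κ` loses nothing; so the map is
  -- injective, and bijective by dimension.
  let Ψ : α.Z → (BaseSpace p × (ℝ × ℝ)) →ₗ[ℝ] EuclideanSpace ℝ (Fin d) × TwoSpace n := fun z =>
    ((mder (ambientModel p) (𝓡 d) r (α.emb z)).prod
      (((κ (α.e z)).prodMap (κ (α.e z))).comp (A z))).toLinearMap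
  have hΨ : ∀ z, Function.Injective (Ψ z) := fun z => by
    refine (injective_iff_map_eq_zero _).2 fun v hv => ?_
    obtain ⟨h1, h2⟩ := Prod.mk.inj hv
    obtain ⟨h2, h3⟩ := Prod.mk.inj h2
    refine hker z v h1 (Prod.ext ?_ ?_)
    · rw [← (hA z v).1]
      exact (congrArg (J (α.e z)) h2).trans (map_zero _)
    · rw [← (hA z v).2]
      exact (congrArg (J (α.e z)) h3).trans (map_zero _)
  have hdim : Module.finrank ℝ (BaseSpace p × (ℝ × ℝ)) =
      Module.finrank ℝ (EuclideanSpace ℝ (Fin d) × TwoSpace n) := by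
    rw [Module.finrank_prod (M := EuclideanSpace ℝ (Fin d)), finrank_baseSpace_prod, finrank_twoSpace,
      finrank_euclideanSpace_fin, hd]
  refine α.tangentBundleIso_of_model
    (fun z => (Ψ z).linearEquivOfInjective (hΨ z) hdim) fun X _ z v hz hv => ?_
  have hK : ∀ a, α.e (z a) ∈ K := fun a => ht.e_mem (z a)
  have hq := hAc X z v hz hv
  exact ⟨h.continuous_tvec hv,
    ht.stab.continuous_tvec (α.continuous_e.comp hz) hK (continuous_fst.comp hq),
    ht.stab.continuous_tvec (α.continuous_e.comp hz) hK (continuous_snd.comp hq)⟩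

end QuadraticLink

end CubicObstruction


/-! ### The empty case and the conclusion -/

namespace CubicObstruction

open Set Filter Topology

namespace QuadraticLink

variable {P : Fin 3 → Type u} {p : Fin 3 → ℕ} {N : Type v} {n : ℕ}
  [∀ i, TopologicalSpace (P i)] [∀ i, ChartedSpace (EuclideanSpace ℝ (Fin (p i))) (P i)]
  [∀ i, IsManifold (𝓡 (p i)) ∞ (P i)]
  [TopologicalSpace N] [ChartedSpace (EuclideanSpace ℝ (Fin n)) N] [IsManifold (𝓡 n) ∞ N]
  {α : QuadraticLink P p N n}

theorem exists_structure_of_isEmpty [hZ : IsEmpty α.Z] (d : ℕ) :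
    ∃ (_ : ChartedSpace (EuclideanSpace ℝ (Fin d)) α.Z) (_ : IsManifold (𝓡 d) ∞ α.Z),
      (∀ c, IsDiffeoOntoImage p d (α.piece c) (α.toZ c)) ∧ α.TangentBundleIso d := by
  let cs : ChartedSpace (EuclideanSpace ℝ (Fin d)) α.Z := ChartedSpace.empty _ _
  refine ⟨cs, { compatible := fun {e} _ he _ => absurd he (notMem_empty e) },
    fun c => ⟨fun q => hZ.elim (α.toZ c q), fun q => hZ.elim (α.toZ c q)⟩, fun z => hZ.elim z,
    continuous_iff_continuousAt.2 fun w => hZ.elim w.proj,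
    continuous_iff_continuousAt.2 fun w => hZ.elim w.proj⟩

end QuadraticLink

end CubicObstruction

theorem mainTheorem5 {P : Fin 3 → Type u} {p : Fin 3 → ℕ} {N : Type v} {n : ℕ}
    [∀ i, TopologicalSpace (P i)] [∀ i, ChartedSpace (EuclideanSpace ℝ (Fin (p i))) (P i)]
    [∀ i, IsManifold (𝓡 (p i)) ∞ (P i)] [∀ i, T2Space (P i)] [∀ i, CompactSpace (P i)]
    [TopologicalSpace N] [ChartedSpace (EuclideanSpace ℝ (Fin n)) N] [IsManifold (𝓡 n) ∞ N]
    [T2Space N] [SecondCountableTopology N]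
    (α : CubicObstruction.QuadraticLink P p N n) (hα : α.IsTransverse) :
    CompactSpace α.Z ∧ T2Space α.Z ∧
      (p 0 + p 1 + p 2 + 2 < 2 * n → IsEmpty α.Z) ∧
      ∀ d : ℕ, d + 2 * n = p 0 + p 1 + p 2 + 2 →
        ∃ (_ : ChartedSpace (EuclideanSpace ℝ (Fin d)) α.Z) (_ : IsManifold (𝓡 d) ∞ α.Z),
          (∀ c, CubicObstruction.IsDiffeoOntoImage p d (α.piece c) (α.toZ c)) ∧
          α.TangentBundleIso d := by
  refine ⟨inferInstance, inferInstance, α.isEmpty_Z hα, fun d hd => ?_⟩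
  -- The map `r` is defined on the whole ambient space and needs a default value in `Z`, so the
  -- empty case is separate.
  rcases isEmpty_or_nonempty α.Z with _ | _
  · exact CubicObstruction.QuadraticLink.exists_structure_of_isEmpty d
  · obtain ⟨cs, hman, r, U, OV, OR, hdiff, h⟩ := α.exists_isResolution hα hd
    exact ⟨cs, hman, hdiff, h.tangentBundleIso hd⟩
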